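/- Let $A=(a_0,a_1,\dots,a_5,\eta,t)\in\mathbb C^8$ with $t\neq 0$. Let $(q_1,q_2,r_1,r_2)$ be coordinates on $\mathbb C^4$ (in terms of the canonical variables $q_i,p_i$ of the four-dimensional Fuji–Suzuki–Tsuda system, $r_i=q_ip_i$), compactify $\mathbb C^4$ to $(\mathbb P^1)^4$, and write $Q_i=q_i^{-1}$, $R_i=r_i^{-1}$. Let $X_A$ be the rational variety obtained from $(\mathbb P^1)^4$ by successively blowing up along $C_1,\dots,C_{12}$, in this order, where $C_1,\dots,C_{12}$ are given by the following equations in affine charts: - $C_1:\ q_1=r_1=0$ in the chart $(q_1,q_2,r_1,r_2)$; - $C_2:\ Q_1=r_1+a_1=0$ in $(Q_1,q_2,r_1,r_2)$; - $C_3:\ q_2=r_2=0$ in $(q_1,q_2,r_1,r_2)$; - $C_4:\ Q_2=r_2+a_5=0$ in $(q_1,Q_2,r_1,r_2)$; - $C_5:\ q_1=q_2=r_1+r_2-a_3+\eta=0$ in $(q_1,q_2,r_1,r_2)$; - $C_6:\ Q_1=Q_2=r_1+r_2+\eta=0$ in $(Q_1,Q_2,r_1,r_2)$; - $C_7:\ q_1-t=R_1=0$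 in $(q_1,q_2,R_1,r_2)$; - $C_8:\ u_7=v_7-a_2t=0$ in $(v_7,q_2,u_7,r_2)=((q_1-t)R_1^{-1},q_2,R_1,r_2)$; - $C_9:\ q_2-1=R_2=0$ in $(q_1,q_2,r_1,R_2)$; - $C_{10}:\ u_9=v_9-a_4=0$ in $(q_1,v_9,r_1,u_9)=(q_1,(q_2-1)R_2^{-1},r_1,R_2)$; - $C_{11}:\ q_1-q_2=R_1=R_2=0$ in $(q_1,q_2,R_1,R_2)$; - $C_{12}:\ u_{11}=v_{11}+1=w_{11}-a_0q_2=0$ in $(w_{11},q_2,u_{11},v_{11})=((q_1-q_2)R_1^{-1},q_2,R_1,R_2R_1^{-1})$. At the $k$-th step, the centre is the Zariski closure (with reduced structure), in the variety constructed so far, of the part of $C_k$ at which this variety agrees locally with the chart (so that the centre is the strict transform of the closure of $C_k$). Then these twelve centres are non-empty and irreducible; $C_1,C_2,C_3,C_4,C_7,C_8,C_9,C_{10}$ are of dimension $2$ and $C_5,C_6,C_{11},C_{12}$ are of dimension $1$. Moreover, each of the following transformations $(q_1,q_2,r_1,r_2)\mapsto(\bar q_1,\bar q_2,\bar r_1,\bar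 r_2)$ (Bäcklund transformations of the Fuji–Suzuki–Tsuda system), with $D=r_1+r_2-a_3+\eta$, - $s_0:\ \bigl(q_1,\ q_2,\ r_1-\tfrac{a_0q_1}{q_1-q_2},\ r_2+\tfrac{a_0q_2}{q_1-q_2}\bigr)$, - $s_1:\ \bigl(q_1(1+\tfrac{a_1}{r_1}),\ q_2,\ r_1+a_1,\ r_2\bigr)$, - $s_2:\ \bigl(q_1,\ q_2,\ r_1-\tfrac{a_2q_1}{q_1-t},\ r_2\bigr)$, - $s_3:\ \bigl(q_1+\tfrac{a_3q_1}{D},\ q_2+\tfrac{a_3q_2}{D},\ r_1,\ r_2\bigr)$, - $s_4:\ \bigl(q_1,\ q_2,\ r_1,\ r_2-\tfrac{a_4q_2}{q_2-1}\bigr)$, - $s_5:\ \bigl(q_1,\ q_2(1+\tfrac{a_5}{r_2}),\ r_1,\ r_2+a_5\bigr)$, - $\rho:\ \bigl(\tfrac{q_2}{t},\ \tfrac{q_1}{t},\ r_2,\ r_1\bigr)$, is birational and lifts to a pseudo-isomorphism $X_A\dashrightarrow X_{\bar A}$, where $\bar A=(\bar a_0,\dots,\bar a_5,\bar\eta,\bar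 t)$ is - for $s_0$: $(-a_0,\ a_0+a_1,\ a_2,\ a_3,\ a_4,\ a_0+a_5,\ \eta+a_0,\ t)$, - for $s_1$: $(a_0+a_1,\ -a_1,\ a_1+a_2,\ a_3,\ a_4,\ a_5,\ \eta-a_1,\ t)$, - for $s_2$: $(a_0,\ a_1+a_2,\ -a_2,\ a_2+a_3,\ a_4,\ a_5,\ \eta+a_2,\ t)$, - for $s_3$: $(a_0,\ a_1,\ a_2+a_3,\ -a_3,\ a_3+a_4,\ a_5,\ \eta-a_3,\ t)$, - for $s_4$: $(a_0,\ a_1,\ a_2,\ a_3+a_4,\ -a_4,\ a_4+a_5,\ \eta+a_4,\ t)$, - for $s_5$: $(a_0+a_5,\ a_1,\ a_2,\ a_3,\ a_4+a_5,\ -a_5,\ \eta-a_5,\ t)$, - for $\rho$: $(a_0,\ a_5,\ a_4,\ a_3,\ a_2,\ a_1,\ \eta,\ t^{-1})$. Here a birational map $f:X\dashrightarrow Y$ is a pseudo-isomorphism if it restricts to an isomorphism $U\cong V$ between open subsets $U\subseteq X$, $V\subseteq Y$ whose complements have codimension at least two. -/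

import Mathlib

noncomputable section

namespace FujiSuzukiTsuda

/-! ### The function field -/

/-- The field `ℂ(q₁, q₂, r₁, r₂)` of rational functions in four variables. -/
abbrev K : Type := FractionRing (MvPolynomial (Fin 4) ℂ)

/-- The coordinate functions `(q₁, q₂, r₁, r₂)`, in this order, where `rᵢ = qᵢ pᵢ`. -/
def coord (i : Fin 4) : K := algebraMap (MvPolynomial (Fin 4) ℂ) K (MvPolynomial.X i)

def q₁ : K := coord 0
def q₂ : K := coord 1
def r₁ : K := coord 2
def r₂ : K := coord 3

/-- A complex number, as a constant rational function. -/
def const (c : ℂ) : K := algebraMap ℂ K c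

/-! ### Varieties as sets of local rings (models of the function field)

An integral separated scheme of finite type over `ℂ` with function field `K` is determined by the
set of its local rings `𝒪_{X,x}`, seen as subrings of `K`, one for each (scheme-theoretic) point
`x`. We describe such a variety by this set of local rings. In this language

* `R` is a specialization of `S`, i.e. `x_R` lies in the closure of `x_S`, iff `R ⊆ S`;
* `S` on `Y` lies over `R` on `X`, for a birational morphism `Y ⟶ X` inducing the identity
  on `K`, iff `S` dominates `R`, i.e. `R ≤ S` in Mathlib's order on `LocalSubring K`;
* the codimension of (the closure of) a point is the Krull dimension of its local ring. -/

/-- A variety with function field `K`, given by the set of its local rings. -/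
abbrev Model : Type := Set (LocalSubring K)

/-- The maximal ideal of a local subring of `K`, as a subset of `K`. -/
def maxIdeal (R : LocalSubring K) : Set K :=
  Subtype.val '' (IsLocalRing.maximalIdeal R.toSubring : Set R.toSubring)

/-- The affine scheme `Spec B` of a subring `B` of `K`: the localizations of `B` at its primes. -/
def affineModel (B : Subring K) : Model :=
  Set.range fun P : PrimeSpectrum B => LocalSubring.ofPrime B P.asIdeal

/-- The affine space with the coordinate functions `x₀, …, x₃`: the spectrum of
`ℂ[x₀, …, x₃] ⊆ K`. -/
def affineChart (x : Fin 4 → K) : Model :=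
  affineModel (Algebra.adjoin ℂ (Set.range x)).toSubring

/-- `(ℙ¹)⁴`, the union of the `16` affine spaces on which each of the four coordinate functions is
one of `q₁` or `Q₁ = q₁⁻¹`, one of `q₂` or `Q₂ = q₂⁻¹`, and so on. -/
def projLinePow4 : Model :=
  ⋃ ε : Fin 4 → Bool, affineChart fun i => if ε i then (coord i)⁻¹ else coord i

/-- The stalk at the point `R` of the (radical) ideal sheaf of the Zariski closure of a set `Z` of
points: the elements of `R` which vanish at each point of `Z` that specializes to `R`. If `R` is
not in the closure of a locally closed set `Z`, this is all of `R`. -/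
def idealAt (Z : Set (LocalSubring K)) (R : LocalSubring K) : Set K :=
  {x | x ∈ R.toSubring ∧ ∀ z ∈ Z, R.toSubring ≤ z.toSubring → x ∈ maxIdeal z}

/-- The subring `R[I / f]` of `K`. -/
def blowUpRing (R : LocalSubring K) (I : Set K) (f : K) : Subring K :=
  Subring.closure ((R.toSubring : Set K) ∪ {y | ∃ x ∈ I, y = x / f})

/-- The blow-up of `M` along the Zariski closure in `M` (with its reduced structure) of a locally
closed set `Z` of points of `M`. Its points over `R ∈ M` are those points of
`Proj (⨁ₙ Iⁿ) = ⋃_{f ∈ I, f ≠ 0} Spec R[I / f]` that lie over the closed point of `Spec R`, where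
`I ⊆ R` is the stalk at `R` of the ideal sheaf of the closure of `Z`. -/
def blowUp (M : Model) (Z : Set (LocalSubring K)) : Model :=
  {S | ∃ R ∈ M, R ≤ S ∧ ∃ f ∈ idealAt Z R, f ≠ 0 ∧ S ∈ affineModel (blowUpRing R (idealAt Z R) f)}

/-- `U` is a Zariski open subset of the variety `M`: a neighbourhood basis of a point consists of
the loci where finitely many rational functions that are regular at the point stay regular. -/
def IsZariskiOpen (M : Model) (U : Set (LocalSubring K)) : Prop :=
  U ⊆ M ∧ ∀ R ∈ U, ∃ s : Finset K, (s : Set K) ⊆ R.toSubring ∧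
    ∀ S ∈ M, (s : Set K) ⊆ S.toSubring → S ∈ U

/-- The birational map `f : M ⇢ N` with pull-back of functions `φ = f^* : K(N) = K → K = K(M)` is a
pseudo-isomorphism: there are open subsets `U ⊆ M` and `V ⊆ N`, both with complement of codimension
at least two, such that `f` restricts to an isomorphism `U ≅ V`, i.e. `𝒪_y ↦ φ(𝒪_y)` maps the set of
local rings of `V` onto that of `U`. -/
def IsPseudoIsomorphism (φ : K ≃ₐ[ℂ] K) (M N : Model) : Prop :=
  ∃ U V : Set (LocalSubring K),
    IsZariskiOpen M U ∧ IsZariskiOpen N V ∧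
    (∀ R ∈ M \ U, 2 ≤ ringKrullDim R.toSubring) ∧
    (∀ R ∈ N \ V, 2 ≤ ringKrullDim R.toSubring) ∧
    LocalSubring.map (φ : K →+* K) '' V = U

/-- The locally closed set `Z` of points of a four-dimensional variety is non-empty and irreducible,
of dimension `d`: it has a generic point, whose local ring has dimension `4 - d`. -/
def IsIrreducibleOfDim (Z : Set (LocalSubring K)) (d : ℕ) : Prop :=
  ∃ z ∈ Z, (∀ y ∈ Z, y.toSubring ≤ z.toSubring) ∧ ringKrullDim z.toSubring + d = 4

/-! ### The variety `X_A` -/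

/-- The parameters `A = (a₀, …, a₅, η, t)`. -/
structure Param where
  a₀ : ℂ
  a₁ : ℂ
  a₂ : ℂ
  a₃ : ℂ
  a₄ : ℂ
  a₅ : ℂ
  η : ℂ
  t : ℂ

/-- The data of a centre: the coordinate functions of an affine chart and the functions on this
chart whose common zeros are the centre. -/
structure Center where
  chart : Fin 4 → K
  eqs : Set K

/-- The part of the centre `C` in the variety `M`: the points of `M` that are points of the chart
and at which all the equations vanish. If `M` is obtained from a variety containing the chart by
blow-ups, these are the points of the centre outside the previous centres, so that the closure is the
strict transform. -/
def Center.locus (C : Center) (M : Model) : Set (LocalSubring K) :=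
  {z | z ∈ M ∧ z ∈ affineChart C.chart ∧ C.eqs ⊆ maxIdeal z}

section centers

variable (A : Param)

/-- The coordinates on the chart `U₇` of the blow-up along `C₇`. -/
def u₇ : K := r₁⁻¹
def v₇ : K := (q₁ - const A.t) / r₁⁻¹

/-- The coordinates on the chart `U₉` of the blow-up along `C₉`. -/
def u₉ : K := r₂⁻¹
def v₉ : K := (q₂ - 1) / r₂⁻¹

/-- The coordinates on the chart `U₁₁` of the blow-up along `C₁₁`. -/
def u₁₁ : K := r₁⁻¹
def v₁₁ : K := r₂⁻¹ / r₁⁻¹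
def w₁₁ : K := (q₁ - q₂) / r₁⁻¹

/-- The centres `C₁, …, C₁₂` (numbered from `0` to `11`). -/
def center : Fin 12 → Center :=
  ![⟨![q₁, q₂, r₁, r₂], {q₁, r₁}⟩,
    ⟨![q₁⁻¹, q₂, r₁, r₂], {q₁⁻¹, r₁ + const A.a₁}⟩,
    ⟨![q₁, q₂, r₁, r₂], {q₂, r₂}⟩,
    ⟨![q₁, q₂⁻¹, r₁, r₂], {q₂⁻¹, r₂ + const A.a₅}⟩,
    ⟨![q₁, q₂, r₁, r₂], {q₁, q₂, r₁ + r₂ - const A.a₃ + const A.η}⟩,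
    ⟨![q₁⁻¹, q₂⁻¹, r₁, r₂], {q₁⁻¹, q₂⁻¹, r₁ + r₂ + const A.η}⟩,
    ⟨![q₁, q₂, r₁⁻¹, r₂], {q₁ - const A.t, r₁⁻¹}⟩,
    ⟨![v₇ A, q₂, u₇, r₂], {u₇, v₇ A - const (A.a₂ * A.t)}⟩,
    ⟨![q₁, q₂, r₁, r₂⁻¹], {q₂ - 1, r₂⁻¹}⟩,
    ⟨![q₁, v₉, r₁, u₉], {u₉, v₉ - const A.a₄}⟩,
    ⟨![q₁, q₂, r₁⁻¹, r₂⁻¹], {q₁ - q₂, r₁⁻¹, r₂⁻¹}⟩,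
    ⟨![w₁₁, q₂, u₁₁, v₁₁], {u₁₁, v₁₁ + 1, w₁₁ - const A.a₀ * q₂}⟩]

/-- The dimensions of the centres. -/
def centerDim : Fin 12 → ℕ :=
  ![2, 2, 2, 2, 1, 1, 2, 2, 2, 2, 1, 1]

/-- The variety obtained from `(ℙ¹)⁴` by the first `k` of the successive blow-ups along
(the strict transforms of the closures of) `C₁, …, C₁₂`. -/
def stage : ℕ → Model
  | 0 => projLinePow4
  | k + 1 =>
    if h : k < 12 then blowUp (stage k) ((center A ⟨k, h⟩).locus (stage k)) else stage k

/-- The variety `X_A`, obtained from `(ℙ¹)⁴` by all the twelve successive blow-ups. -/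
def variety : Model := stage A 12

end centers

/-! ### The Bäcklund transformations -/

/-- Names for the Bäcklund transformations `s₀, …, s₅` and `ρ`. -/
inductive Backlund where
  | s₀ | s₁ | s₂ | s₃ | s₄ | s₅ | ρ

/-- The action on the parameters, `A ↦ Ā`. -/
def Backlund.onParam (A : Param) : Backlund → Param
  | .s₀ => ⟨-A.a₀, A.a₀ + A.a₁, A.a₂, A.a₃, A.a₄, A.a₀ + A.a₅, A.η + A.a₀, A.t⟩
  | .s₁ => ⟨A.a₀ + A.a₁, -A.a₁, A.a₁ + A.a₂, A.a₃, A.a₄, A.a₅, A.η - A.a₁, A.t⟩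
  | .s₂ => ⟨A.a₀, A.a₁ + A.a₂, -A.a₂, A.a₂ + A.a₃, A.a₄, A.a₅, A.η + A.a₂, A.t⟩
  | .s₃ => ⟨A.a₀, A.a₁, A.a₂ + A.a₃, -A.a₃, A.a₃ + A.a₄, A.a₅, A.η - A.a₃, A.t⟩
  | .s₄ => ⟨A.a₀, A.a₁, A.a₂, A.a₃ + A.a₄, -A.a₄, A.a₄ + A.a₅, A.η + A.a₄, A.t⟩
  | .s₅ => ⟨A.a₀ + A.a₅, A.a₁, A.a₂, A.a₃, A.a₄ + A.a₅, -A.a₅, A.η - A.a₅, A.t⟩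
  | .ρ => ⟨A.a₀, A.a₅, A.a₄, A.a₃, A.a₂, A.a₁, A.η, A.t⁻¹⟩

/-- The action on the dependent variables: `(q̄₁, q̄₂, r̄₁, r̄₂)` as rational functions of
`(q₁, q₂, r₁, r₂)`. -/
def Backlund.onCoord (A : Param) : Backlund → Fin 4 → K
  | .s₀ => ![q₁, q₂, r₁ - const A.a₀ * q₁ / (q₁ - q₂), r₂ + const A.a₀ * q₂ / (q₁ - q₂)]
  | .s₁ => ![q₁ * (1 + const A.a₁ / r₁), q₂, r₁ + const A.a₁, r₂]
  | .s₂ => ![q₁, q₂, r₁ - const A.a₂ * q₁ / (q₁ - const A.t), r₂]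
  | .s₃ => ![q₁ + const A.a₃ * q₁ / (r₁ + r₂ - const A.a₃ + const A.η),
      q₂ + const A.a₃ * q₂ / (r₁ + r₂ - const A.a₃ + const A.η), r₁, r₂]
  | .s₄ => ![q₁, q₂, r₁, r₂ - const A.a₄ * q₂ / (q₂ - 1)]
  | .s₅ => ![q₁, q₂ * (1 + const A.a₅ / r₂), r₁, r₂ + const A.a₅]
  | .ρ => ![q₂ / const A.t, q₁ / const A.t, r₂, r₁]

end FujiSuzukiTsuda

end

noncomputable section

namespace FujiSuzukiTsuda

/-! ### Local subrings of `K` -/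

section localSubrings

variable {R S T : LocalSubring K} {x y : K}

/-! A pseudo-isomorphism is decided in codimension one. Call a point big (`Big`) if its residue
field has transcendence degree at least three over `ℂ`. A point of `X_A` that is not big has a local
ring of dimension at least two (`two_le_ringKrullDim`, by Noether normalization and going-down). If
a field automorphism carries the big points of `X_A` and `X_Ā` to points of the other variety
(`MatchesBig`), the local rings common to `X_A` and the transported `X_Ā` form an open subset of
each, both being separated and locally of finite type (`IsVar.isZariskiOpen_inter`). No big point is
missing from it, so `MatchesBig.isPseudoIsomorphism` follows without resolving any indeterminacy.

The big points of `X_A` are those of affine four-space, the four divisors at infinity and the twelve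
exceptional divisors (`big_variety`). Hence each blow-up must contribute exactly one new big point.
Over the generic point of the centre this is an explicit computation (`eq_excTwo`, `eq_excThree`).
Over any other point of the centre the ideal must be generated by as many functions as the
codimension, since then the fibre is too small to carry a big point (`exists_indep_of_le`,
`le_of_indep`). For the surfaces, `(ℙ¹)⁴` is viewed as a product of an `(q₁, r₁)`-surface and a
`(q₂, r₂)`-surface: the centres come from one factor, and blowing them up keeps the product form
(`IsProd`, `IsSurface`). For the curves only closed points matter. There, four generators of the
maximal ideal (`EmbDimLE`) together with a `ℙ¹`-coordinate on the curve yield three generators of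
its ideal by Nakayama (`IsCurve.exists_isGenBy`), and the bound of four generators survives the
blow-up (`embDimLE_blowUpRing`). The induction over the twelve steps is `IsGoodStage`. It also
produces the generic point `genPt` of each centre, which gives irreducibility and dimension.

What remains is a table. The local ring of a prime divisor with equation `y₀ = 0` is a discrete
valuation ring, hence maximal for domination, so its image under a substitution is determined by the
residues of suitable functions (`transport_symm_coordLoc`). These residues are computed with the
relation `Cong`. When the relevant parameter is zero, `s₀, …, s₃` are the identity. Otherwise `s₀`
exchanges `e₁₂` with `q₁ = q₂`, `s₂` exchanges `e₈` with `q₁ = t`, `s₁` exchanges `e₁, e₂` with the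
divisors `r₁ = -a₁` and `r₁ = 0`, and `s₃` exchanges `e₅, e₆` with `r₁ + r₂ + η = 0` and `r₁ + r₂ -
a₃ + η = 0`; the other divisors of the list keep their names. The map `ρ` permutes the list. These
five maps are involutions once the parameters are transformed too, so one direction suffices
(`Backlund.Matches.of_involutive`), and `s₄`, `s₅` are the conjugates of `s₂`, `s₁` by `ρ`. -/

lemma mem_of_mem_maxIdeal (h : x ∈ maxIdeal R) : x ∈ R.toSubring := by
  obtain ⟨z, -, rfl⟩ := h
  exact z.2

lemma mem_maxIdeal_iff (hx : x ∈ R.toSubring) :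
    x ∈ maxIdeal R ↔ (⟨x, hx⟩ : R.toSubring) ∈ IsLocalRing.maximalIdeal R.toSubring := by
  constructor
  · rintro ⟨z, hz, rfl⟩
    exact hz
  · intro h
    exact ⟨_, h, rfl⟩

lemma one_notMem_maxIdeal : (1 : K) ∉ maxIdeal R := by
  intro h
  have := (mem_maxIdeal_iff (mem_of_mem_maxIdeal h)).1 h
  rw [IsLocalRing.mem_maximalIdeal] at this
  exact this isUnit_one

lemma zero_mem_maxIdeal : (0 : K) ∈ maxIdeal R := ⟨0, Ideal.zero_mem _, rfl⟩

lemma add_mem_maxIdeal (hx : x ∈ maxIdeal R) (hy : y ∈ maxIdeal R) : x + y ∈ maxIdeal R := by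
  obtain ⟨a, ha, rfl⟩ := hx
  obtain ⟨b, hb, rfl⟩ := hy
  exact ⟨a + b, Ideal.add_mem _ ha hb, rfl⟩

lemma mul_mem_maxIdeal (hx : x ∈ R.toSubring) (hy : y ∈ maxIdeal R) : x * y ∈ maxIdeal R := by
  obtain ⟨b, hb, rfl⟩ := hy
  exact ⟨⟨x, hx⟩ * b, Ideal.mul_mem_left _ _ hb, rfl⟩

lemma mul_mem_maxIdeal' (hx : x ∈ maxIdeal R) (hy : y ∈ R.toSubring) : x * y ∈ maxIdeal R := by
  rw [mul_comm]
  exact mul_mem_maxIdeal hy hx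

lemma neg_mem_maxIdeal (hx : x ∈ maxIdeal R) : -x ∈ maxIdeal R := by
  obtain ⟨a, ha, rfl⟩ := hx
  exact ⟨-a, neg_mem ha, rfl⟩

lemma sub_mem_maxIdeal (hx : x ∈ maxIdeal R) (hy : y ∈ maxIdeal R) : x - y ∈ maxIdeal R := by
  rw [sub_eq_add_neg]
  exact add_mem_maxIdeal hx (neg_mem_maxIdeal hy)

lemma sum_mem_maxIdeal {ι : Type*} {s : Finset ι} {f : ι → K} (h : ∀ i ∈ s, f i ∈ maxIdeal R) :
    ∑ i ∈ s, f i ∈ maxIdeal R := by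
  classical
  induction s using Finset.induction_on with
  | empty => simpa using zero_mem_maxIdeal
  | insert a s ha ih =>
    rw [Finset.sum_insert ha]
    exact add_mem_maxIdeal (h a (by simp)) (ih fun i hi => h i (by simp [hi]))

lemma ne_zero_of_notMem_maxIdeal (h : x ∉ maxIdeal R) : x ≠ 0 := by
  rintro rfl
  exact h zero_mem_maxIdeal

lemma inv_notMem_of_mem_maxIdeal (h : x ∈ maxIdeal R) (h0 : x ≠ 0) : x⁻¹ ∉ R.toSubring := by
  intro hi
  have := mul_mem_maxIdeal hi h
  rw [inv_mul_cancel₀ h0] at this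
  exact one_notMem_maxIdeal this

lemma inv_mem_of_notMem_maxIdeal (hx : x ∈ R.toSubring) (h : x ∉ maxIdeal R) :
    x⁻¹ ∈ R.toSubring := by
  rw [mem_maxIdeal_iff hx, IsLocalRing.mem_maximalIdeal, mem_nonunits_iff, not_not] at h
  obtain ⟨y, hy⟩ := h.exists_right_inv
  have h1 : x * (y : K) = 1 := congrArg Subtype.val hy
  rw [inv_eq_of_mul_eq_one_right h1]
  exact y.2

lemma notMem_maxIdeal_of_inv_mem (h0 : x ≠ 0) (h : x⁻¹ ∈ R.toSubring) : x ∉ maxIdeal R :=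
  fun hx => inv_notMem_of_mem_maxIdeal hx h0 h

lemma mem_maxIdeal_of_inv_notMem (hx : x ∈ R.toSubring) (h : x⁻¹ ∉ R.toSubring) :
    x ∈ maxIdeal R := by
  by_contra h1
  exact h (inv_mem_of_notMem_maxIdeal hx h1)

lemma mul_notMem_maxIdeal (hx : x ∈ R.toSubring) (hx' : x ∉ maxIdeal R) (hy : y ∈ R.toSubring)
    (hy' : y ∉ maxIdeal R) : x * y ∉ maxIdeal R := by
  apply notMem_maxIdeal_of_inv_mem
  · exact mul_ne_zero (ne_zero_of_notMem_maxIdeal hx') (ne_zero_of_notMem_maxIdeal hy')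
  · rw [mul_inv]
    exact mul_mem (inv_mem_of_notMem_maxIdeal hx hx') (inv_mem_of_notMem_maxIdeal hy hy')

lemma pow_notMem_maxIdeal (hx : x ∈ R.toSubring) (hx' : x ∉ maxIdeal R) (n : ℕ) :
    x ^ n ∉ maxIdeal R := by
  apply notMem_maxIdeal_of_inv_mem
  · exact pow_ne_zero _ (ne_zero_of_notMem_maxIdeal hx')
  · rw [← inv_pow]
    exact pow_mem (inv_mem_of_notMem_maxIdeal hx hx') n

/-- Units of `R` stay units in a larger ring. Only inclusion is needed here, not domination: a
function that vanishes at a point vanishes at each specialization where it is regular. -/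
lemma mem_maxIdeal_of_le (h : R.toSubring ≤ S.toSubring) (hx : x ∈ R.toSubring)
    (hxS : x ∈ maxIdeal S) : x ∈ maxIdeal R := by
  by_contra h1
  exact notMem_maxIdeal_of_inv_mem (ne_zero_of_notMem_maxIdeal h1)
    (h (inv_mem_of_notMem_maxIdeal hx h1)) hxS

/-- Domination phrased with subsets of `K` instead of a local homomorphism between subtypes, so that
different local rings can be compared directly. -/
lemma le_iff_maxIdeal : R ≤ S ↔ R.toSubring ≤ S.toSubring ∧ maxIdeal R ⊆ maxIdeal S := by
  constructor
  · rintro ⟨h, hl⟩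
    refine ⟨h, fun x hx => ?_⟩
    have hxR := mem_of_mem_maxIdeal hx
    rw [mem_maxIdeal_iff hxR, IsLocalRing.mem_maximalIdeal, mem_nonunits_iff] at hx
    rw [mem_maxIdeal_iff (h hxR), IsLocalRing.mem_maximalIdeal, mem_nonunits_iff]
    exact fun hu => hx (hl.map_nonunit ⟨x, hxR⟩ hu)
  · rintro ⟨h, hm⟩
    refine ⟨h, ⟨fun a ha => ?_⟩⟩
    by_contra hn
    have h1 : (a : K) ∈ maxIdeal R := ⟨a, hn, rfl⟩
    have h2 := hm h1
    rw [mem_maxIdeal_iff (h a.2), IsLocalRing.mem_maximalIdeal, mem_nonunits_iff] at h2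
    exact h2 ha

lemma maxIdeal_subset_of_le (h : R ≤ S) : maxIdeal R ⊆ maxIdeal S := (le_iff_maxIdeal.1 h).2

lemma notMem_maxIdeal_of_le (h : R.toSubring ≤ S.toSubring) (hx : x ∈ R.toSubring)
    (hx' : x ∉ maxIdeal R) : x ∉ maxIdeal S :=
  fun h' => hx' (mem_maxIdeal_of_le h hx h')

lemma LocalSubring_ext (h : R.toSubring = S.toSubring) : R = S :=
  LocalSubring.toSubring_injective h

/-! ### Localizations of subrings of `K` -/

/-- The local ring `R` is a localization of `B`. -/
def IsLocOf (B : Subring K) (R : LocalSubring K) : Prop :=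
  B ≤ R.toSubring ∧ ∀ x ∈ R.toSubring, ∃ b ∈ B, ∃ s ∈ B, s ∉ maxIdeal R ∧ x = b / s

variable {B C : Subring K}

/-- The contraction of the maximal ideal of `R` to `B`. -/
def contraction (h : B ≤ R.toSubring) : Ideal B :=
  (IsLocalRing.maximalIdeal R.toSubring).comap (Subring.inclusion h)

instance (h : B ≤ R.toSubring) : (contraction h).IsPrime :=
  Ideal.IsPrime.comap _

lemma mem_contraction (h : B ≤ R.toSubring) (b : B) : b ∈ contraction h ↔ (b : K) ∈ maxIdeal R := by
  rw [mem_maxIdeal_iff (h b.2)]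
  rfl

lemma mem_ofPrime (P : Ideal B) [P.IsPrime] :
    x ∈ (LocalSubring.ofPrime B P).toSubring ↔ ∃ b s : B, s ∉ P ∧ x = b / s := by
  constructor
  · intro hx
    obtain ⟨b, s, h⟩ := IsLocalization.exists_mk'_eq P.primeCompl
      (⟨x, hx⟩ : (LocalSubring.ofPrime B P).toSubring)
    refine ⟨b, s, s.2, ?_⟩
    have h1 := IsLocalization.mk'_spec (LocalSubring.ofPrime B P).toSubring b s
    rw [h] at h1
    have h2 : x * ((s : B) : K) = b := congrArg Subtype.val h1
    have h3 : ((s : B) : K) ≠ 0 := by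
      intro h0
      have : (s : B) = 0 := Subtype.ext h0
      exact s.2 (this ▸ P.zero_mem)
    rw [← h2, mul_div_cancel_right₀ _ h3]
  · rintro ⟨b, s, hs, rfl⟩
    rw [div_eq_mul_inv]
    refine mul_mem (LocalSubring.le_ofPrime B P b.2) ?_
    have hu := IsLocalization.map_units (LocalSubring.ofPrime B P).toSubring
      (⟨s, hs⟩ : P.primeCompl)
    obtain ⟨y, hy⟩ := hu.exists_right_inv
    have h1 : (s : K) * (y : K) = 1 := congrArg Subtype.val hy
    rw [inv_eq_of_mul_eq_one_right h1]
    exact y.2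

lemma mem_maxIdeal_ofPrime (P : Ideal B) [P.IsPrime] (b : B) :
    (b : K) ∈ maxIdeal (LocalSubring.ofPrime B P) ↔ b ∈ P := by
  rw [mem_maxIdeal_iff (LocalSubring.le_ofPrime B P b.2)]
  exact IsLocalization.AtPrime.to_map_mem_maximal_iff
    (LocalSubring.ofPrime B P).toSubring P b

/-- The prime is recovered as the contraction of the maximal ideal, so points of `Spec B` can be
handled without naming primes. -/
lemma mem_affineModel_iff : R ∈ affineModel B ↔ IsLocOf B R := by
  constructor
  · rintro ⟨P, rfl⟩
    refine ⟨LocalSubring.le_ofPrime B _, fun x hx => ?_⟩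
    obtain ⟨b, s, hs, rfl⟩ := (mem_ofPrime _).1 hx
    exact ⟨b, b.2, s, s.2, fun h => hs ((mem_maxIdeal_ofPrime _ _).1 h), rfl⟩
  · rintro ⟨h1, h2⟩
    refine ⟨⟨contraction h1, inferInstance⟩, LocalSubring_ext (le_antisymm ?_ ?_)⟩
    · intro x hx
      obtain ⟨b, s, hs, rfl⟩ := (mem_ofPrime _).1 hx
      rw [div_eq_mul_inv]
      exact mul_mem (h1 b.2) (inv_mem_of_notMem_maxIdeal (h1 s.2)
        fun h => hs ((mem_contraction h1 s).2 h))
    · intro x hx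
      obtain ⟨b, hb, s, hs, hs', rfl⟩ := h2 x hx
      exact (mem_ofPrime _).2
        ⟨⟨b, hb⟩, ⟨s, hs⟩, fun h => hs' ((mem_contraction h1 _).1 h), rfl⟩

/-- This is the centre of `R` on `Spec B`: localize at the contraction of the maximal ideal. -/
lemma exists_isLocOf_le (h : B ≤ R.toSubring) : ∃ S, IsLocOf B S ∧ S ≤ R := by
  refine ⟨LocalSubring.ofPrime B (contraction h), mem_affineModel_iff.1 ⟨⟨contraction h, inferInstance⟩, rfl⟩,
    ?_⟩
  have h1 : (LocalSubring.ofPrime B (contraction h)).toSubring ≤ R.toSubring := by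
    intro x hx
    obtain ⟨b, s, hs, rfl⟩ := (mem_ofPrime _).1 hx
    rw [div_eq_mul_inv]
    exact mul_mem (h b.2) (inv_mem_of_notMem_maxIdeal (h s.2)
        fun h' => hs ((mem_contraction h s).2 h'))
  rw [le_iff_maxIdeal]
  refine ⟨h1, fun x hx => ?_⟩
  by_contra hn
  have hxm := mem_of_mem_maxIdeal hx
  obtain ⟨b, s, hs, rfl⟩ := (mem_ofPrime _).1 hxm
  have hbm : (b : K) ∉ maxIdeal R := by
    intro hb
    apply hn
    rw [div_eq_mul_inv]
    exact mul_mem_maxIdeal' hb (inv_mem_of_notMem_maxIdeal (h s.2)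
        fun h' => hs ((mem_contraction h s).2 h'))
  refine inv_notMem_of_mem_maxIdeal hx (ne_zero_of_notMem_maxIdeal hn) ?_
  rw [inv_div]
  exact (mem_ofPrime _).2 ⟨s, b, fun h' => hbm ((mem_contraction h b).1 h'), rfl⟩

/-- A local ring that contains `B` and inverts what is invertible in a localization `R` of `B`
contains `R`. -/
lemma IsLocOf.le_of_le (hR : IsLocOf B R) (hB : B ≤ S.toSubring)
    (h : ∀ s ∈ B, s ∈ maxIdeal S → s ∈ maxIdeal R) : R.toSubring ≤ S.toSubring := by
  intro x hx
  obtain ⟨b, hb, s, hs, hs', rfl⟩ := hR.2 x hx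
  rw [div_eq_mul_inv]
  exact mul_mem (hB hb) (inv_mem_of_notMem_maxIdeal (hB hs) fun h' => hs' (h s hs h'))

/-- A common dominating ring `T` decides which elements are units, so each ring admits the
denominators of the other. All proofs of separatedness below reduce to this. -/
lemma IsLocOf.eq_of_le_le (hR : IsLocOf B R) (hS : IsLocOf C S) (hBS : B ≤ S.toSubring)
    (hCR : C ≤ R.toSubring) (hRT : R ≤ T) (hST : S ≤ T) : R = S := by
  apply LocalSubring_ext
  apply le_antisymm
  · refine hR.le_of_le hBS fun s hs hs' => ?_
    exact mem_maxIdeal_of_le hRT.1 (hR.1 hs) (maxIdeal_subset_of_le hST hs')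
  · refine hS.le_of_le hCR fun s hs hs' => ?_
    exact mem_maxIdeal_of_le hST.1 (hS.1 hs) (maxIdeal_subset_of_le hRT hs')

/-- Elements of `R` that are fractions of elements of `B` with denominator a unit of `R`. -/
def fractions (B : Subring K) (R : LocalSubring K) (hB : B ≤ R.toSubring) : Subring K where
  carrier := {x | ∃ b ∈ B, ∃ s ∈ B, s ∉ maxIdeal R ∧ x = b / s}
  zero_mem' := ⟨0, zero_mem _, 1, one_mem _, one_notMem_maxIdeal, by simp⟩
  one_mem' := ⟨1, one_mem _, 1, one_mem _, one_notMem_maxIdeal, by simp⟩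
  add_mem' := by
    rintro _ _ ⟨b, hb, s, hs, hs', rfl⟩ ⟨c, hc, u, hu, hu', rfl⟩
    have := ne_zero_of_notMem_maxIdeal hs'
    have := ne_zero_of_notMem_maxIdeal hu'
    exact ⟨b * u + s * c, add_mem (mul_mem hb hu) (mul_mem hs hc), s * u, mul_mem hs hu,
      mul_notMem_maxIdeal (hB hs) hs' (hB hu) hu', div_add_div _ _ ‹_› ‹_›⟩
  mul_mem' := by
    rintro _ _ ⟨b, hb, s, hs, hs', rfl⟩ ⟨c, hc, u, hu, hu', rfl⟩
    exact ⟨b * c, mul_mem hb hc, s * u, mul_mem hs hu,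
      mul_notMem_maxIdeal (hB hs) hs' (hB hu) hu', div_mul_div_comm _ _ _ _⟩
  neg_mem' := by
    rintro _ ⟨b, hb, s, hs, hs', rfl⟩
    exact ⟨-b, neg_mem hb, s, hs, hs', (neg_div _ _).symm⟩

lemma le_fractions (hB : B ≤ R.toSubring) : B ≤ fractions B R hB := fun b hb =>
  ⟨b, hb, 1, one_mem _, one_notMem_maxIdeal, by simp⟩

lemma div_mem_fractions (hB : B ≤ R.toSubring) (hx : x ∈ fractions B R hB)
    (hy : y ∈ fractions B R hB) (hy' : y ∉ maxIdeal R) : x / y ∈ fractions B R hB := by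
  rw [div_eq_mul_inv]
  refine mul_mem hx ?_
  obtain ⟨c, hc, u, hu, hu', rfl⟩ := hy
  refine ⟨u, hu, c, hc, fun h => hy' ?_, by rw [inv_div]⟩
  rw [div_eq_mul_inv]
  exact mul_mem_maxIdeal' h (inv_mem_of_notMem_maxIdeal (hB hu) hu')

/-- A localization of `C` is a localization of the smaller ring `B` when the elements of `C` are
fractions of elements of `B`. -/
lemma IsLocOf.of_le_fractions (hR : IsLocOf C R) (hB : B ≤ R.toSubring)
    (hC : C ≤ fractions B R hB) : IsLocOf B R := by
  refine ⟨hB, fun x hx => ?_⟩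
  obtain ⟨b, hb, s, hs, hs', rfl⟩ := hR.2 x hx
  exact div_mem_fractions hB (hC hb) (hC hs) hs'

lemma IsLocOf.mono (hR : IsLocOf B R) (hBC : B ≤ C) (hC : C ≤ R.toSubring) : IsLocOf C R := by
  refine ⟨hC, fun x hx => ?_⟩
  obtain ⟨b, hb, s, hs, hs', rfl⟩ := hR.2 x hx
  exact ⟨b, hBC hb, s, hBC hs, hs', rfl⟩

lemma isLocOf_self : IsLocOf R.toSubring R :=
  ⟨le_rfl, fun x hx => ⟨x, hx, 1, one_mem _, one_notMem_maxIdeal, by simp⟩⟩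

/-! ### Affine models of finitely generated algebras -/

/-- The ring `ℂ[s] ⊆ K`. -/
def gen (s : Set K) : Subring K := (Algebra.adjoin ℂ s).toSubring

lemma const_mem_gen (s : Set K) (c : ℂ) : const c ∈ gen s :=
  Subalgebra.algebraMap_mem _ c

lemma subset_gen (s : Set K) : s ⊆ gen s := Algebra.subset_adjoin

lemma gen_le {s : Set K} (hc : ∀ c, const c ∈ B) (hs : s ⊆ B) : gen s ≤ B := by
  have : Algebra.adjoin ℂ s ≤ ({ B with algebraMap_mem' := hc } : Subalgebra ℂ K) :=
    Algebra.adjoin_le hs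
  exact this

lemma gen_mono {s t : Set K} (h : s ⊆ gen t) : gen s ≤ gen t :=
  gen_le (const_mem_gen t) h

lemma affineChart_eq (x : Fin 4 → K) : affineChart x = affineModel (gen (Set.range x)) := rfl

lemma const_add (a b : ℂ) : const (a + b) = const a + const b := map_add _ _ _
lemma const_sub (a b : ℂ) : const (a - b) = const a - const b := map_sub _ _ _
lemma const_mul (a b : ℂ) : const (a * b) = const a * const b := map_mul _ _ _
lemma const_neg (a : ℂ) : const (-a) = -const a := map_neg _ _
lemma const_inv (a : ℂ) : const a⁻¹ = (const a)⁻¹ := map_inv₀ (algebraMap ℂ K) _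
@[simp] lemma const_zero : const 0 = 0 := map_zero _
@[simp] lemma const_one : const 1 = 1 := map_one _
lemma const_eq_zero {a : ℂ} : const a = 0 ↔ a = 0 := by
  rw [const, FaithfulSMul.algebraMap_eq_zero_iff]

lemma const_ne_zero {a : ℂ} (h : a ≠ 0) : const a ≠ 0 := fun h' => h (const_eq_zero.1 h')

lemma const_notMem_maxIdeal (hR : ∀ c, const c ∈ R.toSubring) {a : ℂ} (h : a ≠ 0) :
    const a ∉ maxIdeal R := by
  apply notMem_maxIdeal_of_inv_mem (const_ne_zero h)
  rw [← const_inv]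
  exact hR _

end localSubrings


/-! ### Separated models of finite type -/

section models

variable {R S T ζ : LocalSubring K} {x y : K} {M N : Model} {Z : Set (LocalSubring K)}

/-- A set of local rings which is separated and locally the spectrum of a finitely generated
`ℂ`-algebra. -/
structure IsVar (M : Model) : Prop where
  sep : ∀ R ∈ M, ∀ S ∈ M, ∀ T, R ≤ T → S ≤ T → R = S
  ft : ∀ R ∈ M, ∃ s : Finset K, IsLocOf (gen s) R ∧ affineModel (gen s) ⊆ M

lemma IsVar.const_mem (hM : IsVar M) (hR : R ∈ M) (c : ℂ) : const c ∈ R.toSubring := by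
  obtain ⟨s, hs, -⟩ := hM.ft R hR
  exact hs.1 (const_mem_gen _ c)

/-- On an affine neighbourhood of `R`, the ring `T` has a centre of which `R` is a specialization.
By separatedness this centre is `ζ`. -/
lemma IsVar.le_of_le (hM : IsVar M) (hR : R ∈ M) (hζ : ζ ∈ M) (h : R.toSubring ≤ T.toSubring)
    (hζT : ζ ≤ T) : R.toSubring ≤ ζ.toSubring := by
  obtain ⟨s, hs, hsM⟩ := hM.ft R hR
  obtain ⟨S, hS, hST⟩ := exists_isLocOf_le (hs.1.trans h)
  obtain rfl := hM.sep S (hsM (mem_affineModel_iff.2 hS)) ζ hζ T hST hζT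
  exact hs.le_of_le hS.1 fun b hb hb' =>
    mem_maxIdeal_of_le h (hs.1 hb) (maxIdeal_subset_of_le hST hb')

/-- Two finitely generated algebras with a common localization agree after inverting finitely many
elements, so a shared local ring forces nearby local rings to be shared too. -/
lemma IsVar.isZariskiOpen_inter (hM : IsVar M) (hN : IsVar N) : IsZariskiOpen M (M ∩ N) := by
  classical
  refine ⟨Set.inter_subset_left, ?_⟩
  rintro R ⟨hRM, hRN⟩
  obtain ⟨s, hs, hsM⟩ := hM.ft R hRM
  obtain ⟨u, hu, huN⟩ := hN.ft R hRN
  have h1 : ∀ x : K, ∃ b c : K, x ∈ R.toSubring → b ∈ gen (s : Set K) ∧ c ∈ gen (s : Set K) ∧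
      c ∉ maxIdeal R ∧ x = b / c := by
    intro x
    by_cases hx : x ∈ R.toSubring
    · obtain ⟨b, hb, c, hc, hc', rfl⟩ := hs.2 x hx
      exact ⟨b, c, fun _ => ⟨hb, hc, hc', rfl⟩⟩
    · exact ⟨0, 0, fun h => absurd h hx⟩
  have h2 : ∀ x : K, ∃ b c : K, x ∈ R.toSubring → b ∈ gen (u : Set K) ∧ c ∈ gen (u : Set K) ∧
      c ∉ maxIdeal R ∧ x = b / c := by
    intro x
    by_cases hx : x ∈ R.toSubring
    · obtain ⟨b, hb, c, hc, hc', rfl⟩ := hu.2 x hx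
      exact ⟨b, c, fun _ => ⟨hb, hc, hc', rfl⟩⟩
    · exact ⟨0, 0, fun h => absurd h hx⟩
  choose b₁ c₁ hbc₁ using h1
  choose b₂ c₂ hbc₂ using h2
  have hsR : ∀ x ∈ s, x ∈ R.toSubring := fun x hx => hs.1 (subset_gen _ hx)
  have huR : ∀ x ∈ u, x ∈ R.toSubring := fun x hx => hu.1 (subset_gen _ hx)
  -- The generators of both algebras, together with the inverses of the denominators needed to write
  -- the generators of either one as fractions over the other. Where these stay regular, a
  -- localization of `ℂ[s]` is also one of `ℂ[u]`.
  refine ⟨s ∪ u ∪ u.image (fun x => (c₁ x)⁻¹) ∪ s.image (fun x => (c₂ x)⁻¹), ?_, ?_⟩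
  · intro x hx
    simp only [Finset.coe_union, Finset.coe_image, Set.mem_union, Finset.mem_coe,
      Set.mem_image] at hx
    obtain ((hx | hx) | ⟨z, hz, rfl⟩) | ⟨z, hz, rfl⟩ := hx
    · exact hsR x hx
    · exact huR x hx
    · obtain ⟨-, h, h', -⟩ := hbc₁ z (huR z hz)
      exact inv_mem_of_notMem_maxIdeal (hs.1 h) h'
    · obtain ⟨-, h, h', -⟩ := hbc₂ z (hsR z hz)
      exact inv_mem_of_notMem_maxIdeal (hu.1 h) h'
  · intro S hS hsub
    have hsS : (s : Set K) ⊆ S.toSubring := fun x hx => hsub (by simp [Finset.mem_coe.1 hx])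
    have huS : (u : Set K) ⊆ S.toSubring := fun x hx => hsub (by simp [Finset.mem_coe.1 hx])
    have hc₁ : ∀ x ∈ u, (c₁ x)⁻¹ ∈ S.toSubring := fun x hx => hsub (by
      have : (c₁ x)⁻¹ ∈ u.image (fun x => (c₁ x)⁻¹) := Finset.mem_image_of_mem _ hx
      simp only [Finset.coe_union, Set.mem_union, Finset.mem_coe]
      tauto)
    have hc₂ : ∀ x ∈ s, (c₂ x)⁻¹ ∈ S.toSubring := fun x hx => hsub (by
      have : (c₂ x)⁻¹ ∈ s.image (fun x => (c₂ x)⁻¹) := Finset.mem_image_of_mem _ hx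
      simp only [Finset.coe_union, Set.mem_union, Finset.mem_coe]
      tauto)
    refine ⟨hS, ?_⟩
    have hsS' : gen (s : Set K) ≤ S.toSubring := gen_le (hM.const_mem hS) hsS
    have huS' : gen (u : Set K) ≤ S.toSubring := gen_le (hM.const_mem hS) huS
    obtain ⟨S', hS', hSS'⟩ := exists_isLocOf_le hsS'
    obtain rfl := hM.sep S' (hsM (mem_affineModel_iff.2 hS')) S hS S hSS' le_rfl
    apply huN
    rw [mem_affineModel_iff]
    refine hS'.of_le_fractions huS' (gen_le (fun c => ?_) fun x hx => ?_)
    · exact le_fractions huS' (const_mem_gen _ c)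
    · obtain ⟨hb, hc, hc', h⟩ := hbc₂ x (hsR x hx)
      rw [SetLike.mem_coe, h]
      exact ⟨_, hb, _, hc, notMem_maxIdeal_of_inv_mem (ne_zero_of_notMem_maxIdeal hc')
        (hc₂ x hx), rfl⟩

/-! ### Transport along automorphisms of `K` -/

variable (φ : K ≃ₐ[ℂ] K)

/-- The image of a local ring under an automorphism of `K`. -/
abbrev transport (R : LocalSubring K) : LocalSubring K := LocalSubring.map (φ : K →+* K) R

lemma mem_transport : x ∈ (transport φ R).toSubring ↔ φ.symm x ∈ R.toSubring := by
  rw [LocalSubring.map_toSubring, Subring.mem_map]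
  constructor
  · rintro ⟨z, hz, rfl⟩
    simpa using hz
  · intro h
    exact ⟨_, h, by simp⟩

lemma mem_maxIdeal_transport : x ∈ maxIdeal (transport φ R) ↔ φ.symm x ∈ maxIdeal R := by
  by_cases h0 : x = 0
  · subst h0
    simp [zero_mem_maxIdeal]
  have h0' : φ.symm x ≠ 0 := by simpa using h0
  constructor
  · intro h
    apply mem_maxIdeal_of_inv_notMem ((mem_transport φ).1 (mem_of_mem_maxIdeal h))
    rw [← map_inv₀, ← mem_transport]
    exact inv_notMem_of_mem_maxIdeal h h0
  · intro h
    apply mem_maxIdeal_of_inv_notMem ((mem_transport φ).2 (mem_of_mem_maxIdeal h))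
    rw [mem_transport, map_inv₀]
    exact inv_notMem_of_mem_maxIdeal h h0'

lemma transport_le_iff : transport φ R ≤ T ↔ R ≤ transport φ.symm T := by
  rw [le_iff_maxIdeal, le_iff_maxIdeal]
  simp only [SetLike.le_def, Set.subset_def, mem_transport, mem_maxIdeal_transport,
    AlgEquiv.symm_symm]
  constructor
  · rintro ⟨h1, h2⟩
    exact ⟨fun x hx => h1 (by simpa using hx), fun x hx => h2 _ (by simpa using hx)⟩
  · rintro ⟨h1, h2⟩
    exact ⟨fun x hx => by simpa using h1 hx, fun x hx => by simpa using h2 _ hx⟩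

lemma transport_symm_transport : transport φ.symm (transport φ R) = R := by
  apply LocalSubring_ext
  ext x
  simp

lemma transport_transport_symm : transport φ (transport φ.symm R) = R := by
  apply LocalSubring_ext
  ext x
  simp

lemma isLocOf_transport {s : Set K} : IsLocOf (gen (φ '' s)) (transport φ R) ↔
    IsLocOf (gen s) R := by
  have key : ∀ x, x ∈ gen (φ '' s) ↔ φ.symm x ∈ gen s := by
    intro x
    have : Algebra.adjoin ℂ (φ '' s) = (Algebra.adjoin ℂ s).map (φ : K →ₐ[ℂ] K) := by
      rw [AlgHom.map_adjoin]
      rfl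
    change x ∈ Algebra.adjoin ℂ (φ '' s) ↔ φ.symm x ∈ Algebra.adjoin ℂ s
    rw [this, Subalgebra.mem_map]
    constructor
    · rintro ⟨z, hz, rfl⟩
      simpa using hz
    · intro h
      exact ⟨_, h, by simp⟩
  constructor
  · rintro ⟨h1, h2⟩
    refine ⟨fun x hx => ?_, fun x hx => ?_⟩
    · have := (mem_transport φ).1 (h1 ((key (φ x)).2 (by simpa using hx)))
      simpa using this
    · obtain ⟨b, hb, c, hc, hc', h⟩ := h2 (φ x) ((mem_transport φ).2 (by simpa using hx))
      refine ⟨φ.symm b, (key b).1 hb, φ.symm c, (key c).1 hc,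
        fun h => hc' ((mem_maxIdeal_transport φ).2 h), ?_⟩
      rw [← map_div₀, ← h, AlgEquiv.symm_apply_apply]
  · rintro ⟨h1, h2⟩
    refine ⟨fun x hx => ?_, fun x hx => ?_⟩
    · exact (mem_transport φ).2 (h1 ((key x).1 hx))
    · obtain ⟨b, hb, c, hc, hc', h⟩ := h2 _ ((mem_transport φ).1 hx)
      refine ⟨φ b, (key _).2 (by simpa using hb), φ c, (key _).2 (by simpa using hc),
        fun h => hc' ?_, ?_⟩
      · simpa using (mem_maxIdeal_transport φ).1 h
      · rw [← map_div₀, ← h, AlgEquiv.apply_symm_apply]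

lemma IsVar.transport (hM : IsVar M) : IsVar (FujiSuzukiTsuda.transport φ '' M) := by
  classical
  refine ⟨?_, ?_⟩
  · rintro _ ⟨R, hR, rfl⟩ _ ⟨S, hS, rfl⟩ T h1 h2
    rw [transport_le_iff] at h1 h2
    rw [hM.sep R hR S hS _ h1 h2]
  · rintro _ ⟨R, hR, rfl⟩
    obtain ⟨s, hs, hsM⟩ := hM.ft R hR
    refine ⟨s.image φ, ?_, ?_⟩
    · rw [Finset.coe_image]
      exact (isLocOf_transport φ).2 hs
    · intro S hS
      refine ⟨FujiSuzukiTsuda.transport φ.symm S, hsM ?_, transport_transport_symm φ⟩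
      rw [mem_affineModel_iff] at hS ⊢
      rw [Finset.coe_image] at hS
      rw [← isLocOf_transport φ, transport_transport_symm]
      exact hS

/-! ### Blow-ups -/

/-- `ζ` is the generic point of `Z`. -/
def IsGenericPt (Z : Set (LocalSubring K)) (ζ : LocalSubring K) : Prop :=
  ζ ∈ Z ∧ ∀ y ∈ Z, y.toSubring ≤ ζ.toSubring

/-- Vanishing at the generic point propagates to every other point of `Z` at which the function is
regular. -/
lemma mem_idealAt_of_le (hζ : IsGenericPt Z ζ) (h : R.toSubring ≤ ζ.toSubring) :
    x ∈ idealAt Z R ↔ x ∈ R.toSubring ∧ x ∈ maxIdeal ζ := by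
  constructor
  · rintro ⟨h1, h2⟩
    exact ⟨h1, h2 ζ hζ.1 h⟩
  · rintro ⟨h1, h2⟩
    exact ⟨h1, fun z hz hRz => mem_maxIdeal_of_le (hζ.2 z hz) (hRz h1) h2⟩

lemma mem_idealAt_of_not_le (hζ : IsGenericPt Z ζ) (h : ¬ R.toSubring ≤ ζ.toSubring) :
    x ∈ idealAt Z R ↔ x ∈ R.toSubring :=
  ⟨fun h => h.1, fun hx => ⟨hx, fun z hz hRz => absurd (hRz.trans (hζ.2 z hz)) h⟩⟩

lemma mem_blowUp : S ∈ blowUp M Z ↔ ∃ R ∈ M, R ≤ S ∧ ∃ f ∈ idealAt Z R, f ≠ 0 ∧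
    IsLocOf (blowUpRing R (idealAt Z R) f) S := by
  simp only [blowUp, mem_affineModel_iff, Set.mem_ofPred_eq]

lemma le_blowUpRing (R : LocalSubring K) (I : Set K) (f : K) : R.toSubring ≤ blowUpRing R I f :=
  fun _ hx => Subring.subset_closure (Or.inl hx)

lemma div_mem_blowUpRing (R : LocalSubring K) {I : Set K} (f : K) (hx : x ∈ I) :
    x / f ∈ blowUpRing R I f :=
  Subring.subset_closure (Or.inr ⟨x, hx, rfl⟩)

lemma blowUpRing_le {I : Set K} {f : K} {B : Subring K} (hR : R.toSubring ≤ B)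
    (hI : ∀ x ∈ I, x / f ∈ B) : blowUpRing R I f ≤ B := by
  rw [blowUpRing, Subring.closure_le]
  rintro x (hx | ⟨y, hy, rfl⟩)
  · exact hR hx
  · exact hI y hy

/-- The blow-up is an isomorphism away from the centre: there the ideal contains `1`, so `f` is
invertible in `S`, hence in `R` by domination, and the chart ring is `R` itself. -/
lemma eq_of_mem_blowUp_of_not_le (hζ : IsGenericPt Z ζ) (h : ¬ R.toSubring ≤ ζ.toSubring)
    (hRS : R ≤ S) {f : K} (hf : f ∈ idealAt Z R) (hf0 : f ≠ 0)
    (hS : IsLocOf (blowUpRing R (idealAt Z R) f) S) : S = R := by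
  have h1 : (1 : K) ∈ idealAt Z R := (mem_idealAt_of_not_le hζ h).2 (one_mem _)
  have h2 : f⁻¹ ∈ S.toSubring := by
    have := hS.1 (div_mem_blowUpRing R f h1)
    rwa [one_div] at this
  have h3 : f⁻¹ ∈ R.toSubring := by
    refine inv_mem_of_notMem_maxIdeal hf.1 fun h' => ?_
    exact inv_notMem_of_mem_maxIdeal (maxIdeal_subset_of_le hRS h') hf0 h2
  have h4 : blowUpRing R (idealAt Z R) f ≤ R.toSubring := by
    refine blowUpRing_le le_rfl fun x hx => ?_
    rw [div_eq_mul_inv]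
    exact mul_mem hx.1 h3
  apply LocalSubring_ext
  refine le_antisymm ?_ hRS.1
  exact hS.le_of_le h4 fun s _ hs' => maxIdeal_subset_of_le hRS hs'

lemma mem_blowUp_of_not_le (hζ : IsGenericPt Z ζ) (hR : R ∈ M)
    (h : ¬ R.toSubring ≤ ζ.toSubring) : R ∈ blowUp M Z := by
  refine mem_blowUp.2 ⟨R, hR, le_rfl, 1, (mem_idealAt_of_not_le hζ h).2 (one_mem _), one_ne_zero,
    ?_⟩
  refine isLocOf_self.mono (le_blowUpRing _ _ _) (blowUpRing_le le_rfl fun x hx => ?_)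
  rw [div_one]
  exact hx.1

/-- The family `f` generates the ideal `I` of `R`. -/
def IsGenBy {ι : Type*} [Fintype ι] (R : LocalSubring K) (I : Set K) (f : ι → K) : Prop :=
  (∀ i, f i ∈ I) ∧ ∀ x ∈ I, ∃ r : ι → K, (∀ i, r i ∈ R.toSubring) ∧ x = ∑ i, r i * f i

/-- The definition of a blow-up allows charts for every element of the ideal; the charts of a
generating family already cover it. -/
lemma exists_chart {ι : Type*} [Fintype ι] {I : Set K} {f : ι → K} {g : K}
    (hf : IsGenBy R I f) (hRS : R ≤ S) (hg : g ∈ I) (hg0 : g ≠ 0)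
    (hS : IsLocOf (blowUpRing R I g) S) :
    ∃ j, f j ≠ 0 ∧ (∀ i, f i / f j ∈ S.toSubring) ∧
      IsLocOf (blowUpRing R (Set.range f) (f j)) S := by
  have hfg : ∀ i, f i / g ∈ S.toSubring := fun i => hS.1 (div_mem_blowUpRing R g (hf.1 i))
  obtain ⟨r, hr, hgr⟩ := hf.2 g hg
  -- A combination of the quotients `f i / g` with coefficients in `R` equals `1`, so they cannot
  -- all be non-units of `S`.
  obtain ⟨j, hj⟩ : ∃ j, f j / g ∉ maxIdeal S := by
    by_contra! hcon
    have h1 : ∑ i, r i * (f i / g) ∈ maxIdeal S :=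
      sum_mem_maxIdeal fun i _ => mul_mem_maxIdeal (hRS.1 (hr i)) (hcon i)
    have h2 : ∑ i, r i * (f i / g) = 1 := by
      simp_rw [mul_div_assoc']
      rw [← Finset.sum_div, ← hgr, div_self hg0]
    rw [h2] at h1
    exact one_notMem_maxIdeal h1
  have hj0 : f j ≠ 0 := by
    intro h
    apply ne_zero_of_notMem_maxIdeal hj
    rw [h, zero_div]
  have hgj : g / f j ∈ S.toSubring := by
    have := inv_mem_of_notMem_maxIdeal (hfg j) hj
    rwa [inv_div] at this
  have hfj : ∀ i, f i / f j ∈ S.toSubring := by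
    intro i
    have : f i / f j = f i / g * (g / f j) := by field_simp
    rw [this]
    exact mul_mem (hfg i) hgj
  have hB : blowUpRing R (Set.range f) (f j) ≤ S.toSubring := by
    refine blowUpRing_le hRS.1 ?_
    rintro _ ⟨i, rfl⟩
    exact hfj i
  have hdiv : ∀ x ∈ I, x / f j ∈ blowUpRing R (Set.range f) (f j) := by
    intro x hx
    obtain ⟨r, hr, hxr⟩ := hf.2 x hx
    rw [hxr, Finset.sum_div]
    refine sum_mem fun i _ => ?_
    rw [mul_div_assoc]
    exact mul_mem (le_blowUpRing _ _ _ (hr i)) (div_mem_blowUpRing R _ ⟨i, rfl⟩)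
  refine ⟨j, hj0, hfj, hS.of_le_fractions hB (blowUpRing_le ?_ ?_)⟩
  · exact (le_blowUpRing _ _ _).trans (le_fractions hB)
  · intro x hx
    refine ⟨x / f j, hdiv x hx, g / f j, hdiv g hg, ?_, by field_simp⟩
    apply notMem_maxIdeal_of_inv_mem (div_ne_zero hg0 hj0)
    rw [inv_div]
    exact hfg j

lemma mem_blowUp_of_chart {ι : Type*} [Fintype ι] {f : ι → K} (hR : R ∈ M) (hRS : R ≤ S)
    (hf : IsGenBy R (idealAt Z R) f) {j : ι} (hj : f j ≠ 0)
    (hS : IsLocOf (blowUpRing R (Set.range f) (f j)) S) : S ∈ blowUp M Z := by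
  refine mem_blowUp.2 ⟨R, hR, hRS, f j, hf.1 j, hj, ?_⟩
  convert hS using 1
  apply le_antisymm
  · refine blowUpRing_le (le_blowUpRing _ _ _) fun x hx => ?_
    obtain ⟨r, hr, hxr⟩ := hf.2 x hx
    rw [hxr, Finset.sum_div]
    refine sum_mem fun i _ => ?_
    rw [mul_div_assoc]
    exact mul_mem (le_blowUpRing _ _ _ (hr i)) (div_mem_blowUpRing R _ ⟨i, rfl⟩)
  · refine blowUpRing_le (le_blowUpRing _ _ _) ?_
    rintro _ ⟨i, rfl⟩
    exact div_mem_blowUpRing R _ (hf.1 i)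

lemma exists_le_of_mem_blowUp (hS : S ∈ blowUp M Z) : ∃ R ∈ M, R ≤ S := by
  obtain ⟨R, hR, hRS, -⟩ := mem_blowUp.1 hS
  exact ⟨R, hR, hRS⟩

instance (s : Finset K) : IsNoetherianRing (gen (s : Set K)) := by
  have : Algebra.FiniteType ℂ (Algebra.adjoin ℂ (s : Set K)) :=
    (Subalgebra.fg_iff_finiteType _).1 (Subalgebra.fg_adjoin_finset s)
  exact Algebra.FiniteType.isNoetherianRing ℂ (Algebra.adjoin ℂ (s : Set K))

/-- The ideal sheaf of the closure of `Z` is generated on an affine open set by finitely many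
functions. -/
lemma exists_isGenBy (hζ : IsGenericPt Z ζ) (s : Finset K) :
    ∃ (m : ℕ) (f : Fin m → K), (∀ i, f i ∈ gen (s : Set K)) ∧
      ∀ R, IsLocOf (gen s) R → IsGenBy R (idealAt Z R) f := by
  by_cases h : gen (s : Set K) ≤ ζ.toSubring
  · obtain ⟨m, f, hf⟩ := Submodule.fg_iff_exists_fin_generating_family.1
      ((isNoetherianRing_iff_ideal_fg _).1 inferInstance (contraction h))
    have hfm : ∀ i, (f i : K) ∈ maxIdeal ζ := by
      intro i
      rw [← mem_contraction h, ← hf]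
      exact Submodule.subset_span ⟨i, rfl⟩
    have hspan : ∀ b ∈ gen (s : Set K), b ∈ maxIdeal ζ →
        ∃ r : Fin m → gen (s : Set K), b = ∑ i, (r i : K) * (f i : K) := by
      intro b hb hbm
      have : (⟨b, hb⟩ : gen (s : Set K)) ∈ contraction h := (mem_contraction h _).2 hbm
      rw [← hf] at this
      obtain ⟨r, hr⟩ := (Submodule.mem_span_range_iff_exists_fun _).1 this
      refine ⟨r, ?_⟩
      have := congrArg Subtype.val hr
      simpa using this.symm
    refine ⟨m, fun i => f i, fun i => (f i).2, fun R hR => ?_⟩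
    -- In the closure of `ζ` the stalk is the localization of the contracted ideal. Outside it the
    -- stalk is the unit ideal, and then one of the same generators is a unit at `R`.
    by_cases hRζ : R.toSubring ≤ ζ.toSubring
    · refine ⟨fun i => (mem_idealAt_of_le hζ hRζ).2 ⟨hR.1 (f i).2, hfm i⟩, fun x hx => ?_⟩
      obtain ⟨hxR, hxm⟩ := (mem_idealAt_of_le hζ hRζ).1 hx
      obtain ⟨b, hb, c, hc, hc', rfl⟩ := hR.2 x hxR
      have hc0 := ne_zero_of_notMem_maxIdeal hc'
      have hbm : b ∈ maxIdeal ζ := by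
        have := mul_mem_maxIdeal' hxm (h hc)
        rwa [div_mul_cancel₀ _ hc0] at this
      obtain ⟨r, hr⟩ := hspan b hb hbm
      refine ⟨fun i => r i / c, fun i => ?_, ?_⟩
      · change (r i : K) / c ∈ R.toSubring
        rw [div_eq_mul_inv]
        exact mul_mem (hR.1 (r i).2) (inv_mem_of_notMem_maxIdeal (hR.1 hc) hc')
      · rw [hr, Finset.sum_div]
        exact Finset.sum_congr rfl fun i _ => by ring
    · refine ⟨fun i => (mem_idealAt_of_not_le hζ hRζ).2 (hR.1 (f i).2), fun x hx => ?_⟩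
      obtain ⟨j, hj⟩ : ∃ j, (f j : K) ∉ maxIdeal R := by
        -- If all generators vanished at `R`, every function of the algebra vanishing at `ζ` would
        -- vanish at `R`, placing `R` in the closure of `ζ`.
        by_contra! hcon
        apply hRζ
        refine hR.le_of_le h fun b hb hbm => ?_
        obtain ⟨r, rfl⟩ := hspan b hb hbm
        exact sum_mem_maxIdeal fun i _ => mul_mem_maxIdeal (hR.1 (r i).2) (hcon i)
      refine ⟨Pi.single j (x / f j), fun i => ?_, ?_⟩
      · by_cases hij : i = j
        · subst hij
          rw [Pi.single_eq_same, div_eq_mul_inv]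
          exact mul_mem hx.1 (inv_mem_of_notMem_maxIdeal (hR.1 (f i).2) hj)
        · rw [Pi.single_eq_of_ne hij]
          exact zero_mem _
      · rw [Finset.sum_eq_single j]
        · rw [Pi.single_eq_same, div_mul_cancel₀ _ (ne_zero_of_notMem_maxIdeal hj)]
        · intro i _ hij
          rw [Pi.single_eq_of_ne hij, zero_mul]
        · simp
  · refine ⟨1, fun _ => 1, fun _ => one_mem _, fun R hR => ?_⟩
    have hRζ : ¬ R.toSubring ≤ ζ.toSubring := fun h' => h (hR.1.trans h')
    refine ⟨fun _ => (mem_idealAt_of_not_le hζ hRζ).2 (one_mem _), fun x hx => ?_⟩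
    exact ⟨fun _ => x, fun _ => hx.1, by simp⟩

/-- Separatedness: two points below a common `T` lie over the same `R`, and the ratio of their chart
denominators is a unit in both. Finite type: adjoin to an affine algebra downstairs the finitely
many quotients of generators of the ideal. -/
lemma IsVar.blowUp (hM : IsVar M) (hζ : IsGenericPt Z ζ) : IsVar (blowUp M Z) := by
  classical
  refine ⟨?_, ?_⟩
  · intro S₁ hS₁ S₂ hS₂ T h₁ h₂
    obtain ⟨R, hR, hRS₁, f₁, hf₁, hf₁0, hB₁⟩ := mem_blowUp.1 hS₁
    obtain ⟨R', hR', hRS₂, f₂, hf₂, hf₂0, hB₂⟩ := mem_blowUp.1 hS₂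
    obtain rfl := hM.sep R hR R' hR' T (hRS₁.trans h₁) (hRS₂.trans h₂)
    have key : ∀ {S₁ S₂ : LocalSubring K} {f₁ f₂ : K}, R ≤ S₁ → S₁ ≤ T → S₂ ≤ T →
        f₁ ∈ idealAt Z R → f₂ ∈ idealAt Z R → f₁ ≠ 0 → f₂ ≠ 0 →
        blowUpRing R (idealAt Z R) f₁ ≤ S₁.toSubring →
        blowUpRing R (idealAt Z R) f₂ ≤ S₂.toSubring →
        blowUpRing R (idealAt Z R) f₂ ≤ S₁.toSubring := by
      intro S₁ S₂ f₁ f₂ hR h₁ h₂ hf₁ hf₂ hf₁0 hf₂0 hB₁ hB₂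
      have h3 : f₂ / f₁ ∈ S₁.toSubring := hB₁ (div_mem_blowUpRing R f₁ hf₂)
      have h4 : (f₂ / f₁)⁻¹ ∈ T.toSubring := by
        rw [inv_div]
        exact h₂.1 (hB₂ (div_mem_blowUpRing R f₂ hf₁))
      have h5 : (f₂ / f₁)⁻¹ ∈ S₁.toSubring := by
        refine inv_mem_of_notMem_maxIdeal h3 fun h' => ?_
        exact inv_notMem_of_mem_maxIdeal (maxIdeal_subset_of_le h₁ h')
          (div_ne_zero hf₂0 hf₁0) h4
      rw [inv_div] at h5
      refine blowUpRing_le hR.1 fun x hx => ?_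
      have : x / f₂ = x / f₁ * (f₁ / f₂) := by field_simp
      rw [this]
      exact mul_mem (hB₁ (div_mem_blowUpRing R f₁ hx)) h5
    exact hB₁.eq_of_le_le hB₂ (key hRS₂ h₂ h₁ hf₂ hf₁ hf₂0 hf₁0 hB₂.1 hB₁.1)
      (key hRS₁ h₁ h₂ hf₁ hf₂ hf₁0 hf₂0 hB₁.1 hB₂.1) h₁ h₂
  · intro S hS
    obtain ⟨R, hR, hRS, g, hg, hg0, hB⟩ := mem_blowUp.1 hS
    obtain ⟨s, hs, hsM⟩ := hM.ft R hR
    obtain ⟨m, f, hfs, hf⟩ := exists_isGenBy hζ s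
    obtain ⟨j, hj, hfj, hSj⟩ := exists_chart (hf R hs) hRS hg hg0 hB
    set u : Finset K := s ∪ Finset.univ.image (fun i => f i / f j) with hu
    have hsu : gen (s : Set K) ≤ gen (u : Set K) := gen_mono fun x hx =>
      subset_gen _ (by simp [hu, Finset.mem_coe.1 hx])
    have hfu : ∀ i, f i / f j ∈ gen (u : Set K) := fun i => subset_gen _ (by simp [hu])
    have huB : ∀ {R S : LocalSubring K}, IsLocOf (gen s) R → R ≤ S →
        gen (u : Set K) ≤ blowUpRing R (Set.range f) (f j) := by
      intro R S hR hRS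
      refine gen_le (fun c => le_blowUpRing _ _ _ (hR.1 (const_mem_gen _ c))) ?_
      intro x hx
      simp only [hu, Finset.coe_union, Finset.coe_image, Finset.coe_univ, Set.image_univ,
        Set.mem_union, Set.mem_range, Finset.mem_coe] at hx
      rcases hx with hx | ⟨i, rfl⟩
      · exact le_blowUpRing _ _ _ (hR.1 (subset_gen _ hx))
      · exact div_mem_blowUpRing _ _ ⟨i, rfl⟩
    refine ⟨u, ?_, ?_⟩
    · have huS := (huB hs hRS).trans hSj.1
      refine hSj.of_le_fractions huS (blowUpRing_le ?_ ?_)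
      · intro x hx
        obtain ⟨b, hb, c, hc, hc', rfl⟩ := hs.2 x hx
        exact ⟨b, hsu hb, c, hsu hc, notMem_maxIdeal_of_inv_mem
          (ne_zero_of_notMem_maxIdeal hc')
          (hRS.1 (inv_mem_of_notMem_maxIdeal (hs.1 hc) hc')), rfl⟩
      · rintro _ ⟨i, rfl⟩
        exact le_fractions huS (hfu i)
    · intro S' hS'
      rw [mem_affineModel_iff] at hS'
      obtain ⟨R', hR', hRS'⟩ := exists_isLocOf_le (hsu.trans hS'.1)
      refine mem_blowUp_of_chart (hsM (mem_affineModel_iff.2 hR')) hRS' (hf R' hR') hj ?_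
      refine hS'.mono (huB hR' hRS') (blowUpRing_le hRS'.1 ?_)
      rintro _ ⟨i, rfl⟩
      exact hS'.1 (hfu i)

/-! ### The variety `(ℙ¹)⁴` -/

lemma coord_ne_zero (i : Fin 4) : coord i ≠ 0 := by
  rw [coord, Ne, FaithfulSMul.algebraMap_eq_zero_iff]
  exact MvPolynomial.X_ne_zero i

/-- This glues the two charts of `ℙ¹`: `x` is a unit at `T`, hence already a unit at `R`. -/
lemma inv_mem_of_le_of_le (hx : x ∈ R.toSubring) (hx' : x⁻¹ ∈ S.toSubring) (h0 : x ≠ 0)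
    (hR : R ≤ T) (hS : S ≤ T) : x⁻¹ ∈ R.toSubring :=
  inv_mem_of_notMem_maxIdeal hx fun h =>
    inv_notMem_of_mem_maxIdeal (maxIdeal_subset_of_le hR h) h0 (hS.1 hx')

lemma mem_projLinePow4 : R ∈ projLinePow4 ↔ ∃ ε : Fin 4 → Bool,
    IsLocOf (gen (Set.range fun i => if ε i then (coord i)⁻¹ else coord i)) R := by
  simp only [projLinePow4, Set.mem_iUnion, affineChart_eq, mem_affineModel_iff]

lemma isVar_projLinePow4 : IsVar projLinePow4 := by
  classical
  refine ⟨?_, ?_⟩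
  · intro R hR S hS T hRT hST
    obtain ⟨ε, hε⟩ := mem_projLinePow4.1 hR
    obtain ⟨δ, hδ⟩ := mem_projLinePow4.1 hS
    have key : ∀ {R S : LocalSubring K} {ε δ : Fin 4 → Bool}, R ≤ T → S ≤ T →
        gen (Set.range fun i => if ε i then (coord i)⁻¹ else coord i) ≤ R.toSubring →
        gen (Set.range fun i => if δ i then (coord i)⁻¹ else coord i) ≤ S.toSubring →
        gen (Set.range fun i => if δ i then (coord i)⁻¹ else coord i) ≤ R.toSubring := by
      intro R S ε δ hRT hST hR hS
      refine gen_le (fun c => hR (const_mem_gen _ c)) ?_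
      rintro _ ⟨i, rfl⟩
      have h1 := hR (subset_gen _ ⟨i, rfl⟩)
      have h2 := hS (subset_gen _ ⟨i, rfl⟩)
      have h0 := coord_ne_zero i
      simp only at h1 h2 ⊢
      cases hεi : ε i <;> cases hδi : δ i <;> simp only [hεi, hδi] at h1 h2 ⊢ <;>
        simp only [if_true, if_false, Bool.false_eq_true] at h1 h2 ⊢
      · exact h1
      · exact inv_mem_of_le_of_le h1 h2 h0 hRT hST
      · rw [← inv_inv (coord i)] at h2
        have := inv_mem_of_le_of_le h1 h2 (inv_ne_zero h0) hRT hST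
        rwa [inv_inv] at this
      · exact h1
    exact hε.eq_of_le_le hδ (key hST hRT hδ.1 hε.1) (key hRT hST hε.1 hδ.1) hRT hST
  · intro R hR
    obtain ⟨ε, hε⟩ := mem_projLinePow4.1 hR
    refine ⟨Finset.univ.image fun i => if ε i then (coord i)⁻¹ else coord i, ?_, ?_⟩
    · rw [Finset.coe_image, Finset.coe_univ, Set.image_univ]
      exact hε
    · rw [Finset.coe_image, Finset.coe_univ, Set.image_univ]
      intro S hS
      exact mem_projLinePow4.2 ⟨ε, mem_affineModel_iff.1 hS⟩

end models


/-! ### Transcendence degrees of residue fields -/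

section independence

open MvPolynomial

variable {R S T ζ : LocalSubring K} {ι : Type*} {B : Subring K}

/-- The elements `x i` of `R` have residues that are algebraically independent over `ℂ`. -/
def Indep (R : LocalSubring K) (x : ι → K) : Prop :=
  ∀ P : MvPolynomial ι ℂ, P ≠ 0 → aeval x P ∈ R.toSubring ∧ aeval x P ∉ maxIdeal R

lemma Indep.mem {x : ι → K} (h : Indep R x) (i : ι) : x i ∈ R.toSubring := by
  have := (h (X i) (X_ne_zero i)).1
  rwa [aeval_X] at this

lemma Indep.const_mem {x : ι → K} (h : Indep R x) (c : ℂ) : const c ∈ R.toSubring := by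
  by_cases hc : c = 0
  · rw [hc, const_zero]
    exact zero_mem _
  · have := (h (C c) (by simpa using hc)).1
    rwa [aeval_C] at this

lemma Indep.of_le {x : ι → K} (h : Indep R x) (hRS : R.toSubring ≤ S.toSubring) : Indep S x :=
  fun P hP => ⟨hRS (h P hP).1, notMem_maxIdeal_of_le hRS (h P hP).1 (h P hP).2⟩

lemma Indep.comp {ι' : Type*} {x : ι → K} (h : Indep R x) {f : ι' → ι}
    (hf : Function.Injective f) : Indep R (x ∘ f) := by
  intro P hP
  have := h (rename f P) fun h0 => hP (rename_injective f hf (by rw [h0, map_zero]))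
  rwa [aeval_rename] at this

lemma aeval_mem (hc : ∀ c, const c ∈ B) {x : ι → K} (hx : ∀ i, x i ∈ B)
    (P : MvPolynomial ι ℂ) : aeval x P ∈ B := by
  induction P using MvPolynomial.induction_on with
  | C a =>
    rw [aeval_C]
    exact hc a
  | add p q hp hq =>
    rw [map_add]
    exact add_mem hp hq
  | mul_X p i hp =>
    rw [map_mul, aeval_X]
    exact mul_mem hp (hx i)

lemma aeval_sub_aeval_mem_maxIdeal (hc : ∀ c, const c ∈ R.toSubring) {x y : ι → K}
    (hx : ∀ i, x i ∈ R.toSubring) (hxy : ∀ i, x i - y i ∈ maxIdeal R) (P : MvPolynomial ι ℂ) :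
    aeval x P - aeval y P ∈ maxIdeal R := by
  have hy : ∀ i, y i ∈ R.toSubring := fun i => by
    have := sub_mem (hx i) (mem_of_mem_maxIdeal (hxy i))
    rwa [sub_sub_cancel] at this
  induction P using MvPolynomial.induction_on with
  | C a => simpa using zero_mem_maxIdeal
  | add p q hp hq =>
    rw [map_add, map_add, add_sub_add_comm]
    exact add_mem_maxIdeal hp hq
  | mul_X p i hp =>
    rw [map_mul, map_mul, aeval_X, aeval_X]
    have : aeval x p * x i - aeval y p * y i =
      (aeval x p - aeval y p) * x i + aeval y p * (x i - y i) := by ring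
    rw [this]
    exact add_mem_maxIdeal (mul_mem_maxIdeal' hp (hx i))
      (mul_mem_maxIdeal (aeval_mem hc hy p) (hxy i))

/-- The structure of a `ℂ`-algebra on a local ring that contains the constants. -/
@[reducible] def constAlgebra (hc : ∀ c, const c ∈ R.toSubring) : Algebra ℂ R.toSubring :=
  ((algebraMap ℂ K).codRestrict R.toSubring hc).toAlgebra

lemma coe_aeval (hc : ∀ c, const c ∈ R.toSubring) (x : ι → R.toSubring) (P : MvPolynomial ι ℂ) :
    letI := constAlgebra hc
    ((aeval x P : R.toSubring) : K) = aeval (fun i => (x i : K)) P := by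
  let := constAlgebra hc
  let f : R.toSubring →ₐ[ℂ] K := { R.toSubring.subtype with commutes' := fun c => rfl }
  change f (aeval x P) = _
  rw [comp_aeval_apply]
  rfl

lemma indep_iff (hc : ∀ c, const c ∈ R.toSubring) (x : ι → R.toSubring) :
    letI := constAlgebra hc
    Indep R (fun i => (x i : K)) ↔
      AlgebraicIndependent ℂ (fun i => IsLocalRing.residue R.toSubring (x i)) := by
  let := constAlgebra hc
  have key : ∀ P : MvPolynomial ι ℂ,
      aeval (fun i => IsLocalRing.residue R.toSubring (x i)) P = 0 ↔
        aeval (fun i => (x i : K)) P ∈ maxIdeal R := by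
    intro P
    have h1 : aeval (fun i => IsLocalRing.residue R.toSubring (x i)) P =
        IsLocalRing.residue R.toSubring (aeval x P) :=
      aeval_algebraMap_apply (IsLocalRing.ResidueField R.toSubring) x P
    rw [h1, IsLocalRing.residue_eq_zero_iff, ← coe_aeval hc, mem_maxIdeal_iff (Subtype.property _)]
  rw [algebraicIndependent_iff]
  constructor
  · intro h P hP
    by_contra h0
    exact (h P h0).2 ((key P).1 hP)
  · intro h P hP
    exact ⟨aeval_mem hc (fun i => (x i).2) P, fun h' => hP (h P ((key P).2 h'))⟩

/-- The bridge from elements of `K` to transcendence degrees. Dimension counts elsewhere use `Indep`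
only, without algebra structures on residue fields. -/
lemma exists_indep_iff (hc : ∀ c, const c ∈ R.toSubring) (n : ℕ) :
    letI := constAlgebra hc
    (∃ x : Fin n → K, Indep R x) ↔
      (n : Cardinal) ≤ Algebra.trdeg ℂ (IsLocalRing.ResidueField R.toSubring) := by
  let := constAlgebra hc
  constructor
  · rintro ⟨x, hx⟩
    have := (indep_iff hc fun i => ⟨x i, hx.mem i⟩).1 hx
    simpa using this.lift_cardinalMk_le_trdeg
  · intro h
    obtain ⟨s, hs⟩ := exists_isTranscendenceBasis ℂ (IsLocalRing.ResidueField R.toSubring)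
    rw [← hs.cardinalMk_eq_trdeg, ← Cardinal.mk_fin n] at h
    have h' : Cardinal.lift.{0} (Cardinal.mk (Fin n)) ≤ Cardinal.lift.{0} (Cardinal.mk s) := by
      simpa using h
    obtain ⟨f⟩ := Cardinal.lift_mk_le'.1 h'
    have h1 := hs.1.comp f f.injective
    choose g hg using fun i => IsLocalRing.residue_surjective (R := R.toSubring) (f i : _)
    refine ⟨fun i => g i, (indep_iff hc g).2 ?_⟩
    convert h1 using 1
    funext i
    exact hg i

/-- Elements whose residues generate the residue field. -/
lemma isAlgebraic_residueField (hc : ∀ c, const c ∈ S.toSubring) {s : Set K}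
    (hS : IsLocOf (gen s) S) (w : ι → S.toSubring)
    (hs : ∀ x ∈ s, x ∈ maxIdeal S ∨ ∃ i, x = w i) :
    letI := constAlgebra hc
    Algebra.IsAlgebraic (Algebra.adjoin ℂ
      (Set.range fun i => IsLocalRing.residue S.toSubring (w i)))
      (IsLocalRing.ResidueField S.toSubring) := by
  let := constAlgebra hc
  set A := Algebra.adjoin ℂ (Set.range fun i => IsLocalRing.residue S.toSubring (w i)) with hA
  let resA : Subring S.toSubring := A.toSubring.comap (IsLocalRing.residue S.toSubring)
  have hgen : gen s ≤ resA.map S.toSubring.subtype := by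
    refine gen_le (fun c => ⟨⟨const c, hc c⟩, ?_, rfl⟩) fun x hx => ?_
    · exact A.algebraMap_mem c
    · refine ⟨⟨x, hS.1 (subset_gen _ hx)⟩, ?_, rfl⟩
      change IsLocalRing.residue S.toSubring ⟨x, _⟩ ∈ A
      rcases hs x hx with h | ⟨i, rfl⟩
      · rw [(IsLocalRing.residue_eq_zero_iff _).2 ((mem_maxIdeal_iff _).1 h)]
        exact zero_mem _
      · exact Algebra.subset_adjoin ⟨i, rfl⟩
  refine ⟨fun z => ?_⟩
  obtain ⟨x, rfl⟩ := IsLocalRing.residue_surjective z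
  obtain ⟨b, hb, c, hcs, hc', hx⟩ := hS.2 x x.2
  obtain ⟨b, hbA, rfl⟩ := hgen hb
  obtain ⟨c, hcA, rfl⟩ := hgen hcs
  have hc0 : IsLocalRing.residue S.toSubring c ≠ 0 := by
    intro h
    exact hc' ((mem_maxIdeal_iff c.2).2 ((IsLocalRing.residue_eq_zero_iff _).1 h))
  have hmul : x * c = b := by
    apply Subtype.ext
    rw [Subring.coe_mul, hx]
    exact div_mul_cancel₀ _ (ne_zero_of_notMem_maxIdeal hc')
  have hz : IsLocalRing.residue S.toSubring x =
      IsLocalRing.residue S.toSubring b * (IsLocalRing.residue S.toSubring c)⁻¹ := by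
    rw [← hmul, map_mul, mul_inv_cancel_right₀ hc0]
  rw [hz]
  have h1 := isAlgebraic_algebraMap (R := A) (A := IsLocalRing.ResidueField S.toSubring)
    ⟨_, hbA⟩
  have h2 := isAlgebraic_algebraMap (R := A) (A := IsLocalRing.ResidueField S.toSubring)
    ⟨_, hcA⟩
  exact h1.mul h2.inv

/-- If residues of `n` elements generate the residue field of `S`, of transcendence degree at least
`n`, they are algebraically independent. -/
lemma indep_of_isLocOf {n : ℕ} {s : Set K} (hS : IsLocOf (gen s) S) {w : Fin n → K}
    (hw : ∀ i, w i ∈ S.toSubring) (hs : ∀ x ∈ s, x ∈ maxIdeal S ∨ ∃ i, x = w i)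
    {x : Fin n → K} (hx : Indep S x) : Indep S w := by
  have hc := hx.const_mem
  let := constAlgebra hc
  have h1 := (exists_indep_iff hc n).1 ⟨x, hx⟩
  have := isAlgebraic_residueField hc hS (fun i => ⟨w i, hw i⟩) hs
  refine (indep_iff hc fun i => ⟨w i, hw i⟩).2 ?_
  refine (Algebra.IsAlgebraic.isTranscendenceBasis_of_lift_le_trdeg_of_finite ℂ _ ?_).1
  simpa using h1

/-- Generators in the maximal ideal contribute nothing to the residue field, so the transcendence
degree is at most the number of remaining ones. -/
lemma card_le_of_isLocOf {n m : ℕ} {s : Set K} (hS : IsLocOf (gen s) S) {w : Fin n → K}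
    (hw : ∀ i, w i ∈ S.toSubring) (hs : ∀ x ∈ s, x ∈ maxIdeal S ∨ ∃ i, x = w i)
    {x : Fin m → K} (hx : Indep S x) : m ≤ n := by
  have hc := hx.const_mem
  let := constAlgebra hc
  have h1 := (exists_indep_iff hc m).1 ⟨x, hx⟩
  have := isAlgebraic_residueField hc hS (fun i => ⟨w i, hw i⟩) hs
  have h2 := h1.trans (Algebra.IsAlgebraic.trdeg_le_cardinalMk ℂ
    (Set.range fun i : Fin n => IsLocalRing.residue S.toSubring ⟨w i, hw i⟩))
  have h3 := h2.trans Cardinal.mk_range_le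
  simpa using h3

/-- The residue field of a local ring of a blow-up chart. -/
lemma exists_indep_of_le {n m : ℕ} (hRS : R ≤ S) (hS : IsLocOf B S) {z : Fin m → K}
    (hB : B ≤ Subring.closure (R.toSubring ∪ Set.range z)) (hz : ∀ i, z i ∈ S.toSubring)
    (hcR : ∀ c, const c ∈ R.toSubring)
    {x : Fin (n + m) → K} (hx : Indep S x) : ∃ y : Fin n → K, Indep R y := by
  have hc := hx.const_mem
  let := constAlgebra hc
  let := constAlgebra hcR
  let : Algebra R.toSubring S.toSubring := (Subring.inclusion hRS.1).toAlgebra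
  have : IsLocalHom (algebraMap R.toSubring S.toSubring) := hRS.2
  have : IsScalarTower ℂ R.toSubring S.toSubring := .of_algebraMap_eq fun _ => rfl
  let κR := IsLocalRing.ResidueField R.toSubring
  let κS := IsLocalRing.ResidueField S.toSubring
  have : IsScalarTower ℂ κR κS := .of_algebraMap_eq fun c => by
    change _ = algebraMap κR κS (IsLocalRing.residue _ (algebraMap ℂ R.toSubring c))
    change _ = IsLocalRing.residue _ (algebraMap R.toSubring S.toSubring (algebraMap ℂ _ c))
    rw [← IsScalarTower.algebraMap_apply ℂ R.toSubring S.toSubring]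
    rfl
  have h1 := (exists_indep_iff hc (n + m)).1 ⟨x, hx⟩
  rw [exists_indep_iff hcR]
  have : FaithfulSMul κR κS :=
    (faithfulSMul_iff_algebraMap_injective _ _).2 (algebraMap κR κS).injective
  have : FaithfulSMul ℂ κR :=
    (faithfulSMul_iff_algebraMap_injective _ _).2 (algebraMap ℂ κR).injective
  -- Additivity in the tower of `ℂ` and the two residue fields. The upper extension is generated by
  -- the residues of the `m` elements `z i`, so it accounts for at most `m`.
  have h2 : Algebra.trdeg ℂ κR + Algebra.trdeg κR κS = Algebra.trdeg ℂ κS :=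
    trdeg_add_eq ℂ κR
  set s : Set κS := Set.range fun i => IsLocalRing.residue S.toSubring ⟨z i, hz i⟩ with hs
  set A := Algebra.adjoin κR s with hA
  let resA : Subring S.toSubring := A.toSubring.comap (IsLocalRing.residue S.toSubring)
  have hgen : B ≤ resA.map S.toSubring.subtype := by
    refine hB.trans ((Subring.closure_le).2 ?_)
    rintro x (hx | ⟨i, rfl⟩)
    · refine ⟨⟨x, hRS.1 hx⟩, ?_, rfl⟩
      exact A.algebraMap_mem (IsLocalRing.residue R.toSubring ⟨x, hx⟩)
    · exact ⟨⟨z i, hz i⟩, Algebra.subset_adjoin ⟨i, rfl⟩, rfl⟩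
  have halg : Algebra.IsAlgebraic A κS := by
    refine ⟨fun u => ?_⟩
    obtain ⟨x, rfl⟩ := IsLocalRing.residue_surjective u
    obtain ⟨b, hb, c, hcs, hc', hx⟩ := hS.2 x x.2
    obtain ⟨b, hbA, rfl⟩ := hgen hb
    obtain ⟨c, hcA, rfl⟩ := hgen hcs
    have hc0 : IsLocalRing.residue S.toSubring c ≠ 0 := by
      intro h
      exact hc' ((mem_maxIdeal_iff c.2).2 ((IsLocalRing.residue_eq_zero_iff _).1 h))
    have hmul : x * c = b := by
      apply Subtype.ext
      rw [Subring.coe_mul, hx]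
      exact div_mul_cancel₀ _ (ne_zero_of_notMem_maxIdeal hc')
    have hz : IsLocalRing.residue S.toSubring x =
        IsLocalRing.residue S.toSubring b * (IsLocalRing.residue S.toSubring c)⁻¹ := by
      rw [← hmul, map_mul, mul_inv_cancel_right₀ hc0]
    rw [hz]
    have h1 := isAlgebraic_algebraMap (R := A) (A := κS) ⟨_, hbA⟩
    have h2 := isAlgebraic_algebraMap (R := A) (A := κS) ⟨_, hcA⟩
    exact h1.mul h2.inv
  have h3 := (Algebra.IsAlgebraic.trdeg_le_cardinalMk κR s).trans Cardinal.mk_range_le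
  rw [Cardinal.mk_fin] at h3
  have h4 : ((n : Cardinal) + m) ≤ Algebra.trdeg ℂ κR + m := by
    rw [← h2] at h1
    push_cast at h1
    exact h1.trans (add_le_add le_rfl h3)
  exact (Cardinal.add_nat_le_add_nat_iff m).1 h4

/-- An element of the maximal ideal of `R` that is a unit in `ζ` enlarges independent families. -/
lemma Indep.cons {n : ℕ} {x : Fin n → K} (hx : Indep R x) (h : R.toSubring ≤ ζ.toSubring) {y : K}
    (hy : y ∈ maxIdeal R) (hyζ : y ∉ maxIdeal ζ) : Indep ζ (Fin.cons y x : Fin (n + 1) → K) := by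
  intro P hP
  let ev : Polynomial (MvPolynomial (Fin n) ℂ) →+* K :=
    Polynomial.eval₂RingHom (aeval x : MvPolynomial (Fin n) ℂ →ₐ[ℂ] K).toRingHom y
  have hev : ∀ P, aeval (Fin.cons y x : Fin (n + 1) → K) P = ev (finSuccEquiv ℂ n P) := by
    intro P
    induction P using MvPolynomial.induction_on with
    | C a =>
      rw [finSuccEquiv_apply]
      simp [ev]
    | add p q hp hq => rw [map_add, map_add, map_add, hp, hq]
    | mul_X p i hp =>
      rw [map_mul, map_mul, map_mul, hp, aeval_X]
      congr 1
      refine Fin.cases ?_ (fun j => ?_) i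
      · simp [ev, finSuccEquiv_X_zero]
      · simp [ev, finSuccEquiv_X_succ]
  have hyR := mem_of_mem_maxIdeal hy
  have hmem : ∀ Q, ev Q ∈ R.toSubring := by
    intro Q
    change Polynomial.eval₂ _ _ Q ∈ _
    rw [Polynomial.eval₂_eq_sum, Polynomial.sum]
    exact sum_mem fun i _ => mul_mem (aeval_mem hx.const_mem hx.mem _) (pow_mem hyR _)
  have hQ : finSuccEquiv ℂ n P ≠ 0 := by simpa using hP
  -- Seen as a polynomial in `y`, split off the highest power of `y`, a unit in `ζ`. The cofactor
  -- has a non-zero constant coefficient, so its value is congruent to a unit modulo the maximal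
  -- ideal of `R` and is a unit in both rings.
  obtain ⟨Q, hPQ, hdvd⟩ := Polynomial.exists_eq_pow_rootMultiplicity_mul_and_not_dvd _ hQ 0
  rw [Polynomial.C_0, sub_zero] at hPQ hdvd
  have hcoeff : Q.coeff 0 ≠ 0 := fun h0 => hdvd (Polynomial.X_dvd_iff.2 h0)
  have hevQ : ev Q ∉ maxIdeal R := by
    intro hm
    have h1 : ev Q = y * ev Q.divX + aeval x (Q.coeff 0) := by
      conv_lhs => rw [← Polynomial.divX_mul_X_add Q]
      rw [map_add, map_mul, mul_comm]
      simp [ev]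
    have h2 : aeval x (Q.coeff 0) = ev Q - y * ev Q.divX := by rw [h1]; ring
    apply (hx _ hcoeff).2
    rw [h2]
    exact sub_mem_maxIdeal hm (mul_mem_maxIdeal' hy (hmem _))
  rw [hev, hPQ, map_mul, map_pow]
  have hX : ev Polynomial.X = y := by simp [ev]
  rw [hX]
  exact ⟨h (mul_mem (pow_mem hyR _) (hmem _)), mul_notMem_maxIdeal (pow_mem (h hyR) _)
    (pow_notMem_maxIdeal (h hyR) hyζ _) (h (hmem _)) (notMem_maxIdeal_of_le h (hmem _) hevQ)⟩

/-- A strict specialization loses transcendence degree. Thus a point in the closure of `ζ` with a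
residue field as large as that of `ζ` is dominated by `ζ`. -/
lemma le_of_indep {n : ℕ} {x : Fin n → K} (hx : Indep R x) (h : R.toSubring ≤ ζ.toSubring)
    (hζ : ∀ z : Fin (n + 1) → K, ¬ Indep ζ z) : R ≤ ζ := by
  rw [le_iff_maxIdeal]
  refine ⟨h, fun y hy => ?_⟩
  by_contra hyζ
  exact hζ _ (hx.cons h hy hyζ)

end independence


/-! ### Points of codimension one -/

section dimension

open MvPolynomial

/-- A prime of this kind is zero or generated by an irreducible `f`. If `f` involves one variable,
the others remain independent modulo `f`, because non-zero multiples of `f` involve that variable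
too. -/
lemma exists_rename_notMem {s : ℕ} (hs : 4 ≤ s) (p : Ideal (MvPolynomial (Fin s) ℂ)) [p.IsPrime]
    (hp : ∀ f, Prime f → f ∈ p → p = Ideal.span {f}) :
    ∃ i : Fin 3 → Fin s, ∀ Q : MvPolynomial (Fin 3) ℂ, Q ≠ 0 → rename i Q ∉ p := by
  by_cases h0 : p = ⊥
  · have hi : Function.Injective (Fin.castLE (n := 3) (m := s) (by omega)) :=
      Fin.castLE_injective _
    refine ⟨Fin.castLE (by omega), fun Q hQ hQp => hQ (rename_injective _ hi ?_)⟩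
    rw [h0] at hQp
    rw [map_zero]
    exact hQp
  · obtain ⟨f, hfp, hf⟩ := Ideal.IsPrime.exists_mem_prime_of_ne_bot ‹_› h0
    rw [hp f hf hfp]
    obtain ⟨i₀, hi₀⟩ : ∃ i₀, i₀ ∈ f.vars := by
      by_contra! hcon
      have h1 : f.vars = ∅ := Finset.eq_empty_of_forall_notMem hcon
      obtain ⟨c, rfl⟩ : ∃ c, f = C c := ⟨_, vars_eq_empty_iff_eq_C.1 h1⟩
      apply hf.not_isUnit
      have hc : c ≠ 0 := fun h => hf.ne_zero (by rw [h, C_0])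
      exact (isUnit_iff_ne_zero.2 hc).map C
    have hcard : Cardinal.mk (Fin 3) ≤ Cardinal.mk {j : Fin s // j ≠ i₀} := by
      simp only [Cardinal.mk_fintype, Fintype.card_fin, Nat.cast_le, Fintype.card_subtype_compl,
        Fintype.card_unique]
      omega
    obtain ⟨i⟩ := hcard
    have hi : Function.Injective fun k => (i k : Fin s) :=
      Subtype.val_injective.comp i.injective
    refine ⟨fun k => i k, fun Q hQ hQp => ?_⟩
    obtain ⟨h, hh⟩ := Ideal.mem_span_singleton.1 hQp
    have hQ' : rename (fun k => (i k : Fin s)) Q ≠ 0 := fun h0 => hQ (rename_injective _ hi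
      (by rw [h0, map_zero]))
    have h1 : degreeOf i₀ (rename (fun k => (i k : Fin s)) Q) = 0 := by
      rw [← Decidable.not_not (p := degreeOf _ _ = 0), ← ne_eq, ← mem_vars_iff_degreeOf_ne_zero]
      classical
      intro hv
      obtain ⟨k, -, hk⟩ := mem_vars_rename _ _ hv
      exact (i k).2 hk
    -- Degrees in the chosen variable add, so the multiple of `f` has positive degree in it, while
    -- the renamed polynomial has degree zero.
    rw [hh, degreeOf_mul_eq hf.ne_zero (fun h0 => hQ' (by rw [hh, h0, mul_zero]))] at h1
    exact mem_vars_iff_degreeOf_ne_zero.1 hi₀ (by omega)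

/-- The residue field at a prime of height at most one of a four-dimensional affine domain has
transcendence degree at least three. -/
lemma exists_aeval_notMem_of_height_le_one {B : Type} [CommRing B] [IsDomain B] [Algebra ℂ B]
    [Algebra.FiniteType ℂ B] (hB : 4 ≤ Algebra.trdeg ℂ B) (P : Ideal B) [P.IsPrime]
    (hP : P.height ≤ 1) :
    ∃ x : Fin 3 → B, ∀ Q : MvPolynomial (Fin 3) ℂ, Q ≠ 0 → aeval x Q ∉ P := by
  -- Noether normalization reduces the question to a polynomial ring, where the contracted prime is
  -- zero or principal.
  obtain ⟨s, g, inj, int⟩ := exists_integral_inj_algHom_of_fg ℂ B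
  let A := MvPolynomial (Fin s) ℂ
  let : Algebra A B := g.toRingHom.toAlgebra
  have : IsScalarTower ℂ A B := .of_algebraMap_eq fun c => (g.commutes c).symm
  have : Algebra.IsIntegral A B := ⟨int⟩
  have : FaithfulSMul A B := (faithfulSMul_iff_algebraMap_injective A B).2 inj
  have h4s : 4 ≤ s := by
    have h1 : Algebra.trdeg ℂ A + Algebra.trdeg A B = Algebra.trdeg ℂ B := trdeg_add_eq ℂ A
    rw [trdeg_eq_zero (R := A), add_zero, MvPolynomial.trdeg_of_isDomain] at h1
    rw [← h1] at hB
    simpa using hB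
  obtain ⟨i, hi⟩ := exists_rename_notMem h4s (P.under A) (by
    intro f hf hfP
    have : (Ideal.span {f}).IsPrime := (Ideal.span_singleton_prime hf.ne_zero).2 hf
    have hle : Ideal.span {f} ≤ P.under A := (Ideal.span_singleton_le_iff_mem _).2 hfP
    by_contra hne
    -- Going-down: a principal prime strictly inside the contraction would lift to a prime strictly
    -- between zero and `P`, against the height bound.
    obtain ⟨P₁, hP₁, _, hover⟩ := Ideal.exists_ideal_lt_liesOver_of_lt P
      (lt_of_le_of_ne hle (Ne.symm hne))
    have hbot : (⊥ : Ideal B) < P₁ := by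
      rw [bot_lt_iff_ne_bot]
      rintro rfl
      have h1 : f ∈ Ideal.span {f} := Ideal.mem_span_singleton_self f
      rw [hover.over, Ideal.mem_comap, Ideal.mem_bot] at h1
      exact hf.ne_zero (inj (h1.trans (map_zero g).symm))
    have h1 := Ideal.height_add_one_le_of_lt_of_isPrime hbot
    have h2 := Ideal.height_add_one_le_of_lt_of_isPrime hP₁
    have h3 : (1 : ℕ∞) + 1 ≤ 1 :=
      calc (1 : ℕ∞) + 1 ≤ ((⊥ : Ideal B).height + 1) + 1 := by gcongr; exact le_add_self
        _ ≤ P₁.height + 1 := by gcongr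
        _ ≤ P.height := h2
        _ ≤ 1 := hP
    exact absurd h3 (by decide))
  refine ⟨fun k => g (X (i k)), fun Q hQ hQP => hi Q hQ ?_⟩
  change g (rename i Q) ∈ P
  convert hQP using 1
  rw [rename_eq_aeval, comp_aeval_apply]
  rfl

lemma algebraicIndependent_coord : AlgebraicIndependent ℂ coord :=
  (algebraicIndependent_X (Fin 4) ℂ).map' (f := IsScalarTower.toAlgHom ℂ _ K)
    (FaithfulSMul.algebraMap_injective (MvPolynomial (Fin 4) ℂ) K)

lemma four_le_trdeg : 4 ≤ Algebra.trdeg ℂ K := by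
  simpa using algebraicIndependent_coord.lift_cardinalMk_le_trdeg

variable {R S T : LocalSubring K}

/-- The residue field of a point of codimension at most one has transcendence degree at least
three. -/
lemma exists_indep_of_ringKrullDim_le_one {s : Finset K} (hR : IsLocOf (gen (s : Set K)) R)
    (hfrac : ∀ x : K, ∃ a ∈ R.toSubring, ∃ b ∈ R.toSubring, b ≠ 0 ∧ x = a / b)
    (hdim : ringKrullDim R.toSubring ≤ 1) : ∃ x : Fin 3 → K, Indep R x := by
  obtain ⟨⟨P, hPp⟩, rfl⟩ := mem_affineModel_iff.2 hR
  let B := Algebra.adjoin ℂ (s : Set K)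
  have hft : Algebra.FiniteType ℂ B :=
    (Subalgebra.fg_iff_finiteType _).1 (Subalgebra.fg_adjoin_finset s)
  -- `K` is the fraction field of `R`, hence algebraic over the algebra `B`, which therefore has
  -- transcendence degree at least four.
  have halg : Algebra.IsAlgebraic B K := by
    have h1 : ∀ a ∈ (LocalSubring.ofPrime (gen (s : Set K)) P).toSubring, IsAlgebraic B a := by
      intro a ha
      obtain ⟨b, hb, c, hc, -, rfl⟩ := hR.2 a ha
      rw [div_eq_mul_inv]
      exact (isAlgebraic_algebraMap (R := B) (A := K) ⟨b, hb⟩).mul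
        (isAlgebraic_algebraMap (R := B) (A := K) ⟨c, hc⟩).inv
    refine ⟨fun x => ?_⟩
    obtain ⟨a, ha, b, hb, -, rfl⟩ := hfrac x
    rw [div_eq_mul_inv]
    exact (h1 a ha).mul (h1 b hb).inv
  have hB : 4 ≤ Algebra.trdeg ℂ B := by
    have h1 : Algebra.trdeg ℂ B + Algebra.trdeg B K = Algebra.trdeg ℂ K := trdeg_add_eq ℂ B
    rw [trdeg_eq_zero (R := B), add_zero] at h1
    rw [h1]
    exact four_le_trdeg
  have hht : P.height ≤ 1 := by
    have h1 := IsLocalization.AtPrime.ringKrullDim_eq_height P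
      (LocalSubring.ofPrime (gen (s : Set K)) P).toSubring
    rw [h1] at hdim
    exact_mod_cast hdim
  let P' : Ideal B := P
  have : P'.IsPrime := hPp
  obtain ⟨x, hx⟩ := exists_aeval_notMem_of_height_le_one hB P' hht
  refine ⟨fun i => x i, fun Q hQ => ?_⟩
  have h1 : aeval (fun i => (x i : K)) Q = ((aeval x Q : B) : K) := by
    change _ = B.val (aeval x Q)
    rw [comp_aeval_apply]
    rfl
  rw [h1]
  exact ⟨hR.1 (aeval x Q).2, fun h => hx Q hQ ((mem_maxIdeal_ofPrime P (aeval x Q)).1 h)⟩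

/-! ### Systems of coordinates -/

/-- The functions `y` are coordinates on an affine space with function field `K`. -/
structure IsCoord (y : Fin 4 → K) : Prop where
  indep : AlgebraicIndependent ℂ y
  frac : ∀ x : K, ∃ P s : MvPolynomial (Fin 4) ℂ, s ≠ 0 ∧ x = aeval y P / aeval y s

lemma mem_gen_range {ι : Type*} {y : ι → K} {x : K} :
    x ∈ gen (Set.range y) ↔ ∃ P : MvPolynomial ι ℂ, aeval y P = x := by
  change x ∈ Algebra.adjoin ℂ (Set.range y) ↔ _
  rw [Algebra.adjoin_range_eq_range_aeval]
  rfl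

lemma exists_coord_frac (x : K) :
    ∃ P s : MvPolynomial (Fin 4) ℂ, s ≠ 0 ∧ x = aeval coord P / aeval coord s := by
  obtain ⟨P, s, hs, rfl⟩ := IsFractionRing.div_surjective (A := MvPolynomial (Fin 4) ℂ) x
  have h : ∀ P : MvPolynomial (Fin 4) ℂ, aeval coord P = algebraMap _ K P := by
    intro P
    have := aeval_algebraMap_apply (R := ℂ) K (fun i : Fin 4 => (X i : MvPolynomial (Fin 4) ℂ)) P
    rw [aeval_X_left_apply] at this
    exact this
  exact ⟨P, s, nonZeroDivisors.ne_zero hs, by rw [h, h]⟩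

lemma adjoin_coord : IntermediateField.adjoin ℂ (Set.range coord) = ⊤ := by
  rw [eq_top_iff]
  intro x _
  obtain ⟨P, s, -, rfl⟩ := exists_coord_frac x
  have hle := IntermediateField.algebra_adjoin_le_adjoin ℂ (Set.range coord)
  exact div_mem (hle (mem_gen_range.2 ⟨P, rfl⟩)) (hle (mem_gen_range.2 ⟨s, rfl⟩))

/-- Four generators of a field of transcendence degree at least four are automatically independent,
so a coordinate system is verified by recovering the original coordinates rationally. -/
lemma isCoord_of_adjoin {y : Fin 4 → K}
    (h : ∀ i, coord i ∈ IntermediateField.adjoin ℂ (Set.range y)) : IsCoord y := by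
  have htop : IntermediateField.adjoin ℂ (Set.range y) = ⊤ := by
    rw [eq_top_iff, ← adjoin_coord, IntermediateField.adjoin_le_iff]
    rintro _ ⟨i, rfl⟩
    exact h i
  have hdiv : ∀ x : K, ∃ r ∈ Algebra.adjoin ℂ (Set.range y),
      ∃ s ∈ Algebra.adjoin ℂ (Set.range y), x = r / s := by
    intro x
    rw [← IntermediateField.mem_adjoin_iff_div, htop]
    trivial
  have halg : Algebra.IsAlgebraic (Algebra.adjoin ℂ (Set.range y)) K := by
    refine ⟨fun x => ?_⟩
    obtain ⟨r, hr, s, hs, rfl⟩ := hdiv x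
    rw [div_eq_mul_inv]
    exact (isAlgebraic_algebraMap (R := Algebra.adjoin ℂ (Set.range y)) (A := K) ⟨r, hr⟩).mul
      (isAlgebraic_algebraMap (R := Algebra.adjoin ℂ (Set.range y)) (A := K) ⟨s, hs⟩).inv
  have hy : AlgebraicIndependent ℂ y := by
    refine (Algebra.IsAlgebraic.isTranscendenceBasis_of_lift_le_trdeg_of_finite ℂ y ?_).1
    simpa using four_le_trdeg
  refine ⟨hy, fun x => ?_⟩
  obtain ⟨r, hr, s, hs, rfl⟩ := hdiv x
  obtain ⟨P, rfl⟩ := mem_gen_range.1 hr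
  obtain ⟨Q, rfl⟩ := mem_gen_range.1 hs
  by_cases hQ : Q = 0
  · exact ⟨0, 1, one_ne_zero, by simp [hQ]⟩
  · exact ⟨P, Q, hQ, rfl⟩

lemma isCoord_coord : IsCoord coord := ⟨algebraicIndependent_coord, exists_coord_frac⟩

/-- Setting the first `n` variables equal to zero. -/
def strip (n : ℕ) : MvPolynomial (Fin 4) ℂ →ₐ[ℂ] MvPolynomial (Fin 4) ℂ :=
  aeval fun i => if (i : ℕ) < n then 0 else X i

instance (n : ℕ) : (RingHom.ker (strip n)).IsPrime := RingHom.ker_isPrime _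

lemma sub_strip_mem {n : ℕ} (P : MvPolynomial (Fin 4) ℂ) :
    P - strip n P ∈ Ideal.span (X '' {i : Fin 4 | (i : ℕ) < n}) := by
  induction P using MvPolynomial.induction_on with
  | C a => simp [strip]
  | add p q hp hq =>
    rw [map_add, add_sub_add_comm]
    exact add_mem hp hq
  | mul_X p i hp =>
    rw [map_mul]
    have : p * X i - strip n p * strip n (X i) =
      X i * (p - strip n p) + strip n p * (X i - strip n (X i)) := by ring
    rw [this]
    refine add_mem (Ideal.mul_mem_left _ _ hp) (Ideal.mul_mem_left _ _ ?_)
    rw [strip, aeval_X]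
    split_ifs with h
    · rw [sub_zero]
      exact Ideal.subset_span ⟨i, h, rfl⟩
    · rw [sub_self]
      exact zero_mem _

lemma ker_strip (n : ℕ) : RingHom.ker (strip n) =
    Ideal.span (X '' {i : Fin 4 | (i : ℕ) < n}) := by
  apply le_antisymm
  · intro P hP
    have := sub_strip_mem (n := n) P
    rwa [(RingHom.mem_ker).1 hP, sub_zero] at this
  · rw [Ideal.span_le]
    rintro _ ⟨i, hi, rfl⟩
    have hi' : (i : ℕ) < n := hi
    simp [strip, hi']

lemma X_dvd_of_strip {P : MvPolynomial (Fin 4) ℂ} (h : strip 1 P = 0) : X 0 ∣ P := by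
  have h1 : P ∈ RingHom.ker (strip 1) := h
  have h2 : {i : Fin 4 | (i : ℕ) < 1} = {0} := by
    ext i
    fin_cases i <;> simp
  rw [ker_strip, h2, Set.image_singleton] at h1
  exact Ideal.mem_span_singleton.1 h1

/-- Krull's height theorem bounds the height by the number of generating variables; the chain of
kernels for smaller `n` gives the opposite inequality. -/
lemma height_ker_strip {n : ℕ} (hn : n ≤ 4) : (RingHom.ker (strip n)).height = n := by
  apply le_antisymm
  · have hp : RingHom.ker (strip n) ∈ (Ideal.span
        ((X '' {i : Fin 4 | (i : ℕ) < n} : Set (MvPolynomial (Fin 4) ℂ)))).minimalPrimes := by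
      rw [← ker_strip, Ideal.minimalPrimes_eq_subsingleton_self]
      rfl
    refine (Ideal.height_le_card_of_mem_minimalPrimes_span (Set.toFinite _) hp).trans ?_
    have h1 : {i : Fin 4 | (i : ℕ) < n}.ncard ≤ n := by
      have : {i : Fin 4 | (i : ℕ) < n}.ncard ≤ (Set.Iio n).ncard :=
        Set.ncard_le_ncard_of_injOn (fun i : Fin 4 => (i : ℕ)) (fun i hi => hi)
          (fun i _ j _ h => Fin.ext h) (Set.finite_Iio n)
      simpa using this
    exact_mod_cast (Set.ncard_image_le (Set.toFinite _)).trans h1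
  · induction n with
    | zero => simp
    | succ n ih =>
      have hlt : RingHom.ker (strip n) < RingHom.ker (strip (n + 1)) := by
        refine lt_of_le_of_ne ?_ ?_
        · rw [ker_strip, ker_strip]
          refine Ideal.span_mono (Set.image_mono ?_)
          intro i (hi : (i : ℕ) < n)
          exact Nat.lt_succ_of_lt hi
        · intro h
          have h1 : (X ⟨n, hn⟩ : MvPolynomial (Fin 4) ℂ) ∈ RingHom.ker (strip (n + 1)) := by
            simp [strip]
          rw [← h] at h1
          simp [strip] at h1
      push_cast
      exact (add_le_add (ih (by omega)) le_rfl).trans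
        (Ideal.height_add_one_le_of_lt_of_isPrime hlt)

/-- `S` is the local ring of the affine space with the coordinates `y` at the generic point of the
linear subspace where the first `n` coordinates vanish. -/
def IsCoordLoc (y : Fin 4 → K) (n : ℕ) (S : LocalSubring K) : Prop :=
  IsLocOf (gen (Set.range y)) S ∧ ∀ P, aeval y P ∈ maxIdeal S ↔ strip n P = 0

lemma exists_isCoordLoc {y : Fin 4 → K} (hy : IsCoord y) {n : ℕ} (hn : n ≤ 4) :
    ∃ S, IsCoordLoc y n S ∧ ringKrullDim S.toSubring = n := by
  have hmem : ∀ P, (aeval y : MvPolynomial (Fin 4) ℂ →ₐ[ℂ] K) P ∈ gen (Set.range y) :=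
    fun P => mem_gen_range.2 ⟨P, rfl⟩
  let f : MvPolynomial (Fin 4) ℂ →+* gen (Set.range y) :=
    ((aeval y : MvPolynomial (Fin 4) ℂ →ₐ[ℂ] K) : MvPolynomial (Fin 4) ℂ →+* K).codRestrict _ hmem
  have hf : Function.Bijective f := by
    constructor
    · intro P Q h
      exact hy.indep (congrArg Subtype.val h)
    · rintro ⟨x, hx⟩
      obtain ⟨P, rfl⟩ := mem_gen_range.1 hx
      exact ⟨P, rfl⟩
  let e := RingEquiv.ofBijective f hf
  let P : Ideal (gen (Set.range y)) := (RingHom.ker (strip n)).comap e.symm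
  have hP : P.IsPrime := Ideal.comap_isPrime _ _
  refine ⟨LocalSubring.ofPrime _ P, ⟨mem_affineModel_iff.1 ⟨⟨P, hP⟩, rfl⟩, fun Q => ?_⟩, ?_⟩
  · have h1 : aeval y Q = ((e Q : gen (Set.range y)) : K) := rfl
    rw [h1, mem_maxIdeal_ofPrime]
    change e.symm (e Q) ∈ RingHom.ker (strip n) ↔ _
    rw [RingEquiv.symm_apply_apply, RingHom.mem_ker]
  · rw [IsLocalization.AtPrime.ringKrullDim_eq_height P]
    have h1 : P.height = n := by
      rw [← height_ker_strip hn]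
      exact RingEquiv.height_comap e.symm _
    rw [h1]
    rfl

section

variable {y : Fin 4 → K} {n : ℕ}

lemma IsCoordLoc.const_mem (hS : IsCoordLoc y n S) (c : ℂ) : const c ∈ S.toSubring :=
  hS.1.1 (const_mem_gen _ c)

lemma IsCoordLoc.mem (hS : IsCoordLoc y n S) (i : Fin 4) : y i ∈ S.toSubring :=
  hS.1.1 (subset_gen _ ⟨i, rfl⟩)

lemma IsCoordLoc.mem_maxIdeal (hS : IsCoordLoc y n S) (i : Fin 4) (hi : (i : ℕ) < n) :
    y i ∈ maxIdeal S := by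
  have := (hS.2 (X i)).2 (by simp [strip, hi])
  rwa [aeval_X] at this

/-- A function that is non-zero at one closed point of the linear subspace is non-zero at its
generic point. -/
lemma IsCoordLoc.notMem_of_eval (hS : IsCoordLoc y n S) (P : MvPolynomial (Fin 4) ℂ)
    (c : Fin 4 → ℂ) (hc : ∀ i : Fin 4, (i : ℕ) < n → c i = 0) (hP : eval c P ≠ 0) :
    aeval y P ∉ maxIdeal S := by
  rw [hS.2]
  intro h
  apply hP
  have h1 : ∀ P : MvPolynomial (Fin 4) ℂ, eval c P = eval c (strip n P) := by
    intro P
    induction P using MvPolynomial.induction_on with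
    | C a => simp [strip]
    | add p q hp hq => rw [map_add, map_add, map_add, hp, hq]
    | mul_X p i hp =>
      rw [map_mul, map_mul, map_mul, hp]
      congr 1
      by_cases hi : (i : ℕ) < n
      · simp [strip, hi, hc i hi]
      · simp [strip, hi]
  rw [h1, h, map_zero]

lemma aeval_sub_aeval_strip_mem (hc : ∀ c, const c ∈ T.toSubring) (hy : ∀ i, y i ∈ T.toSubring)
    (hm : ∀ i : Fin 4, (i : ℕ) < n → y i ∈ maxIdeal T) (P : MvPolynomial (Fin 4) ℂ) :
    aeval y P - aeval y (strip n P) ∈ maxIdeal T := by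
  have h1 : aeval y (strip n P) = aeval (fun i : Fin 4 => if (i : ℕ) < n then 0 else y i) P := by
    rw [strip, comp_aeval_apply]
    congr 2
    funext i
    split_ifs <;> simp
  rw [h1]
  refine aeval_sub_aeval_mem_maxIdeal hc hy (fun i => ?_) P
  split_ifs with h
  · rw [sub_zero]
    exact hm i h
  · rw [sub_self]
    exact zero_mem_maxIdeal

/-- The local ring with `IsCoordLoc y n` is dominated by every local ring in which the first `n`
coordinates vanish and the others are independent. -/
lemma IsCoordLoc.le (hS : IsCoordLoc y n S) (hc : ∀ c, const c ∈ T.toSubring)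
    (hy : ∀ i, y i ∈ T.toSubring) (hm : ∀ i : Fin 4, (i : ℕ) < n → y i ∈ maxIdeal T)
    (hn : ∀ P, strip n P ≠ 0 → aeval y (strip n P) ∉ maxIdeal T) : S ≤ T := by
  have h1 : ∀ P, aeval y P ∈ maxIdeal T → strip n P = 0 := by
    intro P hP
    by_contra h0
    apply hn P h0
    have h2 := sub_mem_maxIdeal hP (aeval_sub_aeval_strip_mem hc hy hm P)
    rwa [sub_sub_cancel] at h2
  have h2 : S.toSubring ≤ T.toSubring := by
    refine hS.1.le_of_le (gen_le hc ?_) ?_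
    · rintro _ ⟨i, rfl⟩
      exact hy i
    · intro s hs hsT
      obtain ⟨P, rfl⟩ := mem_gen_range.1 hs
      exact (hS.2 P).2 (h1 P hsT)
  rw [le_iff_maxIdeal]
  refine ⟨h2, fun x hx => ?_⟩
  obtain ⟨b, hb, s, hs, hs', rfl⟩ := hS.1.2 x (mem_of_mem_maxIdeal hx)
  obtain ⟨P, rfl⟩ := mem_gen_range.1 hb
  have h0 := ne_zero_of_notMem_maxIdeal hs'
  have h3 : aeval y P ∈ maxIdeal S := by
    have := mul_mem_maxIdeal' hx (hS.1.1 hs)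
    rwa [div_mul_cancel₀ _ h0] at this
  have h4 := aeval_sub_aeval_strip_mem hc hy hm P
  rw [(hS.2 P).1 h3, map_zero, sub_zero] at h4
  rw [div_eq_mul_inv]
  exact mul_mem_maxIdeal' h4 (h2 (inv_mem_of_notMem_maxIdeal (hS.1.1 hs) hs'))

lemma IsCoordLoc.unique (hS : IsCoordLoc y n S) (hT : IsCoordLoc y n T) : S = T := by
  have key : ∀ {S T}, IsCoordLoc y n S → IsCoordLoc y n T → S ≤ T := by
    intro S T hS hT
    refine hS.le hT.const_mem hT.mem hT.mem_maxIdeal fun P hP h => hP ?_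
    have h1 := aeval_sub_aeval_strip_mem hT.const_mem hT.mem hT.mem_maxIdeal P
    have h2 := add_mem_maxIdeal h1 h
    rw [sub_add_cancel] at h2
    exact (hT.2 P).1 h2
  exact le_antisymm (key hS hT) (key hT hS)

lemma IsCoordLoc.indep {ι : Type*} (hS : IsCoordLoc y n S) {f : ι → Fin 4}
    (hf : Function.Injective f) (hn : ∀ i, n ≤ f i) : Indep S (y ∘ f) := by
  intro P hP
  rw [← aeval_rename]
  refine ⟨hS.1.1 (mem_gen_range.2 ⟨_, rfl⟩), fun h => hP ?_⟩
  have h1 := (hS.2 _).1 h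
  rw [strip, aeval_rename] at h1
  apply rename_injective f hf
  rw [map_zero, ← h1, rename_eq_aeval]
  congr 2
  funext i
  simp [Nat.not_lt.2 (hn i)]

/-- A criterion for the last hypothesis of `IsCoordLoc.le`. -/
lemma aeval_strip_notMem {m : ℕ} {f : Fin m → Fin 4} {v : Fin 4 → MvPolynomial (Fin m) ℂ}
    (hv : ∀ i : Fin 4, rename f (v i) = if (i : ℕ) < n then 0 else X i)
    (h : Indep T (y ∘ f)) (P : MvPolynomial (Fin 4) ℂ) (hP : strip n P ≠ 0) :
    aeval y (strip n P) ∉ maxIdeal T := by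
  have h1 : strip n P = rename f (aeval v P) := by
    rw [strip, comp_aeval_apply]
    congr 2
    funext i
    rw [hv]
  rw [h1, aeval_rename]
  refine (h _ fun h0 => hP ?_).2
  rw [h1, h0, map_zero]

lemma aeval_strip_one_notMem (h : Indep T ![y 1, y 2, y 3]) (P : MvPolynomial (Fin 4) ℂ)
    (hP : strip 1 P ≠ 0) : aeval y (strip 1 P) ∉ maxIdeal T := by
  refine aeval_strip_notMem (f := ![1, 2, 3]) (v := ![0, X 0, X 1, X 2]) ?_ ?_ P hP
  · intro i
    fin_cases i <;> simp
  · convert h using 1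
    funext i
    fin_cases i <;> rfl

lemma aeval_strip_two_notMem (h : Indep T ![y 2, y 3]) (P : MvPolynomial (Fin 4) ℂ)
    (hP : strip 2 P ≠ 0) : aeval y (strip 2 P) ∉ maxIdeal T := by
  refine aeval_strip_notMem (f := ![2, 3]) (v := ![0, 0, X 0, X 1]) ?_ ?_ P hP
  · intro i
    fin_cases i <;> simp
  · convert h using 1
    funext i
    fin_cases i <;> rfl

lemma IsCoordLoc.indep_one (hS : IsCoordLoc y 1 S) : Indep S ![y 1, y 2, y 3] := by
  have := hS.indep (f := ![1, 2, 3]) (by decide) (by decide)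
  convert this using 1
  funext i
  fin_cases i <;> rfl

lemma IsCoordLoc.indep_two (hS : IsCoordLoc y 2 S) : Indep S ![y 2, y 3] := by
  have := hS.indep (f := ![2, 3]) (by decide) (by decide)
  convert this using 1
  funext i
  fin_cases i <;> rfl

lemma IsCoordLoc.indep_three (hS : IsCoordLoc y 3 S) : Indep S ![y 3] := by
  have := hS.indep (f := ![3]) (by decide) (by decide)
  convert this using 1
  funext i
  fin_cases i
  rfl

/-- A local ring at a hyperplane is a discrete valuation ring, hence not dominated by any other
local ring. -/
lemma IsCoordLoc.eq_of_le (hy : IsCoord y) (hS : IsCoordLoc y 1 S) (hST : S ≤ T) : S = T := by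
  apply LocalSubring_ext
  refine le_antisymm hST.1 fun x hx => ?_
  obtain ⟨P, s, hs, rfl⟩ := hy.frac x
  -- Write the element as a reduced fraction. If its denominator vanishes on the hyperplane, the
  -- numerator does not, so the inverse of the fraction lies in both maximal ideals, contradicting
  -- membership of the fraction in `T`.
  obtain ⟨P', s', c, hrel, rfl, rfl⟩ := UniqueFactorizationMonoid.exists_reduced_factors' P s hs
  have hc : aeval y c ≠ 0 := by
    intro h
    apply hs
    rw [hy.indep (h.trans (map_zero _).symm), zero_mul]
  have hs0 : aeval y s' ≠ 0 := by
    intro h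
    apply hs
    rw [hy.indep (h.trans (map_zero _).symm), mul_zero]
  rw [map_mul, map_mul, mul_div_mul_left _ _ hc] at hx ⊢
  by_cases h1 : aeval y s' ∈ maxIdeal S
  · by_cases h2 : aeval y P' ∈ maxIdeal S
    · have h3 := hrel (X_dvd_of_strip ((hS.2 _).1 h2)) (X_dvd_of_strip ((hS.2 _).1 h1))
      exact absurd h3 (X_prime (R := ℂ) (i := (0 : Fin 4))).not_isUnit
    · have hP' : aeval y P' ∈ S.toSubring := hS.1.1 (mem_gen_range.2 ⟨_, rfl⟩)
      have h3 : aeval y s' / aeval y P' ∈ maxIdeal S := by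
        rw [div_eq_mul_inv]
        exact mul_mem_maxIdeal' h1 (inv_mem_of_notMem_maxIdeal hP' h2)
      have h4 := mul_mem_maxIdeal hx (maxIdeal_subset_of_le hST h3)
      rw [div_mul_div_cancel₀ hs0, div_self (ne_zero_of_notMem_maxIdeal h2)] at h4
      exact absurd h4 one_notMem_maxIdeal
  · rw [div_eq_mul_inv]
    exact mul_mem (hS.1.1 (mem_gen_range.2 ⟨_, rfl⟩))
      (inv_mem_of_notMem_maxIdeal (hS.1.1 (mem_gen_range.2 ⟨_, rfl⟩)) h1)

end

end dimension


/-! ### Blow-ups along centres in general -/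

section centres

open MvPolynomial

variable {R S T ζ : LocalSubring K} {M : Model} {Z : Set (LocalSubring K)} {y : Fin 4 → K} {n : ℕ}

lemma mem_span_iff {ι : Type*} [Fintype ι] {f : ι → K} {x : K} :
    x ∈ Submodule.span R.toSubring (Set.range f) ↔
      ∃ r : ι → K, (∀ i, r i ∈ R.toSubring) ∧ x = ∑ i, r i * f i := by
  rw [Submodule.mem_span_range_iff_exists_fun]
  constructor
  · rintro ⟨r, rfl⟩
    exact ⟨fun i => r i, fun i => (r i).2, rfl⟩
  · rintro ⟨r, hr, rfl⟩
    exact ⟨fun i => ⟨r i, hr i⟩, rfl⟩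

lemma isGenBy_iff {ι : Type*} [Fintype ι] {f : ι → K} {I : Set K} :
    IsGenBy R I f ↔ (∀ i, f i ∈ I) ∧ ∀ x ∈ I, x ∈ Submodule.span R.toSubring (Set.range f) := by
  simp only [IsGenBy, mem_span_iff]

lemma mul_mem_submodule {W : Submodule R.toSubring K} {x r : K} (hr : r ∈ R.toSubring)
    (hx : x ∈ W) : r * x ∈ W :=
  W.smul_mem ⟨r, hr⟩ hx

lemma aeval_sub_aeval_mem {ι : Type*} (W : Submodule R.toSubring K)
    (hc : ∀ c, const c ∈ R.toSubring) {x y : ι → K}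
    (hx : ∀ i, x i ∈ R.toSubring) (hy : ∀ i, y i ∈ R.toSubring) (hxy : ∀ i, x i - y i ∈ W)
    (P : MvPolynomial ι ℂ) : aeval x P - aeval y P ∈ W := by
  induction P using MvPolynomial.induction_on with
  | C a => simp
  | add p q hp hq =>
    rw [map_add, map_add, add_sub_add_comm]
    exact add_mem hp hq
  | mul_X p i hp =>
    rw [map_mul, map_mul, aeval_X, aeval_X]
    have : aeval x p * x i - aeval y p * y i =
      x i * (aeval x p - aeval y p) + aeval y p * (x i - y i) := by ring
    rw [this]
    exact add_mem (mul_mem_submodule (hx i) hp) (mul_mem_submodule (aeval_mem hc hy p) (hxy i))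

lemma aeval_const {ι : Type*} (c : ι → ℂ) (P : MvPolynomial ι ℂ) :
    aeval (fun i => const (c i)) P = const (eval c P) := by
  have := aeval_algebraMap_apply (R := ℂ) K c P
  rw [← coe_aeval_eq_eval]
  exact this

/-- The maximal ideal as a submodule of `K`. -/
def maxSubmodule (R : LocalSubring K) : Submodule R.toSubring K where
  carrier := maxIdeal R
  zero_mem' := zero_mem_maxIdeal
  add_mem' := add_mem_maxIdeal
  smul_mem' r _ hx := mul_mem_maxIdeal r.2 hx

/-! #### Generic points of centres -/

lemma IsCoordLoc.le_of_mem_maxIdeal (hζ : IsCoordLoc y n ζ) (hR : IsLocOf (gen (Set.range y)) R)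
    (hm : ∀ i : Fin 4, (i : ℕ) < n → y i ∈ maxIdeal R) : R.toSubring ≤ ζ.toSubring := by
  refine hR.le_of_le hζ.1.1 fun b hb hbm => ?_
  obtain ⟨P, rfl⟩ := mem_gen_range.1 hb
  have h1 := aeval_sub_aeval_strip_mem (n := n) (fun c => hR.1 (const_mem_gen _ c))
    (fun i => hR.1 (subset_gen _ ⟨i, rfl⟩)) hm P
  rwa [(hζ.2 P).1 hbm, map_zero, sub_zero] at h1

lemma IsCoordLoc.isGenericPt {C : Center} (hζ : IsCoordLoc y n ζ) (hM : ζ ∈ M)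
    (hchart : gen (Set.range C.chart) = gen (Set.range y)) (heq : C.eqs ⊆ maxIdeal ζ)
    (hy : ∀ z : LocalSubring K, C.eqs ⊆ maxIdeal z → IsLocOf (gen (Set.range y)) z →
      ∀ i : Fin 4, (i : ℕ) < n → y i ∈ maxIdeal z) : IsGenericPt (C.locus M) ζ := by
  refine ⟨⟨hM, ?_, heq⟩, ?_⟩
  · rw [affineChart_eq, mem_affineModel_iff, hchart]
    exact hζ.1
  · rintro z ⟨-, hz, hzeq⟩
    rw [affineChart_eq, mem_affineModel_iff, hchart] at hz
    exact hζ.le_of_mem_maxIdeal hz (hy z hzeq hz)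

/-- A polynomial is congruent to its `strip` modulo the first `n` coordinates, and the `strip` of
one that vanishes at `ζ` is zero. -/
lemma IsCoordLoc.mem_maxIdeal_span (hζ : IsCoordLoc y n ζ) {ι : Type*} [Fintype ι] {f : ι → K}
    (hf : ∀ i, f i ∈ maxIdeal ζ) (hyf : ∀ i : Fin 4, (i : ℕ) < n → y i ∈ Set.range f) :
    IsGenBy ζ (maxIdeal ζ) f := by
  rw [isGenBy_iff]
  refine ⟨hf, fun x hx => ?_⟩
  obtain ⟨b, hb, s, hs, hs', rfl⟩ := hζ.1.2 x (mem_of_mem_maxIdeal hx)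
  obtain ⟨P, rfl⟩ := mem_gen_range.1 hb
  have h0 := ne_zero_of_notMem_maxIdeal hs'
  have h3 : aeval y P ∈ maxIdeal ζ := by
    have := mul_mem_maxIdeal' hx (hζ.1.1 hs)
    rwa [div_mul_cancel₀ _ h0] at this
  have h1 : aeval y (strip n P) = aeval (fun i : Fin 4 => if (i : ℕ) < n then 0 else y i) P := by
    rw [strip, comp_aeval_apply]
    congr 2
    funext i
    split_ifs <;> simp
  have h4 := aeval_sub_aeval_mem (Submodule.span ζ.toSubring (Set.range f)) hζ.const_mem
    (x := y) (y := fun i : Fin 4 => if (i : ℕ) < n then 0 else y i) hζ.mem (fun i => by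
      split_ifs
      · exact zero_mem _
      · exact hζ.mem i) (fun i => by
      split_ifs with h
      · rw [sub_zero]
        exact Submodule.subset_span (hyf i h)
      · rw [sub_self]
        exact zero_mem _) P
  rw [← h1, (hζ.2 P).1 h3, map_zero, sub_zero] at h4
  rw [div_eq_mul_inv, mul_comm]
  exact mul_mem_submodule (inv_mem_of_notMem_maxIdeal (hζ.1.1 hs) hs') h4

/-- The vanishing ideal of `ζ` in `R`. -/
def vanishing (R ζ : LocalSubring K) : Set K := {x | x ∈ R.toSubring ∧ x ∈ maxIdeal ζ}

lemma idealAt_eq_vanishing (hζ : IsGenericPt Z ζ) (h : R.toSubring ≤ ζ.toSubring) :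
    idealAt Z R = vanishing R ζ :=
  Set.ext fun _ => mem_idealAt_of_le hζ h

lemma vanishing_self : vanishing ζ ζ = maxIdeal ζ :=
  Set.ext fun _ => ⟨fun h => h.2, fun h => ⟨mem_of_mem_maxIdeal h, h⟩⟩

lemma vanishing_subset (h : R.toSubring ≤ ζ.toSubring) : vanishing R ζ ⊆ maxIdeal R :=
  fun _ hx => mem_maxIdeal_of_le h hx.1 hx.2

/-- Some local rings of a blow-up over the generic point of the centre. -/
lemma mem_blowUp_of_isLocOf {ι : Type*} [Fintype ι] {f : ι → K} {j : ι} {B : Subring K}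
    (hζ : IsGenericPt Z ζ) (hM : ζ ∈ M) (hf : IsGenBy ζ (maxIdeal ζ) f) (hj : f j ≠ 0)
    (hle : ζ ≤ S) (hS : IsLocOf B S) (hB : B ≤ blowUpRing ζ (Set.range f) (f j))
    (hfS : ∀ i, f i / f j ∈ S.toSubring) : S ∈ blowUp M Z := by
  refine mem_blowUp_of_chart (j := j) hM hle ?_ hj (hS.mono hB ?_)
  · rw [idealAt_eq_vanishing hζ le_rfl, vanishing_self]
    exact hf
  · refine blowUpRing_le hle.1 ?_
    rintro _ ⟨i, rfl⟩
    exact hfS i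

/-- Points whose residue field has transcendence degree at least three survive blow-ups along
centres of codimension at least two. -/
lemma mem_blowUp_of_indep (hζ : IsGenericPt Z ζ) (hζ3 : ∀ z : Fin 3 → K, ¬ Indep ζ z) (hR : R ∈ M)
    {x : Fin 3 → K} (hx : Indep R x) : R ∈ blowUp M Z :=
  mem_blowUp_of_not_le hζ hR fun h => hζ3 x (hx.of_le h)

/-- Two charts of a blow-up share the points at which the ratio of their denominators is a unit. -/
lemma IsLocOf.blowUpRing_change {ι : Type*} {f : ι → K} {i j : ι}
    (hS : IsLocOf (blowUpRing R (Set.range f) (f j)) S) (hi : f i / f j ∉ maxIdeal S) :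
    IsLocOf (blowUpRing R (Set.range f) (f i)) S := by
  have h0 := ne_zero_of_notMem_maxIdeal hi
  have hi0 : f i ≠ 0 := fun h => h0 (by rw [h, zero_div])
  have hj0 : f j ≠ 0 := fun h => h0 (by rw [h, div_zero])
  have hmem : ∀ k, f k / f j ∈ S.toSubring := fun k => hS.1 (div_mem_blowUpRing R _ ⟨k, rfl⟩)
  have hinv : f j / f i ∈ S.toSubring := by
    have := inv_mem_of_notMem_maxIdeal (hmem i) hi
    rwa [inv_div] at this
  have hB : blowUpRing R (Set.range f) (f i) ≤ S.toSubring := by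
    refine blowUpRing_le ((le_blowUpRing _ _ _).trans hS.1) ?_
    rintro _ ⟨k, rfl⟩
    have : f k / f i = f k / f j * (f j / f i) := by field_simp
    rw [this]
    exact mul_mem (hmem k) hinv
  refine hS.of_le_fractions hB (blowUpRing_le ?_ ?_)
  · exact (le_blowUpRing _ _ _).trans (le_fractions hB)
  · rintro _ ⟨k, rfl⟩
    refine ⟨f k / f i, div_mem_blowUpRing R _ ⟨k, rfl⟩, f j / f i,
      div_mem_blowUpRing R _ ⟨j, rfl⟩, ?_, by field_simp⟩
    apply notMem_maxIdeal_of_inv_mem (div_ne_zero hj0 hi0)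
    rw [inv_div]
    exact hmem i

/-- The localization of a blow-up chart over a localization is a localization of a finitely
generated algebra. -/
lemma IsLocOf.of_blowUpRing {s : Set K} {u : Set K} {f : K}
    (hR : IsLocOf (gen s) R) (hRS : R ≤ S) (hS : IsLocOf (blowUpRing R u f) S)
    {v : Set K} (hv : v ⊆ S.toSubring) (hs : s ⊆ gen v)
    (hu : ∀ x ∈ u, x / f ∈ gen v) : IsLocOf (gen v) S := by
  have hc : ∀ c, const c ∈ S.toSubring := fun c => hRS.1 (hR.1 (const_mem_gen _ c))
  have hvS := gen_le hc hv
  refine hS.of_le_fractions hvS (blowUpRing_le ?_ ?_)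
  · intro x hx
    obtain ⟨b, hb, c, hc, hc', rfl⟩ := hR.2 x hx
    exact ⟨b, gen_mono hs hb, c, gen_mono hs hc, notMem_maxIdeal_of_inv_mem
      (ne_zero_of_notMem_maxIdeal hc')
      (hRS.1 (inv_mem_of_notMem_maxIdeal (hR.1 hc) hc')), rfl⟩
  · exact fun x hx => le_fractions hvS (hu x hx)

/-! #### Centres of codimension two -/

lemma IsCoordLoc.isGenBy_two (hζ : IsCoordLoc y 2 ζ) : IsGenBy ζ (maxIdeal ζ) ![y 0, y 1] := by
  refine hζ.mem_maxIdeal_span (fun i => ?_) (fun i hi => ?_)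
  · fin_cases i
    · exact hζ.mem_maxIdeal 0 (by decide)
    · exact hζ.mem_maxIdeal 1 (by decide)
  · have : i = 0 ∨ i = 1 := by omega
    rcases this with rfl | rfl
    · exact ⟨0, rfl⟩
    · exact ⟨1, rfl⟩

/-- Two of the four coordinates vanish at `ζ`, leaving two generators for its residue field. -/
lemma IsCoordLoc.not_indep_three (hζ : IsCoordLoc y 2 ζ) (z : Fin 3 → K) : ¬ Indep ζ z := by
  intro hz
  have := card_le_of_isLocOf hζ.1 (w := ![y 2, y 3]) (fun i => by
    fin_cases i
    exacts [hζ.mem 2, hζ.mem 3]) (by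
    rintro _ ⟨i, rfl⟩
    fin_cases i
    · exact Or.inl (hζ.mem_maxIdeal 0 (by decide))
    · exact Or.inl (hζ.mem_maxIdeal 1 (by decide))
    · exact Or.inr ⟨0, rfl⟩
    · exact Or.inr ⟨1, rfl⟩) hz
  omega

/-- The coordinates of the exceptional divisor of the blow-up along `y₀ = y₁ = 0`. -/
def excTwo (y : Fin 4 → K) : Fin 4 → K := ![y 0, y 1 / y 0, y 2, y 3]

lemma IsCoord.ne_zero (hy : IsCoord y) (i : Fin 4) : y i ≠ 0 := hy.indep.ne_zero i

lemma IsCoord.of_mem {z : Fin 4 → K} (hy : IsCoord y)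
    (h : ∀ i, y i ∈ IntermediateField.adjoin ℂ (Set.range z)) : IsCoord z := by
  refine isCoord_of_adjoin fun i => ?_
  obtain ⟨P, s, -, hPs⟩ := hy.frac (coord i)
  rw [hPs]
  have hmem : ∀ P : MvPolynomial (Fin 4) ℂ,
      aeval y P ∈ IntermediateField.adjoin ℂ (Set.range z) := fun P =>
    aeval_mem (B := (IntermediateField.adjoin ℂ (Set.range z)).toSubalgebra.toSubring)
      (fun c => (IntermediateField.adjoin ℂ (Set.range z)).algebraMap_mem c) h P
  exact div_mem (hmem P) (hmem s)

lemma isCoord_excTwo (hy : IsCoord y) : IsCoord (excTwo y) := by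
  have h : ∀ i, excTwo y i ∈ IntermediateField.adjoin ℂ (Set.range (excTwo y)) :=
    fun i => IntermediateField.subset_adjoin ℂ _ ⟨i, rfl⟩
  refine hy.of_mem fun i => ?_
  fin_cases i
  · exact h 0
  · have := mul_mem (h 1) (h 0)
    change y 1 / y 0 * y 0 ∈ _ at this
    rwa [div_mul_cancel₀ _ (hy.ne_zero 0)] at this
  · exact h 2
  · exact h 3

lemma IsCoordLoc.le_excTwo (hy : IsCoord y) (hζ : IsCoordLoc y 2 ζ)
    (hE : IsCoordLoc (excTwo y) 1 S) : ζ ≤ S := by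
  have h0 : y 0 ∈ maxIdeal S := hE.mem_maxIdeal 0 (by decide)
  have h1 : y 1 ∈ maxIdeal S := by
    have := mul_mem_maxIdeal (hE.mem 1) h0
    change y 1 / y 0 * y 0 ∈ _ at this
    rwa [div_mul_cancel₀ _ (hy.ne_zero 0)] at this
  refine hζ.le hE.const_mem (fun i => ?_) (fun i hi => ?_) (aeval_strip_two_notMem ?_)
  · fin_cases i
    exacts [mem_of_mem_maxIdeal h0, mem_of_mem_maxIdeal h1, hE.mem 2, hE.mem 3]
  · have : i = 0 ∨ i = 1 := by omega
    rcases this with rfl | rfl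
    exacts [h0, h1]
  · have := hE.indep (f := ![2, 3]) (by decide) (by decide)
    convert this using 1
    funext i
    fin_cases i <;> rfl

lemma excTwo_mem_blowUp (hy : IsCoord y) (hζ : IsCoordLoc y 2 ζ) (hgen : IsGenericPt Z ζ)
    (hM : ζ ∈ M) (hE : IsCoordLoc (excTwo y) 1 S) : S ∈ blowUp M Z := by
  refine mem_blowUp_of_isLocOf (j := 0) hgen hM hζ.isGenBy_two (hy.ne_zero 0)
    (hζ.le_excTwo hy hE) hE.1 (gen_le ?_ ?_) fun i => ?_
  · exact fun c => le_blowUpRing _ _ _ (hζ.const_mem c)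
  · rintro _ ⟨i, rfl⟩
    fin_cases i
    · exact le_blowUpRing _ _ _ (hζ.mem 0)
    · exact div_mem_blowUpRing _ _ ⟨1, rfl⟩
    · exact le_blowUpRing _ _ _ (hζ.mem 2)
    · exact le_blowUpRing _ _ _ (hζ.mem 3)
  · fin_cases i
    · change y 0 / y 0 ∈ _
      rw [div_self (hy.ne_zero 0)]
      exact one_mem _
    · exact hE.mem 1

/-- A local ring over the generic point of a centre of codimension two. -/
lemma eq_excTwo (hy : IsCoord y) (hζ : IsCoordLoc y 2 ζ) (hE : IsCoordLoc (excTwo y) 1 T)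
    (hle : ζ ≤ S) {j : Fin 2} (hS : IsLocOf (blowUpRing ζ (Set.range ![y 0, y 1]) (![y 0, y 1] j)) S)
    {x : Fin 3 → K} (hx : Indep S x) : S = T := by
  have hmem : ∀ i, y i ∈ S.toSubring := fun i => hle.1 (hζ.mem i)
  have h0 : y 0 ∈ maxIdeal S := maxIdeal_subset_of_le hle (hζ.mem_maxIdeal 0 (by decide))
  -- Only the point at infinity of the exceptional `ℙ¹` misses this chart, and there the residue
  -- field has just the generators `y 2`, `y 3`.
  have hS0 : IsLocOf (blowUpRing ζ (Set.range ![y 0, y 1]) (![y 0, y 1] 0)) S := by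
    refine hS.blowUpRing_change fun hm => ?_
    fin_cases j
    · change y 0 / y 0 ∈ _ at hm
      rw [div_self (hy.ne_zero 0)] at hm
      exact one_notMem_maxIdeal hm
    · change y 0 / y 1 ∈ _ at hm
      have hS' : IsLocOf (gen {y 1, y 0 / y 1, y 2, y 3}) S := by
        refine hζ.1.of_blowUpRing hle hS ?_ ?_ ?_
        · rintro _ (rfl | rfl | rfl | rfl)
          exacts [hmem 1, mem_of_mem_maxIdeal hm, hmem 2, hmem 3]
        · rintro _ ⟨i, rfl⟩
          fin_cases i
          · have := mul_mem (subset_gen {y 1, y 0 / y 1, y 2, y 3} (by simp : y 0 / y 1 ∈ _))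
              (subset_gen {y 1, y 0 / y 1, y 2, y 3} (by simp : y 1 ∈ _))
            rwa [div_mul_cancel₀ _ (hy.ne_zero 1)] at this
          · exact subset_gen _ (by simp)
          · exact subset_gen _ (by simp)
          · exact subset_gen _ (by simp)
        · rintro _ ⟨i, rfl⟩
          fin_cases i
          · exact subset_gen _ (by simp)
          · change y 1 / y 1 ∈ _
            rw [div_self (hy.ne_zero 1)]
            exact one_mem _
      have := card_le_of_isLocOf hS' (w := ![y 2, y 3]) (fun i => by
        fin_cases i
        exacts [hmem 2, hmem 3]) (by
        rintro _ (rfl | rfl | rfl | rfl)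
        · exact Or.inl (maxIdeal_subset_of_le hle (hζ.mem_maxIdeal 1 (by decide)))
        · exact Or.inl hm
        · exact Or.inr ⟨0, rfl⟩
        · exact Or.inr ⟨1, rfl⟩) hx
      omega
  have h10 : y 1 / y 0 ∈ S.toSubring := hS0.1 (div_mem_blowUpRing _ _ ⟨1, rfl⟩)
  have hmem' : ∀ i, excTwo y i ∈ S.toSubring := by
    intro i
    fin_cases i
    exacts [hmem 0, h10, hmem 2, hmem 3]
  have hS' : IsLocOf (gen (Set.range (excTwo y))) S := by
    refine hζ.1.of_blowUpRing hle hS0 ?_ ?_ ?_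
    · rintro _ ⟨i, rfl⟩
      exact hmem' i
    · rintro _ ⟨i, rfl⟩
      have h : ∀ i, excTwo y i ∈ gen (Set.range (excTwo y)) := fun i => subset_gen _ ⟨i, rfl⟩
      fin_cases i
      · exact h 0
      · have := mul_mem (h 1) (h 0)
        change y 1 / y 0 * y 0 ∈ _ at this
        rwa [div_mul_cancel₀ _ (hy.ne_zero 0)] at this
      · exact h 2
      · exact h 3
    · rintro _ ⟨i, rfl⟩
      fin_cases i
      · change y 0 / y 0 ∈ _
        rw [div_self (hy.ne_zero 0)]
        exact one_mem _
      · exact subset_gen _ ⟨1, rfl⟩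
  have hind : Indep S ![excTwo y 1, excTwo y 2, excTwo y 3] := by
    refine indep_of_isLocOf hS' (fun i => ?_) ?_ hx
    · fin_cases i
      exacts [hmem' 1, hmem' 2, hmem' 3]
    · rintro _ ⟨i, rfl⟩
      fin_cases i
      · exact Or.inl h0
      · exact Or.inr ⟨0, rfl⟩
      · exact Or.inr ⟨1, rfl⟩
      · exact Or.inr ⟨2, rfl⟩
  -- Three residues generate the residue field, hence are independent, so `S` dominates the discrete
  -- valuation ring `T` and equals it.
  refine (hE.eq_of_le (isCoord_excTwo hy) ?_).symm
  refine hE.le (fun c => hle.1 (hζ.const_mem c)) hmem' (fun i hi => ?_)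
    (aeval_strip_one_notMem hind)
  obtain rfl : i = 0 := by omega
  exact h0

end centres


/-! ### Blow-ups along surfaces transversal to a product structure -/

section surfaces

open MvPolynomial

variable {R S T ζ : LocalSubring K} {M : Model} {Z : Set (LocalSubring K)} {y : Fin 4 → K} {n : ℕ}
  {F G : IntermediateField ℂ K}

lemma range_two (a b : K) : Set.range ![a, b] = {a, b} := by
  ext x
  simp [eq_comm]
  try tauto

lemma range_four (a b c d : K) : Set.range ![a, b, c, d] = {a, b, c, d} := by
  ext x
  simp [eq_comm]
  try tauto

/-- `R` is a localization of `ℂ[a, b, c, d]` with `a, b ∈ F` and `c, d ∈ G`. -/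
def IsProd (F G : IntermediateField ℂ K) (R : LocalSubring K) : Prop :=
  ∃ a ∈ F, ∃ b ∈ F, ∃ c ∈ G, ∃ d ∈ G, IsLocOf (gen {a, b, c, d}) R

lemma IsProd.symm (h : IsProd F G R) : IsProd G F R := by
  obtain ⟨a, ha, b, hb, c, hc, d, hd, h⟩ := h
  refine ⟨c, hc, d, hd, a, ha, b, hb, ?_⟩
  convert h using 2
  ext x
  simp only [Set.mem_insert_iff, Set.mem_singleton_iff]
  tauto

lemma Indep.adjoin_le {ι : Type*} {x : ι → K} (h : Indep R x) {z : K}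
    (hz : z ∈ IntermediateField.adjoin ℂ (Set.range x)) : z ∈ R.toSubring := by
  obtain ⟨r, hr, s, hs, rfl⟩ := IntermediateField.mem_adjoin_iff_div.1 hz
  obtain ⟨P, rfl⟩ := mem_gen_range.1 hr
  obtain ⟨Q, rfl⟩ := mem_gen_range.1 hs
  by_cases hQ : Q = 0
  · rw [hQ, map_zero, div_zero]
    exact zero_mem _
  · rw [div_eq_mul_inv]
    exact mul_mem (aeval_mem h.const_mem h.mem P)
      (inv_mem_of_notMem_maxIdeal (h Q hQ).1 (h Q hQ).2)

/-- `ζ` is the generic point of the surface `a = b = 0` in a product of two surfaces with the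
function fields `F` and `G`, where `a` and `b` are coordinates on the first surface. -/
structure IsSurface (F G : IntermediateField ℂ K) (a b : K) (ζ : LocalSubring K) : Prop where
  left_mem : a ∈ F
  right_mem : b ∈ F
  left_mem_maxIdeal : a ∈ maxIdeal ζ
  right_mem_maxIdeal : b ∈ maxIdeal ζ
  le : ∀ x ∈ G, x ∈ ζ.toSubring
  frac : ∀ x ∈ F, x ∈ ζ.toSubring → ∃ P Q : MvPolynomial (Fin 2) ℂ,
    eval 0 Q ≠ 0 ∧ x = aeval ![a, b] P / aeval ![a, b] Q

/-- The essential point is the last field of `IsSurface`: an element of `F` regular at `ζ` is a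
fraction in `y 0`, `y 1` alone whose denominator is non-zero at the origin. Specializing the other
two coordinates to constants produces it. -/
lemma IsCoordLoc.isSurface (hy : IsCoord y) (hζ : IsCoordLoc y 2 ζ)
    (hF : IntermediateField.adjoin ℂ {y 0, y 1} = F)
    (hG : IntermediateField.adjoin ℂ {y 2, y 3} = G) : IsSurface F G (y 0) (y 1) ζ := by
  refine ⟨?_, ?_, hζ.mem_maxIdeal 0 (by decide), hζ.mem_maxIdeal 1 (by decide), ?_, ?_⟩
  · rw [← hF]
    exact IntermediateField.subset_adjoin _ _ (by simp)
  · rw [← hF]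
    exact IntermediateField.subset_adjoin _ _ (by simp)
  · intro x hx
    refine hζ.indep_two.adjoin_le ?_
    rw [← hG] at hx
    rwa [range_two]
  · intro x hxF hx
    rw [← hF, ← range_two] at hxF
    obtain ⟨r, hr, s, hs, rfl⟩ := IntermediateField.mem_adjoin_iff_div.1 hxF
    obtain ⟨P, rfl⟩ := mem_gen_range.1 hr
    obtain ⟨Q, rfl⟩ := mem_gen_range.1 hs
    by_cases hQ : Q = 0
    · exact ⟨0, 1, by simp, by simp [hQ]⟩
    obtain ⟨b, hb, s, hs, hs', h⟩ := hζ.1.2 _ hx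
    obtain ⟨N, rfl⟩ := mem_gen_range.1 hb
    obtain ⟨D, rfl⟩ := mem_gen_range.1 hs
    rw [hζ.2] at hs'
    -- The values `c 2`, `c 3` are chosen so that the denominator survives both the specialization
    -- and restriction to the origin.
    obtain ⟨c, hc⟩ : ∃ c, eval c (strip 2 D) ≠ 0 := by
      by_contra! hcon
      exact hs' (MvPolynomial.funext fun c => by rw [hcon c, map_zero])
    let ι : Fin 2 → Fin 4 := ![0, 1]
    have hι : Function.Injective ι := by decide
    have hyι : y ∘ ι = ![y 0, y 1] := by
      funext i
      fin_cases i <;> rfl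
    have hren : ∀ P : MvPolynomial (Fin 2) ℂ, aeval ![y 0, y 1] P = aeval y (rename ι P) := by
      intro P
      rw [aeval_rename, hyι]
    have hQ' : aeval y (rename ι Q) ≠ 0 := by
      intro h0
      have h1 := hy.indep (h0.trans (map_zero _).symm)
      exact hQ (rename_injective ι hι (by rw [h1, map_zero]))
    have hD' : aeval y D ≠ 0 := by
      intro h0
      have h1 := hy.indep (h0.trans (map_zero _).symm)
      exact hs' (by rw [h1, map_zero])
    rw [hren, hren, div_eq_div_iff hQ' hD', ← map_mul, ← map_mul] at h
    have h2 := hy.indep h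
    let σ : MvPolynomial (Fin 4) ℂ →ₐ[ℂ] MvPolynomial (Fin 2) ℂ :=
      aeval ![X 0, X 1, C (c 2), C (c 3)]
    have hσ : ∀ P, σ (rename ι P) = P := by
      intro P
      change aeval _ (rename ι P) = P
      rw [aeval_rename]
      conv_rhs => rw [← aeval_X_left_apply P]
      congr 2
      funext i
      fin_cases i <;> rfl
    have h3 := congrArg σ h2
    rw [map_mul, map_mul, hσ, hσ] at h3
    have hσD : eval 0 (σ D) = eval c (strip 2 D) := by
      change eval 0 (aeval _ D) = eval c (aeval _ D)
      rw [← coe_aeval_eq_eval, ← coe_aeval_eq_eval]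
      change aeval _ _ = aeval _ _
      rw [comp_aeval_apply, comp_aeval_apply]
      congr 2
      funext i
      fin_cases i <;> simp
    have hind : Function.Injective (aeval ![y 0, y 1] : MvPolynomial (Fin 2) ℂ →ₐ[ℂ] K) := by
      rw [← hyι]
      exact hy.indep.comp ι hι
    have hσD0 : aeval ![y 0, y 1] (σ D) ≠ 0 := by
      intro h0
      rw [hind (h0.trans (map_zero _).symm), map_zero] at hσD
      exact hc hσD.symm
    have hQ0 : aeval ![y 0, y 1] Q ≠ 0 := fun h0 => hQ (hind (h0.trans (map_zero _).symm))
    refine ⟨σ N, σ D, by rw [hσD]; exact hc, ?_⟩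
    rw [div_eq_div_iff hQ0 hσD0, ← map_mul, ← map_mul, h3]

variable {a b : K}

/-- Near the surface `ζ`, the functions `a, b` are coordinates on the first factor. -/
lemma IsSurface.exists_isLocOf (hζ : IsSurface F G a b ζ) (hR : IsProd F G R)
    (hRζ : R.toSubring ≤ ζ.toSubring) (ha : a ∈ R.toSubring) (hb : b ∈ R.toSubring) :
    ∃ c ∈ G, ∃ d ∈ G, IsLocOf (gen {a, b, c, d}) R := by
  obtain ⟨a', ha', b', hb', c, hc, d, hd, hR⟩ := hR
  refine ⟨c, hc, d, hd, ?_⟩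
  have hcR : ∀ c, const c ∈ R.toSubring := fun c => hR.1 (const_mem_gen _ c)
  have hB : gen {a, b, c, d} ≤ R.toSubring := by
    refine gen_le hcR ?_
    rintro _ (rfl | rfl | rfl | rfl)
    exacts [ha, hb, hR.1 (subset_gen _ (by simp)), hR.1 (subset_gen _ (by simp))]
  have ham := mem_maxIdeal_of_le hRζ ha hζ.3
  have hbm := mem_maxIdeal_of_le hRζ hb hζ.4
  have hab : ∀ i, ![a, b] i ∈ R.toSubring := fun i => by
    fin_cases i
    exacts [ha, hb]
  have key : ∀ x ∈ F, x ∈ R.toSubring → x ∈ fractions _ R hB := by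
    intro x hxF hx
    obtain ⟨P, Q, hQ, rfl⟩ := hζ.6 x hxF (hRζ hx)
    have hmem : ∀ P : MvPolynomial (Fin 2) ℂ, aeval ![a, b] P ∈ gen {a, b, c, d} := fun P =>
      aeval_mem (const_mem_gen _) (fun i => by
        fin_cases i <;> exact subset_gen _ (by simp)) P
    refine ⟨_, hmem P, _, hmem Q, fun hQm => ?_, rfl⟩
    have h1 := aeval_sub_aeval_mem_maxIdeal hcR (y := fun i => const ((0 : Fin 2 → ℂ) i)) hab
      (fun i => by
        simp only [Pi.zero_apply, const_zero, sub_zero]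
        fin_cases i
        exacts [ham, hbm]) Q
    rw [aeval_const] at h1
    have h2 := sub_mem_maxIdeal hQm h1
    rw [sub_sub_cancel] at h2
    exact const_notMem_maxIdeal hcR hQ h2
  refine hR.of_le_fractions hB (gen_le (fun k => le_fractions hB (const_mem_gen _ k)) ?_)
  rintro _ (rfl | rfl | rfl | rfl)
  exacts [key _ ha' (hR.1 (subset_gen _ (by simp))), key _ hb' (hR.1 (subset_gen _ (by simp))),
    le_fractions hB (subset_gen _ (by simp)), le_fractions hB (subset_gen _ (by simp))]

/-- Modulo `a` and `b` a numerator becomes an element of the field `G`, which embeds in the residue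
field of `ζ`; if it vanishes at `ζ` it is zero. This gives two generators at every point of the
surface, not only the generic one. -/
lemma IsSurface.isGenBy (hζ : IsSurface F G a b ζ) (hR : IsProd F G R)
    (hRζ : R.toSubring ≤ ζ.toSubring) (ha : a ∈ R.toSubring) (hb : b ∈ R.toSubring) :
    IsGenBy R (vanishing R ζ) ![a, b] := by
  obtain ⟨c, hc, d, hd, hR⟩ := hζ.exists_isLocOf hR hRζ ha hb
  have hcR : ∀ c, const c ∈ R.toSubring := fun c => hR.1 (const_mem_gen _ c)
  rw [isGenBy_iff]
  refine ⟨fun i => ?_, ?_⟩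
  · fin_cases i
    exacts [⟨ha, hζ.3⟩, ⟨hb, hζ.4⟩]
  · rintro x ⟨hx, hxm⟩
    obtain ⟨N, hN, D, hD, hD', rfl⟩ := hR.2 x hx
    have h0 := ne_zero_of_notMem_maxIdeal hD'
    have hNm : N ∈ maxIdeal ζ := by
      have := mul_mem_maxIdeal' hxm (hRζ (hR.1 hD))
      rwa [div_mul_cancel₀ _ h0] at this
    rw [← range_four] at hN
    obtain ⟨P, rfl⟩ := mem_gen_range.1 hN
    have hcR' : c ∈ R.toSubring := hR.1 (subset_gen _ (by simp))
    have hdR' : d ∈ R.toSubring := hR.1 (subset_gen _ (by simp))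
    have h1 := aeval_sub_aeval_mem (Submodule.span R.toSubring (Set.range ![a, b])) hcR
      (x := ![a, b, c, d]) (y := ![0, 0, c, d]) (fun i => by
        fin_cases i
        exacts [ha, hb, hcR', hdR']) (fun i => by
        fin_cases i
        exacts [zero_mem _, zero_mem _, hcR', hdR']) (fun i => by
        fin_cases i
        · change a - 0 ∈ _
          rw [sub_zero]
          exact Submodule.subset_span ⟨0, rfl⟩
        · change b - 0 ∈ _
          rw [sub_zero]
          exact Submodule.subset_span ⟨1, rfl⟩
        · simp
        · simp) P
    have h2 : aeval ![0, 0, c, d] P ∈ G := by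
      refine aeval_mem (B := G.toSubalgebra.toSubring) (fun c => G.algebraMap_mem c)
        (fun i => ?_) P
      fin_cases i
      exacts [G.zero_mem, G.zero_mem, hc, hd]
    have h3 : aeval ![a, b, c, d] P - aeval ![0, 0, c, d] P ∈ maxIdeal ζ := by
      refine aeval_sub_aeval_mem_maxIdeal (fun c => hRζ (hcR c)) (fun i => ?_) (fun i => ?_) P
      · fin_cases i
        exacts [hRζ ha, hRζ hb, hRζ hcR', hRζ hdR']
      · fin_cases i
        · simpa using hζ.3
        · simpa using hζ.4
        · simpa using zero_mem_maxIdeal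
        · simpa using zero_mem_maxIdeal
    have h4 := sub_mem_maxIdeal hNm h3
    rw [sub_sub_cancel] at h4
    -- A non-zero element of `G` has its inverse in `G`, hence in `ζ`, so it cannot vanish there.
    have h5 : aeval ![0, 0, c, d] P = 0 := by
      by_contra hne
      exact inv_notMem_of_mem_maxIdeal h4 hne (hζ.5 _ (G.inv_mem h2))
    rw [h5, sub_zero] at h1
    rw [div_eq_mul_inv, mul_comm]
    exact mul_mem_submodule (inv_mem_of_notMem_maxIdeal (hR.1 hD) hD') h1

/-- A point of the blow-up along a surface lies in a product of surfaces again. -/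
lemma IsSurface.isProd_blowUp (hζ : IsSurface F G a b ζ) (hR : IsProd F G R)
    (hRζ : R.toSubring ≤ ζ.toSubring) (ha : a ∈ R.toSubring) (hb : b ∈ R.toSubring)
    (hRS : R ≤ S) {j : Fin 2} (hj : ![a, b] j ≠ 0)
    (hS : IsLocOf (blowUpRing R (Set.range ![a, b]) (![a, b] j)) S) : IsProd F G S := by
  obtain ⟨c, hc, d, hd, hR⟩ := hζ.exists_isLocOf hR hRζ ha hb
  have hcS : c ∈ S.toSubring := hRS.1 (hR.1 (subset_gen _ (by simp)))
  have hdS : d ∈ S.toSubring := hRS.1 (hR.1 (subset_gen _ (by simp)))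
  fin_cases j
  · change a ≠ 0 at hj
    refine ⟨a, hζ.1, b / a, F.div_mem hζ.2 hζ.1, c, hc, d, hd, hR.of_blowUpRing hRS hS ?_ ?_ ?_⟩
    · rintro _ (rfl | rfl | rfl | rfl)
      exacts [hRS.1 ha, hS.1 (div_mem_blowUpRing _ _ ⟨1, rfl⟩), hcS, hdS]
    · rintro _ (rfl | rfl | rfl | rfl)
      · exact subset_gen _ (by simp)
      · rename_i h
        have := mul_mem (subset_gen {a, h / a, c, d} (by simp : h / a ∈ _))
          (subset_gen {a, h / a, c, d} (by simp : a ∈ _))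
        rwa [div_mul_cancel₀ _ hj] at this
      · exact subset_gen _ (by simp)
      · exact subset_gen _ (by simp)
    · rintro _ ⟨i, rfl⟩
      fin_cases i
      · change a / a ∈ _
        rw [div_self hj]
        exact one_mem _
      · exact subset_gen _ (by simp)
  · change b ≠ 0 at hj
    refine ⟨b, hζ.2, a / b, F.div_mem hζ.1 hζ.2, c, hc, d, hd, hR.of_blowUpRing hRS hS ?_ ?_ ?_⟩
    · rintro _ (rfl | rfl | rfl | rfl)
      exacts [hRS.1 hb, hS.1 (div_mem_blowUpRing _ _ ⟨0, rfl⟩), hcS, hdS]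
    · rintro _ (rfl | rfl | rfl | rfl)
      · rename_i h
        have := mul_mem (subset_gen {b, h / b, c, d} (by simp : h / b ∈ _))
          (subset_gen {b, h / b, c, d} (by simp : b ∈ _))
        rwa [div_mul_cancel₀ _ hj] at this
      exacts [subset_gen _ (by simp), subset_gen _ (by simp), subset_gen _ (by simp)]
    · rintro _ ⟨i, rfl⟩
      fin_cases i
      · exact subset_gen _ (by simp)
      · change b / b ∈ _
        rw [div_self hj]
        exact one_mem _

end surfaces


/-! ### Closed points -/

section closedPoints

open MvPolynomial

variable {R S T ζ : LocalSubring K} {M : Model} {Z : Set (LocalSubring K)} {y : Fin 4 → K} {n : ℕ}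
  {F G : IntermediateField ℂ K}

/-- The residue field of `R` is `ℂ`. -/
def IsClosedPt (R : LocalSubring K) : Prop := ∀ x ∈ R.toSubring, ∃ c : ℂ, x - const c ∈ maxIdeal R

/-- If the residue field of `R` is `ℂ`, its maximal ideal has four generators. -/
def EmbDimLE (R : LocalSubring K) : Prop :=
  IsClosedPt R → ∃ z : Fin 4 → K, IsGenBy R (maxIdeal R) z

lemma IsClosedPt.of_le (hc : ∀ c, const c ∈ R.toSubring) (h : IsClosedPt S) (hRS : R ≤ S) :
    IsClosedPt R := fun x hx => by
  obtain ⟨c, hcS⟩ := h x (hRS.1 hx)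
  exact ⟨c, mem_maxIdeal_of_le hRS.1 (sub_mem hx (hc c)) hcS⟩

/-- `ℂ` is algebraically closed: if `x` has no constant residue, all linear factors `x - a` are
units at `R`, and so is the value at `x` of every non-zero polynomial. -/
lemma indep_singleton_or (hc : ∀ c, const c ∈ R.toSubring) {x : K} (hx : x ∈ R.toSubring) :
    Indep R ![x] ∨ ∃ c, x - const c ∈ maxIdeal R := by
  by_contra! hcon
  obtain ⟨h1, h2⟩ := hcon
  apply h1
  have key : ∀ p : Polynomial ℂ, p ≠ 0 → Polynomial.aeval x p ∉ maxIdeal R := by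
    intro p hp
    have hmem : ∀ p : Polynomial ℂ, Polynomial.aeval x p ∈ R.toSubring := by
      intro p
      rw [Polynomial.aeval_eq_sum_range]
      refine sum_mem fun i _ => ?_
      rw [Algebra.smul_def]
      exact mul_mem (hc _) (pow_mem hx _)
    induction hn : p.natDegree generalizing p with
    | zero =>
      rw [Polynomial.eq_C_of_natDegree_eq_zero hn, Polynomial.aeval_C]
      refine const_notMem_maxIdeal hc fun h0 => hp ?_
      rw [Polynomial.eq_C_of_natDegree_eq_zero hn, h0, Polynomial.C_0]
    | succ n ih =>
      obtain ⟨a, ha⟩ := IsAlgClosed.exists_root p (by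
        rw [Polynomial.degree_eq_natDegree hp, hn]
        exact_mod_cast Nat.succ_ne_zero n)
      obtain ⟨q, rfl⟩ := Polynomial.dvd_iff_isRoot.2 ha
      have hq : q ≠ 0 := right_ne_zero_of_mul hp
      rw [Polynomial.natDegree_mul (Polynomial.X_sub_C_ne_zero a) hq,
        Polynomial.natDegree_X_sub_C] at hn
      have hx1 : Polynomial.aeval x (Polynomial.X - Polynomial.C a) = x - const a := by
        rw [map_sub, Polynomial.aeval_X, Polynomial.aeval_C]
        rfl
      rw [map_mul]
      refine mul_notMem_maxIdeal (hmem _) ?_ (hmem _) (ih q hq (by omega))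
      rw [hx1]
      exact h2 a
  intro P hP
  have hmem : ∀ i, ![x] i ∈ R.toSubring := fun i => by
    fin_cases i
    exact hx
  refine ⟨aeval_mem hc hmem P, ?_⟩
  have h3 : aeval ![x] P = Polynomial.aeval x (uniqueAlgEquiv ℂ (Fin 1) P) := by
    have : (aeval ![x] : MvPolynomial (Fin 1) ℂ →ₐ[ℂ] K) =
        (Polynomial.aeval x).comp (uniqueAlgEquiv ℂ (Fin 1)).toAlgHom := by
      ext i
      fin_cases i
      simp
    rw [this]
    rfl
  rw [h3]
  exact key _ ((map_ne_zero_iff _ (uniqueAlgEquiv ℂ (Fin 1)).injective).2 hP)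

lemma isClosedPt_of_not_indep (hc : ∀ c, const c ∈ R.toSubring)
    (h : ∀ x : Fin 1 → K, ¬ Indep R x) : IsClosedPt R :=
  fun _ hx => (indep_singleton_or hc hx).resolve_left (h _)

/-- Closed points of affine spaces satisfy `EmbDimLE`. -/
lemma embDimLE_of_isLocOf {x : Fin 4 → K} (hR : IsLocOf (gen (Set.range x)) R) : EmbDimLE R := by
  intro hcl
  have hc : ∀ c, const c ∈ R.toSubring := fun c => hR.1 (const_mem_gen _ c)
  have hx : ∀ i, x i ∈ R.toSubring := fun i => hR.1 (subset_gen _ ⟨i, rfl⟩)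
  choose c hcm using fun i => hcl (x i) (hx i)
  refine ⟨fun i => x i - const (c i), isGenBy_iff.2 ⟨hcm, fun z hz => ?_⟩⟩
  obtain ⟨b, hb, s, hs, hs', rfl⟩ := hR.2 z (mem_of_mem_maxIdeal hz)
  obtain ⟨P, rfl⟩ := mem_gen_range.1 hb
  have h0 := ne_zero_of_notMem_maxIdeal hs'
  have hbm : aeval x P ∈ maxIdeal R := by
    have := mul_mem_maxIdeal' hz (hR.1 hs)
    rwa [div_mul_cancel₀ _ h0] at this
  have h1 := aeval_sub_aeval_mem_maxIdeal hc hx hcm P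
  rw [aeval_const] at h1
  have h2 := sub_mem_maxIdeal hbm h1
  rw [sub_sub_cancel] at h2
  have h3 : eval c P = 0 := by
    by_contra hne
    exact const_notMem_maxIdeal hc hne h2
  have h4 := aeval_sub_aeval_mem (Submodule.span R.toSubring
    (Set.range fun i => x i - const (c i))) hc hx (fun i => hc (c i))
    (fun i => Submodule.subset_span ⟨i, rfl⟩) P
  rw [aeval_const, h3, const_zero, sub_zero] at h4
  rw [div_eq_mul_inv, mul_comm]
  exact mul_mem_submodule (inv_mem_of_notMem_maxIdeal (hR.1 hs) hs') h4

lemma IsProd.embDimLE (h : IsProd F G R) : EmbDimLE R := by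
  obtain ⟨a, -, b, -, c, -, d, -, h⟩ := h
  rw [← range_four] at h
  exact embDimLE_of_isLocOf h

/-! ### Centres of codimension three -/

/-- The vanishing ideal of `ζ` in `R` as a submodule of `K`. -/
def vanishingSubmodule (h : R.toSubring ≤ ζ.toSubring) : Submodule R.toSubring K where
  carrier := vanishing R ζ
  zero_mem' := ⟨zero_mem _, zero_mem_maxIdeal⟩
  add_mem' ha hb := ⟨add_mem ha.1 hb.1, add_mem_maxIdeal ha.2 hb.2⟩
  smul_mem' r _ hx := ⟨mul_mem r.2 hx.1, mul_mem_maxIdeal (h r.2) hx.2⟩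

/-- The residue field of `ζ` is `ℂ(w)`. -/
def IsCurve (w : K) (ζ : LocalSubring K) : Prop :=
  Indep ζ ![w] ∧ ∀ x ∈ ζ.toSubring, ∃ g ∈ IntermediateField.adjoin ℂ {w}, x - g ∈ maxIdeal ζ

lemma IsCoordLoc.isCurve (hζ : IsCoordLoc y 3 ζ) : IsCurve (y 3) ζ := by
  have hL : ∀ P, aeval ![0, 0, 0, y 3] P ∈ IntermediateField.adjoin ℂ {y 3} := fun P =>
    aeval_mem (B := (IntermediateField.adjoin ℂ {y 3}).toSubalgebra.toSubring)
      (fun c => (IntermediateField.adjoin ℂ {y 3}).algebraMap_mem c) (fun i => by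
      fin_cases i
      exacts [zero_mem _, zero_mem _, zero_mem _,
        IntermediateField.subset_adjoin _ _ (Set.mem_singleton _)]) P
  have hsub : ∀ P, aeval y P - aeval ![0, 0, 0, y 3] P ∈ maxIdeal ζ :=
    aeval_sub_aeval_mem_maxIdeal hζ.const_mem hζ.mem (fun i => by
      fin_cases i
      · simpa using hζ.mem_maxIdeal 0 (by decide)
      · simpa using hζ.mem_maxIdeal 1 (by decide)
      · simpa using hζ.mem_maxIdeal 2 (by decide)
      · simpa using zero_mem_maxIdeal)
  refine ⟨hζ.indep_three, fun x hx => ?_⟩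
  obtain ⟨b, hb, s, hs, hs', rfl⟩ := hζ.1.2 x hx
  obtain ⟨N, rfl⟩ := mem_gen_range.1 hb
  obtain ⟨D, rfl⟩ := mem_gen_range.1 hs
  -- Setting the three vanishing coordinates to zero in numerator and denominator gives a
  -- representative of the residue in `ℂ(y 3)`.
  refine ⟨aeval ![0, 0, 0, y 3] N / aeval ![0, 0, 0, y 3] D, div_mem (hL N) (hL D), ?_⟩
  have hmem : ∀ P, aeval y P ∈ ζ.toSubring := fun P => hζ.1.1 (mem_gen_range.2 ⟨P, rfl⟩)
  have hmem' : ∀ P, aeval ![0, 0, 0, y 3] P ∈ ζ.toSubring := fun P => by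
    have := sub_mem (hmem P) (mem_of_mem_maxIdeal (hsub P))
    rwa [sub_sub_cancel] at this
  have hD : aeval ![0, 0, 0, y 3] D ∉ maxIdeal ζ := by
    intro h
    have := add_mem_maxIdeal (hsub D) h
    rw [sub_add_cancel] at this
    exact hs' this
  have h0 := ne_zero_of_notMem_maxIdeal hs'
  have h0' := ne_zero_of_notMem_maxIdeal hD
  have : aeval y N / aeval y D - aeval ![0, 0, 0, y 3] N / aeval ![0, 0, 0, y 3] D =
      (aeval y D)⁻¹ * (aeval ![0, 0, 0, y 3] D)⁻¹ *
        (aeval ![0, 0, 0, y 3] D * (aeval y N - aeval ![0, 0, 0, y 3] N) -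
          aeval ![0, 0, 0, y 3] N * (aeval y D - aeval ![0, 0, 0, y 3] D)) := by
    field_simp
    ring
  rw [this]
  exact mul_mem_maxIdeal (mul_mem (inv_mem_of_notMem_maxIdeal (hmem D) hs')
    (inv_mem_of_notMem_maxIdeal (hmem' D) hD))
    (sub_mem_maxIdeal (mul_mem_maxIdeal (hmem' D) (hsub N)) (mul_mem_maxIdeal (hmem' N) (hsub D)))

lemma adjoin_inv (w : K) : IntermediateField.adjoin ℂ {w⁻¹} = IntermediateField.adjoin ℂ {w} := by
  have key : ∀ w : K, IntermediateField.adjoin ℂ {w⁻¹} ≤ IntermediateField.adjoin ℂ {w} := by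
    intro w
    rw [IntermediateField.adjoin_le_iff, Set.singleton_subset_iff]
    exact inv_mem (IntermediateField.subset_adjoin _ _ (Set.mem_singleton _))
  refine le_antisymm (key w) ?_
  have := key w⁻¹
  rwa [inv_inv] at this

/-- At a closed point of the curve either `w` or `w⁻¹` is regular; this symmetry lets both cases use
the same argument. -/
lemma IsCurve.inv {w : K} (h : IsCurve w ζ) : IsCurve w⁻¹ ζ := by
  refine ⟨?_, by rw [adjoin_inv]; exact h.2⟩
  have hwm : w ∉ maxIdeal ζ := by
    have := (h.1 (X 0) (X_ne_zero 0)).2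
    rwa [aeval_X] at this
  have hw0 := ne_zero_of_notMem_maxIdeal hwm
  have hw : w ∈ ζ.toSubring := h.1.mem 0
  refine (indep_singleton_or h.1.const_mem (inv_mem_of_notMem_maxIdeal hw hwm)).resolve_right ?_
  rintro ⟨c, hc⟩
  have h1 := mul_mem_maxIdeal hw hc
  rw [mul_sub, mul_inv_cancel₀ hw0] at h1
  have h2 := (h.1 (1 - X 0 * C c) ?_).2
  · apply h2
    simpa [map_sub, aeval_X, aeval_C, const] using h1
  · intro h0
    have := congrArg (eval 0) h0
    simp at this

lemma polynomial_aeval_mem (hc : ∀ c, const c ∈ R.toSubring) {w : K} (hw : w ∈ R.toSubring)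
    (p : Polynomial ℂ) : Polynomial.aeval w p ∈ R.toSubring := by
  rw [Polynomial.aeval_eq_sum_range]
  refine sum_mem fun i _ => ?_
  rw [Algebra.smul_def]
  exact mul_mem (hc _) (pow_mem hw _)

lemma Indep.polynomial_aeval_notMem {w : K} (h : Indep ζ ![w]) {q : Polynomial ℂ} (hq : q ≠ 0) :
    Polynomial.aeval w q ∉ maxIdeal ζ := by
  have h1 : aeval ![w] ((uniqueAlgEquiv ℂ (Fin 1)).symm q) = Polynomial.aeval w q := by
    have : ((aeval ![w] : MvPolynomial (Fin 1) ℂ →ₐ[ℂ] K)).comp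
        (uniqueAlgEquiv ℂ (Fin 1)).symm.toAlgHom =
        (Polynomial.aeval w : Polynomial ℂ →ₐ[ℂ] K) := by
      ext
      simp
    rw [← this]
    rfl
  have h2 := (h ((uniqueAlgEquiv ℂ (Fin 1)).symm q)
    ((map_ne_zero_iff _ (uniqueAlgEquiv ℂ (Fin 1)).symm.injective).2 hq)).2
  rwa [h1] at h2

/-- The local ring of a curve at a closed point that is dominated by a point of `ℙ¹` is a
discrete valuation ring. -/
lemma IsCurve.exists_mul_sub_mem {w : K} (hζ : IsCurve w ζ) (hRζ : R.toSubring ≤ ζ.toSubring)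
    (hc : ∀ c, const c ∈ R.toSubring) (hw : w ∈ R.toSubring) {c : ℂ}
    (hwc : w - const c ∈ maxIdeal R) {x : K} (hx : x ∈ maxIdeal R) :
    ∃ r ∈ R.toSubring, x - r * (w - const c) ∈ vanishing R ζ := by
  have hxR := mem_of_mem_maxIdeal hx
  obtain ⟨g, hg, hxg⟩ := hζ.2 x (hRζ hxR)
  obtain ⟨p₀, s₀, hgs⟩ := (IntermediateField.mem_adjoin_simple_iff ℂ g).1 hg
  -- The residue of `x` on the curve as a reduced fraction in `w`; coprimality will exclude a pole
  -- at the closed point `w = c`.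
  obtain ⟨p, s, hps, hs0, hg'⟩ : ∃ p s : Polynomial ℂ, IsRelPrime p s ∧ s ≠ 0 ∧
      g = Polynomial.aeval w p / Polynomial.aeval w s := by
    by_cases hs₀ : s₀ = 0
    · refine ⟨0, 1, isRelPrime_one_right, one_ne_zero, ?_⟩
      rw [hgs, hs₀]
      simp
    · obtain ⟨s, p, q, hrel, rfl, rfl⟩ :=
        UniqueFactorizationMonoid.exists_reduced_factors s₀ hs₀ p₀
      refine ⟨p, s, hrel.symm, right_ne_zero_of_mul hs₀, ?_⟩
      rw [hgs, map_mul, map_mul, mul_div_mul_left]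
      exact ne_zero_of_notMem_maxIdeal (hζ.1.polynomial_aeval_notMem (left_ne_zero_of_mul hs₀))
  have hmem := fun q => polynomial_aeval_mem hc hw q
  have heval : ∀ q : Polynomial ℂ, ∃ q' : Polynomial ℂ, q = (Polynomial.X - Polynomial.C c) * q' +
      Polynomial.C (q.eval c) := by
    intro q
    obtain ⟨q', hq'⟩ := Polynomial.X_sub_C_dvd_sub_C_eval (a := c) (p := q)
    exact ⟨q', by rw [← hq']; ring⟩
  have hX : Polynomial.aeval w (Polynomial.X - Polynomial.C c) = w - const c := by
    rw [map_sub, Polynomial.aeval_X, Polynomial.aeval_C]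
    rfl
  have hroot : ∀ q : Polynomial ℂ, Polynomial.aeval w q ∈ maxIdeal R → q.eval c = 0 := by
    intro q hq
    obtain ⟨q', hq'⟩ := heval q
    by_contra hne
    rw [hq', map_add, map_mul, hX, Polynomial.aeval_C] at hq
    have h1 := sub_mem_maxIdeal hq (mul_mem_maxIdeal' hwc (hmem q'))
    rw [add_sub_cancel_left] at h1
    exact const_notMem_maxIdeal hc hne h1
  have hroot' : ∀ q : Polynomial ℂ, q.eval c = 0 → (Polynomial.X - Polynomial.C c) ∣ q := by
    intro q hq
    exact Polynomial.dvd_iff_isRoot.2 hq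
  -- If the denominator vanished at `R`, so would the numerator, being congruent to `s(w) * x` along
  -- the curve. Then `X - c` would divide two coprime polynomials.
  have hsm : Polynomial.aeval w s ∉ maxIdeal R := by
    intro hs
    have hs0 : Polynomial.aeval w s ≠ 0 :=
      ne_zero_of_notMem_maxIdeal (hζ.1.polynomial_aeval_notMem hs0)
    have h1 : Polynomial.aeval w s * (x - g) ∈ maxIdeal R := by
      have h2 : Polynomial.aeval w s * (x - g) =
          Polynomial.aeval w s * x - Polynomial.aeval w p := by
        rw [hg', mul_sub, mul_div_cancel₀ _ hs0]
      refine mem_maxIdeal_of_le hRζ ?_ (mul_mem_maxIdeal (hRζ (hmem s)) hxg)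
      rw [h2]
      exact sub_mem (mul_mem (hmem s) hxR) (hmem p)
    have h2 : Polynomial.aeval w p ∈ maxIdeal R := by
      have h3 := sub_mem_maxIdeal (mul_mem_maxIdeal (hmem s) hx) h1
      convert h3 using 1
      rw [hg', mul_sub, mul_div_cancel₀ _ hs0]
      ring
    exact absurd (hps (hroot' p (hroot p h2)) (hroot' s (hroot s hs)))
      (Polynomial.prime_X_sub_C c).not_isUnit
  have hgR : g ∈ R.toSubring := by
    rw [hg', div_eq_mul_inv]
    exact mul_mem (hmem p) (inv_mem_of_notMem_maxIdeal (hmem s) hsm)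
  have hgm : g ∈ maxIdeal R := by
    have h1 := mem_maxIdeal_of_le hRζ (sub_mem hxR hgR) hxg
    have h2 := sub_mem_maxIdeal hx h1
    rwa [sub_sub_cancel] at h2
  have hpm : Polynomial.aeval w p ∈ maxIdeal R := by
    have := mul_mem_maxIdeal' hgm (hmem s)
    rwa [hg', div_mul_cancel₀ _ (ne_zero_of_notMem_maxIdeal hsm)] at this
  obtain ⟨p', rfl⟩ := hroot' p (hroot p hpm)
  refine ⟨Polynomial.aeval w p' * (Polynomial.aeval w s)⁻¹,
    mul_mem (hmem p') (inv_mem_of_notMem_maxIdeal (hmem s) hsm), ?_⟩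
  have h1 : Polynomial.aeval w p' * (Polynomial.aeval w s)⁻¹ * (w - const c) = g := by
    rw [hg', map_mul, hX]
    ring
  rw [h1]
  exact ⟨sub_mem hxR hgR, hxg⟩

end closedPoints


/-! ### Blow-ups along curves -/

section curves

open MvPolynomial

variable {R S T ζ : LocalSubring K} {M : Model} {Z : Set (LocalSubring K)} {y : Fin 4 → K} {n : ℕ}
  {w : K}

lemma Indep.sub_const_notMem (h : Indep ζ ![w]) (c : ℂ) : w - const c ∉ maxIdeal ζ := by
  have h1 := h.polynomial_aeval_notMem (Polynomial.X_sub_C_ne_zero c)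
  rw [map_sub, Polynomial.aeval_X, Polynomial.aeval_C] at h1
  exact h1

/-- Nakayama's lemma for the vanishing ideal. -/
lemma vanishing_le {ι κ : Type*} [Fintype ι] [Fintype κ] (h : R.toSubring ≤ ζ.toSubring)
    {g : ι → K} (hg : IsGenBy R (vanishing R ζ) g) {f : κ → K} (hf : ∀ i, f i ∈ vanishing R ζ)
    (hm : ∀ x ∈ vanishing R ζ, ∃ r ∈ maxIdeal R, ∃ u ∈ vanishing R ζ,
      ∃ v ∈ Submodule.span R.toSubring (Set.range f), x = r * u + v) :
    IsGenBy R (vanishing R ζ) f := by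
  have hN : vanishingSubmodule h = Submodule.span R.toSubring (Set.range g) := by
    refine le_antisymm (fun x hx => (isGenBy_iff.1 hg).2 x hx) (Submodule.span_le.2 ?_)
    rintro _ ⟨i, rfl⟩
    exact hg.1 i
  have hfg : (vanishingSubmodule h).FG := by
    rw [hN]
    exact Submodule.fg_span (Set.finite_range g)
  have key := Submodule.le_of_le_smul_of_le_jacobson_bot
    (N := Submodule.span R.toSubring (Set.range f)) hfg
    (IsLocalRing.maximalIdeal_le_jacobson ⊥) fun x hx => ?_
  · exact isGenBy_iff.2 ⟨hf, fun x hx => key hx⟩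
  · obtain ⟨_, ⟨r, hr, rfl⟩, u, hu, v, hv, rfl⟩ := hm x hx
    rw [add_comm]
    exact Submodule.add_mem_sup hv (Submodule.smul_mem_smul (M := K) (n := u) hr hu)

/-- Restricted to the curve, each of the four generators of the maximal ideal is a multiple of the
parameter `w - c`. One multiplier is a unit, and that generator is used to correct the other three
so that they vanish on the curve. -/
lemma IsCurve.exists_isGenBy' (hζ : IsCurve w ζ) (hRζ : R.toSubring ≤ ζ.toSubring)
    (hc : ∀ c, const c ∈ R.toSubring) (hw : w ∈ R.toSubring) (hcl : IsClosedPt R)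
    (hE : EmbDimLE R) {ι : Type*} [Fintype ι] {g : ι → K} (hg : IsGenBy R (vanishing R ζ) g) :
    ∃ (x : K) (f : Fin 3 → K), IsGenBy R (vanishing R ζ) f ∧
      IsGenBy R (maxIdeal R) (Fin.cons x f : Fin 4 → K) := by
  obtain ⟨c, hwc⟩ := hcl w hw
  obtain ⟨x, hx⟩ := hE hcl
  have hx' := isGenBy_iff.1 hx
  choose r hr hrx using fun i => hζ.exists_mul_sub_mem hRζ hc hw hwc (hx.1 i)
  have hπ := hζ.1.sub_const_notMem c
  set π := w - const c
  -- Otherwise expanding `w - c` in the four generators shows that it vanishes on the curve up to a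
  -- unit factor of the form `1 - m`.
  obtain ⟨i₀, hi₀⟩ : ∃ i, r i ∉ maxIdeal R := by
    by_contra! hcon
    obtain ⟨s, hs, hsπ⟩ := hx.2 _ hwc
    have h1 : ∑ i, s i * r i ∈ maxIdeal R :=
      sum_mem_maxIdeal fun i _ => mul_mem_maxIdeal (hs i) (hcon i)
    have h2 : ∑ i, s i * (x i - r i * π) ∈ maxIdeal ζ :=
      sum_mem_maxIdeal fun i _ => mul_mem_maxIdeal (hRζ (hs i)) (hrx i).2
    have h3 : (1 - ∑ i, s i * r i) * π = ∑ i, s i * (x i - r i * π) := by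
      simp only [mul_sub, Finset.sum_sub_distrib, ← mul_assoc, ← Finset.sum_mul]
      rw [← hsπ]
      ring
    have h4 : 1 - ∑ i, s i * r i ∉ maxIdeal R := by
      intro h
      have := add_mem_maxIdeal h h1
      rw [sub_add_cancel] at this
      exact one_notMem_maxIdeal this
    rw [← h3] at h2
    have h5 := sub_mem (one_mem _) (mem_of_mem_maxIdeal h1)
    exact mul_notMem_maxIdeal (hRζ h5) (notMem_maxIdeal_of_le hRζ h5 h4)
      (hRζ (mem_of_mem_maxIdeal hwc)) hπ h2
  have hri := hr i₀
  have hxR : ∀ i, x i ∈ R.toSubring := fun i => mem_of_mem_maxIdeal (hx.1 i)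
  have hr0 := ne_zero_of_notMem_maxIdeal hi₀
  have hinv := inv_mem_of_notMem_maxIdeal hri hi₀
  have hx0 : x i₀ ∉ maxIdeal ζ := by
    intro h
    have h1 := sub_mem_maxIdeal h (hrx i₀).2
    rw [sub_sub_cancel] at h1
    exact mul_notMem_maxIdeal (hRζ hri) (notMem_maxIdeal_of_le hRζ hri hi₀)
      (hRζ (mem_of_mem_maxIdeal hwc)) hπ h1
  -- Eliminate the restriction to the curve with the help of `x i₀`.
  let f : Fin 3 → K := fun k => x (i₀.succAbove k) - r (i₀.succAbove k) * (r i₀)⁻¹ * x i₀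
  have hf : ∀ k, f k ∈ vanishing R ζ := by
    intro k
    refine ⟨sub_mem (hxR _) (mul_mem (mul_mem (hr _) hinv) (hxR _)), ?_⟩
    have : f k = (x (i₀.succAbove k) - r (i₀.succAbove k) * π) -
        r (i₀.succAbove k) * (r i₀)⁻¹ * (x i₀ - r i₀ * π) := by
      simp only [f]
      field_simp
      ring
    rw [this]
    exact sub_mem_maxIdeal (hrx _).2
      (mul_mem_maxIdeal (hRζ (mul_mem (hr _) hinv)) (hrx i₀).2)
  have hmax : IsGenBy R (maxIdeal R) (Fin.cons (x i₀) f : Fin 4 → K) := by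
    refine isGenBy_iff.2 ⟨fun k => ?_, fun z hz => ?_⟩
    · refine Fin.cases ?_ (fun k => ?_) k
      · exact hx.1 i₀
      · exact vanishing_subset hRζ (hf k)
    · refine Submodule.span_le.2 ?_ (hx'.2 z hz)
      have h0 : x i₀ ∈ Submodule.span R.toSubring
          (Set.range (Fin.cons (x i₀) f : Fin 4 → K)) := Submodule.subset_span ⟨0, rfl⟩
      rintro _ ⟨i, rfl⟩
      rcases Fin.eq_self_or_eq_succAbove i₀ i with rfl | ⟨k, rfl⟩
      · exact h0
      · have : x (i₀.succAbove k) = f k + r (i₀.succAbove k) * (r i₀)⁻¹ * x i₀ := by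
          simp only [f]
          ring
        rw [this]
        exact add_mem (Submodule.subset_span ⟨k.succ, rfl⟩)
          (mul_mem_submodule (mul_mem (hr _) hinv) h0)
  -- For an element vanishing on the curve, the coefficient of `x i₀` must vanish there too, since
  -- `x i₀` does not. So the ideal lies in the span of `f` plus the maximal ideal times itself, as
  -- Nakayama requires.
  refine ⟨x i₀, f, vanishing_le hRζ hg hf fun z hz => ?_, hmax⟩
  obtain ⟨s, hs, hsz⟩ := hmax.2 z (vanishing_subset hRζ hz)
  rw [Fin.sum_univ_succ] at hsz
  simp only [Fin.cons_zero, Fin.cons_succ] at hsz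
  have hv : ∑ k, s k.succ * f k ∈ Submodule.span R.toSubring (Set.range f) :=
    mem_span_iff.2 ⟨fun k => s k.succ, fun k => hs _, rfl⟩
  have hs0 : s 0 ∈ maxIdeal ζ := by
    by_contra hne
    have h1 : ∑ k, s k.succ * f k ∈ maxIdeal ζ :=
      sum_mem_maxIdeal fun k _ => mul_mem_maxIdeal (hRζ (hs _)) (hf k).2
    have h2 := sub_mem_maxIdeal hz.2 h1
    rw [hsz, add_sub_cancel_right] at h2
    exact mul_notMem_maxIdeal (hRζ (hs 0)) hne (hRζ (hxR i₀)) hx0 h2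
  refine ⟨x i₀, hx.1 i₀, s 0, ⟨hs 0, hs0⟩, _, hv, ?_⟩
  rw [hsz, mul_comm (x i₀)]

lemma IsCurve.exists_isGenBy (hζ : IsCurve w ζ) (hRζ : R.toSubring ≤ ζ.toSubring)
    (hc : ∀ c, const c ∈ R.toSubring) (hw : w ∈ R.toSubring ∨ w⁻¹ ∈ R.toSubring)
    (hcl : IsClosedPt R) (hE : EmbDimLE R)
    {ι : Type*} [Fintype ι] {g : ι → K} (hg : IsGenBy R (vanishing R ζ) g) :
    ∃ (x : K) (f : Fin 3 → K), IsGenBy R (vanishing R ζ) f ∧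
      IsGenBy R (maxIdeal R) (Fin.cons x f : Fin 4 → K) := by
  rcases hw with hw | hw
  · exact hζ.exists_isGenBy' hRζ hc hw hcl hE hg
  · exact hζ.inv.exists_isGenBy' hRζ hc hw hcl hE hg

/-- Closed points of the blow-up along a curve. -/
lemma embDimLE_blowUpRing (hc : ∀ c, const c ∈ R.toSubring) (hRS : R ≤ S) (hcl : IsClosedPt R)
    {x : K} {f : Fin 3 → K} (hf : ∀ i, f i ∈ maxIdeal R)
    (hmax : IsGenBy R (maxIdeal R) (Fin.cons x f : Fin 4 → K)) {j : Fin 3} (hj : f j ≠ 0)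
    (hfS : ∀ i, f i / f j ∈ S.toSubring)
    (hS : IsLocOf (blowUpRing R (Set.range f) (f j)) S) : EmbDimLE S := by
  intro hclS
  choose c hcm using fun k => hclS _ (hfS k)
  have hcS : ∀ c, const c ∈ S.toSubring := fun c => hRS.1 (hc c)
  -- The equation of the exceptional divisor together with the chart quotients translated to vanish
  -- at the closed point.
  let z : Fin 3 → K := fun k => if k = j then f j else f k / f j - const (c k)
  let W := Submodule.span S.toSubring (Set.range (Fin.cons x z : Fin 4 → K))
  have hxm : x ∈ maxIdeal S := maxIdeal_subset_of_le hRS (hmax.1 0)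
  have hzm : ∀ i, (Fin.cons x z : Fin 4 → K) i ∈ maxIdeal S := by
    refine Fin.cases hxm fun k => ?_
    simp only [Fin.cons_succ, z]
    split_ifs
    · exact maxIdeal_subset_of_le hRS (hf j)
    · exact hcm k
  have hxW : x ∈ W := Submodule.subset_span ⟨0, rfl⟩
  have hfjW : f j ∈ W := Submodule.subset_span ⟨j.succ, by simp [z]⟩
  have hWm : ∀ b ∈ W, b ∈ maxIdeal S := fun b hb => by
    have : W ≤ maxSubmodule S := Submodule.span_le.2 (by
      rintro _ ⟨i, rfl⟩
      exact hzm i)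
    exact this hb
  have hRW : ∀ b ∈ maxIdeal R, b ∈ W := by
    intro b hb
    obtain ⟨r, hr, rfl⟩ := hmax.2 b hb
    refine sum_mem fun i _ => mul_mem_submodule (hRS.1 (hr i)) ?_
    refine Fin.cases hxW (fun k => ?_) i
    have : f k = f k / f j * f j := by rw [div_mul_cancel₀ _ hj]
    rw [Fin.cons_succ, this]
    exact mul_mem_submodule (hfS k) hfjW
  -- The chart ring is made of constants modulo `W`: true for its generators, and stable under the
  -- ring operations. For an element of the maximal ideal the constant must be zero.
  have key : ∀ b ∈ blowUpRing R (Set.range f) (f j), ∃ c, b - const c ∈ W := by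
    intro b hb
    have hmem : ∀ {b}, b ∈ blowUpRing R (Set.range f) (f j) → b ∈ S.toSubring := fun h => hS.1 h
    induction hb using Subring.closure_induction with
    | mem b hb =>
      rcases hb with hb | ⟨_, ⟨k, rfl⟩, rfl⟩
      · obtain ⟨c, hc⟩ := hcl b hb
        exact ⟨c, hRW _ hc⟩
      · by_cases hk : k = j
        · refine ⟨1, ?_⟩
          rw [hk, div_self hj, const_one, sub_self]
          exact zero_mem _
        · exact ⟨c k, Submodule.subset_span ⟨k.succ, by simp [z, hk]⟩⟩
    | zero => exact ⟨0, by rw [const_zero, sub_self]; exact zero_mem _⟩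
    | one => exact ⟨1, by rw [const_one, sub_self]; exact zero_mem _⟩
    | add a b _ _ ha hb =>
      obtain ⟨c, hc⟩ := ha
      obtain ⟨d, hd⟩ := hb
      refine ⟨c + d, ?_⟩
      rw [const_add, add_sub_add_comm]
      exact add_mem hc hd
    | neg a _ ha =>
      obtain ⟨c, hc⟩ := ha
      refine ⟨-c, ?_⟩
      rw [const_neg, ← neg_sub']
      exact neg_mem hc
    | mul a b ha' hb' ha hb =>
      obtain ⟨c, hc⟩ := ha
      obtain ⟨d, hd⟩ := hb
      refine ⟨c * d, ?_⟩
      rw [const_mul]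
      have : a * b - const c * const d = b * (a - const c) + const c * (b - const d) := by ring
      rw [this]
      exact add_mem (mul_mem_submodule (hmem hb') hc) (mul_mem_submodule (hcS c) hd)
  refine ⟨Fin.cons x z, isGenBy_iff.2 ⟨hzm, fun u hu => ?_⟩⟩
  obtain ⟨b, hb, s, hs, hs', rfl⟩ := hS.2 u (mem_of_mem_maxIdeal hu)
  obtain ⟨d, hd⟩ := key b hb
  have hbm : b ∈ maxIdeal S := by
    have := mul_mem_maxIdeal' hu (hS.1 hs)
    rwa [div_mul_cancel₀ _ (ne_zero_of_notMem_maxIdeal hs')] at this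
  have hd0 : d = 0 := by
    by_contra hne
    have h1 := sub_mem_maxIdeal hbm (hWm _ hd)
    rw [sub_sub_cancel] at h1
    exact const_notMem_maxIdeal hcS hne h1
  rw [hd0, const_zero, sub_zero] at hd
  rw [div_eq_mul_inv, mul_comm]
  exact mul_mem_submodule (inv_mem_of_notMem_maxIdeal (hS.1 hs) hs') hd

/-! #### The exceptional divisor -/

lemma IsCoordLoc.isGenBy_three (hζ : IsCoordLoc y 3 ζ) :
    IsGenBy ζ (maxIdeal ζ) ![y 0, y 1, y 2] := by
  refine hζ.mem_maxIdeal_span (fun i => ?_) (fun i hi => ?_)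
  · fin_cases i
    exacts [hζ.mem_maxIdeal 0 (by decide), hζ.mem_maxIdeal 1 (by decide),
      hζ.mem_maxIdeal 2 (by decide)]
  · have : i = 0 ∨ i = 1 ∨ i = 2 := by omega
    rcases this with rfl | rfl | rfl
    exacts [⟨0, rfl⟩, ⟨1, rfl⟩, ⟨2, rfl⟩]

lemma IsCoordLoc.not_indep_two (hζ : IsCoordLoc y 3 ζ) (z : Fin 2 → K) : ¬ Indep ζ z := by
  intro hz
  have := card_le_of_isLocOf hζ.1 (w := ![y 3]) (fun i => by
    fin_cases i
    exact hζ.mem 3) (by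
    rintro _ ⟨i, rfl⟩
    fin_cases i
    exacts [Or.inl (hζ.mem_maxIdeal 0 (by decide)), Or.inl (hζ.mem_maxIdeal 1 (by decide)),
      Or.inl (hζ.mem_maxIdeal 2 (by decide)), Or.inr ⟨0, rfl⟩]) hz
  omega

/-- The coordinates of the exceptional divisor of the blow-up along `y₀ = y₁ = y₂ = 0`. -/
def excThree (y : Fin 4 → K) : Fin 4 → K := ![y 0, y 1 / y 0, y 2 / y 0, y 3]

lemma isCoord_excThree (hy : IsCoord y) : IsCoord (excThree y) := by
  have h : ∀ i, excThree y i ∈ IntermediateField.adjoin ℂ (Set.range (excThree y)) :=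
    fun i => IntermediateField.subset_adjoin ℂ _ ⟨i, rfl⟩
  refine hy.of_mem fun i => ?_
  fin_cases i
  · exact h 0
  · have := mul_mem (h 1) (h 0)
    change y 1 / y 0 * y 0 ∈ _ at this
    rwa [div_mul_cancel₀ _ (hy.ne_zero 0)] at this
  · have := mul_mem (h 2) (h 0)
    change y 2 / y 0 * y 0 ∈ _ at this
    rwa [div_mul_cancel₀ _ (hy.ne_zero 0)] at this
  · exact h 3

lemma aeval_strip_three_notMem (h : Indep T ![y 3]) (P : MvPolynomial (Fin 4) ℂ)
    (hP : strip 3 P ≠ 0) : aeval y (strip 3 P) ∉ maxIdeal T := by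
  refine aeval_strip_notMem (f := ![3]) (v := ![0, 0, 0, X 0]) (fun i => ?_) ?_ P hP
  · fin_cases i <;> simp
  · convert h using 1
    funext i
    fin_cases i
    rfl

lemma IsCoordLoc.le_excThree (hy : IsCoord y) (hζ : IsCoordLoc y 3 ζ)
    (hE : IsCoordLoc (excThree y) 1 S) : ζ ≤ S := by
  have h0 : y 0 ∈ maxIdeal S := hE.mem_maxIdeal 0 (by decide)
  have h1 : y 1 ∈ maxIdeal S := by
    have := mul_mem_maxIdeal (hE.mem 1) h0
    change y 1 / y 0 * y 0 ∈ _ at this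
    rwa [div_mul_cancel₀ _ (hy.ne_zero 0)] at this
  have h2 : y 2 ∈ maxIdeal S := by
    have := mul_mem_maxIdeal (hE.mem 2) h0
    change y 2 / y 0 * y 0 ∈ _ at this
    rwa [div_mul_cancel₀ _ (hy.ne_zero 0)] at this
  refine hζ.le hE.const_mem (fun i => ?_) (fun i hi => ?_) (aeval_strip_three_notMem ?_)
  · fin_cases i
    exacts [mem_of_mem_maxIdeal h0, mem_of_mem_maxIdeal h1, mem_of_mem_maxIdeal h2, hE.mem 3]
  · have : i = 0 ∨ i = 1 ∨ i = 2 := by omega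
    rcases this with rfl | rfl | rfl
    exacts [h0, h1, h2]
  · have := hE.indep (f := ![3]) (by decide) (by decide)
    convert this using 1
    funext i
    fin_cases i
    rfl

lemma excThree_mem_blowUp (hy : IsCoord y) (hζ : IsCoordLoc y 3 ζ) (hgen : IsGenericPt Z ζ)
    (hM : ζ ∈ M) (hE : IsCoordLoc (excThree y) 1 S) : S ∈ blowUp M Z := by
  refine mem_blowUp_of_isLocOf (j := 0) hgen hM hζ.isGenBy_three (hy.ne_zero 0)
    (hζ.le_excThree hy hE) hE.1 (gen_le ?_ ?_) fun i => ?_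
  · exact fun c => le_blowUpRing _ _ _ (hζ.const_mem c)
  · rintro _ ⟨i, rfl⟩
    fin_cases i
    exacts [le_blowUpRing _ _ _ (hζ.mem 0), div_mem_blowUpRing _ _ ⟨1, rfl⟩,
      div_mem_blowUpRing _ _ ⟨2, rfl⟩, le_blowUpRing _ _ _ (hζ.mem 3)]
  · fin_cases i
    · change y 0 / y 0 ∈ _
      rw [div_self (hy.ne_zero 0)]
      exact one_mem _
    · exact hE.mem 1
    · exact hE.mem 2

/-- A local ring over the generic point of a centre of codimension three. -/
lemma eq_excThree (hy : IsCoord y) (hζ : IsCoordLoc y 3 ζ) (hE : IsCoordLoc (excThree y) 1 T)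
    (hle : ζ ≤ S) {j : Fin 3}
    (hS : IsLocOf (blowUpRing ζ (Set.range ![y 0, y 1, y 2]) (![y 0, y 1, y 2] j)) S)
    {x : Fin 3 → K} (hx : Indep S x) : S = T := by
  let f : Fin 3 → K := ![y 0, y 1, y 2]
  change IsLocOf (blowUpRing ζ (Set.range f) (f j)) S at hS
  have hmem : ∀ i, y i ∈ S.toSubring := fun i => hle.1 (hζ.mem i)
  have hfm : ∀ i, f i ∈ maxIdeal S := fun i => maxIdeal_subset_of_le hle (hζ.isGenBy_three.1 i)
  have hf0 : ∀ i, f i ≠ 0 := fun i => by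
    fin_cases i
    exacts [hy.ne_zero 0, hy.ne_zero 1, hy.ne_zero 2]
  have hdiv : ∀ i, f i / f j ∈ S.toSubring := fun i => hS.1 (div_mem_blowUpRing _ _ ⟨i, rfl⟩)
  -- The points outside this chart lie on a line of the exceptional plane, where only one chart
  -- quotient and `y 3` generate the residue field.
  have hS0 : IsLocOf (blowUpRing ζ (Set.range f) (f 0)) S := by
    refine hS.blowUpRing_change fun hm => ?_
    let v : Set K := insert (f j) (insert (y 3) (Set.range fun i => f i / f j))
    have hv : ∀ i, f i ∈ gen v := fun i => by
      have := mul_mem (subset_gen v (Or.inr (Or.inr ⟨i, rfl⟩))) (subset_gen v (Or.inl rfl))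
      rwa [div_mul_cancel₀ _ (hf0 j)] at this
    have hS' : IsLocOf (gen v) S := by
      refine hζ.1.of_blowUpRing hle hS ?_ ?_ ?_
      · rintro _ (rfl | rfl | ⟨i, rfl⟩)
        exacts [mem_of_mem_maxIdeal (hfm j), hmem 3, hdiv i]
      · rintro _ ⟨i, rfl⟩
        fin_cases i
        exacts [hv 0, hv 1, hv 2, subset_gen _ (Or.inr (Or.inl rfl))]
      · rintro _ ⟨i, rfl⟩
        exact subset_gen _ (Or.inr (Or.inr ⟨i, rfl⟩))
    have hj0 : j ≠ 0 := by
      rintro rfl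
      rw [div_self (hf0 0)] at hm
      exact one_notMem_maxIdeal hm
    have : ∃ k : Fin 3, ∀ i, i = 0 ∨ i = j ∨ i = k := by
      have : j = 1 ∨ j = 2 := by omega
      rcases this with rfl | rfl
      exacts [⟨2, by decide⟩, ⟨1, by decide⟩]
    obtain ⟨k, hk⟩ := this
    have := card_le_of_isLocOf (s := insert (f j) (insert (y 3) {f 0 / f j, f k / f j}))
      (w := ![f k / f j, y 3]) ?_ (fun i => by
        fin_cases i
        exacts [hdiv k, hmem 3]) (by
      rintro _ (rfl | rfl | rfl | rfl)
      exacts [Or.inl (hfm j), Or.inr ⟨1, rfl⟩, Or.inl hm, Or.inr ⟨0, rfl⟩]) hx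
    · omega
    · refine hS'.of_le_fractions (gen_le (fun c => hle.1 (hζ.const_mem c)) ?_)
        (gen_le (fun c => le_fractions _ (const_mem_gen _ c)) ?_)
      · rintro _ (rfl | rfl | rfl | rfl)
        exacts [mem_of_mem_maxIdeal (hfm j), hmem 3, hdiv 0, hdiv k]
      · rintro _ (rfl | rfl | ⟨i, rfl⟩)
        · exact le_fractions _ (subset_gen _ (by simp))
        · exact le_fractions _ (subset_gen _ (by simp))
        · refine le_fractions _ ?_
          rcases hk i with rfl | rfl | rfl
          · exact subset_gen _ (by simp)
          · simp only [div_self (hf0 i)]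
            exact one_mem _
          · exact subset_gen _ (by simp)
  have h10 : y 1 / y 0 ∈ S.toSubring := hS0.1 (div_mem_blowUpRing _ _ ⟨1, rfl⟩)
  have h20 : y 2 / y 0 ∈ S.toSubring := hS0.1 (div_mem_blowUpRing _ _ ⟨2, rfl⟩)
  have hmem' : ∀ i, excThree y i ∈ S.toSubring := by
    intro i
    fin_cases i
    exacts [hmem 0, h10, h20, hmem 3]
  have hS' : IsLocOf (gen (Set.range (excThree y))) S := by
    refine hζ.1.of_blowUpRing hle hS0 ?_ ?_ ?_
    · rintro _ ⟨i, rfl⟩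
      exact hmem' i
    · rintro _ ⟨i, rfl⟩
      have h : ∀ i, excThree y i ∈ gen (Set.range (excThree y)) := fun i => subset_gen _ ⟨i, rfl⟩
      fin_cases i
      · exact h 0
      · have := mul_mem (h 1) (h 0)
        change y 1 / y 0 * y 0 ∈ _ at this
        rwa [div_mul_cancel₀ _ (hy.ne_zero 0)] at this
      · have := mul_mem (h 2) (h 0)
        change y 2 / y 0 * y 0 ∈ _ at this
        rwa [div_mul_cancel₀ _ (hy.ne_zero 0)] at this
      · exact h 3
    · rintro _ ⟨i, rfl⟩
      fin_cases i
      · change y 0 / y 0 ∈ _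
        rw [div_self (hy.ne_zero 0)]
        exact one_mem _
      · exact subset_gen _ ⟨1, rfl⟩
      · exact subset_gen _ ⟨2, rfl⟩
  have hind : Indep S ![excThree y 1, excThree y 2, excThree y 3] := by
    refine indep_of_isLocOf hS' (fun i => ?_) ?_ hx
    · fin_cases i
      exacts [hmem' 1, hmem' 2, hmem' 3]
    · rintro _ ⟨i, rfl⟩
      fin_cases i
      exacts [Or.inl (hfm 0), Or.inr ⟨0, rfl⟩, Or.inr ⟨1, rfl⟩, Or.inr ⟨2, rfl⟩]
  refine (hE.eq_of_le (isCoord_excThree hy) ?_).symm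
  refine hE.le (fun c => hle.1 (hζ.const_mem c)) hmem' (fun i hi => ?_)
    (aeval_strip_one_notMem hind)
  obtain rfl : i = 0 := by omega
  exact hfm 0

end curves


/-! ### The steps of the construction -/

section steps

open MvPolynomial

variable {R S T ζ : LocalSubring K} {M : Model} {Z : Set (LocalSubring K)} {y : Fin 4 → K} {n : ℕ}
  {F G : IntermediateField ℂ K}

/-- The residue field of `R` has transcendence degree at least three. -/
def Big (R : LocalSubring K) : Prop := ∃ x : Fin 3 → K, Indep R x

/-- A `ℙ¹`-valued function with a constant finite value at `ζ` keeps that value on the whole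
closure, hence is finite at `R`. -/
lemma mem_of_mem_or_inv_mem (hc : ∀ c, const c ∈ R.toSubring) (hRζ : R.toSubring ≤ ζ.toSubring)
    {x : K} {c : ℂ} (hx : x ∈ R.toSubring ∨ x⁻¹ ∈ R.toSubring) (hxc : x - const c ∈ maxIdeal ζ) :
    x ∈ R.toSubring := by
  refine hx.elim id fun hx => ?_
  rcases eq_or_ne x 0 with rfl | h0
  · exact zero_mem _
  have hcζ := fun c => hRζ (hc c)
  rcases eq_or_ne c 0 with rfl | hc0
  · rw [const_zero, sub_zero] at hxc
    exact absurd (hRζ hx) (inv_notMem_of_mem_maxIdeal hxc h0)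
  · have hxi : x⁻¹ ∉ maxIdeal R := by
      intro hm
      have hm' : (const c)⁻¹ - x⁻¹ ∈ maxIdeal ζ := by
        have : (const c)⁻¹ - x⁻¹ = x⁻¹ * const c⁻¹ * (x - const c) := by
          rw [const_inv]
          field_simp [const_ne_zero hc0]
        rw [this]
        exact mul_mem_maxIdeal (mul_mem (hRζ hx) (hcζ _)) hxc
      rw [← const_inv] at hm'
      have h1 := add_mem_maxIdeal (mem_maxIdeal_of_le hRζ (sub_mem (hc _) hx) hm') hm
      rw [sub_add_cancel] at h1
      exact const_notMem_maxIdeal hc (inv_ne_zero hc0) h1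
    have := inv_mem_of_notMem_maxIdeal hx hxi
    rwa [inv_inv] at this

/-- The quotient of index `j` is trivial, so an ideal with `n + 1` generators has blow-up fibres of
dimension at most `n`. -/
lemma blowUpRing_range_le {n : ℕ} (f : Fin (n + 1) → K) (j : Fin (n + 1)) :
    blowUpRing R (Set.range f) (f j) ≤
      Subring.closure (R.toSubring ∪ Set.range fun i => f (j.succAbove i) / f j) := by
  refine blowUpRing_le (fun a ha => Subring.subset_closure (Or.inl ha)) ?_
  rintro _ ⟨i, rfl⟩
  rcases Fin.eq_self_or_eq_succAbove j i with rfl | ⟨k, rfl⟩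
  · by_cases h0 : f i = 0
    · rw [h0, div_zero]
      exact zero_mem _
    · rw [div_self h0]
      exact one_mem _
  · exact Subring.subset_closure (Or.inr ⟨k, rfl⟩)

/-- The blow-up along the surface `ζ`. -/
lemma IsSurface.blowUp_cases (hgen : IsGenericPt Z ζ)
    (hsurf : IsSurface F G (y 0) (y 1) ζ)
    (hprod : ∀ R ∈ M, R.toSubring ≤ ζ.toSubring →
      IsProd F G R ∧ y 0 ∈ R.toSubring ∧ y 1 ∈ R.toSubring) (hS : S ∈ blowUp M Z) :
    (S ∈ M ∧ ¬ S.toSubring ≤ ζ.toSubring) ∨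
      ∃ R ∈ M, R ≤ S ∧ R.toSubring ≤ ζ.toSubring ∧ IsProd F G S ∧
        ∃ j, (∀ i, ![y 0, y 1] i / ![y 0, y 1] j ∈ S.toSubring) ∧
          IsLocOf (blowUpRing R (Set.range ![y 0, y 1]) (![y 0, y 1] j)) S := by
  obtain ⟨R, hR, hRS, g, hg, hg0, hS⟩ := mem_blowUp.1 hS
  by_cases h : R.toSubring ≤ ζ.toSubring
  · obtain ⟨hp, h0, h1⟩ := hprod R hR h
    rw [idealAt_eq_vanishing hgen h] at hg hS
    obtain ⟨j, hj, hjS, hS⟩ := exists_chart (hsurf.isGenBy hp h h0 h1) hRS hg hg0 hS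
    exact Or.inr ⟨R, hR, hRS, h, hsurf.isProd_blowUp hp h h0 h1 hRS hj hS, j, hjS, hS⟩
  · obtain rfl := eq_of_mem_blowUp_of_not_le hgen h hRS hg hg0 hS
    exact Or.inl ⟨hR, h⟩

/-- Two generators give fibres of dimension at most one. A big point over the centre thus lies over
a point with transcendence degree at least two, which must be the generic point of the surface. -/
lemma IsSurface.big_cases (hM : IsVar M) (hgen : IsGenericPt Z ζ) (hζM : ζ ∈ M)
    (hy : IsCoord y) (hζ : IsCoordLoc y 2 ζ) (hT : IsCoordLoc (excTwo y) 1 T)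
    (hsurf : IsSurface F G (y 0) (y 1) ζ)
    (hprod : ∀ R ∈ M, R.toSubring ≤ ζ.toSubring →
      IsProd F G R ∧ y 0 ∈ R.toSubring ∧ y 1 ∈ R.toSubring) (hS : S ∈ blowUp M Z)
    (hbig : Big S) : S ∈ M ∨ S = T := by
  rcases hsurf.blowUp_cases hgen hprod hS with ⟨h, -⟩ | ⟨R, hR, hRS, h, -, j, hjS, hS⟩
  · exact Or.inl h
  · right
    obtain ⟨x, hx⟩ := hbig
    obtain ⟨u, hu⟩ := exists_indep_of_le (n := 2) (m := 1) hRS hS (blowUpRing_range_le _ j)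
      (fun i => hjS _) (hM.const_mem hR) hx
    obtain rfl := hM.sep R hR ζ hζM ζ (le_of_indep hu h hζ.not_indep_three) le_rfl
    exact eq_excTwo hy hζ hT hRS hS hx

/-- The blow-up along the curve `ζ`. -/
lemma IsCurve.blowUp_cases (hM : IsVar M) (hgen : IsGenericPt Z ζ) {w : K} (hζ : IsCurve w ζ)
    (hw : ∀ R ∈ M, w ∈ R.toSubring ∨ w⁻¹ ∈ R.toSubring) (hE : ∀ R ∈ M, EmbDimLE R)
    (hS : S ∈ blowUp M Z) :
    (EmbDimLE S) ∧ ((S ∈ M ∧ ¬ S.toSubring ≤ ζ.toSubring) ∨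
      ∃ R ∈ M, R ≤ S ∧ R.toSubring ≤ ζ.toSubring ∧ (IsClosedPt R →
        ∃ (f : Fin 3 → K) (j : Fin 3), (∀ i, f i / f j ∈ S.toSubring) ∧
          IsLocOf (blowUpRing R (Set.range f) (f j)) S)) := by
  obtain ⟨R, hR, hRS, g, hg, hg0, hS⟩ := mem_blowUp.1 hS
  by_cases h : R.toSubring ≤ ζ.toSubring
  · rw [idealAt_eq_vanishing hgen h] at hg hS
    have hc := hM.const_mem hR
    obtain ⟨s, hs, -⟩ := hM.ft R hR
    obtain ⟨m, u, -, hu⟩ := FujiSuzukiTsuda.exists_isGenBy hgen s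
    have hu := hu R hs
    rw [idealAt_eq_vanishing hgen h] at hu
    -- A closed point upstairs lies over a closed point, so regular parameters are needed at closed
    -- points only.
    refine ⟨fun hclS => ?_, Or.inr ⟨R, hR, hRS, h, fun hcl => ?_⟩⟩
    · have hcl := hclS.of_le hc hRS
      obtain ⟨x, f, hf, hx⟩ := hζ.exists_isGenBy h hc (hw R hR) hcl (hE R hR) hu
      obtain ⟨j, hj, hjS, hS⟩ := exists_chart hf hRS hg hg0 hS
      exact embDimLE_blowUpRing hc hRS hcl (fun i => vanishing_subset h (hf.1 i)) hx hj hjS hS hclS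
    · obtain ⟨x, f, hf, hx⟩ := hζ.exists_isGenBy h hc (hw R hR) hcl (hE R hR) hu
      obtain ⟨j, hj, hjS, hS⟩ := exists_chart hf hRS hg hg0 hS
      exact ⟨f, j, hjS, hS⟩
  · obtain rfl := eq_of_mem_blowUp_of_not_le hgen h hRS hg hg0 hS
    exact ⟨hE _ hR, Or.inl ⟨hR, h⟩⟩

/-- A point of the curve is generic or closed. Over a closed point, three generators give fibres of
dimension at most two, too small for a big point. -/
lemma IsCurve.big_cases (hM : IsVar M) (hgen : IsGenericPt Z ζ) (hζM : ζ ∈ M)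
    (hy : IsCoord y) (hζ : IsCoordLoc y 3 ζ) (hT : IsCoordLoc (excThree y) 1 T)
    (hw : ∀ R ∈ M, y 3 ∈ R.toSubring ∨ (y 3)⁻¹ ∈ R.toSubring) (hE : ∀ R ∈ M, EmbDimLE R)
    (hS : S ∈ blowUp M Z) (hbig : Big S) : S ∈ M ∨ S = T := by
  rcases (hζ.isCurve.blowUp_cases hM hgen hw hE hS).2 with ⟨h, -⟩ | ⟨R, hR, hRS, h, hcl⟩
  · exact Or.inl h
  right
  obtain ⟨x, hx⟩ := hbig
  by_cases hind : ∃ u : Fin 1 → K, Indep R u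
  · obtain ⟨u, hu⟩ := hind
    obtain rfl := hM.sep R hR ζ hζM ζ (le_of_indep hu h hζ.not_indep_two) le_rfl
    obtain ⟨R', hR', hRS', g, hg, hg0, hS⟩ := mem_blowUp.1 hS
    obtain rfl := hM.sep R hR R' hR' S hRS hRS'
    rw [idealAt_eq_vanishing hgen le_rfl] at hg hS
    have := hζ.isGenBy_three
    rw [← vanishing_self] at this
    obtain ⟨j, hj, hjS, hS⟩ := exists_chart this hRS hg hg0 hS
    exact eq_excThree hy hζ hT hRS hS hx
  · exfalso
    have hcl' := isClosedPt_of_not_indep (hM.const_mem hR) fun u hu => hind ⟨u, hu⟩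
    obtain ⟨f, j, hjS, hS⟩ := hcl hcl'
    obtain ⟨u, hu⟩ := exists_indep_of_le (n := 1) (m := 2) hRS hS (blowUpRing_range_le _ j)
      (fun i => hjS _) (hM.const_mem hR) hx
    exact hind ⟨u, hu⟩

/-- The local ring of the generic point of `y₀ = … = y_{n-1} = 0`. -/
def coordLoc (y : Fin 4 → K) (n : ℕ) : LocalSubring K :=
  @Classical.epsilon _ ⟨LocalSubring.ofPrime ⊥ ⊥⟩ (IsCoordLoc y n)

lemma isCoordLoc_coordLoc (hy : IsCoord y) (hn : n ≤ 4) : IsCoordLoc y n (coordLoc y n) := by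
  obtain ⟨S, hS, -⟩ := exists_isCoordLoc hy hn
  exact Classical.epsilon_spec_aux _ _ ⟨S, hS⟩

lemma ringKrullDim_coordLoc (hy : IsCoord y) (hn : n ≤ 4) :
    ringKrullDim (coordLoc y n).toSubring = n := by
  obtain ⟨S, hS, hdim⟩ := exists_isCoordLoc hy hn
  rwa [(isCoordLoc_coordLoc hy hn).unique hS]

/-- The coordinates `y` of a chart are adapted to a centre of codimension `n`. -/
structure IsAdapted (C : Center) (y : Fin 4 → K) (n : ℕ) : Prop where
  coord : IsCoord y
  chart : gen (Set.range C.chart) = gen (Set.range y)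
  eqs : C.eqs = y '' {i | (i : ℕ) < n}

lemma IsAdapted.isGenericPt {C : Center} (h : IsAdapted C y n) (hn : n ≤ 4)
    (hM : coordLoc y n ∈ M) : IsGenericPt (C.locus M) (coordLoc y n) := by
  have hζ := isCoordLoc_coordLoc h.coord hn
  refine hζ.isGenericPt hM h.chart ?_ ?_
  · rw [h.eqs]
    rintro _ ⟨i, hi, rfl⟩
    exact hζ.mem_maxIdeal i hi
  · intro z hz _ i hi
    rw [h.eqs] at hz
    exact hz ⟨i, hi, rfl⟩

lemma gen_eq_gen {ι κ : Type*} {x : ι → K} {y : κ → K} (hx : ∀ i, x i ∈ gen (Set.range y))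
    (hy : ∀ i, y i ∈ gen (Set.range x)) : gen (Set.range x) = gen (Set.range y) := by
  refine le_antisymm (gen_le (const_mem_gen _) ?_) (gen_le (const_mem_gen _) ?_)
  · rintro _ ⟨i, rfl⟩
    exact hx i
  · rintro _ ⟨i, rfl⟩
    exact hy i

end steps


/-! ### The twelve centres -/

section concreteCentres

variable (A : Param)

/-- Coordinates adapted to the centres. -/
def centerCoord : Fin 12 → Fin 4 → K :=
  ![![q₁, r₁, q₂, r₂],
    ![q₁⁻¹, r₁ + const A.a₁, q₂, r₂],
    ![q₂, r₂, q₁, r₁],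
    ![q₂⁻¹, r₂ + const A.a₅, q₁, r₁],
    ![q₁, q₂, r₁ + r₂ - const A.a₃ + const A.η, r₁],
    ![q₁⁻¹, q₂⁻¹, r₁ + r₂ + const A.η, r₁],
    ![r₁⁻¹, q₁ - const A.t, q₂, r₂],
    ![u₇, v₇ A - const (A.a₂ * A.t), q₂, r₂],
    ![r₂⁻¹, q₂ - 1, q₁, r₁],
    ![u₉, v₉ - const A.a₄, q₁, r₁],
    ![r₁⁻¹, r₂⁻¹, q₁ - q₂, q₂],
    ![u₁₁, v₁₁ + 1, w₁₁ - const A.a₀ * q₂, q₂]]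

/-- The codimensions of the centres. -/
def codim : Fin 12 → ℕ := ![2, 2, 2, 2, 3, 3, 2, 2, 2, 2, 3, 3]

lemma codim_add_centerDim (k : Fin 12) : codim k + centerDim k = 4 := by
  revert k
  decide

lemma image_lt_two (y : Fin 4 → K) : y '' {i | (i : ℕ) < 2} = {y 0, y 1} := by
  have : {i : Fin 4 | (i : ℕ) < 2} = {0, 1} := by
    ext i
    fin_cases i <;> simp
  rw [this, Set.image_pair]

lemma image_lt_three (y : Fin 4 → K) : y '' {i | (i : ℕ) < 3} = {y 0, y 1, y 2} := by
  have : {i : Fin 4 | (i : ℕ) < 3} = {0, 1, 2} := by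
    ext i
    fin_cases i <;> simp
  rw [this, Set.image_insert_eq, Set.image_pair]

lemma isCoord_of_mem {y : Fin 4 → K} {L : IntermediateField ℂ K}
    (hL : L = IntermediateField.adjoin ℂ (Set.range y)) (h1 : q₁ ∈ L) (h2 : q₂ ∈ L) (h3 : r₁ ∈ L)
    (h4 : r₂ ∈ L) : IsCoord y := by
  subst hL
  refine isCoord_of_adjoin fun i => ?_
  fin_cases i
  exacts [h1, h2, h3, h4]

lemma add_const_mem_iff {L : IntermediateField ℂ K} {x : K} (c : ℂ) :
    x + const c ∈ L ↔ x ∈ L :=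
  ⟨fun h => by simpa [const] using sub_mem h (L.algebraMap_mem c), fun h => add_mem h (L.algebraMap_mem c)⟩

lemma sub_const_mem_iff {L : IntermediateField ℂ K} {x : K} (c : ℂ) :
    x - const c ∈ L ↔ x ∈ L := by
  rw [sub_eq_add_neg, ← const_neg, add_const_mem_iff]

lemma inv_mem_field {L : IntermediateField ℂ K} {x : K} : x⁻¹ ∈ L ↔ x ∈ L :=
  ⟨fun h => by simpa using inv_mem h, fun h => inv_mem h⟩

lemma div_mem_field {L : IntermediateField ℂ K} {x y : K} (hy : y ∈ L) (h0 : y ≠ 0) :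
    x / y ∈ L ↔ x ∈ L :=
  ⟨fun h => by simpa [div_mul_cancel₀ _ h0] using mul_mem h hy, fun h => div_mem h hy⟩

lemma q₁_ne_zero : q₁ ≠ 0 := coord_ne_zero 0
lemma q₂_ne_zero : q₂ ≠ 0 := coord_ne_zero 1
lemma r₁_ne_zero : r₁ ≠ 0 := coord_ne_zero 2
lemma r₂_ne_zero : r₂ ≠ 0 := coord_ne_zero 3

/-- The adapted coordinates list the equations first and then the coordinates along the centre; they
differ from the chart by polynomial substitutions invertible over `ℂ`. -/
lemma isAdapted (k : Fin 12) : IsAdapted (center A k) (centerCoord A k) (codim k) := by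
  have hcoord : IsCoord (centerCoord A k) := by
    have h : ∀ i, centerCoord A k i ∈ IntermediateField.adjoin ℂ (Set.range (centerCoord A k)) :=
      fun i => IntermediateField.subset_adjoin ℂ _ ⟨i, rfl⟩
    generalize hL : IntermediateField.adjoin ℂ (Set.range (centerCoord A k)) = L at h
    have h0 := h 0
    have h1 := h 1
    have h2 := h 2
    have h3 := h 3
    clear h
    fin_cases k
    · exact isCoord_of_mem hL.symm h0 h2 h1 h3
    · exact isCoord_of_mem hL.symm (inv_mem_field.1 h0) h2 ((add_const_mem_iff _).1 h1) h3
    · exact isCoord_of_mem hL.symm h2 h0 h3 h1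
    · exact isCoord_of_mem hL.symm h2 (inv_mem_field.1 h0) h3 ((add_const_mem_iff _).1 h1)
    · refine isCoord_of_mem hL.symm h0 h1 h3 ?_
      have := sub_mem ((sub_const_mem_iff _).1 ((add_const_mem_iff _).1 h2)) h3
      change r₁ + r₂ - r₁ ∈ L at this
      rwa [add_sub_cancel_left] at this
    · refine isCoord_of_mem hL.symm (inv_mem_field.1 h0) (inv_mem_field.1 h1) h3 ?_
      have := sub_mem ((add_const_mem_iff _).1 h2) h3
      change r₁ + r₂ - r₁ ∈ L at this
      rwa [add_sub_cancel_left] at this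
    · exact isCoord_of_mem hL.symm ((sub_const_mem_iff _).1 h1) h2 (inv_mem_field.1 h0) h3
    · exact isCoord_of_mem hL.symm ((sub_const_mem_iff _).1 ((div_mem_field h0
        (inv_ne_zero r₁_ne_zero)).1 ((sub_const_mem_iff _).1 h1))) h2 (inv_mem_field.1 h0) h3
    · refine isCoord_of_mem hL.symm h2 ((sub_const_mem_iff 1).1 ?_) h3 (inv_mem_field.1 h0)
      rw [const_one]
      exact h1
    · refine isCoord_of_mem hL.symm h2 ((sub_const_mem_iff 1).1 ?_) h3 (inv_mem_field.1 h0)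
      rw [const_one]
      exact (div_mem_field h0 (inv_ne_zero r₂_ne_zero)).1 ((sub_const_mem_iff _).1 h1)
    · refine isCoord_of_mem hL.symm ?_ h3 (inv_mem_field.1 h0) (inv_mem_field.1 h1)
      have := add_mem h2 h3
      change q₁ - q₂ + q₂ ∈ L at this
      rwa [sub_add_cancel] at this
    · have h2' : w₁₁ ∈ L := by
        have := add_mem h2 (mul_mem (L.algebraMap_mem A.a₀) h3)
        change w₁₁ - const A.a₀ * q₂ + const A.a₀ * q₂ ∈ L at this
        rwa [sub_add_cancel] at this
      have h2'' := (div_mem_field h0 (inv_ne_zero r₁_ne_zero)).1 h2'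
      refine isCoord_of_mem hL.symm ?_ h3 (inv_mem_field.1 h0) ?_
      · have := add_mem h2'' h3
        change q₁ - q₂ + q₂ ∈ L at this
        rwa [sub_add_cancel] at this
      · refine inv_mem_field.1 ((div_mem_field h0 (inv_ne_zero r₁_ne_zero)).1 ?_)
        refine (add_const_mem_iff 1).1 ?_
        rw [const_one]
        exact h1
  have h : ∀ i, centerCoord A k i ∈ gen (Set.range (centerCoord A k)) :=
    fun i => subset_gen _ ⟨i, rfl⟩
  have h' : ∀ i, (center A k).chart i ∈ gen (Set.range (center A k).chart) :=
    fun i => subset_gen _ ⟨i, rfl⟩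
  have hc := fun c => const_mem_gen (Set.range (centerCoord A k)) c
  have hc' := fun c => const_mem_gen (Set.range (center A k).chart) c
  refine ⟨hcoord, gen_eq_gen (fun i => ?_) (fun i => ?_), ?_⟩
  · clear h' hc' hcoord
    revert i
    rw [Fin.forall_fin_succ, Fin.forall_fin_succ, Fin.forall_fin_succ, Fin.forall_fin_one]
    generalize gen (Set.range (centerCoord A k)) = B at h hc
    fin_cases k
    · exact ⟨h 0, h 2, h 1, h 3⟩
    · exact ⟨h 0, h 2, by simpa [centerCoord, center] using sub_mem (h 1) (hc A.a₁), h 3⟩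
    · exact ⟨h 2, h 0, h 3, h 1⟩
    · exact ⟨h 2, h 0, h 3, by simpa [centerCoord, center] using sub_mem (h 1) (hc A.a₅)⟩
    · refine ⟨h 0, h 1, h 3, ?_⟩
      convert sub_mem (sub_mem (add_mem (h 2) (hc A.a₃)) (hc A.η)) (h 3) using 1
      change r₂ = r₁ + r₂ - const A.a₃ + const A.η + const A.a₃ - const A.η - r₁
      ring
    · refine ⟨h 0, h 1, h 3, ?_⟩
      convert sub_mem (sub_mem (h 2) (hc A.η)) (h 3) using 1
      simp [centerCoord, center]
    · exact ⟨by simpa [centerCoord, center] using add_mem (h 1) (hc A.t), h 2, h 0, h 3⟩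
    · exact ⟨by simpa [centerCoord, center] using add_mem (h 1) (hc (A.a₂ * A.t)), h 2, h 0, h 3⟩
    · exact ⟨h 2, by simpa [centerCoord, center] using add_mem (h 1) (one_mem _), h 3, h 0⟩
    · exact ⟨h 2, by simpa [centerCoord, center] using add_mem (h 1) (hc A.a₄), h 3, h 0⟩
    · exact ⟨by simpa [centerCoord, center] using add_mem (h 2) (h 3), h 3, h 0, h 1⟩
    · refine ⟨?_, h 3, h 0, by simpa [centerCoord, center] using sub_mem (h 1) (one_mem _)⟩
      simpa [centerCoord, center] using add_mem (h 2) (mul_mem (hc A.a₀) (h 3))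
  · clear h hc hcoord
    revert i
    rw [Fin.forall_fin_succ, Fin.forall_fin_succ, Fin.forall_fin_succ, Fin.forall_fin_one]
    generalize gen (Set.range (center A k).chart) = B at h' hc'
    fin_cases k
    exacts [⟨h' 0, h' 2, h' 1, h' 3⟩, ⟨h' 0, add_mem (h' 2) (hc' A.a₁), h' 1, h' 3⟩,
      ⟨h' 1, h' 3, h' 0, h' 2⟩, ⟨h' 1, add_mem (h' 3) (hc' A.a₅), h' 0, h' 2⟩,
      ⟨h' 0, h' 1, add_mem (sub_mem (add_mem (h' 2) (h' 3)) (hc' A.a₃)) (hc' A.η), h' 2⟩,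
      ⟨h' 0, h' 1, add_mem (add_mem (h' 2) (h' 3)) (hc' A.η), h' 2⟩,
      ⟨h' 2, sub_mem (h' 0) (hc' A.t), h' 1, h' 3⟩, ⟨h' 2, sub_mem (h' 0) (hc' _), h' 1, h' 3⟩,
      ⟨h' 3, sub_mem (h' 1) (one_mem _), h' 0, h' 2⟩, ⟨h' 3, sub_mem (h' 1) (hc' _), h' 0, h' 2⟩,
      ⟨h' 2, h' 3, sub_mem (h' 0) (h' 1), h' 1⟩,
      ⟨h' 2, add_mem (h' 3) (one_mem _), sub_mem (h' 0) (mul_mem (hc' _) (h' 1)), h' 1⟩]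
  · fin_cases k
    · exact (image_lt_two (centerCoord A 0)).symm
    · exact (image_lt_two (centerCoord A 1)).symm
    · exact (image_lt_two (centerCoord A 2)).symm
    · exact (image_lt_two (centerCoord A 3)).symm
    · exact (image_lt_three (centerCoord A 4)).symm
    · exact (image_lt_three (centerCoord A 5)).symm
    · exact (Set.pair_comm _ _).trans (image_lt_two (centerCoord A 6)).symm
    · exact (image_lt_two (centerCoord A 7)).symm
    · exact (Set.pair_comm _ _).trans (image_lt_two (centerCoord A 8)).symm
    · exact (image_lt_two (centerCoord A 9)).symm
    · refine Eq.trans ?_ (image_lt_three (centerCoord A 10)).symm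
      change ({q₁ - q₂, r₁⁻¹, r₂⁻¹} : Set K) = {r₁⁻¹, r₂⁻¹, q₁ - q₂}
      ext x
      simp only [Set.mem_insert_iff, Set.mem_singleton_iff]
      tauto
    · exact (image_lt_three (centerCoord A 11)).symm

end concreteCentres


/-! ### The successive blow-ups -/

section stages

variable {A : Param} {R S T ζ : LocalSubring K} {F G : IntermediateField ℂ K}

/-- The generic points of the centres. -/
def genPt (A : Param) (k : Fin 12) : LocalSubring K := coordLoc (centerCoord A k) (codim k)

/-- Coordinates adapted to the exceptional divisors. -/
def excCoord (A : Param) (k : Fin 12) : Fin 4 → K :=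
  if codim k = 2 then excTwo (centerCoord A k) else excThree (centerCoord A k)

/-- The local rings of the exceptional divisors. -/
def exc (A : Param) (k : Fin 12) : LocalSubring K := coordLoc (excCoord A k) 1

/-- The function field of the first factor. -/
def F₁ : IntermediateField ℂ K := IntermediateField.adjoin ℂ {q₁, r₁}

/-- The function field of the second factor. -/
def F₂ : IntermediateField ℂ K := IntermediateField.adjoin ℂ {q₂, r₂}

lemma codim_le (k : Fin 12) : codim k ≤ 4 := by
  revert k
  decide

lemma codim_eq (k : Fin 12) : codim k = 2 ∨ codim k = 3 := by
  revert k
  decide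

lemma isCoordLoc_genPt (A : Param) (k : Fin 12) :
    IsCoordLoc (centerCoord A k) (codim k) (genPt A k) :=
  isCoordLoc_coordLoc (isAdapted A k).coord (codim_le k)

lemma isCoord_excCoord (A : Param) (k : Fin 12) : IsCoord (excCoord A k) := by
  unfold excCoord
  split_ifs
  · exact isCoord_excTwo (isAdapted A k).coord
  · exact isCoord_excThree (isAdapted A k).coord

lemma isCoordLoc_exc (A : Param) (k : Fin 12) : IsCoordLoc (excCoord A k) 1 (exc A k) :=
  isCoordLoc_coordLoc (isCoord_excCoord A k) (by norm_num)

lemma stage_succ (A : Param) (k : Fin 12) :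
    stage A (k + 1) = blowUp (stage A k) ((center A k).locus (stage A k)) := by
  rw [stage, dif_pos k.2]

/-- The properties of the stages of the construction. -/
structure IsGoodStage (A : Param) (k : ℕ) : Prop where
  isVar : IsVar (stage A k)
  dom : ∀ R ∈ stage A k, ∃ R₀ ∈ projLinePow4, R₀ ≤ R
  emb : ∀ R ∈ stage A k, EmbDimLE R
  prod : k ≤ 4 → ∀ R ∈ stage A k, IsProd F₁ F₂ R
  prod_or : k ≤ 10 → ∀ R ∈ stage A k, IsProd F₁ F₂ R ∨ (q₁ ∈ maxIdeal R ∧ q₂ ∈ maxIdeal R) ∨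
    (q₁⁻¹ ∈ maxIdeal R ∧ q₂⁻¹ ∈ maxIdeal R)
  genPt_mem : ∀ j : Fin 12, j < k → genPt A j ∈ stage A j
  big : ∀ R ∈ stage A k, Big R → R ∈ projLinePow4 ∨ ∃ j : Fin 12, j < k ∧ R = exc A j
  mem_of_big : ∀ R ∈ projLinePow4, Big R → R ∈ stage A k
  exc_mem : ∀ j : Fin 12, j < k → exc A j ∈ stage A k

lemma isGenericPt_genPt {k : Fin 12} (h : genPt A k ∈ stage A k) :
    IsGenericPt ((center A k).locus (stage A k)) (genPt A k) :=
  (isAdapted A k).isGenericPt (codim_le k) h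

lemma IsGoodStage.coord_mem_or {k : ℕ} (h : IsGoodStage A k) (hR : R ∈ stage A k) (i : Fin 4) :
    coord i ∈ R.toSubring ∨ (coord i)⁻¹ ∈ R.toSubring := by
  obtain ⟨R₀, hR₀, hle⟩ := h.dom R hR
  obtain ⟨ε, hε⟩ := mem_projLinePow4.1 hR₀
  have := hle.1 (hε.1 (subset_gen _ ⟨i, rfl⟩))
  cases hi : ε i <;> simp [hi] at this
  exacts [Or.inl this, Or.inr this]

/-- A point of `(ℙ¹)⁴` outside all earlier centres is untouched by the earlier blow-ups. This is how
the generic points of the centres given in charts of `(ℙ¹)⁴` are shown to survive. -/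
lemma IsGoodStage.mem_of_not_le {k : ℕ} (h : IsGoodStage A k) (hk : k ≤ 12)
    (hζ : ζ ∈ projLinePow4)
    (hn : ∀ j : Fin 12, j < k → ¬ ζ.toSubring ≤ (genPt A j).toSubring) : ζ ∈ stage A k := by
  have key : ∀ i, i ≤ k → ζ ∈ stage A i := by
    intro i
    induction i with
    | zero => exact fun _ => hζ
    | succ i ih =>
      intro hi
      have := stage_succ A ⟨i, by omega⟩
      rw [this]
      exact mem_blowUp_of_not_le (isGenericPt_genPt (h.genPt_mem ⟨i, by omega⟩ hi)) (ih (by omega))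
        (hn ⟨i, by omega⟩ hi)
  exact key k le_rfl

lemma big_exc (A : Param) (k : Fin 12) : Big (exc A k) := ⟨_, (isCoordLoc_exc A k).indep_one⟩

lemma not_indep_genPt (A : Param) (k : Fin 12) (z : Fin 3 → K) : ¬ Indep (genPt A k) z := by
  intro hz
  have h := isCoordLoc_genPt A k
  rcases codim_eq k with hk | hk <;> rw [hk] at h
  · exact h.not_indep_three z hz
  · exact h.not_indep_two _ (hz.comp (f := ![0, 1]) (by decide))

lemma mem_stage_succ {k : Fin 12} (hmem : genPt A k ∈ stage A k)
    (hR : R ∈ stage A k) (hbig : Big R) : R ∈ stage A (k + 1) := by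
  rw [stage_succ]
  obtain ⟨x, hx⟩ := hbig
  exact mem_blowUp_of_indep (isGenericPt_genPt hmem) (not_indep_genPt A k) hR hx

lemma IsGoodStage.exc_mem_succ {k : Fin 12} (h : IsGoodStage A k) (hmem : genPt A k ∈ stage A k)
    (j : Fin 12) (hj : (j : ℕ) < k + 1) : exc A j ∈ stage A (k + 1) := by
  rcases Nat.lt_succ_iff_lt_or_eq.1 hj with hj | hj
  · exact mem_stage_succ hmem (h.exc_mem j hj) (big_exc A j)
  · obtain rfl := Fin.ext hj
    rw [stage_succ]
    have hy := (isAdapted A j).coord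
    have hζ := isCoordLoc_genPt A j
    have hE := isCoordLoc_exc A j
    rcases codim_eq j with hk | hk <;> simp only [hk, excCoord] at hζ hE
    · exact excTwo_mem_blowUp hy hζ (isGenericPt_genPt hmem) hmem hE
    · exact excThree_mem_blowUp hy hζ (isGenericPt_genPt hmem) hmem hE

lemma isGoodStage_zero (A : Param) : IsGoodStage A 0 := by
  have hprod : ∀ R ∈ stage A 0, IsProd F₁ F₂ R := by
    intro R hR
    obtain ⟨ε, hε⟩ := mem_projLinePow4.1 hR
    have hmem : ∀ (L : IntermediateField ℂ K) (b : Bool) (x : K), x ∈ L →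
        (if b then x⁻¹ else x) ∈ L := by
      rintro L (_ | _) x hx
      exacts [hx, inv_mem hx]
    refine ⟨_, hmem F₁ (ε 0) q₁ ?_, _, hmem F₁ (ε 2) r₁ ?_, _, hmem F₂ (ε 1) q₂ ?_,
      _, hmem F₂ (ε 3) r₂ ?_, ?_⟩
    · exact IntermediateField.subset_adjoin _ _ (by simp)
    · exact IntermediateField.subset_adjoin _ _ (by simp)
    · exact IntermediateField.subset_adjoin _ _ (by simp)
    · exact IntermediateField.subset_adjoin _ _ (by simp)
    · convert hε using 2
      ext x
      simp only [Set.mem_insert_iff, Set.mem_singleton_iff, Set.mem_range, Fin.exists_fin_succ,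
        q₁, q₂, r₁, r₂, eq_comm (a := x)]
      simp
      tauto
  exact ⟨isVar_projLinePow4, fun R hR => ⟨R, hR, le_rfl⟩, fun R hR => (hprod R hR).embDimLE,
    fun _ => hprod, fun _ R hR => Or.inl (hprod R hR), fun j hj => absurd hj (Nat.not_lt_zero _),
    fun R hR _ => Or.inl hR, fun R hR _ => hR, fun j hj => absurd hj (Nat.not_lt_zero _)⟩

/-- The product structure is required only near the centre, because after the first curve blow-ups
it no longer holds everywhere. -/
lemma IsGoodStage.succ_surface {k : Fin 12} (h : IsGoodStage A k) (hk : codim k = 2)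
    (hmem : genPt A k ∈ stage A k)
    (hF : IntermediateField.adjoin ℂ {centerCoord A k 0, centerCoord A k 1} = F)
    (hG : IntermediateField.adjoin ℂ {centerCoord A k 2, centerCoord A k 3} = G)
    (hFG : F = F₁ ∧ G = F₂ ∨ F = F₂ ∧ G = F₁)
    (hprod : ∀ R ∈ stage A k, R.toSubring ≤ (genPt A k).toSubring → IsProd F₁ F₂ R ∧
      centerCoord A k 0 ∈ R.toSubring ∧ centerCoord A k 1 ∈ R.toSubring) :
    IsGoodStage A (k + 1) := by
  have hprod' : ∀ R ∈ stage A k, R.toSubring ≤ (genPt A k).toSubring → IsProd F G R ∧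
      centerCoord A k 0 ∈ R.toSubring ∧ centerCoord A k 1 ∈ R.toSubring := by
    intro R hR hle
    refine ⟨?_, (hprod R hR hle).2⟩
    rcases hFG with ⟨rfl, rfl⟩ | ⟨rfl, rfl⟩
    exacts [(hprod R hR hle).1, (hprod R hR hle).1.symm]
  have hFG' : ∀ {S}, IsProd F G S → IsProd F₁ F₂ S := by
    intro S hS
    rcases hFG with ⟨rfl, rfl⟩ | ⟨rfl, rfl⟩
    exacts [hS, hS.symm]
  have hy := (isAdapted A k).coord
  have hζ := isCoordLoc_genPt A k
  have hE := isCoordLoc_exc A k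
  have hgen := isGenericPt_genPt hmem
  simp only [hk, excCoord, if_true] at hζ hE
  have hsurf := hζ.isSurface hy hF hG
  have hcases : ∀ S ∈ stage A (k + 1), S ∈ stage A k ∨ IsProd F₁ F₂ S := by
    intro S hS
    rw [stage_succ] at hS
    rcases hsurf.blowUp_cases hgen hprod' hS with ⟨h, -⟩ | ⟨R, -, -, -, h, -⟩
    exacts [Or.inl h, Or.inr (hFG' h)]
  refine ⟨?_, fun S hS => ?_, fun S hS => ?_, fun hk S hS => ?_, fun hk S hS => ?_,
    fun j hj => ?_, fun S hS hbig => ?_, fun S hS hbig => ?_, h.exc_mem_succ hmem⟩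
  · rw [stage_succ]
    exact h.isVar.blowUp hgen
  · rw [stage_succ] at hS
    obtain ⟨R, hR, hRS⟩ := exists_le_of_mem_blowUp hS
    obtain ⟨R₀, hR₀, hle⟩ := h.dom R hR
    exact ⟨R₀, hR₀, hle.trans hRS⟩
  · rcases hcases S hS with hS | hS
    exacts [h.emb S hS, hS.embDimLE]
  · rcases hcases S hS with hS | hS
    exacts [h.prod (by omega) S hS, hS]
  · rcases hcases S hS with hS | hS
    exacts [h.prod_or (by omega) S hS, Or.inl hS]
  · rcases Nat.lt_succ_iff_lt_or_eq.1 hj with hj | hj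
    · exact h.genPt_mem j hj
    · obtain rfl := Fin.ext hj
      exact hmem
  · rw [stage_succ] at hS
    rcases hsurf.big_cases h.isVar hgen hmem hy hζ hE hprod' hS hbig with hS | hS
    · rcases h.big S hS hbig with h | ⟨j, hj, rfl⟩
      exacts [Or.inl h, Or.inr ⟨j, by omega, rfl⟩]
    · exact Or.inr ⟨k, by omega, hS⟩
  · exact mem_stage_succ hmem (h.mem_of_big S hS hbig) hbig

/-- Blowing up a curve spoils the product structure over it. Before the last two curves this happens
only where `q₁` and `q₂` are both zero or both infinite, which the alternative `prod_or` records;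
the later surfaces avoid those points. -/
lemma IsGoodStage.succ_curve {k : Fin 12} (h : IsGoodStage A k) (hk : codim k = 3)
    (hmem : genPt A k ∈ stage A k) {i : Fin 4} (hi : centerCoord A k 3 = coord i)
    (hk4 : 4 ≤ (k : ℕ))
    (hprod : (k : ℕ) < 10 → ∀ R ∈ stage A k, R.toSubring ≤ (genPt A k).toSubring →
      (q₁ ∈ maxIdeal R ∧ q₂ ∈ maxIdeal R) ∨ (q₁⁻¹ ∈ maxIdeal R ∧ q₂⁻¹ ∈ maxIdeal R)) :
    IsGoodStage A (k + 1) := by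
  have hy := (isAdapted A k).coord
  have hζ := isCoordLoc_genPt A k
  have hE := isCoordLoc_exc A k
  have hgen := isGenericPt_genPt hmem
  have hk2 : ¬ codim k = 2 := by omega
  simp only [hk2, excCoord, if_false] at hE
  rw [hk] at hζ
  have hw : ∀ R ∈ stage A k,
      centerCoord A k 3 ∈ R.toSubring ∨ (centerCoord A k 3)⁻¹ ∈ R.toSubring := by
    intro R hR
    rw [hi]
    exact h.coord_mem_or hR i
  have hcases := fun S (hS : S ∈ stage A (k + 1)) =>
    hζ.isCurve.blowUp_cases h.isVar hgen hw h.emb (by rwa [← stage_succ])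
  refine ⟨?_, fun S hS => ?_, fun S hS => (hcases S hS).1, fun hk S hS => by omega,
    fun hk S hS => ?_, fun j hj => ?_, fun S hS hbig => ?_, fun S hS hbig => ?_,
    h.exc_mem_succ hmem⟩
  · rw [stage_succ]
    exact h.isVar.blowUp hgen
  · rw [stage_succ] at hS
    obtain ⟨R, hR, hRS⟩ := exists_le_of_mem_blowUp hS
    obtain ⟨R₀, hR₀, hle⟩ := h.dom R hR
    exact ⟨R₀, hR₀, hle.trans hRS⟩
  · rcases (hcases S hS).2 with ⟨hS, -⟩ | ⟨R, hR, hRS, hle, -⟩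
    · exact h.prod_or (by omega) S hS
    · right
      rcases hprod (by omega) R hR hle with ⟨h1, h2⟩ | ⟨h1, h2⟩
      exacts [Or.inl ⟨maxIdeal_subset_of_le hRS h1, maxIdeal_subset_of_le hRS h2⟩,
        Or.inr ⟨maxIdeal_subset_of_le hRS h1, maxIdeal_subset_of_le hRS h2⟩]
  · rcases Nat.lt_succ_iff_lt_or_eq.1 hj with hj | hj
    · exact h.genPt_mem j hj
    · obtain rfl := Fin.ext hj
      exact hmem
  · rw [stage_succ] at hS
    rcases IsCurve.big_cases h.isVar hgen hmem hy hζ hE hw h.emb hS hbig with hS | hS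
    · rcases h.big S hS hbig with h | ⟨j, hj, rfl⟩
      exacts [Or.inl h, Or.inr ⟨j, by omega, rfl⟩]
    · exact Or.inr ⟨k, by omega, hS⟩
  · exact mem_stage_succ hmem (h.mem_of_big S hS hbig) hbig

end stages


/-! ### The twelve blow-ups -/

section blowUps

open MvPolynomial

variable {A : Param} {R S T ζ : LocalSubring K} {M : Model} {Z : Set (LocalSubring K)}
  {y : Fin 4 → K} {n : ℕ}

/-- Needed for a centre lying on the exceptional divisor of the preceding blow-up, whose generic
point must be found in the new chart. -/
lemma mem_blowUp_excTwo (hy : IsCoord y) (hζ : IsCoordLoc y 2 ζ) (hgen : IsGenericPt Z ζ)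
    (hM : ζ ∈ M) (hle : ζ ≤ S) (hS : IsLocOf (gen (Set.range (excTwo y))) S) :
    S ∈ blowUp M Z := by
  refine mem_blowUp_of_isLocOf (j := 0) hgen hM hζ.isGenBy_two (hy.ne_zero 0) hle hS
    (gen_le ?_ ?_) fun i => ?_
  · exact fun c => le_blowUpRing _ _ _ (hζ.const_mem c)
  · rintro _ ⟨i, rfl⟩
    fin_cases i
    exacts [le_blowUpRing _ _ _ (hζ.mem 0), div_mem_blowUpRing _ _ ⟨1, rfl⟩,
      le_blowUpRing _ _ _ (hζ.mem 2), le_blowUpRing _ _ _ (hζ.mem 3)]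
  · fin_cases i
    · change y 0 / y 0 ∈ _
      rw [div_self (hy.ne_zero 0)]
      exact one_mem _
    · exact hS.1 (subset_gen _ ⟨1, rfl⟩)

lemma mem_blowUp_excThree (hy : IsCoord y) (hζ : IsCoordLoc y 3 ζ) (hgen : IsGenericPt Z ζ)
    (hM : ζ ∈ M) (hle : ζ ≤ S) (hS : IsLocOf (gen (Set.range (excThree y))) S) :
    S ∈ blowUp M Z := by
  refine mem_blowUp_of_isLocOf (j := 0) hgen hM hζ.isGenBy_three (hy.ne_zero 0) hle hS
    (gen_le ?_ ?_) fun i => ?_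
  · exact fun c => le_blowUpRing _ _ _ (hζ.const_mem c)
  · rintro _ ⟨i, rfl⟩
    fin_cases i
    exacts [le_blowUpRing _ _ _ (hζ.mem 0), div_mem_blowUpRing _ _ ⟨1, rfl⟩,
      div_mem_blowUpRing _ _ ⟨2, rfl⟩, le_blowUpRing _ _ _ (hζ.mem 3)]
  · fin_cases i
    · change y 0 / y 0 ∈ _
      rw [div_self (hy.ne_zero 0)]
      exact one_mem _
    · exact hS.1 (subset_gen _ ⟨1, rfl⟩)
    · exact hS.1 (subset_gen _ ⟨2, rfl⟩)

lemma IsCoordLoc.add_const_notMem (hS : IsCoordLoc y n S) (i : Fin 4) (hi : n ≤ (i : ℕ)) (c : ℂ) :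
    y i + const c ∉ maxIdeal S := by
  have := hS.notMem_of_eval (X i + C c) (fun j => if j = i then 1 - c else 0) (fun j hj => by
    rw [if_neg]
    rintro rfl
    omega) (by simp)
  simpa [const] using this

lemma IsCoordLoc.notMem (hS : IsCoordLoc y n S) (i : Fin 4) (hi : n ≤ (i : ℕ)) :
    y i ∉ maxIdeal S := by
  have := hS.add_const_notMem i hi 0
  rwa [const_zero, add_zero] at this

lemma IsCoordLoc.inv_mem (hS : IsCoordLoc y n S) (i : Fin 4) (hi : n ≤ (i : ℕ)) :
    (y i)⁻¹ ∈ S.toSubring :=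
  inv_mem_of_notMem_maxIdeal (hS.mem i) (hS.notMem i hi)

/-- The certificate for lying outside a closed set: a function that vanishes on the set and has a
regular inverse at the point. -/
lemma not_le_of_inv_mem {u : K} (hu : u ∈ maxIdeal S) (h0 : u ≠ 0) (h : u⁻¹ ∈ R.toSubring) :
    ¬ R.toSubring ≤ S.toSubring :=
  fun hle => inv_notMem_of_mem_maxIdeal hu h0 (hle h)

lemma not_le_of_mem {u : K} (hu : u⁻¹ ∈ maxIdeal S) (h0 : u ≠ 0) (h : u ∈ R.toSubring) :
    ¬ R.toSubring ≤ S.toSubring :=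
  not_le_of_inv_mem hu (inv_ne_zero h0) (by rwa [inv_inv])

lemma IsGoodStage.coord_mem {k : ℕ} (h : IsGoodStage A k) (hR : R ∈ stage A k)
    (hle : R.toSubring ≤ ζ.toSubring) (i : Fin 4) {c : ℂ} (hc : coord i - const c ∈ maxIdeal ζ) :
    coord i ∈ R.toSubring :=
  mem_of_mem_or_inv_mem (h.isVar.const_mem hR) hle (h.coord_mem_or hR i) hc

lemma IsGoodStage.coord_mem' {k : ℕ} (h : IsGoodStage A k) (hR : R ∈ stage A k)
    (hle : R.toSubring ≤ ζ.toSubring) (i : Fin 4) (hc : coord i ∈ maxIdeal ζ) :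
    coord i ∈ R.toSubring :=
  h.coord_mem hR hle i (c := 0) (by rwa [const_zero, sub_zero])

lemma IsGoodStage.coord_inv_mem {k : ℕ} (h : IsGoodStage A k) (hR : R ∈ stage A k)
    (hle : R.toSubring ≤ ζ.toSubring) (i : Fin 4) (hc : (coord i)⁻¹ ∈ maxIdeal ζ) :
    (coord i)⁻¹ ∈ R.toSubring := by
  refine mem_of_mem_or_inv_mem (c := 0) (h.isVar.const_mem hR) hle ?_ ?_
  · rw [inv_inv]
    exact (h.coord_mem_or hR i).symm
  · rwa [const_zero, sub_zero]

lemma mem_projLinePow4_of_chart (b : Fin 4 → Bool) {x : Fin 4 → K}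
    (hb : ∀ i, x i = if b i then (coord i)⁻¹ else coord i) (hR : IsLocOf (gen (Set.range x)) R) :
    R ∈ projLinePow4 := by
  rw [mem_projLinePow4]
  refine ⟨b, ?_⟩
  convert hR using 4
  exact (hb _).symm

lemma isLocOf_genPt (k : Fin 12) : IsLocOf (gen (Set.range (center A k).chart)) (genPt A k) := by
  rw [(isAdapted A k).chart]
  exact (isCoordLoc_genPt A k).1

lemma genPt_mem_projLinePow4 {k : Fin 12} (b : Fin 4 → Bool)
    (hb : ∀ i, (center A k).chart i = if b i then (coord i)⁻¹ else coord i) :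
    genPt A k ∈ projLinePow4 :=
  mem_projLinePow4_of_chart b hb (isLocOf_genPt k)

lemma adjoin_pair_eq {a b c d : K} (ha : a ∈ IntermediateField.adjoin ℂ {c, d})
    (hb : b ∈ IntermediateField.adjoin ℂ {c, d}) (hc : c ∈ IntermediateField.adjoin ℂ {a, b})
    (hd : d ∈ IntermediateField.adjoin ℂ {a, b}) :
    IntermediateField.adjoin ℂ {a, b} = IntermediateField.adjoin ℂ {c, d} := by
  refine le_antisymm (IntermediateField.adjoin_le_iff.2 ?_) (IntermediateField.adjoin_le_iff.2 ?_)
  · rintro _ (rfl | rfl)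
    exacts [ha, hb]
  · rintro _ (rfl | rfl)
    exacts [hc, hd]

lemma adjoin_swap (a b : K) :
    IntermediateField.adjoin ℂ {a, b} = IntermediateField.adjoin ℂ {b, a} := by
  rw [Set.pair_comm]

/-- The function fields of the factors in terms of the coordinates adapted to the surfaces. -/
lemma adjoin_left (a b c d : K) (β : ℂ) (h : c = a ∨ c = a⁻¹) (hd : d = b + const β) :
    IntermediateField.adjoin ℂ {c, d} = IntermediateField.adjoin ℂ {a, b} := by
  have h1 : ∀ a b : K, a ∈ IntermediateField.adjoin ℂ {a, b} := fun a b =>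
    IntermediateField.subset_adjoin _ _ (by simp)
  have h2 : ∀ a b : K, b ∈ IntermediateField.adjoin ℂ {a, b} := fun a b =>
    IntermediateField.subset_adjoin _ _ (by simp)
  subst hd
  have hd := (add_const_mem_iff β).1 (h2 c (b + const β))
  rcases h with rfl | rfl
  · exact adjoin_pair_eq (h1 _ _) ((add_const_mem_iff β).2 (h2 _ _)) (h1 _ _) hd
  · exact adjoin_pair_eq (inv_mem_field.2 (h1 _ _)) ((add_const_mem_iff β).2 (h2 _ _))
      (inv_mem_field.1 (h1 _ _)) hd

/-! #### The surfaces in `(ℙ¹)⁴` -/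

lemma genPt_mem_zero (A : Param) : genPt A 0 ∈ stage A 0 :=
  genPt_mem_projLinePow4 ![false, false, false, false] fun i => by fin_cases i <;> rfl

lemma isGoodStage_one (A : Param) : IsGoodStage A 1 := by
  have h := isGoodStage_zero A
  have hζ := isCoordLoc_genPt A 0
  refine IsGoodStage.succ_surface (k := 0) h rfl (genPt_mem_zero A) rfl rfl (Or.inl ⟨rfl, rfl⟩)
    fun R hR hle => ⟨h.prod (by norm_num) R hR, ?_, ?_⟩
  · exact h.coord_mem' hR hle 0 (hζ.mem_maxIdeal 0 (by decide))
  · exact h.coord_mem' hR hle 2 (hζ.mem_maxIdeal 1 (by decide))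

lemma genPt_mem_one (A : Param) : genPt A 1 ∈ stage A 1 := by
  have hζ := isCoordLoc_genPt A 1
  refine (isGoodStage_one A).mem_of_not_le (by norm_num)
    (genPt_mem_projLinePow4 ![true, false, false, false] fun i => by fin_cases i <;> rfl) ?_
  intro j hj
  obtain rfl : j = 0 := by omega
  exact not_le_of_inv_mem ((isCoordLoc_genPt A 0).mem_maxIdeal 0 (by decide)) q₁_ne_zero (hζ.mem 0)

lemma isGoodStage_two (A : Param) : IsGoodStage A 2 := by
  have h := isGoodStage_one A
  have hζ := isCoordLoc_genPt A 1
  refine IsGoodStage.succ_surface (k := 1) h rfl (genPt_mem_one A)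
    (adjoin_left q₁ r₁ _ _ A.a₁ (Or.inr rfl) rfl) rfl (Or.inl ⟨rfl, rfl⟩)
    fun R hR hle => ⟨h.prod (by norm_num) R hR, ?_, ?_⟩
  · exact h.coord_inv_mem hR hle 0 (hζ.mem_maxIdeal 0 (by decide))
  · refine add_mem (h.coord_mem hR hle 2 (c := -A.a₁) ?_) (h.isVar.const_mem hR _)
    rw [const_neg, sub_neg_eq_add]
    exact hζ.mem_maxIdeal 1 (by decide)

lemma genPt_mem_two (A : Param) : genPt A 2 ∈ stage A 2 := by
  have hζ := isCoordLoc_genPt A 2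
  refine (isGoodStage_two A).mem_of_not_le (by norm_num)
    (genPt_mem_projLinePow4 ![false, false, false, false] fun i => by fin_cases i <;> rfl) ?_
  intro j hj
  have : j = 0 ∨ j = 1 := by omega
  rcases this with rfl | rfl
  · exact not_le_of_inv_mem ((isCoordLoc_genPt A 0).mem_maxIdeal 0 (by decide)) q₁_ne_zero
      (hζ.inv_mem 2 (by decide))
  · exact not_le_of_mem ((isCoordLoc_genPt A 1).mem_maxIdeal 0 (by decide)) q₁_ne_zero (hζ.mem 2)

lemma isGoodStage_three (A : Param) : IsGoodStage A 3 := by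
  have h := isGoodStage_two A
  have hζ := isCoordLoc_genPt A 2
  refine IsGoodStage.succ_surface (k := 2) h rfl (genPt_mem_two A) rfl rfl (Or.inr ⟨rfl, rfl⟩)
    fun R hR hle => ⟨h.prod (by norm_num) R hR, ?_, ?_⟩
  · exact h.coord_mem' hR hle 1 (hζ.mem_maxIdeal 0 (by decide))
  · exact h.coord_mem' hR hle 3 (hζ.mem_maxIdeal 1 (by decide))

lemma genPt_mem_three (A : Param) : genPt A 3 ∈ stage A 3 := by
  have hζ := isCoordLoc_genPt A 3
  refine (isGoodStage_three A).mem_of_not_le (by norm_num)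
    (genPt_mem_projLinePow4 ![false, true, false, false] fun i => by fin_cases i <;> rfl) ?_
  intro j hj
  have : j = 0 ∨ j = 1 ∨ j = 2 := by omega
  rcases this with rfl | rfl | rfl
  exacts [not_le_of_inv_mem ((isCoordLoc_genPt A 0).mem_maxIdeal 0 (by decide)) q₁_ne_zero
      (hζ.inv_mem 2 (by decide)),
    not_le_of_mem ((isCoordLoc_genPt A 1).mem_maxIdeal 0 (by decide)) q₁_ne_zero (hζ.mem 2),
    not_le_of_inv_mem ((isCoordLoc_genPt A 2).mem_maxIdeal 0 (by decide)) q₂_ne_zero (hζ.mem 0)]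

lemma isGoodStage_four (A : Param) : IsGoodStage A 4 := by
  have h := isGoodStage_three A
  have hζ := isCoordLoc_genPt A 3
  refine IsGoodStage.succ_surface (k := 3) h rfl (genPt_mem_three A)
    (adjoin_left q₂ r₂ _ _ A.a₅ (Or.inr rfl) rfl) rfl (Or.inr ⟨rfl, rfl⟩)
    fun R hR hle => ⟨h.prod (by norm_num) R hR, ?_, ?_⟩
  · exact h.coord_inv_mem hR hle 1 (hζ.mem_maxIdeal 0 (by decide))
  · refine add_mem (h.coord_mem hR hle 3 (c := -A.a₅) ?_) (h.isVar.const_mem hR _)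
    rw [const_neg, sub_neg_eq_add]
    exact hζ.mem_maxIdeal 1 (by decide)

/-! #### The two curves at `q₁ = q₂ = 0, ∞` -/

lemma genPt_mem_four (A : Param) : genPt A 4 ∈ stage A 4 := by
  have hζ := isCoordLoc_genPt A 4
  -- On this curve `r₂` is a constant minus the free coordinate `r₁`, hence non-zero at the generic
  -- point.
  have hr₂ : r₂ ∉ maxIdeal (genPt A 4) := by
    intro h
    have h1 := sub_mem_maxIdeal (hζ.mem_maxIdeal 2 (by decide)) h
    refine hζ.add_const_notMem 3 (by decide) (A.η - A.a₃) ?_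
    convert h1 using 1
    change r₁ + const (A.η - A.a₃) = r₁ + r₂ - const A.a₃ + const A.η - r₂
    rw [const_sub]
    ring
  refine (isGoodStage_four A).mem_of_not_le (by norm_num)
    (genPt_mem_projLinePow4 ![false, false, false, false] fun i => by fin_cases i <;> rfl) ?_
  intro j hj
  have : j = 0 ∨ j = 1 ∨ j = 2 ∨ j = 3 := by omega
  rcases this with rfl | rfl | rfl | rfl
  exacts [not_le_of_inv_mem ((isCoordLoc_genPt A 0).mem_maxIdeal 1 (by decide)) r₁_ne_zero
      (hζ.inv_mem 3 (by decide)),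
    not_le_of_mem ((isCoordLoc_genPt A 1).mem_maxIdeal 0 (by decide)) q₁_ne_zero (hζ.mem 0),
    not_le_of_inv_mem ((isCoordLoc_genPt A 2).mem_maxIdeal 1 (by decide)) r₂_ne_zero
      (inv_mem_of_notMem_maxIdeal ((isLocOf_genPt 4).1 (subset_gen _ ⟨3, rfl⟩)) hr₂),
    not_le_of_mem ((isCoordLoc_genPt A 3).mem_maxIdeal 0 (by decide)) q₂_ne_zero (hζ.mem 1)]

lemma isGoodStage_five (A : Param) : IsGoodStage A 5 := by
  have h := isGoodStage_four A
  have hζ := isCoordLoc_genPt A 4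
  refine IsGoodStage.succ_curve (k := 4) h rfl (genPt_mem_four A) (i := 2) rfl (by decide)
    fun _ R hR hle => Or.inl ⟨?_, ?_⟩
  · exact mem_maxIdeal_of_le hle (h.coord_mem' hR hle 0 (hζ.mem_maxIdeal 0 (by decide)))
      (hζ.mem_maxIdeal 0 (by decide))
  · exact mem_maxIdeal_of_le hle (h.coord_mem' hR hle 1 (hζ.mem_maxIdeal 1 (by decide)))
      (hζ.mem_maxIdeal 1 (by decide))

lemma genPt_mem_five (A : Param) : genPt A 5 ∈ stage A 5 := by
  have hζ := isCoordLoc_genPt A 5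
  have hr₁ : r₁ + const A.a₁ ∉ maxIdeal (genPt A 5) := hζ.add_const_notMem 3 (by decide) A.a₁
  have hr₂ : r₂ + const A.a₅ ∉ maxIdeal (genPt A 5) := by
    intro h
    have h1 := sub_mem_maxIdeal (hζ.mem_maxIdeal 2 (by decide)) h
    refine hζ.add_const_notMem 3 (by decide) (A.η - A.a₅) ?_
    convert h1 using 1
    change r₁ + const (A.η - A.a₅) = r₁ + r₂ + const A.η - (r₂ + const A.a₅)
    rw [const_sub]
    ring
  have hr₂' : r₂ + const A.a₅ ∈ (genPt A 5).toSubring :=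
    add_mem ((isLocOf_genPt 5).1 (subset_gen _ ⟨3, rfl⟩)) (hζ.const_mem _)
  refine (isGoodStage_five A).mem_of_not_le (by norm_num)
    (genPt_mem_projLinePow4 ![true, true, false, false] fun i => by fin_cases i <;> rfl) ?_
  intro j hj
  have : j = 0 ∨ j = 1 ∨ j = 2 ∨ j = 3 ∨ j = 4 := by omega
  rcases this with rfl | rfl | rfl | rfl | rfl
  exacts [not_le_of_inv_mem ((isCoordLoc_genPt A 0).mem_maxIdeal 0 (by decide)) q₁_ne_zero (hζ.mem
      0),
    not_le_of_inv_mem ((isCoordLoc_genPt A 1).mem_maxIdeal 1 (by decide))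
      (ne_zero_of_notMem_maxIdeal hr₁) (inv_mem_of_notMem_maxIdeal (add_mem (hζ.mem 3)
      (hζ.const_mem _)) hr₁),
    not_le_of_inv_mem ((isCoordLoc_genPt A 2).mem_maxIdeal 0 (by decide)) q₂_ne_zero (hζ.mem 1),
    not_le_of_inv_mem ((isCoordLoc_genPt A 3).mem_maxIdeal 1 (by decide))
      (ne_zero_of_notMem_maxIdeal hr₂) (inv_mem_of_notMem_maxIdeal hr₂' hr₂),
    not_le_of_inv_mem ((isCoordLoc_genPt A 4).mem_maxIdeal 0 (by decide)) q₁_ne_zero (hζ.mem 0)]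

lemma isGoodStage_six (A : Param) : IsGoodStage A 6 := by
  have h := isGoodStage_five A
  have hζ := isCoordLoc_genPt A 5
  refine IsGoodStage.succ_curve (k := 5) h rfl (genPt_mem_five A) (i := 2) rfl (by decide)
    fun _ R hR hle => Or.inr ⟨?_, ?_⟩
  · exact mem_maxIdeal_of_le hle (h.coord_inv_mem hR hle 0 (hζ.mem_maxIdeal 0 (by decide)))
      (hζ.mem_maxIdeal 0 (by decide))
  · exact mem_maxIdeal_of_le hle (h.coord_inv_mem hR hle 1 (hζ.mem_maxIdeal 1 (by decide)))
      (hζ.mem_maxIdeal 1 (by decide))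

/-! #### The surfaces `q₁ = t, r₁ = ∞` and `q₂ = 1, r₂ = ∞` -/

/-- If `q₁` or `q₂` has a finite non-zero constant value along the centre, it is neither zero nor
infinite at its points, so the exceptional alternatives of `prod_or` are excluded. This is where `t
≠ 0` enters. -/
lemma IsGoodStage.isProd {k : ℕ} (h : IsGoodStage A k) (hk : k ≤ 10) (hR : R ∈ stage A k)
    (hle : R.toSubring ≤ ζ.toSubring) {i : Fin 4} (hi : i = 0 ∨ i = 1) {c : ℂ} (hc0 : c ≠ 0)
    (hc : coord i - const c ∈ maxIdeal ζ) : IsProd F₁ F₂ R := by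
  have hcR := h.isVar.const_mem hR
  have hx := h.coord_mem hR hle i hc
  have hxm := mem_maxIdeal_of_le hle (sub_mem hx (hcR c)) hc
  have h1 : coord i ∉ maxIdeal R := fun hm => by
    have := sub_mem_maxIdeal hm hxm
    rw [sub_sub_cancel] at this
    exact const_notMem_maxIdeal hcR hc0 this
  have h2 : (coord i)⁻¹ ∉ maxIdeal R := fun hm => inv_notMem_of_mem_maxIdeal hm
    (inv_ne_zero (coord_ne_zero i)) (by rwa [inv_inv])
  rcases h.prod_or hk R hR with h | ⟨h3, h4⟩ | ⟨h3, h4⟩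
  · exact h
  · rcases hi with rfl | rfl
    exacts [absurd h3 h1, absurd h4 h1]
  · rcases hi with rfl | rfl
    exacts [absurd h3 h2, absurd h4 h2]

/-- On each of the first six centres one of `q₁`, `q₂` is identically zero or infinite. -/
lemma not_le_genPt {j : Fin 12} (hj : (j : ℕ) < 6) (h1 : q₁ ∈ R.toSubring)
    (h1' : q₁ ∉ maxIdeal R) (h2 : q₂ ∈ R.toSubring) (h2' : q₂ ∉ maxIdeal R) :
    ¬ R.toSubring ≤ (genPt A j).toSubring := by
  have hi1 := inv_mem_of_notMem_maxIdeal h1 h1'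
  have hi2 := inv_mem_of_notMem_maxIdeal h2 h2'
  have : j = 0 ∨ j = 1 ∨ j = 2 ∨ j = 3 ∨ j = 4 ∨ j = 5 := by omega
  rcases this with rfl | rfl | rfl | rfl | rfl | rfl
  exacts [not_le_of_inv_mem ((isCoordLoc_genPt A 0).mem_maxIdeal 0 (by decide)) q₁_ne_zero hi1,
    not_le_of_mem ((isCoordLoc_genPt A 1).mem_maxIdeal 0 (by decide)) q₁_ne_zero h1,
    not_le_of_inv_mem ((isCoordLoc_genPt A 2).mem_maxIdeal 0 (by decide)) q₂_ne_zero hi2,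
    not_le_of_mem ((isCoordLoc_genPt A 3).mem_maxIdeal 0 (by decide)) q₂_ne_zero h2,
    not_le_of_inv_mem ((isCoordLoc_genPt A 4).mem_maxIdeal 0 (by decide)) q₁_ne_zero hi1,
    not_le_of_mem ((isCoordLoc_genPt A 5).mem_maxIdeal 0 (by decide)) q₁_ne_zero h1]

lemma notMem_of_sub_const {x : K} {c : ℂ} (hc : ∀ c, const c ∈ R.toSubring) (hc0 : c ≠ 0)
    (h : x - const c ∈ maxIdeal R) : x ∉ maxIdeal R := fun hm => by
  have := sub_mem_maxIdeal hm h
  rw [sub_sub_cancel] at this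
  exact const_notMem_maxIdeal hc hc0 this

lemma genPt_mem_six (A : Param) (ht : A.t ≠ 0) : genPt A 6 ∈ stage A 6 := by
  have hζ := isCoordLoc_genPt A 6
  refine (isGoodStage_six A).mem_of_not_le (by norm_num)
    (genPt_mem_projLinePow4 ![false, false, true, false] fun i => by fin_cases i <;> rfl) ?_
  intro j hj
  exact not_le_genPt hj ((isLocOf_genPt 6).1 (subset_gen _ ⟨0, rfl⟩))
    (notMem_of_sub_const hζ.const_mem ht (hζ.mem_maxIdeal 1 (by decide))) (hζ.mem 2)
    (hζ.notMem 2 (by decide))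

lemma isProd_six (ht : A.t ≠ 0) (hR : R ∈ stage A 6)
    (hle : R.toSubring ≤ (genPt A 6).toSubring) : IsProd F₁ F₂ R ∧
      centerCoord A 6 0 ∈ R.toSubring ∧ centerCoord A 6 1 ∈ R.toSubring := by
  have h := isGoodStage_six A
  have hζ := isCoordLoc_genPt A 6
  refine ⟨h.isProd (by norm_num) hR hle (Or.inl rfl) ht (hζ.mem_maxIdeal 1 (by decide)),
    h.coord_inv_mem hR hle 2 (hζ.mem_maxIdeal 0 (by decide)),
    sub_mem (h.coord_mem hR hle 0 (hζ.mem_maxIdeal 1 (by decide))) (h.isVar.const_mem hR _)⟩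

lemma adjoin_six (A : Param) :
    IntermediateField.adjoin ℂ {centerCoord A 6 0, centerCoord A 6 1} = F₁ := by
  rw [F₁, adjoin_swap q₁]
  refine adjoin_left r₁ q₁ _ _ (-A.t) (Or.inr rfl) ?_
  rw [const_neg, ← sub_eq_add_neg]
  rfl

lemma isGoodStage_seven (A : Param) (ht : A.t ≠ 0) : IsGoodStage A 7 :=
  IsGoodStage.succ_surface (k := 6) (isGoodStage_six A) rfl (genPt_mem_six A ht) (adjoin_six A) rfl
    (Or.inl ⟨rfl, rfl⟩) fun _ hR hle => isProd_six ht hR hle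

/-- The next centre is the section `y₁ / y₀ = c` of the exceptional divisor, so its generic point
dominates the previous one and lies in the corresponding blow-up chart. -/
lemma IsCoordLoc.le_chart_two (hy : IsCoord y) (hζ : IsCoordLoc y 2 ζ) {c : ℂ}
    (hS : IsCoordLoc ![y 0, y 1 / y 0 - const c, y 2, y 3] 2 S) :
    ζ ≤ S ∧ IsLocOf (gen (Set.range (excTwo y))) S := by
  have h0 : y 0 ∈ maxIdeal S := hS.mem_maxIdeal 0 (by decide)
  have hv : y 1 / y 0 ∈ S.toSubring := by
    have := add_mem (hS.mem 1) (hS.const_mem c)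
    change y 1 / y 0 - const c + const c ∈ _ at this
    rwa [sub_add_cancel] at this
  have h1 : y 1 ∈ maxIdeal S := by
    have := mul_mem_maxIdeal hv h0
    rwa [div_mul_cancel₀ _ (hy.ne_zero 0)] at this
  constructor
  · refine hζ.le hS.const_mem (fun i => ?_) (fun i hi => ?_) (aeval_strip_two_notMem hS.indep_two)
    · fin_cases i
      exacts [mem_of_mem_maxIdeal h0, mem_of_mem_maxIdeal h1, hS.mem 2, hS.mem 3]
    · have : i = 0 ∨ i = 1 := by omega
      rcases this with rfl | rfl
      exacts [h0, h1]
  · have h := hS.1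
    rwa [gen_eq_gen (y := excTwo y) (fun i => ?_) (fun i => ?_)] at h
    · have h : ∀ i, excTwo y i ∈ gen (Set.range (excTwo y)) := fun i => subset_gen _ ⟨i, rfl⟩
      fin_cases i
      exacts [h 0, sub_mem (h 1) (const_mem_gen _ _), h 2, h 3]
    · generalize hw : ![y 0, y 1 / y 0 - const c, y 2, y 3] = w
      have h : ∀ i, w i ∈ gen (Set.range w) := fun i => subset_gen _ ⟨i, rfl⟩
      subst hw
      fin_cases i
      · exact h 0
      · have := add_mem (h 1) (const_mem_gen _ c)
        change y 1 / y 0 - const c + const c ∈ _ at this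
        rwa [sub_add_cancel] at this
      · exact h 2
      · exact h 3

lemma genPt_six_le_seven (A : Param) : genPt A 6 ≤ genPt A 7 ∧
    IsLocOf (gen (Set.range (excTwo (centerCoord A 6)))) (genPt A 7) :=
  (isCoordLoc_genPt A 6).le_chart_two (isAdapted A 6).coord (isCoordLoc_genPt A 7)

lemma genPt_mem_seven (A : Param) (ht : A.t ≠ 0) : genPt A 7 ∈ stage A 7 := by
  have hmem := genPt_mem_six A ht
  have h := genPt_six_le_seven A
  have := stage_succ A 6
  rw [show ((6 : Fin 12) : ℕ) + 1 = 7 from rfl] at this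
  rw [this]
  exact mem_blowUp_excTwo (isAdapted A 6).coord (isCoordLoc_genPt A 6) (isGenericPt_genPt hmem)
    hmem h.1 h.2

/-- The point of the exceptional divisor below a point of the next centre. -/
lemma IsGoodStage.div_mem_or {F G : IntermediateField ℂ K} {k : Fin 12} (h : IsGoodStage A k)
    (hmem : genPt A k ∈ stage A k)
    (hsurf : IsSurface F G (centerCoord A k 0) (centerCoord A k 1) (genPt A k))
    (hprod : ∀ R ∈ stage A k, R.toSubring ≤ (genPt A k).toSubring → IsProd F G R ∧
      centerCoord A k 0 ∈ R.toSubring ∧ centerCoord A k 1 ∈ R.toSubring)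
    (hT : genPt A k ≤ T) (hS : S ∈ stage A (k + 1)) (hST : S.toSubring ≤ T.toSubring) :
    centerCoord A k 1 / centerCoord A k 0 ∈ S.toSubring ∨
      (centerCoord A k 1 / centerCoord A k 0)⁻¹ ∈ S.toSubring := by
  rw [stage_succ] at hS
  rcases hsurf.blowUp_cases (isGenericPt_genPt hmem) hprod hS with ⟨hS, hn⟩ |
    ⟨R, -, -, -, -, j, hj, -⟩
  · exact absurd (h.isVar.le_of_le hS hmem hST hT) hn
  · fin_cases j
    · exact Or.inl (hj 1)
    · rw [inv_div]
      exact Or.inr (hj 0)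

lemma isGoodStage_eight (A : Param) (ht : A.t ≠ 0) : IsGoodStage A 8 := by
  have h := isGoodStage_seven A ht
  have hζ := isCoordLoc_genPt A 7
  have hq : q₁ - const A.t ∈ maxIdeal (genPt A 7) := maxIdeal_subset_of_le (genPt_six_le_seven A).1
    ((isCoordLoc_genPt A 6).mem_maxIdeal 1 (by decide))
  refine IsGoodStage.succ_surface (k := 7) h rfl (genPt_mem_seven A ht) (F := F₁) ?_ rfl
    (Or.inl ⟨rfl, rfl⟩) fun R hR hle => ⟨h.isProd (by norm_num) hR hle (Or.inl rfl) ht hq,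
    h.coord_inv_mem hR hle 2 (hζ.mem_maxIdeal 0 (by decide)), ?_⟩
  · rw [F₁, adjoin_swap q₁]
    have h1 : ∀ a b : K, a ∈ IntermediateField.adjoin ℂ {a, b} := fun a b =>
      IntermediateField.subset_adjoin _ _ (by simp)
    have h2 : ∀ a b : K, b ∈ IntermediateField.adjoin ℂ {a, b} := fun a b =>
      IntermediateField.subset_adjoin _ _ (by simp)
    refine adjoin_pair_eq (inv_mem_field.2 (h1 r₁ q₁)) ?_ (inv_mem_field.1 (h1 u₇ _)) ?_
    · exact (sub_const_mem_iff _).2 (div_mem ((sub_const_mem_iff _).2 (h2 _ _))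
        (inv_mem_field.2 (h1 r₁ q₁)))
    · exact (sub_const_mem_iff A.t).1 ((div_mem_field (h1 u₇ _) (inv_ne_zero r₁_ne_zero)).1
        ((sub_const_mem_iff _).1 (h2 _ _)))
  · refine sub_mem (mem_of_mem_or_inv_mem (c := A.a₂ * A.t) (h.isVar.const_mem hR) hle ?_ ?_)
      (h.isVar.const_mem hR _)
    -- The coordinate `v₇` of the exceptional `ℙ¹` or its inverse is regular, by the charts of the
    -- preceding blow-up. Its constant finite value on the centre then makes `v₇` itself regular.
    · exact (isGoodStage_six A).div_mem_or (k := 6) (genPt_mem_six A ht)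
        ((isCoordLoc_genPt A 6).isSurface (isAdapted A 6).coord (adjoin_six A) rfl)
        (fun R hR hle => isProd_six ht hR hle) (genPt_six_le_seven A).1 hR hle
    · exact hζ.mem_maxIdeal 1 (by decide)

lemma not_le_genPt_six_seven {j : Fin 12} (hj : j = 6 ∨ j = 7)
    (h : q₁ - const A.t ∈ R.toSubring) (h' : q₁ - const A.t ∉ maxIdeal R) :
    ¬ R.toSubring ≤ (genPt A j).toSubring := by
  have h6 := (isCoordLoc_genPt A 6).mem_maxIdeal 1 (by decide)
  have hi := inv_mem_of_notMem_maxIdeal h h'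
  rcases hj with rfl | rfl
  · exact not_le_of_inv_mem h6 (ne_zero_of_notMem_maxIdeal h') hi
  · exact not_le_of_inv_mem (maxIdeal_subset_of_le (genPt_six_le_seven A).1 h6)
      (ne_zero_of_notMem_maxIdeal h') hi

lemma genPt_mem_eight (A : Param) (ht : A.t ≠ 0) : genPt A 8 ∈ stage A 8 := by
  have hζ := isCoordLoc_genPt A 8
  refine (isGoodStage_eight A ht).mem_of_not_le (by norm_num)
    (genPt_mem_projLinePow4 ![false, false, false, true] fun i => by fin_cases i <;> rfl) ?_
  intro j hj
  have : (j : ℕ) < 6 ∨ (j = 6 ∨ j = 7) := by omega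
  rcases this with hj | hj
  · refine not_le_genPt hj (hζ.mem 2) (hζ.notMem 2 (by decide))
      ((isLocOf_genPt 8).1 (subset_gen _ ⟨1, rfl⟩))
      (notMem_of_sub_const (c := 1) hζ.const_mem one_ne_zero ?_)
    rw [const_one]
    exact hζ.mem_maxIdeal 1 (by decide)
  · refine not_le_genPt_six_seven hj (sub_mem (hζ.mem 2) (hζ.const_mem _)) ?_
    have := hζ.add_const_notMem 2 (by decide) (-A.t)
    rwa [const_neg, ← sub_eq_add_neg] at this

lemma q₂_sub_mem (A : Param) : coord 1 - const 1 ∈ maxIdeal (genPt A 8) := by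
  rw [const_one]
  exact (isCoordLoc_genPt A 8).mem_maxIdeal 1 (by decide)

lemma isProd_eight (ht : A.t ≠ 0) (hR : R ∈ stage A 8)
    (hle : R.toSubring ≤ (genPt A 8).toSubring) : IsProd F₁ F₂ R ∧
      centerCoord A 8 0 ∈ R.toSubring ∧ centerCoord A 8 1 ∈ R.toSubring := by
  have h := isGoodStage_eight A ht
  have hζ := isCoordLoc_genPt A 8
  exact ⟨h.isProd (by norm_num) hR hle (Or.inr rfl) one_ne_zero (q₂_sub_mem A),
    h.coord_inv_mem hR hle 3 (hζ.mem_maxIdeal 0 (by decide)),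
    sub_mem (h.coord_mem hR hle 1 (q₂_sub_mem A)) (one_mem _)⟩

lemma adjoin_eight (A : Param) :
    IntermediateField.adjoin ℂ {centerCoord A 8 0, centerCoord A 8 1} = F₂ := by
  rw [F₂, adjoin_swap q₂]
  refine adjoin_left r₂ q₂ _ _ (-1) (Or.inr rfl) ?_
  rw [const_neg, const_one, ← sub_eq_add_neg]
  rfl

lemma isGoodStage_nine (A : Param) (ht : A.t ≠ 0) : IsGoodStage A 9 :=
  IsGoodStage.succ_surface (k := 8) (isGoodStage_eight A ht) rfl (genPt_mem_eight A ht)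
    (adjoin_eight A) rfl (Or.inr ⟨rfl, rfl⟩) fun _ hR hle => isProd_eight ht hR hle

lemma genPt_eight_le_nine (A : Param) : genPt A 8 ≤ genPt A 9 ∧
    IsLocOf (gen (Set.range (excTwo (centerCoord A 8)))) (genPt A 9) :=
  (isCoordLoc_genPt A 8).le_chart_two (isAdapted A 8).coord (isCoordLoc_genPt A 9)

lemma genPt_mem_nine (A : Param) (ht : A.t ≠ 0) : genPt A 9 ∈ stage A 9 := by
  have hmem := genPt_mem_eight A ht
  have h := genPt_eight_le_nine A
  have := stage_succ A 8
  rw [show ((8 : Fin 12) : ℕ) + 1 = 9 from rfl] at this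
  rw [this]
  exact mem_blowUp_excTwo (isAdapted A 8).coord (isCoordLoc_genPt A 8) (isGenericPt_genPt hmem)
    hmem h.1 h.2

lemma isGoodStage_ten (A : Param) (ht : A.t ≠ 0) : IsGoodStage A 10 := by
  have h := isGoodStage_nine A ht
  have hζ := isCoordLoc_genPt A 9
  have hq := maxIdeal_subset_of_le (genPt_eight_le_nine A).1 (q₂_sub_mem A)
  refine IsGoodStage.succ_surface (k := 9) h rfl (genPt_mem_nine A ht) (F := F₂) ?_ rfl
    (Or.inr ⟨rfl, rfl⟩) fun R hR hle => ⟨h.isProd (by norm_num) hR hle (Or.inr rfl) one_ne_zero hq,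
    h.coord_inv_mem hR hle 3 (hζ.mem_maxIdeal 0 (by decide)), ?_⟩
  · rw [F₂, adjoin_swap q₂]
    have h1 : ∀ a b : K, a ∈ IntermediateField.adjoin ℂ {a, b} := fun a b =>
      IntermediateField.subset_adjoin _ _ (by simp)
    have h2 : ∀ a b : K, b ∈ IntermediateField.adjoin ℂ {a, b} := fun a b =>
      IntermediateField.subset_adjoin _ _ (by simp)
    refine adjoin_pair_eq (inv_mem_field.2 (h1 r₂ q₂)) ?_ (inv_mem_field.1 (h1 u₉ _)) ?_
    · exact (sub_const_mem_iff _).2 (div_mem (sub_mem (h2 _ _) (one_mem _))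
        (inv_mem_field.2 (h1 r₂ q₂)))
    · refine (sub_const_mem_iff 1).1 ?_
      rw [const_one]
      exact (div_mem_field (h1 u₉ _) (inv_ne_zero r₂_ne_zero)).1
        ((sub_const_mem_iff _).1 (h2 _ _))
  · refine sub_mem (mem_of_mem_or_inv_mem (c := A.a₄) (h.isVar.const_mem hR) hle ?_ ?_)
      (h.isVar.const_mem hR _)
    · exact (isGoodStage_eight A ht).div_mem_or (k := 8) (genPt_mem_eight A ht)
        ((isCoordLoc_genPt A 8).isSurface (isAdapted A 8).coord (adjoin_eight A) rfl)
        (fun R hR hle => (isProd_eight ht hR hle).imp_left IsProd.symm)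
        (genPt_eight_le_nine A).1 hR hle
    · exact hζ.mem_maxIdeal 1 (by decide)

/-! #### The last two curves -/

lemma genPt_mem_ten (A : Param) (ht : A.t ≠ 0) : genPt A 10 ∈ stage A 10 := by
  have hζ := isCoordLoc_genPt A 10
  have h3 := hζ.mem_maxIdeal 2 (by decide)
  -- On this curve `q₁` agrees with the free coordinate `q₂`.
  have hq : ∀ c, q₁ + const c ∉ maxIdeal (genPt A 10) := fun c hm => by
    have := sub_mem_maxIdeal hm h3
    refine hζ.add_const_notMem 3 (by decide) c ?_
    convert this using 1
    change q₂ + const c = q₁ + const c - (q₁ - q₂)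
    ring
  have hq₁ : q₁ ∈ (genPt A 10).toSubring := (isLocOf_genPt 10).1 (subset_gen _ ⟨0, rfl⟩)
  refine (isGoodStage_ten A ht).mem_of_not_le (by norm_num)
    (genPt_mem_projLinePow4 ![false, false, true, true] fun i => by fin_cases i <;> rfl) ?_
  intro j hj
  have : (j : ℕ) < 6 ∨ (j = 6 ∨ j = 7) ∨ j = 8 ∨ j = 9 := by omega
  rcases this with hj | hj | hj
  · refine not_le_genPt hj hq₁ ?_ (hζ.mem 3) (hζ.notMem 3 (by decide))
    simpa [const_zero] using hq 0
  · refine not_le_genPt_six_seven hj (sub_mem hq₁ (hζ.const_mem _)) ?_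
    rw [sub_eq_add_neg, ← const_neg]
    exact hq _
  · have h1 := hζ.add_const_notMem 3 (by decide) (-1)
    rw [const_neg, ← sub_eq_add_neg] at h1
    have h2 := inv_mem_of_notMem_maxIdeal (sub_mem (hζ.mem 3) (hζ.const_mem 1)) h1
    rcases hj with rfl | rfl
    · exact not_le_of_inv_mem (q₂_sub_mem A) (ne_zero_of_notMem_maxIdeal h1) h2
    · exact not_le_of_inv_mem (maxIdeal_subset_of_le (genPt_eight_le_nine A).1 (q₂_sub_mem A))
        (ne_zero_of_notMem_maxIdeal h1) h2

/-- No surface remains to be blown up, so the product structure is dropped and the corresponding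
hypothesis is vacuous from here on. -/
lemma isGoodStage_eleven (A : Param) (ht : A.t ≠ 0) : IsGoodStage A 11 :=
  IsGoodStage.succ_curve (k := 10) (isGoodStage_ten A ht) rfl (genPt_mem_ten A ht) (i := 1) rfl
    (by decide) fun h => absurd h (by decide)

lemma genPt_ten_le_eleven (A : Param) : genPt A 10 ≤ genPt A 11 ∧
    IsLocOf (gen (Set.range (excThree (centerCoord A 10)))) (genPt A 11) := by
  have hS := isCoordLoc_genPt A 11
  have h0 : r₁⁻¹ ∈ maxIdeal (genPt A 11) := hS.mem_maxIdeal 0 (by decide)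
  have hloc := isLocOf_genPt (A := A) 11
  have hv : v₁₁ ∈ (genPt A 11).toSubring := hloc.1 (subset_gen _ ⟨3, rfl⟩)
  have hw : w₁₁ ∈ (genPt A 11).toSubring := hloc.1 (subset_gen _ ⟨0, rfl⟩)
  have h1 : r₂⁻¹ ∈ maxIdeal (genPt A 11) := by
    have := mul_mem_maxIdeal hv h0
    rwa [v₁₁, div_mul_cancel₀ _ (inv_ne_zero r₁_ne_zero)] at this
  have h2 : q₁ - q₂ ∈ maxIdeal (genPt A 11) := by
    have := mul_mem_maxIdeal hw h0
    rwa [w₁₁, div_mul_cancel₀ _ (inv_ne_zero r₁_ne_zero)] at this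
  constructor
  · refine (isCoordLoc_genPt A 10).le hS.const_mem (fun i => ?_) (fun i hi => ?_)
      (aeval_strip_three_notMem hS.indep_three)
    · fin_cases i
      exacts [mem_of_mem_maxIdeal h0, mem_of_mem_maxIdeal h1, mem_of_mem_maxIdeal h2, hS.mem 3]
    · have : i = 0 ∨ i = 1 ∨ i = 2 := by
        have : (i : ℕ) < 3 := hi
        omega
      rcases this with rfl | rfl | rfl
      exacts [h0, h1, h2]
  · rwa [gen_eq_gen (y := excThree (centerCoord A 10)) (fun i => ?_) (fun i => ?_)] at hloc
    · have h : ∀ i, excThree (centerCoord A 10) i ∈ gen (Set.range (excThree (centerCoord A 10))) :=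
        fun i => subset_gen _ ⟨i, rfl⟩
      fin_cases i
      exacts [h 2, h 3, h 0, h 1]
    · have h : ∀ i, (center A 11).chart i ∈ gen (Set.range (center A 11).chart) :=
        fun i => subset_gen _ ⟨i, rfl⟩
      fin_cases i
      exacts [h 2, h 3, h 0, h 1]

lemma genPt_mem_eleven (A : Param) (ht : A.t ≠ 0) : genPt A 11 ∈ stage A 11 := by
  have hmem := genPt_mem_ten A ht
  have h := genPt_ten_le_eleven A
  have := stage_succ A 10
  rw [show ((10 : Fin 12) : ℕ) + 1 = 11 from rfl] at this
  rw [this]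
  exact mem_blowUp_excThree (isAdapted A 10).coord (isCoordLoc_genPt A 10) (isGenericPt_genPt hmem)
    hmem h.1 h.2

lemma isGoodStage_twelve (A : Param) (ht : A.t ≠ 0) : IsGoodStage A 12 :=
  IsGoodStage.succ_curve (k := 11) (isGoodStage_eleven A ht) rfl (genPt_mem_eleven A ht) (i := 1)
    rfl (by decide) fun h => absurd h (by decide)

/-- The centres are irreducible, of the asserted dimensions. -/
lemma isIrreducibleOfDim_center (A : Param) (ht : A.t ≠ 0) (k : Fin 12) :
    IsIrreducibleOfDim ((center A k).locus (stage A k)) (centerDim k) := by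
  have hmem := isGenericPt_genPt ((isGoodStage_twelve A ht).genPt_mem k k.2)
  refine ⟨genPt A k, hmem.1, hmem.2, ?_⟩
  rw [genPt, ringKrullDim_coordLoc (isAdapted A k).coord (codim_le k)]
  exact_mod_cast codim_add_centerDim k

end blowUps


/-! ### Prime divisors -/

section primeDivisors

open MvPolynomial

variable {A B : Param} {R S T : LocalSubring K} {M N : Model} {y : Fin 4 → K} {n : ℕ}
  {φ : K ≃ₐ[ℂ] K}

lemma Big.of_transport (h : Big R) : Big (transport φ R) := by
  obtain ⟨x, hx⟩ := h
  refine ⟨fun i => φ (x i), fun P hP => ?_⟩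
  have : aeval (fun i => φ (x i)) P = φ (aeval x P) := by
    have := comp_aeval_apply (R := ℂ) (f := x) (φ : K →ₐ[ℂ] K) P
    exact this.symm
  rw [this, mem_transport, mem_maxIdeal_transport, AlgEquiv.symm_apply_apply]
  exact hx P hP

lemma IsCoordLoc.transport (h : IsCoordLoc y n S) :
    IsCoordLoc (fun i => φ (y i)) n (FujiSuzukiTsuda.transport φ S) := by
  refine ⟨?_, fun P => ?_⟩
  · have : Set.range (fun i => φ (y i)) = φ '' Set.range y := by
      rw [← Set.range_comp]
      rfl
    rw [this, isLocOf_transport]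
    exact h.1
  · have : aeval (fun i => φ (y i)) P = φ (aeval y P) :=
      (comp_aeval_apply (R := ℂ) (f := y) (φ : K →ₐ[ℂ] K) P).symm
    rw [this, mem_maxIdeal_transport, AlgEquiv.symm_apply_apply]
    exact h.2 P

lemma IsCoord.map (h : IsCoord y) : IsCoord fun i => φ (y i) := by
  refine isCoord_of_adjoin fun i => ?_
  obtain ⟨P, s, -, hx⟩ := h.frac (φ.symm (coord i))
  have : coord i = aeval (fun i => φ (y i)) P / aeval (fun i => φ (y i)) s := by
    rw [← φ.apply_symm_apply (coord i), hx, map_div₀]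
    congr 1 <;> exact comp_aeval_apply (R := ℂ) (f := y) (φ : K →ₐ[ℂ] K) _
  rw [this]
  have hmem : ∀ P : MvPolynomial (Fin 4) ℂ, aeval (fun i => φ (y i)) P ∈
      IntermediateField.adjoin ℂ (Set.range fun i => φ (y i)) := fun P =>
    aeval_mem (B := (IntermediateField.adjoin ℂ (Set.range fun i => φ (y i))).toSubalgebra.toSubring)
      (fun c => IntermediateField.algebraMap_mem _ c)
      (fun i => IntermediateField.subset_adjoin _ _ ⟨i, rfl⟩) P
  exact div_mem (hmem P) (hmem s)

/-- The automorphism of `K` that maps the coordinates to `x`. -/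
lemma IsCoord.exists_algEquiv {x : Fin 4 → K} (hx : IsCoord x) :
    ∃ φ : K ≃ₐ[ℂ] K, ∀ i, φ (coord i) = x i := by
  have hinj : Function.Injective (aeval x : MvPolynomial (Fin 4) ℂ →ₐ[ℂ] K) := hx.indep
  let ψ : K →ₐ[ℂ] K := IsFractionRing.liftAlgHom (K := K) (g := aeval x) hinj
  have hψ : ∀ P, ψ (algebraMap _ K P) = aeval x P := fun P =>
    IsFractionRing.lift_algebraMap (K := K) (g := (aeval x : MvPolynomial (Fin 4) ℂ →ₐ[ℂ] K).toRingHom) hinj P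
  refine ⟨AlgEquiv.ofBijective ψ ⟨ψ.toRingHom.injective, fun z => ?_⟩, fun i => ?_⟩
  · obtain ⟨P, s, -, hz⟩ := hx.frac z
    refine ⟨algebraMap _ K P / algebraMap _ K s, ?_⟩
    rw [map_div₀, hψ, hψ, hz]
  · change ψ (algebraMap _ K (X i)) = x i
    rw [hψ, aeval_X]

lemma map_const (c : ℂ) : φ (const c) = const c := φ.commutes c

/-! #### Big points of the blow-up -/

/-- The coordinates at the divisor where the coordinate `i` is infinite. -/
def infCoord (i : Fin 4) : Fin 4 → K := Fin.cons (coord i)⁻¹ fun j : Fin 3 => coord (i.succAbove j)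

lemma isCoord_infCoord (i : Fin 4) : IsCoord (infCoord i) := by
  have h : ∀ j, infCoord i j ∈ IntermediateField.adjoin ℂ (Set.range (infCoord i)) :=
    fun i => IntermediateField.subset_adjoin ℂ _ ⟨i, rfl⟩
  refine isCoord_of_adjoin fun j => ?_
  rcases Fin.eq_self_or_eq_succAbove i j with rfl | ⟨k, rfl⟩
  · exact inv_mem_field.1 (h 0)
  · exact h k.succ

lemma Indep.notMem {ι : Type*} {x : ι → K} (h : Indep R x) (i : ι) : x i ∉ maxIdeal R := by
  have := (h (X i) (X_ne_zero i)).2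
  rwa [aeval_X] at this

/-- A big point of affine space where the first coordinate vanishes. -/
lemma eq_coordLoc_of_big (hy : IsCoord y) (hR : IsLocOf (gen (Set.range y)) R) (hbig : Big R)
    (h0 : y 0 ∈ maxIdeal R) : R = coordLoc y 1 := by
  have hS := isCoordLoc_coordLoc hy (n := 1) (by norm_num)
  have hmem : ∀ i, y i ∈ R.toSubring := fun i => hR.1 (subset_gen _ ⟨i, rfl⟩)
  obtain ⟨x, hx⟩ := hbig
  refine (hS.eq_of_le hy (hS.le (fun c => hR.1 (const_mem_gen _ c)) hmem (fun i hi => ?_)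
    (aeval_strip_one_notMem (indep_of_isLocOf hR (fun i => ?_) ?_ hx)))).symm
  · obtain rfl : i = 0 := by omega
    exact h0
  · fin_cases i
    exacts [hmem 1, hmem 2, hmem 3]
  · rintro _ ⟨i, rfl⟩
    fin_cases i
    exacts [Or.inl h0, Or.inr ⟨0, rfl⟩, Or.inr ⟨1, rfl⟩, Or.inr ⟨2, rfl⟩]

/-- If one coordinate is infinite at a big point, the other three must be independent, so the point
is the generic point of that divisor at infinity. -/
lemma big_projLinePow4 (hR : R ∈ projLinePow4) (hbig : Big R) :
    IsLocOf (gen (Set.range coord)) R ∨ ∃ i, R = coordLoc (infCoord i) 1 := by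
  obtain ⟨ε, hε⟩ := mem_projLinePow4.1 hR
  have hmem := fun i => hε.1 (subset_gen _ ⟨i, rfl⟩)
  have hcR : ∀ c, const c ∈ R.toSubring := fun c => hε.1 (const_mem_gen _ c)
  simp only at hmem
  by_cases h : ∃ i, (coord i)⁻¹ ∈ maxIdeal R
  · obtain ⟨i, hi⟩ := h
    refine Or.inr ⟨i, ?_⟩
    have hεi : ε i = true := by
      by_contra hne
      have := hmem i
      simp only [hne] at this
      exact inv_notMem_of_mem_maxIdeal hi (inv_ne_zero (coord_ne_zero i)) (by simpa using this)
    let x : Fin 3 → K := fun j => if ε (i.succAbove j) then (coord (i.succAbove j))⁻¹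
      else coord (i.succAbove j)
    obtain ⟨u, hu⟩ := hbig
    -- The three remaining chart functions generate a residue field of transcendence degree at least
    -- three. In particular none of them vanishes, so the inverted ones can be inverted back.
    have hx : Indep R x := by
      refine indep_of_isLocOf hε (fun j => hmem _) ?_ hu
      rintro _ ⟨j, rfl⟩
      rcases Fin.eq_self_or_eq_succAbove i j with rfl | ⟨k, rfl⟩
      · left
        simpa [hεi] using hi
      · exact Or.inr ⟨k, rfl⟩
    have hcoord : ∀ j, coord (i.succAbove j) ∈ R.toSubring ∧
        (coord (i.succAbove j) ∉ maxIdeal R ∨ ε (i.succAbove j) = false) := by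
      intro j
      have h1 := hmem (i.succAbove j)
      have h2 := hx.notMem j
      simp only [x] at h2
      cases hj : ε (i.succAbove j) <;> simp only [hj, if_true, Bool.false_eq_true, if_false] at h1 h2
      · exact ⟨h1, Or.inr rfl⟩
      · have := inv_mem_of_notMem_maxIdeal h1 h2
        rw [inv_inv] at this
        exact ⟨this, Or.inl (notMem_maxIdeal_of_inv_mem (coord_ne_zero _) h1)⟩
    refine eq_coordLoc_of_big (isCoord_infCoord i) ?_ ⟨u, hu⟩ hi
    have hB : gen (Set.range (infCoord i)) ≤ R.toSubring := by
      refine gen_le hcR ?_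
      rintro _ ⟨j, rfl⟩
      refine Fin.cases (mem_of_mem_maxIdeal hi) (fun j => ?_) j
      exact (hcoord j).1
    refine hε.of_le_fractions hB (gen_le (fun c => le_fractions hB (const_mem_gen _ c)) ?_)
    rintro _ ⟨j, rfl⟩
    rcases Fin.eq_self_or_eq_succAbove i j with rfl | ⟨k, rfl⟩
    · simp only [hεi, if_true]
      exact le_fractions hB (subset_gen _ ⟨0, rfl⟩)
    · have hk : coord (i.succAbove k) ∈ gen (Set.range (infCoord i)) := subset_gen _ ⟨k.succ, rfl⟩
      rcases hε' : ε (i.succAbove k) with _ | _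
      · simp only [hε', Bool.false_eq_true, if_false]
        exact le_fractions hB hk
      · simp only [hε', if_true]
        refine ⟨1, one_mem _, _, hk, (hcoord k).2.resolve_right (by simp [hε']), by simp⟩
  · left
    push Not at h
    have hcoord : ∀ i, coord i ∈ R.toSubring := by
      intro i
      have h1 := hmem i
      cases hi : ε i <;> simp only [hi, if_true, Bool.false_eq_true, if_false] at h1
      · exact h1
      · have := inv_mem_of_notMem_maxIdeal h1 (h i)
        rwa [inv_inv] at this
    have hB : gen (Set.range coord) ≤ R.toSubring := by
      refine gen_le hcR ?_
      rintro _ ⟨j, rfl⟩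
      exact hcoord j
    refine hε.of_le_fractions hB (gen_le (fun c => le_fractions hB (const_mem_gen _ c)) ?_)
    rintro _ ⟨j, rfl⟩
    have hk : coord j ∈ gen (Set.range coord) := subset_gen _ ⟨j, rfl⟩
    rcases hε' : ε j with _ | _
    · simp only [hε', Bool.false_eq_true, if_false]
      exact le_fractions hB hk
    · have h1 := hmem j
      simp only [hε', if_true] at h1 ⊢
      exact ⟨1, one_mem _, _, hk, notMem_maxIdeal_of_inv_mem (coord_ne_zero _) h1, by simp⟩

lemma mem_projLinePow4_of_isLocOf (hR : IsLocOf (gen (Set.range coord)) R) : R ∈ projLinePow4 :=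
  mem_projLinePow4_of_chart (fun _ => false) (fun _ => by simp) hR

lemma mem_variety_of_isLocOf (ht : A.t ≠ 0) (hR : IsLocOf (gen (Set.range coord)) R)
    (hbig : Big R) : R ∈ variety A :=
  (isGoodStage_twelve A ht).mem_of_big R (mem_projLinePow4_of_isLocOf hR) hbig

lemma big_coordLoc (hy : IsCoord y) : Big (coordLoc y 1) :=
  ⟨_, (isCoordLoc_coordLoc hy (by norm_num)).indep_one⟩

lemma infCoord_mem_variety (ht : A.t ≠ 0) (i : Fin 4) : coordLoc (infCoord i) 1 ∈ variety A := by
  refine (isGoodStage_twelve A ht).mem_of_big _ ?_ (big_coordLoc (isCoord_infCoord i))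
  have h := (isCoordLoc_coordLoc (isCoord_infCoord i) (n := 1) (by norm_num)).1
  refine mem_projLinePow4_of_chart (x := fun j => if j = i then (coord j)⁻¹ else coord j)
    (fun j => j = i) (fun j => by simp) ?_
  rwa [gen_eq_gen (y := infCoord i) (fun j => ?_) (fun j => ?_)]
  · have h : ∀ j, infCoord i j ∈ gen (Set.range (infCoord i)) := fun j => subset_gen _ ⟨j, rfl⟩
    rcases Fin.eq_self_or_eq_succAbove i j with rfl | ⟨k, rfl⟩
    · simp only [if_true]
      exact h 0
    · simp only [Fin.succAbove_ne, if_false]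
      exact h k.succ
  · refine Fin.cases ?_ (fun j => ?_) j
    · exact subset_gen _ ⟨i, by simp [infCoord]⟩
    · exact subset_gen _ ⟨i.succAbove j, by simp [infCoord]⟩

lemma big_variety (ht : A.t ≠ 0) (hR : R ∈ variety A) (hbig : Big R) :
    IsLocOf (gen (Set.range coord)) R ∨ (∃ i, R = coordLoc (infCoord i) 1) ∨ ∃ k, R = exc A k := by
  rcases (isGoodStage_twelve A ht).big R hR hbig with h | ⟨k, -, rfl⟩
  · rcases big_projLinePow4 h hbig with h | h
    exacts [Or.inl h, Or.inr (Or.inl h)]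
  · exact Or.inr (Or.inr ⟨k, rfl⟩)

/-! #### A criterion for pseudo-isomorphisms -/

lemma withBot_le_one {d : WithBot ℕ∞} (h : d < 2) : d ≤ 1 := by
  induction d with
  | bot => exact bot_le
  | coe d =>
    have h' : d < 2 := WithBot.coe_lt_coe.1 h
    have : d ≤ 1 := Order.le_of_lt_add_one (by rwa [one_add_one_eq_two])
    exact_mod_cast this

/-- The contrapositive of the dimension estimate at points of codimension at most one. -/
lemma two_le_ringKrullDim (ht : A.t ≠ 0) (hR : R ∈ variety A) (hbig : ¬ Big R) :
    2 ≤ ringKrullDim R.toSubring := by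
  classical
  by_contra! hlt
  have h := isGoodStage_twelve A ht
  obtain ⟨s, hs, -⟩ := h.isVar.ft R hR
  refine hbig (exists_indep_of_ringKrullDim_le_one hs (fun x => ?_) (withBot_le_one hlt))
  -- Coordinates of a chart of `(ℙ¹)⁴` that are regular at `R`; they show that `K` is the fraction
  -- field of `R`.
  let y : Fin 4 → K := fun i => if coord i ∈ R.toSubring then coord i else (coord i)⁻¹
  have hyR : ∀ i, y i ∈ R.toSubring := fun i => by
    by_cases hi : coord i ∈ R.toSubring
    · simp only [y, hi, if_true]
    · simpa only [y, hi, if_false] using (h.coord_mem_or hR i).resolve_left hi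
  have hy : IsCoord y := isCoord_of_adjoin fun i => by
    have hi : y i ∈ IntermediateField.adjoin ℂ (Set.range y) :=
      IntermediateField.subset_adjoin ℂ _ ⟨i, rfl⟩
    simp only [y] at hi
    split_ifs at hi
    exacts [hi, inv_mem_field.1 hi]
  obtain ⟨P, Q, hQ, hx⟩ := hy.frac x
  have hc := h.isVar.const_mem hR
  exact ⟨_, aeval_mem hc hyR P, _, aeval_mem hc hyR Q,
    fun h0 => hQ (hy.indep (h0.trans (map_zero _).symm)), hx⟩

/-- `φ` matches the big points of `X_A` with those of `X_B`. -/
def MatchesBig (φ : K ≃ₐ[ℂ] K) (A B : Param) : Prop :=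
  (∀ R ∈ variety A, Big R → transport φ.symm R ∈ variety B) ∧
    ∀ R ∈ variety B, Big R → transport φ R ∈ variety A

/-- Take the local rings of `X_A` that are transported from `X_B`, and conversely. Points left out
are not big, hence of codimension at least two. -/
lemma MatchesBig.isPseudoIsomorphism (hA : A.t ≠ 0) (hB : B.t ≠ 0) (h : MatchesBig φ A B) :
    IsPseudoIsomorphism φ (variety A) (variety B) := by
  have hVA := (isGoodStage_twelve A hA).isVar
  have hVB := (isGoodStage_twelve B hB).isVar
  refine ⟨variety A ∩ transport φ '' variety B, variety B ∩ transport φ.symm '' variety A,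
    hVA.isZariskiOpen_inter (hVB.transport _), hVB.isZariskiOpen_inter (hVA.transport _), ?_, ?_, ?_⟩
  · rintro R ⟨hR, hRU⟩
    refine two_le_ringKrullDim hA hR fun hbig => hRU ⟨hR, _, h.1 R hR hbig, ?_⟩
    exact transport_transport_symm _
  · rintro R ⟨hR, hRU⟩
    refine two_le_ringKrullDim hB hR fun hbig => hRU ⟨hR, _, h.2 R hR hbig, ?_⟩
    exact transport_symm_transport _
  · ext R
    constructor
    · rintro ⟨_, ⟨hS, S, hSA, rfl⟩, rfl⟩
      change transport φ (transport φ.symm S) ∈ _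
      refine ⟨?_, _, hS, rfl⟩
      rw [transport_transport_symm]
      exact hSA
    · rintro ⟨hR, S, hS, rfl⟩
      exact ⟨S, ⟨hS, _, hR, transport_symm_transport _⟩, rfl⟩

lemma MatchesBig.trans {C : Param} {ψ : K ≃ₐ[ℂ] K} (h : MatchesBig φ A B)
    (h' : MatchesBig ψ B C) : MatchesBig (ψ.trans φ) A C := by
  have e1 : ∀ R, transport (ψ.trans φ) R = transport φ (transport ψ R) := fun R => by
    apply LocalSubring_ext
    ext x
    simp only [mem_transport]
    rfl
  have e2 : ∀ R, transport (ψ.trans φ).symm R = transport ψ.symm (transport φ.symm R) :=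
    fun R => by
      apply LocalSubring_ext
      ext x
      simp only [mem_transport]
      rfl
  refine ⟨fun R hR hbig => ?_, fun R hR hbig => ?_⟩
  · rw [e2]
    exact h'.1 _ (h.1 R hR hbig) hbig.of_transport
  · rw [e1]
    exact h.2 _ (h'.2 R hR hbig) hbig.of_transport

end primeDivisors


/-! ### Residues along prime divisors -/

section residues

open MvPolynomial

variable {A B : Param} {R S T : LocalSubring K} {y : Fin 4 → K} {n : ℕ} {φ : K ≃ₐ[ℂ] K}

/-- `y` is a coordinate system, and `x` has the residue `w` along the prime divisor `y₀ = 0`, whose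
function field is identified with `ℂ(y₁, y₂, y₃)`. -/
structure Cong (y : Fin 4 → K) (x w : K) : Prop where
  isCoord : IsCoord y
  mem : w ∈ IntermediateField.adjoin ℂ (Set.range ![y 1, y 2, y 3])
  sub_mem : x - w ∈ maxIdeal (coordLoc y 1)

namespace Cong

variable {x x' w w' : K}

lemma isCoordLoc (h : IsCoord y) : IsCoordLoc y 1 (coordLoc y 1) :=
  isCoordLoc_coordLoc h (by norm_num)

lemma right_mem (h : Cong y x w) : w ∈ (coordLoc y 1).toSubring :=
  (isCoordLoc h.isCoord).indep_one.adjoin_le h.mem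

lemma left_mem (h : Cong y x w) : x ∈ (coordLoc y 1).toSubring := by
  have := add_mem (mem_of_mem_maxIdeal h.sub_mem) h.right_mem
  rwa [sub_add_cancel] at this

lemma const (hy : IsCoord y) (c : ℂ) : Cong y (const c) (const c) :=
  ⟨hy, IntermediateField.algebraMap_mem _ c, by rw [sub_self]; exact zero_mem_maxIdeal⟩

lemma one (hy : IsCoord y) : Cong y 1 1 := by
  have := const hy 1
  rwa [const_one] at this

lemma zero (hy : IsCoord y) : Cong y (y 0) 0 :=
  ⟨hy, zero_mem _, by rw [sub_zero]; exact (isCoordLoc hy).mem_maxIdeal 0 (by decide)⟩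

lemma coord (hy : IsCoord y) (i : Fin 3) : Cong y (y i.succ) (y i.succ) := by
  refine ⟨hy, IntermediateField.subset_adjoin _ _ ?_, by rw [sub_self]; exact zero_mem_maxIdeal⟩
  fin_cases i
  exacts [⟨0, rfl⟩, ⟨1, rfl⟩, ⟨2, rfl⟩]

lemma of (h : Cong y x w) (hx : x = x') (hw : w = w') : Cong y x' w' := by
  subst hx hw
  exact h

lemma add (h : Cong y x w) (h' : Cong y x' w') : Cong y (x + x') (w + w') := by
  refine ⟨h.isCoord, add_mem h.mem h'.mem, ?_⟩
  rw [add_sub_add_comm]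
  exact add_mem_maxIdeal h.sub_mem h'.sub_mem

lemma sub (h : Cong y x w) (h' : Cong y x' w') : Cong y (x - x') (w - w') := by
  refine ⟨h.isCoord, _root_.sub_mem h.mem h'.mem, ?_⟩
  rw [sub_sub_sub_comm]
  exact sub_mem_maxIdeal h.sub_mem h'.sub_mem

lemma mul (h : Cong y x w) (h' : Cong y x' w') : Cong y (x * x') (w * w') := by
  refine ⟨h.isCoord, mul_mem h.mem h'.mem, ?_⟩
  have : x * x' - w * w' = x * (x' - w') + w' * (x - w) := by ring
  rw [this]
  exact add_mem_maxIdeal (mul_mem_maxIdeal h.left_mem h'.sub_mem)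
    (mul_mem_maxIdeal h'.right_mem h.sub_mem)

/-- The representative `w` lies in the field `ℂ(y 1, y 2, y 3)`, which is contained in the local
ring. So a residue is non-zero as soon as `w ≠ 0` in `K`. -/
lemma right_notMem (h : Cong y x w) (hw : w ≠ 0) : w ∉ maxIdeal (coordLoc y 1) := fun hm =>
  inv_notMem_of_mem_maxIdeal hm hw ((isCoordLoc h.isCoord).indep_one.adjoin_le (inv_mem h.mem))

lemma notMem (h : Cong y x w) (hw : w ≠ 0) : x ∉ maxIdeal (coordLoc y 1) := fun hm => by
  have := sub_mem_maxIdeal hm h.sub_mem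
  rw [sub_sub_cancel] at this
  exact h.right_notMem hw this

lemma ne_zero (h : Cong y x w) (hw : w ≠ 0) : x ≠ 0 := ne_zero_of_notMem_maxIdeal (h.notMem hw)

lemma inv (h : Cong y x w) (hw : w ≠ 0) : Cong y x⁻¹ w⁻¹ := by
  refine ⟨h.isCoord, inv_mem h.mem, ?_⟩
  have : x⁻¹ - w⁻¹ = -(x⁻¹ * w⁻¹ * (x - w)) := by
    field_simp [h.ne_zero hw]
    ring
  rw [this]
  exact neg_mem_maxIdeal (mul_mem_maxIdeal (mul_mem
    (inv_mem_of_notMem_maxIdeal h.left_mem (h.notMem hw))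
    (inv_mem_of_notMem_maxIdeal h.right_mem (h.right_notMem hw))) h.sub_mem)

lemma div (h : Cong y x w) (h' : Cong y x' w') (hw : w' ≠ 0) : Cong y (x / x') (w / w') := by
  rw [div_eq_mul_inv, div_eq_mul_inv]
  exact h.mul (h'.inv hw)

end Cong

/-- The image of a prime divisor is determined by the residues of the coordinates. -/
lemma transport_symm_coordLoc {y y' : Fin 4 → K} (hy' : IsCoord y') {w₁ w₂ w₃ : K}
    (h0 : Cong y (φ (y' 0)) 0) (h1 : Cong y (φ (y' 1)) w₁) (h2 : Cong y (φ (y' 2)) w₂)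
    (h3 : Cong y (φ (y' 3)) w₃)
    (hL : ∀ L : IntermediateField ℂ K, w₁ ∈ L → w₂ ∈ L → w₃ ∈ L → y 1 ∈ L ∧ y 2 ∈ L ∧ y 3 ∈ L) :
    transport φ.symm (coordLoc y 1) = coordLoc y' 1 := by
  have hy := h0.isCoord
  have hD := isCoordLoc_coordLoc hy (n := 1) (by norm_num)
  have hT := (isCoordLoc_coordLoc hy' (n := 1) (by norm_num)).transport (φ := φ)
  -- The last hypothesis recovers `y 1`, `y 2`, `y 3` from the residues, which are therefore
  -- algebraically independent.
  have hw : IsCoord ![y 0, w₁, w₂, w₃] := by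
    have h : ∀ i, ![y 0, w₁, w₂, w₃] i ∈
        IntermediateField.adjoin ℂ (Set.range ![y 0, w₁, w₂, w₃]) :=
      fun i => IntermediateField.subset_adjoin ℂ _ ⟨i, rfl⟩
    obtain ⟨g1, g2, g3⟩ := hL _ (h 1) (h 2) (h 3)
    refine hy.of_mem fun i => ?_
    fin_cases i
    exacts [h 0, g1, g2, g3]
  have hind : Indep (coordLoc y 1) ![φ (y' 1), φ (y' 2), φ (y' 3)] := by
    intro P hP
    have hmem : ∀ i, ![φ (y' 1), φ (y' 2), φ (y' 3)] i ∈ (coordLoc y 1).toSubring := by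
      intro i
      fin_cases i
      exacts [h1.left_mem, h2.left_mem, h3.left_mem]
    refine ⟨aeval_mem hD.const_mem hmem P, fun hm => ?_⟩
    have h4 := aeval_sub_aeval_mem_maxIdeal hD.const_mem (y := ![w₁, w₂, w₃]) hmem (fun i => by
      fin_cases i
      exacts [h1.sub_mem, h2.sub_mem, h3.sub_mem]) P
    have h5 := sub_mem_maxIdeal hm h4
    rw [sub_sub_cancel] at h5
    have h6 : aeval ![w₁, w₂, w₃] P ≠ 0 := by
      intro h0
      have h7 : AlgebraicIndependent ℂ ![w₁, w₂, w₃] := by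
        have := hw.indep.comp ![1, 2, 3] (by decide)
        convert this using 1
        funext i
        fin_cases i <;> rfl
      exact hP (h7 (h0.trans (map_zero _).symm))
    have h8 : aeval ![w₁, w₂, w₃] P ∈
        IntermediateField.adjoin ℂ (Set.range ![y 1, y 2, y 3]) := by
      refine aeval_mem (B := (IntermediateField.adjoin ℂ
        (Set.range ![y 1, y 2, y 3])).toSubalgebra.toSubring)
        (fun c => IntermediateField.algebraMap_mem _ c) (fun i => ?_) P
      fin_cases i
      exacts [h1.mem, h2.mem, h3.mem]
    exact inv_notMem_of_mem_maxIdeal h5 h6 (hD.indep_one.adjoin_le (inv_mem h8))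
  have hle := hT.le hD.const_mem (fun i => by
    fin_cases i
    exacts [h0.left_mem, h1.left_mem, h2.left_mem, h3.left_mem]) (fun i hi => by
    obtain rfl : i = 0 := by omega
    have := h0.sub_mem
    rwa [sub_zero] at this) (aeval_strip_one_notMem hind)
  -- The transported discrete valuation ring is dominated by `coordLoc y 1`, so the two coincide.
  rw [← hT.eq_of_le hy'.map hle, transport_symm_transport]

end residues

/-! ### The prime divisors that matter -/

section divisors

variable {A B : Param} {R S T : LocalSubring K} {φ : K ≃ₐ[ℂ] K}

/-- Names for prime divisors: the exceptional divisors, the divisors at infinity of `(ℙ¹)⁴`, and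
divisors that are contracted by one of the transformations. -/
inductive Divisor where
  | e₁ | e₂ | e₃ | e₄ | e₅ | e₆ | e₇ | e₈ | e₉ | e₁₀ | e₁₁ | e₁₂
  | q₁inf | q₂inf | r₁inf | r₂inf
  | diag | r₁zero | r₁neg | q₁t | dzero | dneg

/-- Coordinates near a prime divisor, the first one being an equation of the divisor. -/
def Divisor.coords (A : Param) (x₁ x₂ z₁ z₂ : K) : Divisor → Fin 4 → K
  | .e₁ => ![x₁, z₁ / x₁, x₂, z₂]
  | .e₂ => ![x₁⁻¹, (z₁ + const A.a₁) * x₁, x₂, z₂]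
  | .e₃ => ![x₂, z₂ / x₂, x₁, z₁]
  | .e₄ => ![x₂⁻¹, (z₂ + const A.a₅) * x₂, x₁, z₁]
  | .e₅ => ![x₁, x₂ / x₁, (z₁ + z₂ - const A.a₃ + const A.η) / x₁, z₁]
  | .e₆ => ![x₁⁻¹, x₁ / x₂, (z₁ + z₂ + const A.η) * x₁, z₁]
  | .e₇ => ![z₁⁻¹, (x₁ - const A.t) * z₁, x₂, z₂]
  | .e₈ => ![z₁⁻¹, ((x₁ - const A.t) * z₁ - const (A.a₂ * A.t)) * z₁, x₂, z₂]
  | .e₉ => ![z₂⁻¹, (x₂ - 1) * z₂, x₁, z₁]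
  | .e₁₀ => ![z₂⁻¹, ((x₂ - 1) * z₂ - const A.a₄) * z₂, x₁, z₁]
  | .e₁₁ => ![z₁⁻¹, z₁ / z₂, (x₁ - x₂) * z₁, x₂]
  | .e₁₂ => ![z₁⁻¹, (z₁ / z₂ + 1) * z₁, ((x₁ - x₂) * z₁ - const A.a₀ * x₂) * z₁, x₂]
  | .q₁inf => ![x₁⁻¹, x₂, z₁, z₂]
  | .q₂inf => ![x₂⁻¹, x₁, z₁, z₂]
  | .r₁inf => ![z₁⁻¹, x₁, x₂, z₂]
  | .r₂inf => ![z₂⁻¹, x₁, x₂, z₁]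
  | .diag => ![x₁ - x₂, x₂, z₁, z₂]
  | .r₁zero => ![z₁, x₁, x₂, z₂]
  | .r₁neg => ![z₁ + const A.a₁, x₁, x₂, z₂]
  | .q₁t => ![x₁ - const A.t, x₂, z₁, z₂]
  | .dzero => ![z₁ + z₂ - const A.a₃ + const A.η, x₁, x₂, z₁]
  | .dneg => ![z₁ + z₂ + const A.η, x₁, x₂, z₁]

/-- The exceptional divisors. -/
def excDivisor : Fin 12 → Divisor :=
  ![.e₁, .e₂, .e₃, .e₄, .e₅, .e₆, .e₇, .e₈, .e₉, .e₁₀, .e₁₁, .e₁₂]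

/-- The divisors at infinity. -/
def infDivisor : Fin 4 → Divisor := ![.q₁inf, .q₂inf, .r₁inf, .r₂inf]

/-- The coordinates near a prime divisor as elements of `K`. -/
def Divisor.coord (A : Param) (d : Divisor) : Fin 4 → K := d.coords A q₁ q₂ r₁ r₂

/-- The local ring of a prime divisor. -/
def Divisor.loc (A : Param) (d : Divisor) : LocalSubring K := coordLoc (d.coord A) 1

lemma excDivisor_coord (A : Param) (k : Fin 12) : (excDivisor k).coord A = excCoord A k := by
  funext i
  fin_cases k
  all_goals
    fin_cases i <;> simp [excDivisor, Divisor.coord, Divisor.coords, excCoord, codim, excTwo,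
      excThree, centerCoord, u₇, v₇, u₉, v₉, u₁₁, v₁₁, w₁₁, div_eq_mul_inv, mul_comm]

lemma infDivisor_coord (A : Param) (k : Fin 4) : (infDivisor k).coord A = infCoord k := by
  funext i
  fin_cases k
  all_goals fin_cases i <;> rfl

lemma Divisor.map_coords (φ : K ≃ₐ[ℂ] K) (A : Param) (x₁ x₂ z₁ z₂ : K) (d : Divisor) (i : Fin 4) :
    φ (d.coords A x₁ x₂ z₁ z₂ i) = d.coords A (φ x₁) (φ x₂) (φ z₁) (φ z₂) i := by
  cases d
  all_goals fin_cases i <;> simp [Divisor.coords, map_const]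

end divisors


/-! ### Prime divisors as points of `X_A`, and criteria for moving them -/

section divisors

open MvPolynomial

variable {A B : Param} {R S T : LocalSubring K} {φ : K ≃ₐ[ℂ] K}

/-- The divisors of affine space that are contracted by some transformation. -/
def Divisor.IsAffine : Divisor → Prop
  | .diag | .r₁zero | .r₁neg | .q₁t | .dzero | .dneg => True
  | _ => False

lemma Divisor.cases_of (d : Divisor) :
    d.IsAffine ∨ (∃ k, d = excDivisor k) ∨ ∃ k, d = infDivisor k := by
  cases d
  case e₁ => exact Or.inr (Or.inl ⟨0, rfl⟩)
  case e₂ => exact Or.inr (Or.inl ⟨1, rfl⟩)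
  case e₃ => exact Or.inr (Or.inl ⟨2, rfl⟩)
  case e₄ => exact Or.inr (Or.inl ⟨3, rfl⟩)
  case e₅ => exact Or.inr (Or.inl ⟨4, rfl⟩)
  case e₆ => exact Or.inr (Or.inl ⟨5, rfl⟩)
  case e₇ => exact Or.inr (Or.inl ⟨6, rfl⟩)
  case e₈ => exact Or.inr (Or.inl ⟨7, rfl⟩)
  case e₉ => exact Or.inr (Or.inl ⟨8, rfl⟩)
  case e₁₀ => exact Or.inr (Or.inl ⟨9, rfl⟩)
  case e₁₁ => exact Or.inr (Or.inl ⟨10, rfl⟩)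
  case e₁₂ => exact Or.inr (Or.inl ⟨11, rfl⟩)
  case q₁inf => exact Or.inr (Or.inr ⟨0, rfl⟩)
  case q₂inf => exact Or.inr (Or.inr ⟨1, rfl⟩)
  case r₁inf => exact Or.inr (Or.inr ⟨2, rfl⟩)
  case r₂inf => exact Or.inr (Or.inr ⟨3, rfl⟩)
  all_goals exact Or.inl trivial

/-- These divisors lie in affine four-space, where their adapted coordinates are a polynomial change
of variables. -/
lemma Divisor.gen_eq {d : Divisor} (h : d.IsAffine) :
    gen (Set.range (d.coord A)) = gen (Set.range FujiSuzukiTsuda.coord) := by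
  have h1 : ∀ i, FujiSuzukiTsuda.coord i ∈ gen (Set.range FujiSuzukiTsuda.coord) :=
    fun i => subset_gen _ ⟨i, rfl⟩
  have h2 : ∀ i, d.coord A i ∈ gen (Set.range (d.coord A)) := fun i => subset_gen _ ⟨i, rfl⟩
  have c1 := const_mem_gen (Set.range FujiSuzukiTsuda.coord)
  have c2 := const_mem_gen (Set.range (d.coord A))
  refine gen_eq_gen (fun i => ?_) (fun i => ?_)
  · clear h2 c2
    generalize gen (Set.range FujiSuzukiTsuda.coord) = L at h1 c1
    cases d <;> first | exact h.elim | skip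
    case diag =>
      fin_cases i
      exacts [sub_mem (h1 0) (h1 1), h1 1, h1 2, h1 3]
    case r₁zero =>
      fin_cases i
      exacts [h1 2, h1 0, h1 1, h1 3]
    case r₁neg =>
      fin_cases i
      exacts [add_mem (h1 2) (c1 _), h1 0, h1 1, h1 3]
    case q₁t =>
      fin_cases i
      exacts [sub_mem (h1 0) (c1 _), h1 1, h1 2, h1 3]
    case dzero =>
      fin_cases i
      exacts [add_mem (sub_mem (add_mem (h1 2) (h1 3)) (c1 _)) (c1 _), h1 0, h1 1, h1 2]
    case dneg =>
      fin_cases i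
      exacts [add_mem (add_mem (h1 2) (h1 3)) (c1 _), h1 0, h1 1, h1 2]
  · clear h1 c1
    generalize gen (Set.range (d.coord A)) = L at h2 c2
    cases d <;> first | exact h.elim | skip
    case diag =>
      fin_cases i
      · simpa [Divisor.coord, Divisor.coords] using! add_mem (h2 0) (h2 1)
      exacts [h2 1, h2 2, h2 3]
    case r₁zero =>
      fin_cases i
      exacts [h2 1, h2 2, h2 0, h2 3]
    case r₁neg =>
      fin_cases i
      · exact h2 1
      · exact h2 2
      · simpa [Divisor.coord, Divisor.coords] using! sub_mem (h2 0) (c2 A.a₁)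
      · exact h2 3
    case q₁t =>
      fin_cases i
      · simpa [Divisor.coord, Divisor.coords] using! add_mem (h2 0) (c2 A.t)
      exacts [h2 1, h2 2, h2 3]
    case dzero =>
      fin_cases i
      · exact h2 1
      · exact h2 2
      · exact h2 3
      · have := add_mem (sub_mem (sub_mem (h2 0) (c2 A.η)) (h2 3)) (c2 A.a₃)
        change r₁ + r₂ - const A.a₃ + const A.η - const A.η - r₁ + const A.a₃ ∈ L at this
        change r₂ ∈ L
        convert this using 1
        ring
    case dneg =>
      fin_cases i
      · exact h2 1
      · exact h2 2
      · exact h2 3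
      · have := sub_mem (sub_mem (h2 0) (c2 A.η)) (h2 3)
        change r₁ + r₂ + const A.η - const A.η - r₁ ∈ L at this
        change r₂ ∈ L
        convert this using 1
        ring

lemma gen_le_adjoin {s : Set K} : gen s ≤ (IntermediateField.adjoin ℂ s).toSubalgebra.toSubring :=
  gen_le (fun c => IntermediateField.algebraMap_mem _ c) (IntermediateField.subset_adjoin ℂ s)

lemma Divisor.isCoord (A : Param) (d : Divisor) : IsCoord (d.coord A) := by
  rcases d.cases_of with h | ⟨k, rfl⟩ | ⟨k, rfl⟩
  · refine isCoord_of_adjoin fun i => gen_le_adjoin ?_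
    rw [Divisor.gen_eq h]
    exact subset_gen _ ⟨i, rfl⟩
  · rw [excDivisor_coord]
    exact isCoord_excCoord A k
  · rw [infDivisor_coord]
    exact isCoord_infCoord k

lemma Divisor.big (A : Param) (d : Divisor) : Big (d.loc A) := big_coordLoc (d.isCoord A)

lemma Divisor.loc_mem (ht : A.t ≠ 0) (d : Divisor) : d.loc A ∈ variety A := by
  rcases d.cases_of with h | ⟨k, rfl⟩ | ⟨k, rfl⟩
  · have := (isCoordLoc_coordLoc (d.isCoord A) (n := 1) (by norm_num)).1
    rw [Divisor.gen_eq h] at this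
    exact mem_variety_of_isLocOf ht this (d.big A)
  · rw [Divisor.loc, excDivisor_coord]
    exact (isGoodStage_twelve A ht).exc_mem k k.2
  · rw [Divisor.loc, infDivisor_coord]
    exact infCoord_mem_variety ht k

/-- An affine divisor is determined by its equation. -/
lemma Divisor.eq_loc {d : Divisor} (hd : d.IsAffine) (hR : IsLocOf (gen (Set.range FujiSuzukiTsuda.coord)) R)
    (hbig : Big R) (h0 : d.coord A 0 ∈ maxIdeal R) : R = d.loc A := by
  rw [← Divisor.gen_eq (A := A) hd] at hR
  exact eq_coordLoc_of_big (d.isCoord A) hR hbig h0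

/-- A criterion for `φ` to match big points in one direction. -/
lemma forall_mem_variety (hA : A.t ≠ 0) (hB : B.t ≠ 0)
    (h : ∀ d : Divisor, ¬ d.IsAffine → ∃ d' : Divisor, transport φ.symm (d.loc A) = d'.loc B)
    (h' : ∀ R, IsLocOf (gen (Set.range coord)) R → Big R →
      IsLocOf (gen (Set.range fun i => φ (coord i))) R ∨
        ∃ d' : Divisor, transport φ.symm R = d'.loc B) :
    ∀ R ∈ variety A, Big R → transport φ.symm R ∈ variety B := by
  intro R hR hbig
  have key : ∀ d : Divisor, ¬ d.IsAffine → transport φ.symm (d.loc A) ∈ variety B := fun d hd => by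
    obtain ⟨d', hd'⟩ := h d hd
    rw [hd']
    exact d'.loc_mem hB
  rcases big_variety hA hR hbig with hR | ⟨i, rfl⟩ | ⟨k, rfl⟩
  · rcases h' R hR hbig with hR | ⟨d', hd'⟩
    · refine mem_variety_of_isLocOf hB ?_ hbig.of_transport
      have : Set.range coord = φ.symm '' Set.range fun i => φ (coord i) := by
        rw [← Set.range_comp]
        congr 1
        funext i
        simp
      rw [this, isLocOf_transport]
      exact hR
    · rw [hd']
      exact d'.loc_mem hB
  · rw [← infDivisor_coord A]
    refine key (infDivisor i) ?_
    fin_cases i <;> exact id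
  · rw [exc, ← excDivisor_coord A]
    refine key (excDivisor k) ?_
    fin_cases k <;> exact id

/-- The image of a prime divisor under a substitution. -/
lemma Divisor.move {x₁ x₂ z₁ z₂ : K} (hx₁ : φ q₁ = x₁) (hx₂ : φ q₂ = x₂) (hz₁ : φ r₁ = z₁)
    (hz₂ : φ r₂ = z₂) (d d' : Divisor) {w₁ w₂ w₃ : K}
    (h0 : Cong (d.coord A) (d'.coords B x₁ x₂ z₁ z₂ 0) 0)
    (h1 : Cong (d.coord A) (d'.coords B x₁ x₂ z₁ z₂ 1) w₁)
    (h2 : Cong (d.coord A) (d'.coords B x₁ x₂ z₁ z₂ 2) w₂)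
    (h3 : Cong (d.coord A) (d'.coords B x₁ x₂ z₁ z₂ 3) w₃)
    (hL : ∀ L : IntermediateField ℂ K, w₁ ∈ L → w₂ ∈ L → w₃ ∈ L →
      d.coord A 1 ∈ L ∧ d.coord A 2 ∈ L ∧ d.coord A 3 ∈ L) :
    transport φ.symm (d.loc A) = d'.loc B := by
  subst hx₁ hx₂ hz₁ hz₂
  rw [← Divisor.map_coords] at h0 h1 h2 h3
  exact transport_symm_coordLoc (d'.isCoord B) h0 h1 h2 h3 hL

/-- Denominators in the residue computations are shown to be non-zero by exhibiting one point where
they do not vanish. -/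
lemma ne_zero_of_eval {x : K} (P : MvPolynomial (Fin 4) ℂ) (c : Fin 4 → ℂ) (hc : eval c P ≠ 0)
    (hx : aeval coord P = x) : x ≠ 0 := by
  rintro rfl
  have := isCoord_coord.indep (hx.trans (map_zero _).symm)
  rw [this, map_zero] at hc
  exact hc rfl

lemma q₁_sub_q₂_ne_zero : q₁ - q₂ ≠ 0 :=
  ne_zero_of_eval (X 0 - X 1) ![1, 0, 0, 0] (by simp) (by simp [q₁, q₂])

lemma q₁_sub_const_ne_zero (c : ℂ) : q₁ - const c ≠ 0 :=
  ne_zero_of_eval (X 0 - C c) ![c + 1, 0, 0, 0] (by simp) (by simp [q₁, const])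

lemma q₂_sub_const_ne_zero (c : ℂ) : q₂ - const c ≠ 0 :=
  ne_zero_of_eval (X 1 - C c) ![0, c + 1, 0, 0] (by simp) (by simp [q₂, const])

lemma q₁_sub_one_ne_zero : q₁ - 1 ≠ 0 := by
  rw [← const_one]
  exact q₁_sub_const_ne_zero 1

lemma q₂_sub_one_ne_zero : q₂ - 1 ≠ 0 := by
  rw [← const_one]
  exact q₂_sub_const_ne_zero 1

lemma r₁_add_const_ne_zero (c : ℂ) : r₁ + const c ≠ 0 :=
  ne_zero_of_eval (X 2 + C c) ![0, 0, 1 - c, 0] (by simp) (by simp [r₁, const])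

lemma r₂_add_const_ne_zero (c : ℂ) : r₂ + const c ≠ 0 :=
  ne_zero_of_eval (X 3 + C c) ![0, 0, 0, 1 - c] (by simp) (by simp [r₂, const])

lemma r₁_add_r₂_add_const_ne_zero (c : ℂ) : r₁ + r₂ + const c ≠ 0 :=
  ne_zero_of_eval (X 2 + X 3 + C c) ![0, 0, 1 - c, 0] (by simp) (by simp [r₁, r₂, const])

end divisors


/-! ### Residues of the coordinates -/

section residues

variable (A : Param)

lemma cong_e₁ : Cong (Divisor.e₁.coord A) q₁ 0 ∧ Cong (Divisor.e₁.coord A) (r₁ / q₁) (r₁ / q₁) ∧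
    Cong (Divisor.e₁.coord A) q₂ q₂ ∧ Cong (Divisor.e₁.coord A) r₂ r₂ :=
  ⟨.zero (Divisor.isCoord A _), .coord (Divisor.isCoord A _) 0, .coord (Divisor.isCoord A _) 1,
    .coord (Divisor.isCoord A _) 2⟩

lemma cong_e₂ : Cong (Divisor.e₂.coord A) q₁⁻¹ 0 ∧
    Cong (Divisor.e₂.coord A) ((r₁ + const A.a₁) * q₁) ((r₁ + const A.a₁) * q₁) ∧
    Cong (Divisor.e₂.coord A) q₂ q₂ ∧ Cong (Divisor.e₂.coord A) r₂ r₂ :=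
  ⟨.zero (Divisor.isCoord A _), .coord (Divisor.isCoord A _) 0, .coord (Divisor.isCoord A _) 1,
    .coord (Divisor.isCoord A _) 2⟩

lemma cong_e₃ : Cong (Divisor.e₃.coord A) q₂ 0 ∧ Cong (Divisor.e₃.coord A) (r₂ / q₂) (r₂ / q₂) ∧
    Cong (Divisor.e₃.coord A) q₁ q₁ ∧ Cong (Divisor.e₃.coord A) r₁ r₁ :=
  ⟨.zero (Divisor.isCoord A _), .coord (Divisor.isCoord A _) 0, .coord (Divisor.isCoord A _) 1,
    .coord (Divisor.isCoord A _) 2⟩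

lemma cong_e₄ : Cong (Divisor.e₄.coord A) q₂⁻¹ 0 ∧
    Cong (Divisor.e₄.coord A) ((r₂ + const A.a₅) * q₂) ((r₂ + const A.a₅) * q₂) ∧
    Cong (Divisor.e₄.coord A) q₁ q₁ ∧ Cong (Divisor.e₄.coord A) r₁ r₁ :=
  ⟨.zero (Divisor.isCoord A _), .coord (Divisor.isCoord A _) 0, .coord (Divisor.isCoord A _) 1,
    .coord (Divisor.isCoord A _) 2⟩

lemma cong_e₅ : Cong (Divisor.e₅.coord A) q₁ 0 ∧ Cong (Divisor.e₅.coord A) (q₂ / q₁) (q₂ / q₁) ∧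
    Cong (Divisor.e₅.coord A) ((r₁ + r₂ - const A.a₃ + const A.η) / q₁)
      ((r₁ + r₂ - const A.a₃ + const A.η) / q₁) ∧ Cong (Divisor.e₅.coord A) r₁ r₁ :=
  ⟨.zero (Divisor.isCoord A _), .coord (Divisor.isCoord A _) 0, .coord (Divisor.isCoord A _) 1,
    .coord (Divisor.isCoord A _) 2⟩

lemma cong_e₆ : Cong (Divisor.e₆.coord A) q₁⁻¹ 0 ∧ Cong (Divisor.e₆.coord A) (q₁ / q₂) (q₁ / q₂) ∧
    Cong (Divisor.e₆.coord A) ((r₁ + r₂ + const A.η) * q₁) ((r₁ + r₂ + const A.η) * q₁) ∧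
    Cong (Divisor.e₆.coord A) r₁ r₁ :=
  ⟨.zero (Divisor.isCoord A _), .coord (Divisor.isCoord A _) 0, .coord (Divisor.isCoord A _) 1,
    .coord (Divisor.isCoord A _) 2⟩

/-- The residue of `q₁` follows from `q₁ - t` being the product of the coordinate `(q₁ - t) * r₁`
and the vanishing `r₁⁻¹`. -/
lemma cong_e₇ : Cong (Divisor.e₇.coord A) r₁⁻¹ 0 ∧
    Cong (Divisor.e₇.coord A) ((q₁ - const A.t) * r₁) ((q₁ - const A.t) * r₁) ∧
    Cong (Divisor.e₇.coord A) q₂ q₂ ∧ Cong (Divisor.e₇.coord A) r₂ r₂ ∧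
    Cong (Divisor.e₇.coord A) q₁ (const A.t) := by
  have h0 : Cong (Divisor.e₇.coord A) r₁⁻¹ 0 := .zero (Divisor.isCoord A _)
  have h1 : Cong (Divisor.e₇.coord A) ((q₁ - const A.t) * r₁) ((q₁ - const A.t) * r₁) :=
    .coord (Divisor.isCoord A _) 0
  refine ⟨h0, h1, .coord (Divisor.isCoord A _) 1, .coord (Divisor.isCoord A _) 2,
    ((h1.mul h0).add (.const h0.isCoord A.t)).of ?_ (by simp)⟩
  field_simp [r₁_ne_zero]
  ring

lemma cong_e₈ : Cong (Divisor.e₈.coord A) r₁⁻¹ 0 ∧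
    Cong (Divisor.e₈.coord A) (((q₁ - const A.t) * r₁ - const (A.a₂ * A.t)) * r₁)
      (((q₁ - const A.t) * r₁ - const (A.a₂ * A.t)) * r₁) ∧
    Cong (Divisor.e₈.coord A) q₂ q₂ ∧ Cong (Divisor.e₈.coord A) r₂ r₂ ∧
    Cong (Divisor.e₈.coord A) ((q₁ - const A.t) * r₁) (const A.a₂ * const A.t) ∧
    Cong (Divisor.e₈.coord A) q₁ (const A.t) := by
  have h0 : Cong (Divisor.e₈.coord A) r₁⁻¹ 0 := .zero (Divisor.isCoord A _)
  have h1 : Cong (Divisor.e₈.coord A) (((q₁ - const A.t) * r₁ - const (A.a₂ * A.t)) * r₁)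
      (((q₁ - const A.t) * r₁ - const (A.a₂ * A.t)) * r₁) := .coord (Divisor.isCoord A _) 0
  have h2 : Cong (Divisor.e₈.coord A) ((q₁ - const A.t) * r₁) (const A.a₂ * const A.t) := by
    refine ((h1.mul h0).add (.const h0.isCoord (A.a₂ * A.t))).of ?_ (by simp [const_mul])
    field_simp [r₁_ne_zero]
    ring
  refine ⟨h0, h1, .coord (Divisor.isCoord A _) 1, .coord (Divisor.isCoord A _) 2, h2,
    ((h2.mul h0).add (.const h0.isCoord A.t)).of ?_ (by simp)⟩
  field_simp [r₁_ne_zero]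
  ring

lemma cong_e₉ : Cong (Divisor.e₉.coord A) r₂⁻¹ 0 ∧
    Cong (Divisor.e₉.coord A) ((q₂ - 1) * r₂) ((q₂ - 1) * r₂) ∧
    Cong (Divisor.e₉.coord A) q₁ q₁ ∧ Cong (Divisor.e₉.coord A) r₁ r₁ ∧
    Cong (Divisor.e₉.coord A) q₂ 1 := by
  have h0 : Cong (Divisor.e₉.coord A) r₂⁻¹ 0 := .zero (Divisor.isCoord A _)
  have h1 : Cong (Divisor.e₉.coord A) ((q₂ - 1) * r₂) ((q₂ - 1) * r₂) :=
    .coord (Divisor.isCoord A _) 0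
  refine ⟨h0, h1, .coord (Divisor.isCoord A _) 1, .coord (Divisor.isCoord A _) 2,
    ((h1.mul h0).add (.one h0.isCoord)).of ?_ (by simp)⟩
  field_simp [r₂_ne_zero]
  ring

lemma cong_e₁₀ : Cong (Divisor.e₁₀.coord A) r₂⁻¹ 0 ∧
    Cong (Divisor.e₁₀.coord A) (((q₂ - 1) * r₂ - const A.a₄) * r₂)
      (((q₂ - 1) * r₂ - const A.a₄) * r₂) ∧
    Cong (Divisor.e₁₀.coord A) q₁ q₁ ∧ Cong (Divisor.e₁₀.coord A) r₁ r₁ ∧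
    Cong (Divisor.e₁₀.coord A) ((q₂ - 1) * r₂) (const A.a₄) ∧
    Cong (Divisor.e₁₀.coord A) q₂ 1 := by
  have h0 : Cong (Divisor.e₁₀.coord A) r₂⁻¹ 0 := .zero (Divisor.isCoord A _)
  have h1 : Cong (Divisor.e₁₀.coord A) (((q₂ - 1) * r₂ - const A.a₄) * r₂)
      (((q₂ - 1) * r₂ - const A.a₄) * r₂) := .coord (Divisor.isCoord A _) 0
  have h2 : Cong (Divisor.e₁₀.coord A) ((q₂ - 1) * r₂) (const A.a₄) := by
    refine ((h1.mul h0).add (.const h0.isCoord A.a₄)).of ?_ (by simp)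
    field_simp [r₂_ne_zero]
    ring
  refine ⟨h0, h1, .coord (Divisor.isCoord A _) 1, .coord (Divisor.isCoord A _) 2, h2,
    ((h2.mul h0).add (.one h0.isCoord)).of ?_ (by simp)⟩
  field_simp [r₂_ne_zero]
  ring

lemma cong_e₁₁ : Cong (Divisor.e₁₁.coord A) r₁⁻¹ 0 ∧
    Cong (Divisor.e₁₁.coord A) (r₁ / r₂) (r₁ / r₂) ∧
    Cong (Divisor.e₁₁.coord A) ((q₁ - q₂) * r₁) ((q₁ - q₂) * r₁) ∧
    Cong (Divisor.e₁₁.coord A) q₂ q₂ ∧ Cong (Divisor.e₁₁.coord A) q₁ q₂ := by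
  have h0 : Cong (Divisor.e₁₁.coord A) r₁⁻¹ 0 := .zero (Divisor.isCoord A _)
  have h2 : Cong (Divisor.e₁₁.coord A) ((q₁ - q₂) * r₁) ((q₁ - q₂) * r₁) :=
    .coord (Divisor.isCoord A _) 1
  have h3 : Cong (Divisor.e₁₁.coord A) q₂ q₂ := .coord (Divisor.isCoord A _) 2
  refine ⟨h0, .coord (Divisor.isCoord A _) 0, h2, h3, ((h2.mul h0).add h3).of ?_ (by simp)⟩
  field_simp [r₁_ne_zero]
  ring

/-- Multiplying the coordinates by `r₁⁻¹` gives the residues on the infinitely near centre, and once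
more those on the original curve `q₁ = q₂`. -/
lemma cong_e₁₂ : Cong (Divisor.e₁₂.coord A) r₁⁻¹ 0 ∧
    Cong (Divisor.e₁₂.coord A) ((r₁ / r₂ + 1) * r₁) ((r₁ / r₂ + 1) * r₁) ∧
    Cong (Divisor.e₁₂.coord A) (((q₁ - q₂) * r₁ - const A.a₀ * q₂) * r₁)
      (((q₁ - q₂) * r₁ - const A.a₀ * q₂) * r₁) ∧
    Cong (Divisor.e₁₂.coord A) q₂ q₂ ∧
    Cong (Divisor.e₁₂.coord A) (r₁ / r₂) (-1) ∧
    Cong (Divisor.e₁₂.coord A) ((q₁ - q₂) * r₁) (const A.a₀ * q₂) ∧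
    Cong (Divisor.e₁₂.coord A) q₁ q₂ := by
  have h0 : Cong (Divisor.e₁₂.coord A) r₁⁻¹ 0 := .zero (Divisor.isCoord A _)
  have h1 : Cong (Divisor.e₁₂.coord A) ((r₁ / r₂ + 1) * r₁) ((r₁ / r₂ + 1) * r₁) :=
    .coord (Divisor.isCoord A _) 0
  have h2 : Cong (Divisor.e₁₂.coord A) (((q₁ - q₂) * r₁ - const A.a₀ * q₂) * r₁)
      (((q₁ - q₂) * r₁ - const A.a₀ * q₂) * r₁) := .coord (Divisor.isCoord A _) 1
  have h3 : Cong (Divisor.e₁₂.coord A) q₂ q₂ := .coord (Divisor.isCoord A _) 2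
  have h4 : Cong (Divisor.e₁₂.coord A) (r₁ / r₂) (-1) := by
    refine ((h1.mul h0).sub (.one h0.isCoord)).of ?_ (by simp)
    field_simp [r₁_ne_zero, r₂_ne_zero]
    ring
  have h5 : Cong (Divisor.e₁₂.coord A) ((q₁ - q₂) * r₁) (const A.a₀ * q₂) := by
    refine ((h2.mul h0).add ((Cong.const h0.isCoord A.a₀).mul h3)).of ?_ (by simp)
    field_simp [r₁_ne_zero]
    ring
  refine ⟨h0, h1, h2, h3, h4, h5, ((h5.mul h0).add h3).of ?_ (by simp)⟩
  field_simp [r₁_ne_zero]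
  ring

lemma cong_q₁inf : Cong (Divisor.q₁inf.coord A) q₁⁻¹ 0 ∧ Cong (Divisor.q₁inf.coord A) q₂ q₂ ∧
    Cong (Divisor.q₁inf.coord A) r₁ r₁ ∧ Cong (Divisor.q₁inf.coord A) r₂ r₂ :=
  ⟨.zero (Divisor.isCoord A _), .coord (Divisor.isCoord A _) 0, .coord (Divisor.isCoord A _) 1,
    .coord (Divisor.isCoord A _) 2⟩

lemma cong_q₂inf : Cong (Divisor.q₂inf.coord A) q₂⁻¹ 0 ∧ Cong (Divisor.q₂inf.coord A) q₁ q₁ ∧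
    Cong (Divisor.q₂inf.coord A) r₁ r₁ ∧ Cong (Divisor.q₂inf.coord A) r₂ r₂ :=
  ⟨.zero (Divisor.isCoord A _), .coord (Divisor.isCoord A _) 0, .coord (Divisor.isCoord A _) 1,
    .coord (Divisor.isCoord A _) 2⟩

lemma cong_r₁inf : Cong (Divisor.r₁inf.coord A) r₁⁻¹ 0 ∧ Cong (Divisor.r₁inf.coord A) q₁ q₁ ∧
    Cong (Divisor.r₁inf.coord A) q₂ q₂ ∧ Cong (Divisor.r₁inf.coord A) r₂ r₂ :=
  ⟨.zero (Divisor.isCoord A _), .coord (Divisor.isCoord A _) 0, .coord (Divisor.isCoord A _) 1,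
    .coord (Divisor.isCoord A _) 2⟩

lemma cong_r₂inf : Cong (Divisor.r₂inf.coord A) r₂⁻¹ 0 ∧ Cong (Divisor.r₂inf.coord A) q₁ q₁ ∧
    Cong (Divisor.r₂inf.coord A) q₂ q₂ ∧ Cong (Divisor.r₂inf.coord A) r₁ r₁ :=
  ⟨.zero (Divisor.isCoord A _), .coord (Divisor.isCoord A _) 0, .coord (Divisor.isCoord A _) 1,
    .coord (Divisor.isCoord A _) 2⟩

end residues


/-! ### Images of prime divisors under a Bäcklund transformation -/

section sends

variable {A : Param}

/-- Substituting `onCoord` for the coordinates maps the prime divisor `d` of `X_A` to the prime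
divisor `d'` of `X_Ā`. -/
def Backlund.Sends (g : Backlund) (A : Param) (d d' : Divisor) : Prop :=
  ∀ φ : K ≃ₐ[ℂ] K, (∀ i, φ (coord i) = g.onCoord A i) →
    transport φ.symm (d.loc A) = d'.loc (g.onParam A)

variable {g : Backlund}

/-- In applications the `w`s are the residues of the transformed coordinates, and the last
hypothesis asks to recover the old coordinates of the divisor from them, constants being available.
-/
lemma Backlund.sends {d d' : Divisor} (w₁ w₂ w₃ : K)
    (h0 : Cong (d.coord A) (d'.coords (g.onParam A) (g.onCoord A 0) (g.onCoord A 1) (g.onCoord A 2)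
      (g.onCoord A 3) 0) 0)
    (h1 : Cong (d.coord A) (d'.coords (g.onParam A) (g.onCoord A 0) (g.onCoord A 1) (g.onCoord A 2)
      (g.onCoord A 3) 1) w₁)
    (h2 : Cong (d.coord A) (d'.coords (g.onParam A) (g.onCoord A 0) (g.onCoord A 1) (g.onCoord A 2)
      (g.onCoord A 3) 2) w₂)
    (h3 : Cong (d.coord A) (d'.coords (g.onParam A) (g.onCoord A 0) (g.onCoord A 1) (g.onCoord A 2)
      (g.onCoord A 3) 3) w₃)
    (hL : ∀ L : IntermediateField ℂ K, (∀ c, const c ∈ L) → w₁ ∈ L → w₂ ∈ L → w₃ ∈ L →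
      d.coord A 1 ∈ L ∧ d.coord A 2 ∈ L ∧ d.coord A 3 ∈ L) : g.Sends A d d' :=
  fun _ hφ => Divisor.move (hφ 0) (hφ 1) (hφ 2) (hφ 3) d d' h0 h1 h2 h3
    fun L => hL L fun c => L.algebraMap_mem c

lemma mem_of_eq {L : IntermediateField ℂ K} {x y : K} (h : x ∈ L) (e : x = y) : y ∈ L := e ▸ h

namespace Cong

variable {y : Fin 4 → K} {x u w : K}

/-- A function with a pole along the divisor keeps it after subtraction of a regular function. -/
lemma inv_sub (h : Cong y x⁻¹ 0) (hx : x ≠ 0) (hu : Cong y u w) : Cong y (x - u)⁻¹ 0 := by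
  refine (h.div ((one h.isCoord).sub (hu.mul h)) (by simp)).of ?_ (zero_div _)
  rw [div_eq_mul_inv, ← mul_inv, mul_sub, mul_one, mul_left_comm, mul_inv_cancel₀ hx, mul_one]

lemma inv_add (h : Cong y x⁻¹ 0) (hx : x ≠ 0) (hu : Cong y u w) : Cong y (x + u)⁻¹ 0 := by
  refine (h.div ((one h.isCoord).add (hu.mul h)) (by simp)).of ?_ (zero_div _)
  rw [div_eq_mul_inv, ← mul_inv, mul_add, mul_one, mul_left_comm, mul_inv_cancel₀ hx, mul_one]

end Cong

end sends


/-! ### The transformation `s₀` -/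

section s₀

variable (A : Param)

lemma s₀_e₁ : Backlund.s₀.Sends A .e₁ .e₁ := by
  obtain ⟨c0, c1, c2, c3⟩ := cong_e₁ A
  have a := Cong.const c0.isCoord A.a₀
  have n := q₁_sub_q₂_ne_zero
  have n1 := q₁_ne_zero
  have n2 := q₂_ne_zero
  refine Backlund.sends (r₁ / q₁ + const A.a₀ / q₂) q₂ (r₂ - const A.a₀) ?_ ?_ ?_ ?_
    fun L m m1 m2 m3 => ⟨mem_of_eq (sub_mem m1 (div_mem (m A.a₀) m2)) (add_sub_cancel_right _ _),
      m2, (sub_const_mem_iff _).1 m3⟩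
  all_goals simp only [Divisor.coords, Backlund.onCoord, Matrix.cons_val]
  exacts [c0, (c1.sub (a.div (c0.sub c2) (by simpa using n2))).of (by grind) (by grind), c2,
    (c3.add ((a.mul c2).div (c0.sub c2) (by simpa using n2))).of (by grind) (by grind)]

/-- With `ā₁ = a₀ + a₁` the transformed `r₁ + a₁` is the old one minus `a₀ q₂ / (q₁ - q₂)`, which
stays finite after multiplication by the pole `q₁`. -/
lemma s₀_e₂ : Backlund.s₀.Sends A .e₂ .e₂ := by
  obtain ⟨c0, c1, c2, c3⟩ := cong_e₂ A
  have a := Cong.const c0.isCoord A.a₀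
  have n := q₁_sub_q₂_ne_zero
  have n1 := q₁_ne_zero
  have d := (Cong.one c0.isCoord).sub (c0.mul c2)
  have e : 1 - q₁⁻¹ * q₂ = (q₁ - q₂) / q₁ := by field_simp
  rw [e, zero_mul, sub_zero] at d
  refine Backlund.sends ((r₁ + const A.a₁) * q₁ - const A.a₀ * q₂) q₂ r₂ ?_ ?_ ?_ ?_
    fun L m m1 m2 m3 => ⟨mem_of_eq (add_mem m1 (mul_mem (m A.a₀) m2)) (sub_add_cancel _ _), m2, m3⟩
  all_goals simp only [Divisor.coords, Backlund.onCoord, Backlund.onParam, Matrix.cons_val,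
    const_add]
  exacts [c0, (c1.sub ((a.mul c2).div d one_ne_zero)).of (by grind) (by grind), c2,
    (c3.add ((a.mul (c0.mul c2)).div d one_ne_zero)).of (by grind) (by grind)]

lemma s₀_e₃ : Backlund.s₀.Sends A .e₃ .e₃ := by
  obtain ⟨c0, c1, c2, c3⟩ := cong_e₃ A
  have a := Cong.const c0.isCoord A.a₀
  have n := q₁_sub_q₂_ne_zero
  have n1 := q₁_ne_zero
  have n2 := q₂_ne_zero
  refine Backlund.sends (r₂ / q₂ + const A.a₀ / q₁) q₁ (r₁ - const A.a₀) ?_ ?_ ?_ ?_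
    fun L m m1 m2 m3 => ⟨mem_of_eq (sub_mem m1 (div_mem (m A.a₀) m2)) (add_sub_cancel_right _ _),
      m2, (sub_const_mem_iff _).1 m3⟩
  all_goals simp only [Divisor.coords, Backlund.onCoord, Matrix.cons_val]
  exacts [c0, (c1.add (a.div (c2.sub c0) (by simpa using n1))).of (by grind) (by grind), c2,
    (c3.sub ((a.mul c2).div (c2.sub c0) (by simpa using n1))).of (by grind) (by grind)]

lemma s₀_e₄ : Backlund.s₀.Sends A .e₄ .e₄ := by
  obtain ⟨c0, c1, c2, c3⟩ := cong_e₄ A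
  have a := Cong.const c0.isCoord A.a₀
  have n := q₁_sub_q₂_ne_zero
  have n2 := q₂_ne_zero
  have d := (Cong.one c0.isCoord).sub (c0.mul c2)
  have e : 1 - q₂⁻¹ * q₁ = (q₂ - q₁) / q₂ := by field_simp
  rw [e, zero_mul, sub_zero] at d
  refine Backlund.sends ((r₂ + const A.a₅) * q₂ - const A.a₀ * q₁) q₁ r₁ ?_ ?_ ?_ ?_
    fun L m m1 m2 m3 => ⟨mem_of_eq (add_mem m1 (mul_mem (m A.a₀) m2)) (sub_add_cancel _ _), m2, m3⟩
  all_goals simp only [Divisor.coords, Backlund.onCoord, Backlund.onParam, Matrix.cons_val,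
    const_add]
  exacts [c0, (c1.sub ((a.mul c2).div d one_ne_zero)).of (by grind) (by grind), c2,
    (c3.add ((a.mul (c0.mul c2)).div d one_ne_zero)).of (by grind) (by grind)]

/-- The sum `r₁ + r₂` drops by `a₀` while `η` rises by `a₀`, so the equation of the centre is
invariant. -/
lemma s₀_e₅ : Backlund.s₀.Sends A .e₅ .e₅ := by
  obtain ⟨c0, c1, c2, c3⟩ := cong_e₅ A
  have a := Cong.const c0.isCoord A.a₀
  have n := q₁_sub_q₂_ne_zero
  have n1 := q₁_ne_zero
  have e : 1 - q₂ / q₁ = (q₁ - q₂) / q₁ := by field_simp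
  have d := (Cong.one c0.isCoord).sub c1
  have ne : 1 - q₂ / q₁ ≠ 0 := by rw [e]; exact div_ne_zero n n1
  refine Backlund.sends (q₂ / q₁) ((r₁ + r₂ - const A.a₃ + const A.η) / q₁)
    (r₁ - const A.a₀ / (1 - q₂ / q₁)) ?_ ?_ ?_ ?_
    fun L m m1 m2 m3 => ⟨m1, m2, mem_of_eq (add_mem m3 (div_mem (m A.a₀) (sub_mem L.one_mem m1)))
      (sub_add_cancel _ _)⟩
  all_goals simp only [Divisor.coords, Backlund.onCoord, Backlund.onParam, Matrix.cons_val,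
    const_add]
  exacts [c0, c1, c2.of (by grind) rfl, (c3.sub (a.div d ne)).of (by grind) rfl]

lemma s₀_e₆ : Backlund.s₀.Sends A .e₆ .e₆ := by
  obtain ⟨c0, c1, c2, c3⟩ := cong_e₆ A
  have a := Cong.const c0.isCoord A.a₀
  have n := q₁_sub_q₂_ne_zero
  have n2 := q₂_ne_zero
  have e : q₁ / q₂ - 1 = (q₁ - q₂) / q₂ := by field_simp
  have d := c1.sub (Cong.one c0.isCoord)
  have ne : q₁ / q₂ - 1 ≠ 0 := by rw [e]; exact div_ne_zero n n2
  refine Backlund.sends (q₁ / q₂) ((r₁ + r₂ + const A.η) * q₁)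
    (r₁ - const A.a₀ * (q₁ / q₂) / (q₁ / q₂ - 1)) ?_ ?_ ?_ ?_
    fun L m m1 m2 m3 => ⟨m1, m2, mem_of_eq (add_mem m3 (div_mem (mul_mem (m A.a₀) m1)
      (sub_mem m1 L.one_mem))) (sub_add_cancel _ _)⟩
  all_goals simp only [Divisor.coords, Backlund.onCoord, Backlund.onParam, Matrix.cons_val,
    const_add]
  exacts [c0, c1, c2.of (by grind) rfl, (c3.sub ((a.mul c1).div d ne)).of (by grind) rfl]

lemma const_sub_q₂_ne_zero (c : ℂ) : const c - q₂ ≠ 0 :=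
  sub_ne_zero.2 (sub_ne_zero.1 (q₂_sub_const_ne_zero c)).symm

lemma s₀_e₇ : Backlund.s₀.Sends A .e₇ .e₇ := by
  obtain ⟨c0, c1, c2, c3, c4⟩ := cong_e₇ A
  have a := Cong.const c0.isCoord A.a₀
  have n := q₁_sub_q₂_ne_zero
  have nt := const_sub_q₂_ne_zero A.t
  have u := (a.mul c4).div (c4.sub c2) nt
  have v := (a.mul c2).div (c4.sub c2) nt
  refine Backlund.sends ((q₁ - const A.t) * r₁) q₂ (r₂ + const A.a₀ * q₂ / (const A.t - q₂))
    ?_ ?_ ?_ ?_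
    fun L m m1 m2 m3 => ⟨m1, m2, mem_of_eq (sub_mem m3 (div_mem (mul_mem (m A.a₀) m2)
      (sub_mem (m _) m2))) (add_sub_cancel_right _ _)⟩
  all_goals simp only [Divisor.coords, Backlund.onCoord, Backlund.onParam, Matrix.cons_val]
  exacts [c0.inv_sub r₁_ne_zero u,
    (c1.sub ((c4.sub (Cong.const c0.isCoord A.t)).mul u)).of (by ring) (by ring), c2, c3.add v]

/-- Replacing `r₁` by `r₁ - u` changes the quadratic coordinate by terms with known residues: `(q₁ -
t) * r₁` tends to `a₂ t` and `q₁ - t` to zero. -/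
lemma s₀_e₈ : Backlund.s₀.Sends A .e₈ .e₈ := by
  obtain ⟨c0, c1, c2, c3, c4, c5⟩ := cong_e₈ A
  have a := Cong.const c0.isCoord A.a₀
  have b := (Cong.const c0.isCoord A.a₂).mul (Cong.const c0.isCoord A.t)
  have n := q₁_sub_q₂_ne_zero
  have nt := const_sub_q₂_ne_zero A.t
  have u := (a.mul c5).div (c5.sub c2) nt
  have v := (a.mul c2).div (c5.sub c2) nt
  refine Backlund.sends (((q₁ - const A.t) * r₁ - const (A.a₂ * A.t)) * r₁ -
    const A.a₂ * const A.t * (const A.a₀ * const A.t / (const A.t - q₂))) q₂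
    (r₂ + const A.a₀ * q₂ / (const A.t - q₂)) ?_ ?_ ?_ ?_
    fun L m m1 m2 m3 => ⟨mem_of_eq (add_mem m1 (mul_mem (mul_mem (m _) (m _)) (div_mem
      (mul_mem (m _) (m _)) (sub_mem (m _) m2)))) (sub_add_cancel _ _), m2,
      mem_of_eq (sub_mem m3 (div_mem (mul_mem (m A.a₀) m2)
      (sub_mem (m _) m2))) (add_sub_cancel_right _ _)⟩
  all_goals simp only [Divisor.coords, Backlund.onCoord, Backlund.onParam, Matrix.cons_val]
  exacts [c0.inv_sub r₁_ne_zero u,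
    (((c1.sub ((c4.sub b).mul u)).sub (c4.mul u)).add ((c5.sub (Cong.const c0.isCoord A.t)).mul
      (u.mul u))).of (by rw [const_mul]; ring) (by ring),
    c2, c3.add v]

lemma s₀_e₉ : Backlund.s₀.Sends A .e₉ .e₉ := by
  obtain ⟨c0, c1, c2, c3, c4⟩ := cong_e₉ A
  have a := Cong.const c0.isCoord A.a₀
  have n := q₁_sub_one_ne_zero
  have u := (a.mul c2).div (c2.sub c4) n
  have v := (a.mul c4).div (c2.sub c4) n
  refine Backlund.sends ((q₂ - 1) * r₂) q₁ (r₁ - const A.a₀ * q₁ / (q₁ - 1)) ?_ ?_ ?_ ?_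
    fun L m m1 m2 m3 => ⟨m1, m2, mem_of_eq (add_mem m3 (div_mem (mul_mem (m A.a₀) m2)
      (sub_mem m2 L.one_mem))) (sub_add_cancel _ _)⟩
  all_goals simp only [Divisor.coords, Backlund.onCoord, Matrix.cons_val]
  exacts [c0.inv_add r₂_ne_zero v,
    (c1.add ((c4.sub (Cong.one c0.isCoord)).mul v)).of (by ring) (by ring), c2, c3.sub u]

lemma s₀_e₁₀ : Backlund.s₀.Sends A .e₁₀ .e₁₀ := by
  obtain ⟨c0, c1, c2, c3, c4, c5⟩ := cong_e₁₀ A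
  have a := Cong.const c0.isCoord A.a₀
  have b := Cong.const c0.isCoord A.a₄
  have n := q₁_sub_one_ne_zero
  have u := (a.mul c2).div (c2.sub c5) n
  have v := (a.mul c5).div (c2.sub c5) n
  refine Backlund.sends (((q₂ - 1) * r₂ - const A.a₄) * r₂ + const A.a₄ * (const A.a₀ / (q₁ - 1))) q₁
    (r₁ - const A.a₀ * q₁ / (q₁ - 1)) ?_ ?_ ?_ ?_
    fun L m m1 m2 m3 => ⟨mem_of_eq (sub_mem m1 (mul_mem (m _) (div_mem (m _)
      (sub_mem m2 L.one_mem)))) (add_sub_cancel_right _ _), m2,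
      mem_of_eq (add_mem m3 (div_mem (mul_mem (m A.a₀) m2)
      (sub_mem m2 L.one_mem))) (sub_add_cancel _ _)⟩
  all_goals simp only [Divisor.coords, Backlund.onCoord, Backlund.onParam, Matrix.cons_val]
  exacts [c0.inv_add r₂_ne_zero v,
    (((c1.add ((c4.sub b).mul v)).add (c4.mul v)).add ((c5.sub (Cong.one c0.isCoord)).mul (v.mul
      v))).of (by ring) (by ring),
    c2, c3.sub u]

lemma diff_mul_r₁_ne_zero : (q₁ - q₂) * r₁ ≠ 0 := mul_ne_zero q₁_sub_q₂_ne_zero r₁_ne_zero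

-- Both momenta have poles along `e₁₁`. Dividing the new ones by the old `r₁` leaves factors whose
-- residues are non-zero there, so the poles persist.
open MvPolynomial in
lemma s₀_e₁₁ : Backlund.s₀.Sends A .e₁₁ .e₁₁ := by
  obtain ⟨c0, c1, c2, c3, c4⟩ := cong_e₁₁ A
  have a := Cong.const c0.isCoord A.a₀
  have n := q₁_sub_q₂_ne_zero
  have n3 := r₁_ne_zero
  have n4 := r₂_ne_zero
  have nn := diff_mul_r₁_ne_zero
  have n5 : (q₁ - q₂) * r₁ - const A.a₀ * q₂ ≠ 0 :=
    ne_zero_of_eval ((X 0 - X 1) * X 2 - C A.a₀ * X 1) ![1, 0, 1, 0] (by simp)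
      (by simp [q₁, q₂, r₁, const])
  have n6 : (q₁ - q₂) * r₂ + const A.a₀ * q₂ ≠ 0 :=
    ne_zero_of_eval ((X 0 - X 1) * X 3 + C A.a₀ * X 1) ![1, 0, 0, 1] (by simp)
      (by simp [q₁, q₂, r₂, const])
  have k := (Cong.one c0.isCoord).sub ((a.mul c4).div c2 nn)
  have l := (c1.inv (div_ne_zero n3 n4)).add ((a.mul c3).div c2 nn)
  have nk : 1 - const A.a₀ * q₂ / ((q₁ - q₂) * r₁) ≠ 0 := by
    rw [one_sub_div nn]
    exact div_ne_zero n5 nn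
  have nl : (r₁ / r₂)⁻¹ + const A.a₀ * q₂ / ((q₁ - q₂) * r₁) ≠ 0 := by
    have : (r₁ / r₂)⁻¹ + const A.a₀ * q₂ / ((q₁ - q₂) * r₁) =
      ((q₁ - q₂) * r₂ + const A.a₀ * q₂) / ((q₁ - q₂) * r₁) := by field_simp
    rw [this]
    exact div_ne_zero n6 nn
  refine Backlund.sends ((1 - const A.a₀ * q₂ / ((q₁ - q₂) * r₁)) /
    ((r₁ / r₂)⁻¹ + const A.a₀ * q₂ / ((q₁ - q₂) * r₁)))
    ((q₁ - q₂) * r₁ - const A.a₀ * q₂) q₂ ?_ ?_ ?_ ?_ fun L m m1 m2 m3 => ?_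
  rotate_right
  · have m4 : (q₁ - q₂) * r₁ ∈ L := mem_of_eq (add_mem m2 (mul_mem (m A.a₀) m3)) (sub_add_cancel _ _)
    have m5 := div_mem (mul_mem (m A.a₀) m3) m4
    refine ⟨?_, m4, m3⟩
    change r₁ / r₂ ∈ L
    rw [← inv_mem_field]
    refine mem_of_eq (sub_mem (div_mem (sub_mem L.one_mem m5) m1) m5) ?_
    rw [div_div_cancel₀ nk, add_sub_cancel_right]
  all_goals simp only [Divisor.coords, Backlund.onCoord, Matrix.cons_val]
  exacts [(c0.div k nk).of (by field_simp) (zero_div _), (k.div l nl).of (by field_simp) rfl,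
    (c2.sub (a.mul c4)).of (by field_simp) rfl, c3]

/-- Here `(q₁ - q₂) * r₁` has residue `a₀ q₂`, exactly what cancels the pole of the new `r₁`; its
finite part is read off from the quadratic coordinate. The new `r₂` then follows because `r₁ + r₂`
is finite on `e₁₂`. -/
lemma s₀_e₁₂ (h : A.a₀ ≠ 0) : Backlund.s₀.Sends A .e₁₂ .diag := by
  obtain ⟨c0, c1, c2, c3, c4, c5, c6⟩ := cong_e₁₂ A
  have a := Cong.const c0.isCoord A.a₀
  have na := const_ne_zero h
  have n := q₁_sub_q₂_ne_zero
  have n2 := q₂_ne_zero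
  have n3 := r₁_ne_zero
  have n4 := r₂_ne_zero
  have nn := diff_mul_r₁_ne_zero
  have naq := mul_ne_zero na n2
  have k := (c2.sub (a.mul c5)).div c5 naq
  refine Backlund.sends q₂ (((((q₁ - q₂) * r₁ - const A.a₀ * q₂) * r₁) -
    const A.a₀ * (const A.a₀ * q₂)) / (const A.a₀ * q₂))
    (-const A.a₀ - (r₁ / r₂ + 1) * r₁ - ((((q₁ - q₂) * r₁ - const A.a₀ * q₂) * r₁) -
    const A.a₀ * (const A.a₀ * q₂)) / (const A.a₀ * q₂)) ?_ ?_ ?_ ?_ fun L m m1 m2 m3 => ?_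
  rotate_right
  · have m4 := mul_mem (m A.a₀) m1
    refine ⟨?_, mem_of_eq (add_mem ((div_mem_field m4 naq).1 m2) (mul_mem (m A.a₀) m4))
      (sub_add_cancel _ _), m1⟩
    change (r₁ / r₂ + 1) * r₁ ∈ L
    exact mem_of_eq (sub_mem (sub_mem (neg_mem (m A.a₀)) m2) m3) (by ring)
  all_goals simp only [Divisor.coords, Backlund.onCoord, Matrix.cons_val]
  · exact (c6.sub c3).of rfl (sub_self _)
  · exact c3
  · exact k.of (by grind) rfl
  · refine (((c1.div c4 (by simp)).sub a).sub k).of ?_ (by ring)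
    have e : (r₁ / r₂ + 1) * r₁ / (r₁ / r₂) = r₁ + r₂ := by
      field_simp
    rw [e]
    field_simp
    ring

lemma s₀_q₁inf : Backlund.s₀.Sends A .q₁inf .q₁inf := by
  obtain ⟨c0, c1, c2, c3⟩ := cong_q₁inf A
  have a := Cong.const c0.isCoord A.a₀
  have n := q₁_sub_q₂_ne_zero
  have n1 := q₁_ne_zero
  have d := (Cong.one c0.isCoord).sub (c1.mul c0)
  refine Backlund.sends q₂ (r₁ - const A.a₀) r₂ ?_ ?_ ?_ ?_
    fun L m m1 m2 m3 => ⟨m1, (sub_const_mem_iff _).1 m2, m3⟩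
  all_goals simp only [Divisor.coords, Backlund.onCoord, Matrix.cons_val]
  exacts [c0, c1, (c2.sub (a.div d (by simp))).of (by grind) (by simp),
    (c3.add ((a.mul (c1.mul c0)).div d (by simp))).of (by grind) (by simp)]

lemma s₀_q₂inf : Backlund.s₀.Sends A .q₂inf .q₂inf := by
  obtain ⟨c0, c1, c2, c3⟩ := cong_q₂inf A
  have a := Cong.const c0.isCoord A.a₀
  have n := q₁_sub_q₂_ne_zero
  have n2 := q₂_ne_zero
  have d := (Cong.one c0.isCoord).sub (c1.mul c0)
  refine Backlund.sends q₁ r₁ (r₂ - const A.a₀) ?_ ?_ ?_ ?_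
    fun L m m1 m2 m3 => ⟨m1, m2, (sub_const_mem_iff _).1 m3⟩
  all_goals simp only [Divisor.coords, Backlund.onCoord, Matrix.cons_val]
  exacts [c0, c1, (c2.add ((a.mul (c1.mul c0)).div d (by simp))).of (by grind) (by simp),
    (c3.sub (a.div d (by simp))).of (by grind) (by simp)]

lemma s₀_r₁inf : Backlund.s₀.Sends A .r₁inf .r₁inf := by
  obtain ⟨c0, c1, c2, c3⟩ := cong_r₁inf A
  have a := Cong.const c0.isCoord A.a₀
  have n := q₁_sub_q₂_ne_zero
  refine Backlund.sends q₁ q₂ (r₂ + const A.a₀ * q₂ / (q₁ - q₂)) ?_ ?_ ?_ ?_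
    fun L m m1 m2 m3 => ⟨m1, m2, mem_of_eq (sub_mem m3 (div_mem (mul_mem (m A.a₀) m2)
      (sub_mem m1 m2))) (add_sub_cancel_right _ _)⟩
  all_goals simp only [Divisor.coords, Backlund.onCoord, Matrix.cons_val]
  exacts [c0.inv_sub r₁_ne_zero ((a.mul c1).div (c1.sub c2) n), c1, c2,
    c3.add ((a.mul c2).div (c1.sub c2) n)]

lemma s₀_r₂inf : Backlund.s₀.Sends A .r₂inf .r₂inf := by
  obtain ⟨c0, c1, c2, c3⟩ := cong_r₂inf A
  have a := Cong.const c0.isCoord A.a₀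
  have n := q₁_sub_q₂_ne_zero
  refine Backlund.sends q₁ q₂ (r₁ - const A.a₀ * q₁ / (q₁ - q₂)) ?_ ?_ ?_ ?_
    fun L m m1 m2 m3 => ⟨m1, m2, mem_of_eq (add_mem m3 (div_mem (mul_mem (m A.a₀) m1)
      (sub_mem m1 m2))) (sub_add_cancel _ _)⟩
  all_goals simp only [Divisor.coords, Backlund.onCoord, Matrix.cons_val]
  exacts [c0.inv_add r₂_ne_zero ((a.mul c2).div (c1.sub c2) n), c1, c2,
    c3.sub ((a.mul c1).div (c1.sub c2) n)]

lemma s₀_diag (h : A.a₀ ≠ 0) : Backlund.s₀.Sends A .diag .e₁₂ := by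
  have c0 : Cong (Divisor.diag.coord A) (q₁ - q₂) 0 := .zero (Divisor.isCoord A _)
  have c1 : Cong (Divisor.diag.coord A) q₂ q₂ := .coord (Divisor.isCoord A _) 0
  have c2 : Cong (Divisor.diag.coord A) r₁ r₁ := .coord (Divisor.isCoord A _) 1
  have c3 : Cong (Divisor.diag.coord A) r₂ r₂ := .coord (Divisor.isCoord A _) 2
  have a := Cong.const c0.isCoord A.a₀
  have na := const_ne_zero h
  have n := q₁_sub_q₂_ne_zero
  have n2 := q₂_ne_zero
  have naq := mul_ne_zero na n2
  have N := (c0.mul (c2.sub a)).sub (a.mul c1)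
  have M := (c0.mul c3).add (a.mul c1)
  have nN : (0 : K) * (r₁ - const A.a₀) - const A.a₀ * q₂ ≠ 0 := by simpa [const_eq_zero, n2] using h
  have nM : (0 : K) * r₂ + const A.a₀ * q₂ ≠ 0 := by simpa [const_eq_zero, n2] using h
  have N0 := N.ne_zero nN
  have M0 := M.ne_zero nM
  -- Over the denominator `q₁ - q₂` the numerators have the non-zero residues `-a₀ q₂` and `a₀ q₂`,
  -- so both momenta acquire simple poles along the diagonal.
  have e1 : r₁ - const A.a₀ * q₁ / (q₁ - q₂) =
      ((q₁ - q₂) * (r₁ - const A.a₀) - const A.a₀ * q₂) / (q₁ - q₂) := by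
    field_simp
    ring
  have e2 : r₂ + const A.a₀ * q₂ / (q₁ - q₂) =
      ((q₁ - q₂) * r₂ + const A.a₀ * q₂) / (q₁ - q₂) := by
    field_simp
  refine Backlund.sends (-(r₁ + r₂ - const A.a₀)) (-((r₁ - const A.a₀) * (const A.a₀ * q₂))) q₂
    ?_ ?_ ?_ ?_ fun L m m1 m2 m3 => ?_
  rotate_right
  · have m4 : r₁ ∈ L := by
      have := neg_mem m2
      rw [neg_neg, mul_comm] at this
      exact (sub_const_mem_iff A.a₀).1
        (mem_of_eq (div_mem this (mul_mem (m A.a₀) m3)) (mul_div_cancel_left₀ _ naq))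
    refine ⟨m3, m4, ?_⟩
    change r₂ ∈ L
    exact mem_of_eq (sub_mem (add_mem (neg_mem m1) (m A.a₀)) m4) (by ring)
  all_goals simp only [Divisor.coords, Backlund.onCoord, Backlund.onParam, Matrix.cons_val,
    const_neg]
  · exact (c0.div N nN).of (by rw [e1, inv_div]) (zero_div _)
  · refine (((c2.add c3).sub a).mul (N.div M nM)).of ?_ (by grind)
    rw [e1, e2, div_div_div_cancel_right₀ n, div_add_one M0, div_mul_div_comm, mul_div_assoc',
      div_eq_div_iff M0 (mul_ne_zero M0 n)]
    ring
  · refine ((c2.sub a).mul N).of ?_ (by ring)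
    rw [e1]
    field_simp
    ring
  · exact c1

end s₀


/-! ### The transformation `s₁` -/

section s₁

lemma one_add_div_r₁_ne_zero (c : ℂ) : 1 + const c / r₁ ≠ 0 := by
  rw [one_add_div r₁_ne_zero]
  exact div_ne_zero (r₁_add_const_ne_zero c) r₁_ne_zero

lemma Cong.one_add_div_r₁ {y : Fin 4 → K} (c : ℂ) (h : Cong y r₁ r₁) :
    Cong y (1 + FujiSuzukiTsuda.const c / r₁) (1 + FujiSuzukiTsuda.const c / r₁) :=
  (Cong.one h.isCoord).add ((Cong.const h.isCoord c).div h r₁_ne_zero)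

lemma one_add_div_mem {L : IntermediateField ℂ K} {x : K} (hx : x ∈ L) {c : ℂ} (hc : const c ∈ L) :
    1 + const c / x ∈ L := add_mem L.one_mem (div_mem hc hx)

variable (A : Param)

/-- The coordinate `r₁ / q₁` of the exceptional divisor becomes the finite value `a₁ / (r₁ / q₁)` of
the new `q₁`. The new `r₁ + a₁` is the old `r₁`, which vanishes. -/
lemma s₁_e₁ (h : A.a₁ ≠ 0) : Backlund.s₁.Sends A .e₁ .r₁neg := by
  obtain ⟨c0, c1, c2, c3⟩ := cong_e₁ A
  have a := Cong.const c0.isCoord A.a₁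
  have na := const_ne_zero h
  have n1 := q₁_ne_zero
  have n3 := r₁_ne_zero
  have ny := div_ne_zero n3 n1
  refine Backlund.sends (const A.a₁ / (r₁ / q₁)) q₂ r₂ ?_ ?_ ?_ ?_
    fun L m m1 m2 m3 => ⟨?_, m2, m3⟩
  rotate_right
  · exact mem_of_eq (div_mem (m A.a₁) m1) (div_div_cancel₀ na)
  all_goals simp only [Divisor.coords, Backlund.onCoord, Backlund.onParam, Matrix.cons_val,
    const_neg]
  exacts [(c0.mul c1).of (by field_simp; ring) (zero_mul _),
    (c0.add (a.div c1 ny)).of (by field_simp) (zero_add _), c2, c3]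

lemma s₁_e₂ (h : A.a₁ ≠ 0) : Backlund.s₁.Sends A .e₂ .r₁zero := by
  obtain ⟨c0, c1, c2, c3⟩ := cong_e₂ A
  have a := Cong.const c0.isCoord A.a₁
  have na := const_ne_zero h
  have n1 := q₁_ne_zero
  have n3 := r₁_ne_zero
  have d : Cong (Divisor.e₂.coord A) r₁ (-const A.a₁) :=
    ((c1.mul c0).sub a).of (by field_simp; ring) (by ring)
  refine Backlund.sends ((r₁ + const A.a₁) * q₁ / -const A.a₁) q₂ r₂ ?_ ?_ ?_ ?_
    fun L m m1 m2 m3 => ⟨(div_mem_field (neg_mem (m _)) (neg_ne_zero.2 na)).1 m1, m2, m3⟩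
  all_goals simp only [Divisor.coords, Backlund.onCoord, Matrix.cons_val]
  exacts [(c1.mul c0).of (by field_simp) (mul_zero _),
    (c1.div d (neg_ne_zero.2 na)).of (by field_simp) rfl, c2, c3]

/-- The new `q₁` gets a pole from `a₁ / r₁`, and its product with the old `r₁`, which is the new `r₁
+ a₁`, tends to `a₁ q₁`. -/
lemma s₁_r₁zero (h : A.a₁ ≠ 0) : Backlund.s₁.Sends A .r₁zero .e₂ := by
  have c0 : Cong (Divisor.r₁zero.coord A) r₁ 0 := .zero (Divisor.isCoord A _)
  have c1 : Cong (Divisor.r₁zero.coord A) q₁ q₁ := .coord (Divisor.isCoord A _) 0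
  have c2 : Cong (Divisor.r₁zero.coord A) q₂ q₂ := .coord (Divisor.isCoord A _) 1
  have c3 : Cong (Divisor.r₁zero.coord A) r₂ r₂ := .coord (Divisor.isCoord A _) 2
  have a := Cong.const c0.isCoord A.a₁
  have na := const_ne_zero h
  have n1 := q₁_ne_zero
  have n3 := r₁_ne_zero
  have n := r₁_add_const_ne_zero A.a₁
  have d := c1.mul (c0.add a)
  rw [zero_add] at d
  refine Backlund.sends (q₁ * const A.a₁) q₂ r₂ ?_ ?_ ?_ ?_
    fun L m m1 m2 m3 => ⟨mem_of_eq (div_mem m1 (m A.a₁)) (mul_div_cancel_right₀ _ na), m2, m3⟩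
  all_goals simp only [Divisor.coords, Backlund.onCoord, Backlund.onParam, Matrix.cons_val,
    const_neg]
  exacts [(c0.div d (mul_ne_zero n1 na)).of (by field_simp) (zero_div _),
    d.of (by field_simp; ring) rfl, c2, c3]

lemma s₁_r₁neg (h : A.a₁ ≠ 0) : Backlund.s₁.Sends A .r₁neg .e₁ := by
  have c0 : Cong (Divisor.r₁neg.coord A) (r₁ + const A.a₁) 0 := .zero (Divisor.isCoord A _)
  have c1 : Cong (Divisor.r₁neg.coord A) q₁ q₁ := .coord (Divisor.isCoord A _) 0
  have c2 : Cong (Divisor.r₁neg.coord A) q₂ q₂ := .coord (Divisor.isCoord A _) 1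
  have c3 : Cong (Divisor.r₁neg.coord A) r₂ r₂ := .coord (Divisor.isCoord A _) 2
  have a := Cong.const c0.isCoord A.a₁
  have na := const_ne_zero h
  have n1 := q₁_ne_zero
  have n3 := r₁_ne_zero
  have n := r₁_add_const_ne_zero A.a₁
  have d : Cong (Divisor.r₁neg.coord A) r₁ (-const A.a₁) := (c0.sub a).of (by ring) (by ring)
  refine Backlund.sends (-const A.a₁ / q₁) q₂ r₂ ?_ ?_ ?_ ?_
    fun L m m1 m2 m3 => ⟨mem_of_eq (div_mem (neg_mem (m A.a₁)) m1)
      (div_div_cancel₀ (neg_ne_zero.2 na)), m2, m3⟩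
  all_goals simp only [Divisor.coords, Backlund.onCoord, Matrix.cons_val]
  exacts [((c1.mul c0).div d (neg_ne_zero.2 na)).of (by field_simp) (by simp),
    (d.div c1 n1).of (by field_simp) rfl, c2, c3]

lemma s₁_e₃ : Backlund.s₁.Sends A .e₃ .e₃ := by
  obtain ⟨c0, c1, c2, c3⟩ := cong_e₃ A
  have n := one_add_div_r₁_ne_zero A.a₁
  refine Backlund.sends (r₂ / q₂) (q₁ * (1 + const A.a₁ / r₁)) (r₁ + const A.a₁) c0 c1
    (c2.mul (c3.one_add_div_r₁ _)) (c3.add (Cong.const c3.isCoord A.a₁)) fun L m m1 m2 m3 => ?_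
  have m4 := (add_const_mem_iff _).1 m3
  exact ⟨m1, mem_of_eq (div_mem m2 (one_add_div_mem m4 (m _))) (mul_div_cancel_right₀ _ n), m4⟩

lemma s₁_e₄ : Backlund.s₁.Sends A .e₄ .e₄ := by
  obtain ⟨c0, c1, c2, c3⟩ := cong_e₄ A
  have n := one_add_div_r₁_ne_zero A.a₁
  refine Backlund.sends ((r₂ + const A.a₅) * q₂) (q₁ * (1 + const A.a₁ / r₁)) (r₁ + const A.a₁)
    c0 c1 (c2.mul (c3.one_add_div_r₁ _)) (c3.add (Cong.const c3.isCoord A.a₁))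
    fun L m m1 m2 m3 => ?_
  have m4 := (add_const_mem_iff _).1 m3
  exact ⟨m1, mem_of_eq (div_mem m2 (one_add_div_mem m4 (m _))) (mul_div_cancel_right₀ _ n), m4⟩

lemma s₁_e₅ : Backlund.s₁.Sends A .e₅ .e₅ := by
  obtain ⟨c0, c1, c2, c3⟩ := cong_e₅ A
  have n := one_add_div_r₁_ne_zero A.a₁
  have n1 := q₁_ne_zero
  have th := c3.one_add_div_r₁ A.a₁
  refine Backlund.sends (q₂ / q₁ / (1 + const A.a₁ / r₁))
    ((r₁ + r₂ - const A.a₃ + const A.η) / q₁ / (1 + const A.a₁ / r₁)) (r₁ + const A.a₁)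
    ?_ ?_ ?_ ?_ fun L m m1 m2 m3 => ?_
  rotate_right
  · have m4 := (add_const_mem_iff _).1 m3
    have m5 := one_add_div_mem m4 (m A.a₁)
    exact ⟨(div_mem_field m5 n).1 m1, (div_mem_field m5 n).1 m2, m4⟩
  all_goals simp only [Divisor.coords, Backlund.onCoord, Backlund.onParam, Matrix.cons_val,
    const_sub]
  exacts [(c0.mul th).of rfl (zero_mul _), (c1.div th n).of (div_div _ _ _) rfl,
    (c2.div th n).of (by rw [div_div]; congr 1; ring) rfl, c3.add (Cong.const c3.isCoord A.a₁)]

lemma s₁_e₆ : Backlund.s₁.Sends A .e₆ .e₆ := by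
  obtain ⟨c0, c1, c2, c3⟩ := cong_e₆ A
  have n := one_add_div_r₁_ne_zero A.a₁
  have n1 := q₁_ne_zero
  have th := c3.one_add_div_r₁ A.a₁
  refine Backlund.sends (q₁ / q₂ * (1 + const A.a₁ / r₁))
    ((r₁ + r₂ + const A.η) * q₁ * (1 + const A.a₁ / r₁)) (r₁ + const A.a₁)
    ?_ ?_ ?_ ?_ fun L m m1 m2 m3 => ?_
  rotate_right
  · have m4 := (add_const_mem_iff _).1 m3
    have m5 := one_add_div_mem m4 (m A.a₁)
    exact ⟨mem_of_eq (div_mem m1 m5) (mul_div_cancel_right₀ _ n),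
      mem_of_eq (div_mem m2 m5) (mul_div_cancel_right₀ _ n), m4⟩
  all_goals simp only [Divisor.coords, Backlund.onCoord, Backlund.onParam, Matrix.cons_val,
    const_sub]
  exacts [(c0.mul (th.inv n)).of (mul_inv _ _).symm (zero_mul _), (c1.mul th).of (by ring) rfl,
    (c2.mul th).of (by ring) rfl, c3.add (Cong.const c3.isCoord A.a₁)]

/-- The new coordinate is `((q₁ - t) * r₁ + a₁ q₁) * (1 + a₁ / r₁)`, with second factor tending to
one and `q₁` to `t`. -/
lemma s₁_e₇ : Backlund.s₁.Sends A .e₇ .e₇ := by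
  obtain ⟨c0, c1, c2, c3, c4⟩ := cong_e₇ A
  have a := Cong.const c0.isCoord A.a₁
  have n3 := r₁_ne_zero
  refine Backlund.sends ((q₁ - const A.t) * r₁ + const A.a₁ * const A.t) q₂ r₂ ?_ ?_ ?_ ?_
    fun L m m1 m2 m3 => ⟨mem_of_eq (sub_mem m1 (mul_mem (m A.a₁) (m A.t)))
      (add_sub_cancel_right _ _), m2, m3⟩
  all_goals simp only [Divisor.coords, Backlund.onCoord, Backlund.onParam, Matrix.cons_val]
  exacts [c0.inv_add n3 a,
    ((c1.add (a.mul c4)).mul ((Cong.one c0.isCoord).add (a.mul c0))).of (by field_simp; ring) (by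
      ring),
    c2, c3]

lemma s₁_e₈ : Backlund.s₁.Sends A .e₈ .e₈ := by
  obtain ⟨c0, c1, c2, c3, c4, c5⟩ := cong_e₈ A
  have a := Cong.const c0.isCoord A.a₁
  have n3 := r₁_ne_zero
  refine Backlund.sends (((q₁ - const A.t) * r₁ - const (A.a₂ * A.t)) * r₁ +
    (const A.a₁ * (const A.a₂ * const A.t) + const A.a₁ * (const A.a₂ * const A.t) +
      const A.a₁ * const A.a₁ * const A.t)) q₂ r₂ ?_ ?_ ?_ ?_
    fun L m m1 m2 m3 => ⟨mem_of_eq (sub_mem m1 (add_mem (add_mem ?_ ?_)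
      (mul_mem (mul_mem (m A.a₁) (m A.a₁)) (m A.t)))) (add_sub_cancel_right _ _), m2, m3⟩
  rotate_right 2
  · exact mul_mem (m _) (mul_mem (m _) (m _))
  · exact mul_mem (m _) (mul_mem (m _) (m _))
  all_goals simp only [Divisor.coords, Backlund.onCoord, Backlund.onParam, Matrix.cons_val]
  · exact c0.inv_add n3 a
  · refine ((c1.add (((a.mul c4).add (a.mul c4)).add ((a.mul a).mul c5))).mul
      ((Cong.one c0.isCoord).add (a.mul c0))).of ?_ (by ring)
    simp only [const_mul, const_add]
    field_simp
    ring
  · exact c2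
  · exact c3

lemma s₁_e₉ : Backlund.s₁.Sends A .e₉ .e₉ := by
  obtain ⟨c0, c1, c2, c3, -⟩ := cong_e₉ A
  have n := one_add_div_r₁_ne_zero A.a₁
  refine Backlund.sends ((q₂ - 1) * r₂) (q₁ * (1 + const A.a₁ / r₁)) (r₁ + const A.a₁) c0 c1
    (c2.mul (c3.one_add_div_r₁ _)) (c3.add (Cong.const c3.isCoord A.a₁)) fun L m m1 m2 m3 => ?_
  have m4 := (add_const_mem_iff _).1 m3
  exact ⟨m1, mem_of_eq (div_mem m2 (one_add_div_mem m4 (m _))) (mul_div_cancel_right₀ _ n), m4⟩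

lemma s₁_e₁₀ : Backlund.s₁.Sends A .e₁₀ .e₁₀ := by
  obtain ⟨c0, c1, c2, c3, -⟩ := cong_e₁₀ A
  have n := one_add_div_r₁_ne_zero A.a₁
  refine Backlund.sends (((q₂ - 1) * r₂ - const A.a₄) * r₂) (q₁ * (1 + const A.a₁ / r₁))
    (r₁ + const A.a₁) c0 c1 (c2.mul (c3.one_add_div_r₁ _))
    (c3.add (Cong.const c3.isCoord A.a₁)) fun L m m1 m2 m3 => ?_
  have m4 := (add_const_mem_iff _).1 m3
  exact ⟨m1, mem_of_eq (div_mem m2 (one_add_div_mem m4 (m _))) (mul_div_cancel_right₀ _ n), m4⟩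

lemma s₁_e₁₁ : Backlund.s₁.Sends A .e₁₁ .e₁₁ := by
  obtain ⟨c0, c1, c2, c3, c4⟩ := cong_e₁₁ A
  have a := Cong.const c0.isCoord A.a₁
  have n3 := r₁_ne_zero
  have n4 := r₂_ne_zero
  have b := (Cong.one c0.isCoord).add (a.mul c0)
  refine Backlund.sends (r₁ / r₂) ((q₁ - q₂) * r₁ + const A.a₁ * q₂) q₂ ?_ ?_ ?_ ?_
    fun L m m1 m2 m3 => ⟨m1, mem_of_eq (sub_mem m2 (mul_mem (m A.a₁) m3))
      (add_sub_cancel_right _ _), m3⟩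
  all_goals simp only [Divisor.coords, Backlund.onCoord, Matrix.cons_val]
  exacts [c0.inv_add n3 a, (c1.mul b).of (by field_simp) (by ring),
    ((c2.add (a.mul c4)).mul b).of (by field_simp; ring) (by ring), c3]

lemma s₁_e₁₂ : Backlund.s₁.Sends A .e₁₂ .e₁₂ := by
  obtain ⟨c0, c1, c2, c3, c4, c5, c6⟩ := cong_e₁₂ A
  have a := Cong.const c0.isCoord A.a₁
  have n3 := r₁_ne_zero
  have n4 := r₂_ne_zero
  have b := (Cong.one c0.isCoord).add (a.mul c0)
  refine Backlund.sends ((r₁ / r₂ + 1) * r₁ - const A.a₁)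
    (((q₁ - q₂) * r₁ - const A.a₀ * q₂) * r₁ + (const A.a₁ * (const A.a₀ * q₂) +
      const A.a₁ * (const A.a₀ * q₂) + const A.a₁ * const A.a₁ * q₂)) q₂ ?_ ?_ ?_ ?_
    fun L m m1 m2 m3 => ⟨(sub_const_mem_iff _).1 m1, mem_of_eq (sub_mem m2 (add_mem (add_mem ?_ ?_)
      (mul_mem (mul_mem (m A.a₁) (m A.a₁)) m3))) (add_sub_cancel_right _ _), m3⟩
  rotate_right 2
  · exact mul_mem (m _) (mul_mem (m _) m3)
  · exact mul_mem (m _) (mul_mem (m _) m3)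
  all_goals simp only [Divisor.coords, Backlund.onCoord, Backlund.onParam, Matrix.cons_val,
    const_add]
  exacts [c0.inv_add n3 a, ((c1.add (a.mul c4)).mul b).of (by field_simp; ring) (by ring),
    ((c2.add (((a.mul c5).add (a.mul c5)).add ((a.mul a).mul c6))).mul b).of (by field_simp; ring)
      (by ring),
    c3]

lemma s₁_q₁inf : Backlund.s₁.Sends A .q₁inf .q₁inf := by
  obtain ⟨c0, c1, c2, c3⟩ := cong_q₁inf A
  have n := one_add_div_r₁_ne_zero A.a₁
  exact Backlund.sends q₂ (r₁ + const A.a₁) r₂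
    ((c0.mul ((c2.one_add_div_r₁ _).inv n)).of (mul_inv _ _).symm (zero_mul _)) c1
    (c2.add (Cong.const c0.isCoord A.a₁)) c3
    fun L m m1 m2 m3 => ⟨m1, (add_const_mem_iff _).1 m2, m3⟩

lemma s₁_q₂inf : Backlund.s₁.Sends A .q₂inf .q₂inf := by
  obtain ⟨c0, c1, c2, c3⟩ := cong_q₂inf A
  have n := one_add_div_r₁_ne_zero A.a₁
  refine Backlund.sends (q₁ * (1 + const A.a₁ / r₁)) (r₁ + const A.a₁) r₂ c0
    (c1.mul (c2.one_add_div_r₁ _)) (c2.add (Cong.const c0.isCoord A.a₁)) c3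
    fun L m m1 m2 m3 => ?_
  have m4 := (add_const_mem_iff _).1 m2
  exact ⟨mem_of_eq (div_mem m1 (one_add_div_mem m4 (m _))) (mul_div_cancel_right₀ _ n), m4, m3⟩

lemma s₁_r₁inf : Backlund.s₁.Sends A .r₁inf .r₁inf := by
  obtain ⟨c0, c1, c2, c3⟩ := cong_r₁inf A
  have a := Cong.const c0.isCoord A.a₁
  exact Backlund.sends q₁ q₂ r₂ (c0.inv_add r₁_ne_zero a)
    ((c1.mul ((Cong.one c0.isCoord).add (a.mul c0))).of
      (by rw [← div_eq_mul_inv]; rfl) (by ring)) c2 c3 fun L m m1 m2 m3 => ⟨m1, m2, m3⟩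

lemma s₁_r₂inf : Backlund.s₁.Sends A .r₂inf .r₂inf := by
  obtain ⟨c0, c1, c2, c3⟩ := cong_r₂inf A
  have n := one_add_div_r₁_ne_zero A.a₁
  refine Backlund.sends (q₁ * (1 + const A.a₁ / r₁)) q₂ (r₁ + const A.a₁) c0
    (c1.mul (c3.one_add_div_r₁ _)) c2 (c3.add (Cong.const c0.isCoord A.a₁))
    fun L m m1 m2 m3 => ?_
  have m4 := (add_const_mem_iff _).1 m3
  exact ⟨mem_of_eq (div_mem m1 (one_add_div_mem m4 (m _))) (mul_div_cancel_right₀ _ n), m2, m4⟩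

end s₁


/-! ### The transformation `s₂` -/

section s₂

variable (A : Param)

lemma Cong.shift_s₂ {y : Fin 4 → K} {x w : K} (c d : ℂ) (h : Cong y x w)
    (hw : w - FujiSuzukiTsuda.const d ≠ 0) :
    Cong y (FujiSuzukiTsuda.const c * x / (x - FujiSuzukiTsuda.const d))
      (FujiSuzukiTsuda.const c * w / (w - FujiSuzukiTsuda.const d)) :=
  ((Cong.const h.isCoord c).mul h).div (h.sub (Cong.const h.isCoord d)) hw

lemma mul_div_sub_mem {L : IntermediateField ℂ K} {x : K} (hx : x ∈ L) {c d : ℂ}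
    (hc : const c ∈ L) (hd : const d ∈ L) : const c * x / (x - const d) ∈ L :=
  div_mem (mul_mem hc hx) (sub_mem hx hd)

lemma s₂_e₁ (ht : A.t ≠ 0) : Backlund.s₂.Sends A .e₁ .e₁ := by
  obtain ⟨c0, c1, c2, c3⟩ := cong_e₁ A
  have a := Cong.const c0.isCoord A.a₂
  have n1 := q₁_ne_zero
  have n := q₁_sub_const_ne_zero A.t
  have nt := neg_ne_zero.2 (const_ne_zero ht)
  have d := c0.sub (Cong.const c0.isCoord A.t)
  rw [zero_sub] at d
  refine Backlund.sends (r₁ / q₁ - const A.a₂ / -const A.t) q₂ r₂ ?_ ?_ ?_ ?_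
    fun L m m1 m2 m3 => ⟨mem_of_eq (add_mem m1 (div_mem (m A.a₂) (neg_mem (m A.t))))
      (sub_add_cancel _ _), m2, m3⟩
  all_goals simp only [Divisor.coords, Backlund.onCoord, Matrix.cons_val]
  exacts [c0, (c1.sub (a.div d nt)).of (by field_simp) rfl, c2, c3]

lemma s₂_e₂ : Backlund.s₂.Sends A .e₂ .e₂ := by
  obtain ⟨c0, c1, c2, c3⟩ := cong_e₂ A
  have a := Cong.const c0.isCoord A.a₂
  have n1 := q₁_ne_zero
  have n := q₁_sub_const_ne_zero A.t
  have d := (Cong.one c0.isCoord).sub ((Cong.const c0.isCoord A.t).mul c0)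
  have e : 1 - const A.t * q₁⁻¹ = (q₁ - const A.t) / q₁ := by field_simp
  rw [e, mul_zero, sub_zero] at d
  refine Backlund.sends ((r₁ + const A.a₁) * q₁ - const A.a₂ * const A.t) q₂ r₂ ?_ ?_ ?_ ?_
    fun L m m1 m2 m3 => ⟨mem_of_eq (add_mem m1 (mul_mem (m A.a₂) (m A.t)))
      (sub_add_cancel _ _), m2, m3⟩
  all_goals simp only [Divisor.coords, Backlund.onCoord, Backlund.onParam, Matrix.cons_val,
    const_add]
  exacts [c0,
    (c1.sub ((a.mul (Cong.const c0.isCoord A.t)).div d one_ne_zero)).of (by field_simp; ring) (by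
      rw [div_one]),
    c2, c3]

lemma s₂_e₃ : Backlund.s₂.Sends A .e₃ .e₃ := by
  obtain ⟨c0, c1, c2, c3⟩ := cong_e₃ A
  have n := q₁_sub_const_ne_zero A.t
  exact Backlund.sends (r₂ / q₂) q₁ (r₁ - const A.a₂ * q₁ / (q₁ - const A.t)) c0 c1 c2
    (c3.sub (c2.shift_s₂ _ _ n)) fun L m m1 m2 m3 => ⟨m1, m2,
      mem_of_eq (add_mem m3 (mul_div_sub_mem m2 (m _) (m _))) (sub_add_cancel _ _)⟩

lemma s₂_e₄ : Backlund.s₂.Sends A .e₄ .e₄ := by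
  obtain ⟨c0, c1, c2, c3⟩ := cong_e₄ A
  have n := q₁_sub_const_ne_zero A.t
  exact Backlund.sends ((r₂ + const A.a₅) * q₂) q₁ (r₁ - const A.a₂ * q₁ / (q₁ - const A.t))
    c0 c1 c2 (c3.sub (c2.shift_s₂ _ _ n)) fun L m m1 m2 m3 => ⟨m1, m2,
      mem_of_eq (add_mem m3 (mul_div_sub_mem m2 (m _) (m _))) (sub_add_cancel _ _)⟩

lemma s₂_e₅ (ht : A.t ≠ 0) : Backlund.s₂.Sends A .e₅ .e₅ := by
  obtain ⟨c0, c1, c2, c3⟩ := cong_e₅ A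
  have a := Cong.const c0.isCoord A.a₂
  have n1 := q₁_ne_zero
  have n := q₁_sub_const_ne_zero A.t
  have nt := neg_ne_zero.2 (const_ne_zero ht)
  have d := c0.sub (Cong.const c0.isCoord A.t)
  rw [zero_sub] at d
  refine Backlund.sends (q₂ / q₁)
    ((r₁ + r₂ - const A.a₃ + const A.η) / q₁ - const A.a₂ / -const A.t) r₁ ?_ ?_ ?_ ?_
    fun L m m1 m2 m3 => ⟨m1, mem_of_eq (add_mem m2 (div_mem (m A.a₂) (neg_mem (m A.t))))
      (sub_add_cancel _ _), m3⟩
  all_goals simp only [Divisor.coords, Backlund.onCoord, Backlund.onParam, Matrix.cons_val,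
    const_add]
  exacts [c0, c1, (c2.sub (a.div d nt)).of (by field_simp; ring) rfl,
    (c3.sub ((a.mul c0).div d nt)).of rfl (by simp)]

lemma s₂_e₆ : Backlund.s₂.Sends A .e₆ .e₆ := by
  obtain ⟨c0, c1, c2, c3⟩ := cong_e₆ A
  have a := Cong.const c0.isCoord A.a₂
  have n1 := q₁_ne_zero
  have n2 := q₂_ne_zero
  have n := q₁_sub_const_ne_zero A.t
  have d := (Cong.one c0.isCoord).sub ((Cong.const c0.isCoord A.t).mul c0)
  have e : 1 - const A.t * q₁⁻¹ = (q₁ - const A.t) / q₁ := by field_simp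
  rw [e, mul_zero, sub_zero] at d
  refine Backlund.sends (q₁ / q₂) ((r₁ + r₂ + const A.η) * q₁ - const A.a₂ * const A.t)
    (r₁ - const A.a₂) ?_ ?_ ?_ ?_
    fun L m m1 m2 m3 => ⟨m1, mem_of_eq (add_mem m2 (mul_mem (m A.a₂) (m A.t)))
      (sub_add_cancel _ _), (sub_const_mem_iff _).1 m3⟩
  all_goals simp only [Divisor.coords, Backlund.onCoord, Backlund.onParam, Matrix.cons_val,
    const_add]
  exacts [c0, c1,
    (c2.sub ((a.mul (Cong.const c0.isCoord A.t)).div d one_ne_zero)).of (by field_simp; ring) (by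
      rw [div_one]),
    (c3.sub (a.div d one_ne_zero)).of (by field_simp) (by rw [div_one])]

open MvPolynomial in
-- The new `r₁` is the old one times a factor whose residue `1 - a₂ t / ((q₁ - t) * r₁)` is not
-- identically zero on `e₇`, so its pole survives; that factor vanishes exactly on the next centre.
lemma s₂_e₇ : Backlund.s₂.Sends A .e₇ .e₇ := by
  obtain ⟨c0, c1, c2, c3, c4⟩ := cong_e₇ A
  have a := Cong.const c0.isCoord A.a₂
  have n3 := r₁_ne_zero
  have n := q₁_sub_const_ne_zero A.t
  have nn := mul_ne_zero n n3
  have n5 : (q₁ - const A.t) * r₁ - const A.a₂ * const A.t ≠ 0 :=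
    ne_zero_of_eval ((X 0 - C A.t) * X 2 - C A.a₂ * C A.t) ![A.t + 1, 0, A.a₂ * A.t + 1, 0]
      (by simp) (by simp [q₁, r₁, const])
  have d := (Cong.one c0.isCoord).sub ((a.mul c4).div c1 nn)
  have nd : 1 - const A.a₂ * const A.t / ((q₁ - const A.t) * r₁) ≠ 0 := by
    rw [one_sub_div nn]
    exact div_ne_zero n5 nn
  refine Backlund.sends ((q₁ - const A.t) * r₁ - const A.a₂ * const A.t) q₂ r₂ ?_ ?_ ?_ ?_
    fun L m m1 m2 m3 => ⟨mem_of_eq (add_mem m1 (mul_mem (m A.a₂) (m A.t)))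
      (sub_add_cancel _ _), m2, m3⟩
  all_goals simp only [Divisor.coords, Backlund.onCoord, Backlund.onParam, Matrix.cons_val]
  exacts [(c0.div d nd).of (by field_simp) (zero_div _), (c1.sub (a.mul c4)).of (by field_simp) rfl,
    c2, c3]

/-- The residue `a₂ t` of `(q₁ - t) * r₁` cancels the pole of the new `r₁`, whose finite part comes
from the second-order coordinate of `e₈`. -/
lemma s₂_e₈ (ht : A.t ≠ 0) (h : A.a₂ ≠ 0) : Backlund.s₂.Sends A .e₈ .q₁t := by
  obtain ⟨c0, c1, c2, c3, c4, c5⟩ := cong_e₈ A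
  have a := Cong.const c0.isCoord A.a₂
  have n3 := r₁_ne_zero
  have n := q₁_sub_const_ne_zero A.t
  have na := mul_ne_zero (const_ne_zero h) (const_ne_zero ht)
  refine Backlund.sends q₂ ((((q₁ - const A.t) * r₁ - const (A.a₂ * A.t)) * r₁ -
    const A.a₂ * (const A.a₂ * const A.t)) / (const A.a₂ * const A.t)) r₂ ?_ ?_ ?_ ?_
    fun L m m1 m2 m3 => ⟨?_, m1, m3⟩
  rotate_right
  · have m4 := mul_mem (m A.a₂) (m A.t)
    exact mem_of_eq (add_mem ((div_mem_field m4 na).1 m2) (mul_mem (m A.a₂) m4))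
      (sub_add_cancel _ _)
  all_goals simp only [Divisor.coords, Backlund.onCoord, Backlund.onParam, Matrix.cons_val]
  · exact (c5.sub (Cong.const c0.isCoord A.t)).of rfl (sub_self _)
  · exact c2
  · refine ((c1.sub (a.mul c4)).div c4 na).of ?_ rfl
    rw [const_mul]
    field_simp
    ring
  · exact c3

lemma s₂_q₁t (ht : A.t ≠ 0) (h : A.a₂ ≠ 0) : Backlund.s₂.Sends A .q₁t .e₈ := by
  have c0 : Cong (Divisor.q₁t.coord A) (q₁ - const A.t) 0 := .zero (Divisor.isCoord A _)
  have c1 : Cong (Divisor.q₁t.coord A) q₂ q₂ := .coord (Divisor.isCoord A _) 0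
  have c2 : Cong (Divisor.q₁t.coord A) r₁ r₁ := .coord (Divisor.isCoord A _) 1
  have c3 : Cong (Divisor.q₁t.coord A) r₂ r₂ := .coord (Divisor.isCoord A _) 2
  have a := Cong.const c0.isCoord A.a₂
  have b := a.mul (Cong.const c0.isCoord A.t)
  have n := q₁_sub_const_ne_zero A.t
  have na := neg_ne_zero.2 (mul_ne_zero (const_ne_zero h) (const_ne_zero ht))
  have N := (c0.mul (c2.sub a)).sub b
  rw [zero_mul, zero_sub] at N
  have N0 := N.ne_zero na
  -- The numerator has residue `-a₂ t`, so the new `r₁` has a simple pole along `q₁ = t`.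
  have e : r₁ - const A.a₂ * q₁ / (q₁ - const A.t) =
      ((q₁ - const A.t) * (r₁ - const A.a₂) - const A.a₂ * const A.t) / (q₁ - const A.t) := by
    field_simp
    ring
  refine Backlund.sends ((r₁ - const A.a₂) * -(const A.a₂ * const A.t)) q₂ r₂ ?_ ?_ ?_ ?_
    fun L m m1 m2 m3 => ⟨m2, (sub_const_mem_iff A.a₂).1 (mem_of_eq (div_mem m1
      (neg_mem (mul_mem (m A.a₂) (m A.t)))) (mul_div_cancel_right₀ _ na)), m3⟩
  all_goals simp only [Divisor.coords, Backlund.onCoord, Backlund.onParam, Matrix.cons_val,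
    const_neg, const_mul, e]
  exacts [(c0.div N na).of (inv_div _ _).symm (zero_div _),
    ((c2.sub a).mul N).of (by field_simp; ring) rfl, c1, c3]

lemma s₂_e₉ : Backlund.s₂.Sends A .e₉ .e₉ := by
  obtain ⟨c0, c1, c2, c3, -⟩ := cong_e₉ A
  have n := q₁_sub_const_ne_zero A.t
  exact Backlund.sends ((q₂ - 1) * r₂) q₁ (r₁ - const A.a₂ * q₁ / (q₁ - const A.t)) c0 c1 c2
    (c3.sub (c2.shift_s₂ _ _ n)) fun L m m1 m2 m3 => ⟨m1, m2,
      mem_of_eq (add_mem m3 (mul_div_sub_mem m2 (m _) (m _))) (sub_add_cancel _ _)⟩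

lemma s₂_e₁₀ : Backlund.s₂.Sends A .e₁₀ .e₁₀ := by
  obtain ⟨c0, c1, c2, c3, -⟩ := cong_e₁₀ A
  have n := q₁_sub_const_ne_zero A.t
  exact Backlund.sends (((q₂ - 1) * r₂ - const A.a₄) * r₂) q₁
    (r₁ - const A.a₂ * q₁ / (q₁ - const A.t)) c0 c1 c2
    (c3.sub (c2.shift_s₂ _ _ n)) fun L m m1 m2 m3 => ⟨m1, m2,
      mem_of_eq (add_mem m3 (mul_div_sub_mem m2 (m _) (m _))) (sub_add_cancel _ _)⟩

lemma s₂_e₁₁ : Backlund.s₂.Sends A .e₁₁ .e₁₁ := by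
  obtain ⟨c0, c1, c2, c3, c4⟩ := cong_e₁₁ A
  have n3 := r₁_ne_zero
  have p := c4.shift_s₂ A.a₂ A.t (q₂_sub_const_ne_zero A.t)
  have b := (Cong.one c0.isCoord).sub (p.mul c0)
  have e := mul_inv_cancel₀ n3
  refine Backlund.sends (r₁ / r₂) ((q₁ - q₂) * r₁) q₂ ?_ ?_ ?_ ?_ fun L m m1 m2 m3 => ⟨m1, m2, m3⟩
  all_goals simp only [Divisor.coords, Backlund.onCoord, Matrix.cons_val]
  · exact c0.inv_sub n3 p
  · refine (c1.mul b).of ?_ (by ring)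
    linear_combination -(const A.a₂ * q₁ / (q₁ - const A.t)) * r₂⁻¹ * e
  · refine (c2.mul b).of ?_ (by ring)
    linear_combination -(const A.a₂ * q₁ / (q₁ - const A.t)) * (q₁ - q₂) * e
  · exact c3

lemma s₂_e₁₂ : Backlund.s₂.Sends A .e₁₂ .e₁₂ := by
  obtain ⟨c0, c1, c2, c3, c4, c5, c6⟩ := cong_e₁₂ A
  have n3 := r₁_ne_zero
  have n4 := r₂_ne_zero
  have p := c6.shift_s₂ A.a₂ A.t (q₂_sub_const_ne_zero A.t)
  have b := (Cong.one c0.isCoord).sub (p.mul c0)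
  refine Backlund.sends ((r₁ / r₂ + 1) * r₁ + const A.a₂ * q₂ / (q₂ - const A.t))
    (((q₁ - q₂) * r₁ - const A.a₀ * q₂) * r₁ -
      const A.a₀ * q₂ * (const A.a₂ * q₂ / (q₂ - const A.t))) q₂ ?_ ?_ ?_ ?_
    fun L m m1 m2 m3 => ?_
  rotate_right
  · have m4 := mul_div_sub_mem m3 (m A.a₂) (m A.t)
    exact ⟨mem_of_eq (sub_mem m1 m4) (add_sub_cancel_right _ _),
      mem_of_eq (add_mem m2 (mul_mem (mul_mem (m A.a₀) m3) m4)) (sub_add_cancel _ _), m3⟩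
  all_goals simp only [Divisor.coords, Backlund.onCoord, Backlund.onParam, Matrix.cons_val]
  · exact c0.inv_sub n3 p
  · refine ((c1.sub (c4.mul p)).mul b).of ?_ (by ring)
    generalize const A.a₂ * q₁ / (q₁ - const A.t) = p
    field_simp
    ring
  · refine ((c2.sub (c5.mul p)).mul b).of ?_ (by ring)
    generalize const A.a₂ * q₁ / (q₁ - const A.t) = p
    field_simp
    ring
  · exact c3

lemma s₂_q₁inf : Backlund.s₂.Sends A .q₁inf .q₁inf := by
  obtain ⟨c0, c1, c2, c3⟩ := cong_q₁inf A
  have n1 := q₁_ne_zero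
  have n := q₁_sub_const_ne_zero A.t
  have d := (Cong.one c0.isCoord).sub ((Cong.const c0.isCoord A.t).mul c0)
  have e : 1 - const A.t * q₁⁻¹ = (q₁ - const A.t) / q₁ := by field_simp
  rw [e, mul_zero, sub_zero] at d
  refine Backlund.sends q₂ (r₁ - const A.a₂) r₂ c0 c1 ?_ c3
    fun L m m1 m2 m3 => ⟨m1, (sub_const_mem_iff _).1 m2, m3⟩
  exact (c2.sub ((Cong.const c0.isCoord A.a₂).div d one_ne_zero)).of
    (by rw [div_div_eq_mul_div]; rfl) (by rw [div_one])

lemma s₂_q₂inf : Backlund.s₂.Sends A .q₂inf .q₂inf := by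
  obtain ⟨c0, c1, c2, c3⟩ := cong_q₂inf A
  have n := q₁_sub_const_ne_zero A.t
  exact Backlund.sends q₁ (r₁ - const A.a₂ * q₁ / (q₁ - const A.t)) r₂ c0 c1
    (c2.sub (c1.shift_s₂ _ _ n)) c3 fun L m m1 m2 m3 => ⟨m1,
      mem_of_eq (add_mem m2 (mul_div_sub_mem m1 (m _) (m _))) (sub_add_cancel _ _), m3⟩

lemma s₂_r₁inf : Backlund.s₂.Sends A .r₁inf .r₁inf := by
  obtain ⟨c0, c1, c2, c3⟩ := cong_r₁inf A
  exact Backlund.sends q₁ q₂ r₂ (c0.inv_sub r₁_ne_zero (c1.shift_s₂ _ _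
    (q₁_sub_const_ne_zero A.t))) c1 c2 c3 fun L m m1 m2 m3 => ⟨m1, m2, m3⟩

lemma s₂_r₂inf : Backlund.s₂.Sends A .r₂inf .r₂inf := by
  obtain ⟨c0, c1, c2, c3⟩ := cong_r₂inf A
  exact Backlund.sends q₁ q₂ (r₁ - const A.a₂ * q₁ / (q₁ - const A.t)) c0 c1 c2
    (c3.sub (c1.shift_s₂ _ _ (q₁_sub_const_ne_zero A.t))) fun L m m1 m2 m3 => ⟨m1, m2,
      mem_of_eq (add_mem m3 (mul_div_sub_mem m1 (m _) (m _))) (sub_add_cancel _ _)⟩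

end s₂


/-! ### The transformation `s₃` -/

section s₃

lemma Cong.one_add_div {y : Fin 4 → K} {x w : K} (c : ℂ) (h : Cong y x w) (hw : w ≠ 0) :
    Cong y (1 + FujiSuzukiTsuda.const c / x) (1 + FujiSuzukiTsuda.const c / w) :=
  (Cong.one h.isCoord).add ((Cong.const h.isCoord c).div h hw)

lemma Cong.self_div_add {y : Fin 4 → K} {x u w : K} (h : Cong y x⁻¹ 0) (hx : x ≠ 0)
    (hu : Cong y u w) : Cong y (x / (x + u)) 1 := by
  refine (((Cong.one h.isCoord).add (hu.mul h)).inv (by simp)).of ?_ (by simp)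
  rw [← inv_inv (x / (x + u)), inv_div, _root_.add_div, div_self hx, div_eq_mul_inv]

lemma one_add_div_ne_zero {w : K} {c : ℂ} (hw : w ≠ 0) (hw' : w + const c ≠ 0) :
    1 + const c / w ≠ 0 := by
  rw [_root_.one_add_div hw]
  exact div_ne_zero hw' hw

variable (A : Param)

lemma d_ne_zero : r₁ + r₂ - const A.a₃ + const A.η ≠ 0 := by
  convert r₁_add_r₂_add_const_ne_zero (A.η - A.a₃) using 1
  rw [const_sub]
  ring

lemma d_add_ne_zero : r₁ + r₂ - const A.a₃ + const A.η + const A.a₃ ≠ 0 := by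
  convert r₁_add_r₂_add_const_ne_zero A.η using 1
  ring

/-- `s₃` multiplies `q₁` and `q₂` by a common factor. On `e₁`, where `r₁` vanishes, its residue
depends on `r₂` only, so the factor can be divided out again. -/
lemma s₃_e₁ : Backlund.s₃.Sends A .e₁ .e₁ := by
  obtain ⟨c0, c1, c2, c3⟩ := cong_e₁ A
  have a := Cong.const c0.isCoord A.a₃
  have n1 := q₁_ne_zero
  have cr : Cong (Divisor.e₁.coord A) r₁ 0 := (c0.mul c1).of (by field_simp) (zero_mul _)
  have nd : 0 + r₂ - const A.a₃ + const A.η ≠ 0 := by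
    convert r₂_add_const_ne_zero (A.η - A.a₃) using 1
    rw [const_sub]
    ring
  have nd' : 0 + r₂ - const A.a₃ + const A.η + const A.a₃ ≠ 0 := by
    convert r₂_add_const_ne_zero A.η using 1
    ring
  have n := one_add_div_ne_zero nd nd'
  have th := (((cr.add c3).sub a).add (Cong.const c0.isCoord A.η)).one_add_div A.a₃ nd
  refine Backlund.sends (r₁ / q₁ / (1 + const A.a₃ / (0 + r₂ - const A.a₃ + const A.η)))
    (q₂ * (1 + const A.a₃ / (0 + r₂ - const A.a₃ + const A.η))) r₂ ?_ ?_ ?_ ?_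
    fun L m m1 m2 m3 => ?_
  rotate_right
  · have m4 := one_add_div_mem (add_mem (sub_mem (add_mem L.zero_mem m3) (m A.a₃)) (m A.η)) (m A.a₃)
    exact ⟨(div_mem_field m4 n).1 m1, mem_of_eq (div_mem m2 m4) (mul_div_cancel_right₀ _ n), m3⟩
  all_goals simp only [Divisor.coords, Backlund.onCoord, Matrix.cons_val]
  exacts [(c0.mul th).of (by ring) (zero_mul _),
    (c1.div th n).of (by rw [div_div]; congr 1; ring) rfl, (c2.mul th).of (by ring) rfl, c3]

lemma s₃_e₂ : Backlund.s₃.Sends A .e₂ .e₂ := by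
  obtain ⟨c0, c1, c2, c3⟩ := cong_e₂ A
  have a := Cong.const c0.isCoord A.a₃
  have n1 := q₁_ne_zero
  have cr : Cong (Divisor.e₂.coord A) r₁ (-const A.a₁) :=
    ((c1.mul c0).sub (Cong.const c0.isCoord A.a₁)).of (by field_simp; ring) (by ring)
  have nd : -const A.a₁ + r₂ - const A.a₃ + const A.η ≠ 0 := by
    convert r₂_add_const_ne_zero (A.η - A.a₃ - A.a₁) using 1
    rw [const_sub, const_sub]
    ring
  have nd' : -const A.a₁ + r₂ - const A.a₃ + const A.η + const A.a₃ ≠ 0 := by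
    convert r₂_add_const_ne_zero (A.η - A.a₁) using 1
    rw [const_sub]
    ring
  have n := one_add_div_ne_zero nd nd'
  have th := (((cr.add c3).sub a).add (Cong.const c0.isCoord A.η)).one_add_div A.a₃ nd
  refine Backlund.sends
    ((r₁ + const A.a₁) * q₁ * (1 + const A.a₃ / (-const A.a₁ + r₂ - const A.a₃ + const A.η)))
    (q₂ * (1 + const A.a₃ / (-const A.a₁ + r₂ - const A.a₃ + const A.η))) r₂ ?_ ?_ ?_ ?_
    fun L m m1 m2 m3 => ?_
  rotate_right
  · have m4 := one_add_div_mem (add_mem (sub_mem (add_mem (neg_mem (m A.a₁)) m3) (m A.a₃))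
      (m A.η)) (m A.a₃)
    exact ⟨mem_of_eq (div_mem m1 m4) (mul_div_cancel_right₀ _ n),
      mem_of_eq (div_mem m2 m4) (mul_div_cancel_right₀ _ n), m3⟩
  all_goals simp only [Divisor.coords, Backlund.onCoord, Backlund.onParam, Matrix.cons_val]
  exacts [(c0.mul (th.inv n)).of (by rw [← mul_inv]; congr 1; ring) (zero_mul _),
    (c1.mul th).of (by ring) rfl, (c2.mul th).of (by ring) rfl, c3]

lemma s₃_e₃ : Backlund.s₃.Sends A .e₃ .e₃ := by
  obtain ⟨c0, c1, c2, c3⟩ := cong_e₃ A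
  have a := Cong.const c0.isCoord A.a₃
  have n2 := q₂_ne_zero
  have cr : Cong (Divisor.e₃.coord A) r₂ 0 := (c0.mul c1).of (by field_simp) (zero_mul _)
  have nd : r₁ + 0 - const A.a₃ + const A.η ≠ 0 := by
    convert r₁_add_const_ne_zero (A.η - A.a₃) using 1
    rw [const_sub]
    ring
  have nd' : r₁ + 0 - const A.a₃ + const A.η + const A.a₃ ≠ 0 := by
    convert r₁_add_const_ne_zero A.η using 1
    ring
  have n := one_add_div_ne_zero nd nd'
  have th := (((c3.add cr).sub a).add (Cong.const c0.isCoord A.η)).one_add_div A.a₃ nd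
  refine Backlund.sends (r₂ / q₂ / (1 + const A.a₃ / (r₁ + 0 - const A.a₃ + const A.η)))
    (q₁ * (1 + const A.a₃ / (r₁ + 0 - const A.a₃ + const A.η))) r₁ ?_ ?_ ?_ ?_
    fun L m m1 m2 m3 => ?_
  rotate_right
  · have m4 := one_add_div_mem (add_mem (sub_mem (add_mem m3 L.zero_mem) (m A.a₃)) (m A.η)) (m A.a₃)
    exact ⟨(div_mem_field m4 n).1 m1, mem_of_eq (div_mem m2 m4) (mul_div_cancel_right₀ _ n), m3⟩
  all_goals simp only [Divisor.coords, Backlund.onCoord, Matrix.cons_val]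
  exacts [(c0.mul th).of (by ring) (zero_mul _),
    (c1.div th n).of (by rw [div_div]; congr 1; ring) rfl, (c2.mul th).of (by ring) rfl, c3]

lemma s₃_e₄ : Backlund.s₃.Sends A .e₄ .e₄ := by
  obtain ⟨c0, c1, c2, c3⟩ := cong_e₄ A
  have a := Cong.const c0.isCoord A.a₃
  have n2 := q₂_ne_zero
  have cr : Cong (Divisor.e₄.coord A) r₂ (-const A.a₅) :=
    ((c1.mul c0).sub (Cong.const c0.isCoord A.a₅)).of (by field_simp; ring) (by ring)
  have nd : r₁ + -const A.a₅ - const A.a₃ + const A.η ≠ 0 := by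
    convert r₁_add_const_ne_zero (A.η - A.a₃ - A.a₅) using 1
    rw [const_sub, const_sub]
    ring
  have nd' : r₁ + -const A.a₅ - const A.a₃ + const A.η + const A.a₃ ≠ 0 := by
    convert r₁_add_const_ne_zero (A.η - A.a₅) using 1
    rw [const_sub]
    ring
  have n := one_add_div_ne_zero nd nd'
  have th := (((c3.add cr).sub a).add (Cong.const c0.isCoord A.η)).one_add_div A.a₃ nd
  refine Backlund.sends
    ((r₂ + const A.a₅) * q₂ * (1 + const A.a₃ / (r₁ + -const A.a₅ - const A.a₃ + const A.η)))
    (q₁ * (1 + const A.a₃ / (r₁ + -const A.a₅ - const A.a₃ + const A.η))) r₁ ?_ ?_ ?_ ?_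
    fun L m m1 m2 m3 => ?_
  rotate_right
  · have m4 := one_add_div_mem (add_mem (sub_mem (add_mem m3 (neg_mem (m A.a₅))) (m A.a₃))
      (m A.η)) (m A.a₃)
    exact ⟨mem_of_eq (div_mem m1 m4) (mul_div_cancel_right₀ _ n),
      mem_of_eq (div_mem m2 m4) (mul_div_cancel_right₀ _ n), m3⟩
  all_goals simp only [Divisor.coords, Backlund.onCoord, Backlund.onParam, Matrix.cons_val]
  exacts [(c0.mul (th.inv n)).of (by rw [← mul_inv]; congr 1; ring) (zero_mul _),
    (c1.mul th).of (by ring) rfl, (c2.mul th).of (by ring) rfl, c3]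

/-- Both `qᵢ` and the denominator vanish on `e₅`, and their ratios give finite new `qᵢ`. With the
new `η` the equation of `dneg` is the old denominator. -/
lemma s₃_e₅ (h : A.a₃ ≠ 0) : Backlund.s₃.Sends A .e₅ .dneg := by
  obtain ⟨c0, c1, c2, c3⟩ := cong_e₅ A
  have a := Cong.const c0.isCoord A.a₃
  have na := const_ne_zero h
  have n1 := q₁_ne_zero
  have nd := d_ne_zero A
  have ny := div_ne_zero nd n1
  refine Backlund.sends (const A.a₃ / ((r₁ + r₂ - const A.a₃ + const A.η) / q₁))
    (q₂ / q₁ * (const A.a₃ / ((r₁ + r₂ - const A.a₃ + const A.η) / q₁))) r₁ ?_ ?_ ?_ ?_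
    fun L m m1 m2 m3 => ⟨mem_of_eq (div_mem m2 m1)
      (mul_div_cancel_right₀ _ (div_ne_zero na ny)), mem_of_eq (div_mem (m A.a₃) m1)
      (div_div_cancel₀ na), m3⟩
  all_goals simp only [Divisor.coords, Backlund.onCoord, Backlund.onParam, Matrix.cons_val,
    const_sub]
  exacts [(c0.mul c2).of (by field_simp; ring) (zero_mul _),
    (c0.add (a.div c2 ny)).of (by field_simp) (zero_add _),
    (c1.mul (c0.add (a.div c2 ny))).of (by field_simp) (by rw [zero_add]), c3]

lemma s₃_e₆ (h : A.a₃ ≠ 0) : Backlund.s₃.Sends A .e₆ .dzero := by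
  obtain ⟨c0, c1, c2, c3⟩ := cong_e₆ A
  have a := Cong.const c0.isCoord A.a₃
  have na := neg_ne_zero.2 (const_ne_zero h)
  have n1 := q₁_ne_zero
  have n2 := q₂_ne_zero
  have nd := d_ne_zero A
  have ne := r₁_add_r₂_add_const_ne_zero A.η
  have ny := mul_ne_zero ne n1
  have e : Cong (Divisor.e₆.coord A) (r₁ + r₂ + const A.η) 0 :=
    (c2.mul c0).of (by field_simp) (mul_zero _)
  have d : Cong (Divisor.e₆.coord A) (r₁ + r₂ - const A.a₃ + const A.η) (-const A.a₃) :=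
    (e.sub a).of (by ring) (by ring)
  refine Backlund.sends ((r₁ + r₂ + const A.η) * q₁ / -const A.a₃)
    ((r₁ + r₂ + const A.η) * q₁ / -const A.a₃ / (q₁ / q₂)) r₁ ?_ ?_ ?_ ?_
    fun L m m1 m2 m3 => ⟨mem_of_eq (div_mem m1 m2) (div_div_cancel₀ (div_ne_zero ny na)),
      (div_mem_field (neg_mem (m _)) na).1 m1, m3⟩
  all_goals simp only [Divisor.coords, Backlund.onCoord, Backlund.onParam, Matrix.cons_val,
    const_sub, const_neg]
  exacts [e.of (by ring) rfl, (c2.div d na).of (by field_simp; ring) rfl,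
    ((c2.div d na).div c1 (div_ne_zero n1 n2)).of (by field_simp; ring) rfl, c3]

/-- The vanishing denominator gives both `qᵢ` poles with an unchanged ratio, and multiplying by the
denominator leaves `a₃ q₁`. -/
lemma s₃_dzero (h : A.a₃ ≠ 0) : Backlund.s₃.Sends A .dzero .e₆ := by
  have c0 : Cong (Divisor.dzero.coord A) (r₁ + r₂ - const A.a₃ + const A.η) 0 :=
    .zero (Divisor.isCoord A _)
  have c1 : Cong (Divisor.dzero.coord A) q₁ q₁ := .coord (Divisor.isCoord A _) 0
  have c2 : Cong (Divisor.dzero.coord A) q₂ q₂ := .coord (Divisor.isCoord A _) 1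
  have c3 : Cong (Divisor.dzero.coord A) r₁ r₁ := .coord (Divisor.isCoord A _) 2
  have a := Cong.const c0.isCoord A.a₃
  have na := const_ne_zero h
  have n1 := q₁_ne_zero
  have n2 := q₂_ne_zero
  have nd := d_ne_zero A
  have n := one_add_div_ne_zero nd (d_add_ne_zero A)
  have ne := d_add_ne_zero A
  have d := c1.mul (c0.add a)
  rw [zero_add] at d
  have e : ∀ q : K, q + const A.a₃ * q / (r₁ + r₂ - const A.a₃ + const A.η) =
    q * (r₁ + r₂ - const A.a₃ + const A.η + const A.a₃) /
      (r₁ + r₂ - const A.a₃ + const A.η) := fun q => by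
    field_simp
  refine Backlund.sends (q₁ / q₂) (q₁ * const A.a₃) r₁ ?_ ?_ ?_ ?_ fun L m m1 m2 m3 => ?_
  rotate_right
  · have m4 := mem_of_eq (div_mem m2 (m A.a₃)) (mul_div_cancel_right₀ _ na)
    exact ⟨m4, mem_of_eq (div_mem m4 m1) (div_div_cancel₀ n1), m3⟩
  all_goals simp only [Divisor.coords, Backlund.onCoord, Backlund.onParam, Matrix.cons_val,
    const_sub, e]
  · exact (c0.div d (mul_ne_zero n1 na)).of (inv_div _ _).symm (zero_div _)
  · exact (c1.div c2 n2).of (by field_simp) rfl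
  · refine d.of ?_ rfl
    rw [mul_div_assoc', eq_div_iff nd]
    ring
  · exact c3

lemma s₃_dneg (h : A.a₃ ≠ 0) : Backlund.s₃.Sends A .dneg .e₅ := by
  have c0 : Cong (Divisor.dneg.coord A) (r₁ + r₂ + const A.η) 0 := .zero (Divisor.isCoord A _)
  have c1 : Cong (Divisor.dneg.coord A) q₁ q₁ := .coord (Divisor.isCoord A _) 0
  have c2 : Cong (Divisor.dneg.coord A) q₂ q₂ := .coord (Divisor.isCoord A _) 1
  have c3 : Cong (Divisor.dneg.coord A) r₁ r₁ := .coord (Divisor.isCoord A _) 2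
  have a := Cong.const c0.isCoord A.a₃
  have na := neg_ne_zero.2 (const_ne_zero h)
  have n1 := q₁_ne_zero
  have n2 := q₂_ne_zero
  have nd := d_ne_zero A
  have ne := r₁_add_r₂_add_const_ne_zero A.η
  have d : Cong (Divisor.dneg.coord A) (r₁ + r₂ - const A.a₃ + const A.η) (-const A.a₃) :=
    (c0.sub a).of (by ring) (by ring)
  have e : ∀ q : K, q + const A.a₃ * q / (r₁ + r₂ - const A.a₃ + const A.η) =
    q * (r₁ + r₂ + const A.η) / (r₁ + r₂ - const A.a₃ + const A.η) := fun q => by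
    field_simp
    ring
  refine Backlund.sends (q₂ / q₁) (-const A.a₃ / q₁) r₁ ?_ ?_ ?_ ?_ fun L m m1 m2 m3 => ?_
  rotate_right
  · have m4 := mem_of_eq (div_mem (neg_mem (m A.a₃)) m2) (div_div_cancel₀ na)
    exact ⟨m4, (div_mem_field m4 n1).1 m1, m3⟩
  all_goals simp only [Divisor.coords, Backlund.onCoord, Backlund.onParam, Matrix.cons_val,
    const_sub, const_neg, e]
  · exact ((c1.mul c0).div d na).of rfl (by simp)
  · exact (c2.div c1 n1).of (by field_simp) rfl
  · refine (d.div c1 n1).of ?_ rfl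
    rw [div_div_eq_mul_div, div_eq_div_iff n1 (mul_ne_zero n1 ne)]
    ring
  · exact c3

lemma s₃_e₇ : Backlund.s₃.Sends A .e₇ .e₇ := by
  obtain ⟨c0, c1, c2, c3, c4⟩ := cong_e₇ A
  have a := Cong.const c0.isCoord A.a₃
  have s := (c3.sub a).add (Cong.const c0.isCoord A.η)
  have d := c0.inv_add r₁_ne_zero s
  have k := c0.self_div_add r₁_ne_zero s
  have e : r₁ + r₂ - const A.a₃ + const A.η = r₁ + (r₂ - const A.a₃ + const A.η) := by ring
  refine Backlund.sends ((q₁ - const A.t) * r₁ + const A.a₃ * const A.t) q₂ r₂ ?_ ?_ ?_ ?_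
    fun L m m1 m2 m3 => ⟨mem_of_eq (sub_mem m1 (mul_mem (m A.a₃) (m A.t)))
      (add_sub_cancel_right _ _), m2, m3⟩
  all_goals simp only [Divisor.coords, Backlund.onCoord, Backlund.onParam, Matrix.cons_val, e]
  exacts [c0, (c1.add ((a.mul c4).mul k)).of (by ring) (by ring),
    (c2.add ((a.mul c2).mul d)).of (by ring) (by ring), c3]

lemma s₃_e₈ : Backlund.s₃.Sends A .e₈ .e₈ := by
  obtain ⟨c0, c1, c2, c3, c4, c5⟩ := cong_e₈ A
  have a := Cong.const c0.isCoord A.a₃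
  have t := Cong.const c0.isCoord A.t
  have s := (c3.sub a).add (Cong.const c0.isCoord A.η)
  have d := c0.inv_add r₁_ne_zero s
  have k := c0.self_div_add r₁_ne_zero s
  have e : r₁ + r₂ - const A.a₃ + const A.η = r₁ + (r₂ - const A.a₃ + const A.η) := by ring
  have nd := d_ne_zero A
  rw [e] at nd
  -- Used to write `r₁ / (r₁ + u) = 1 - u / (r₁ + u)`: the leading term is absorbed by the change of
  -- `a₂`, and the next order remains.
  have e' := mul_inv_cancel₀ nd
  refine Backlund.sends (((q₁ - const A.t) * r₁ - const (A.a₂ * A.t)) * r₁ +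
    const A.a₃ * (const A.a₂ * const A.t - const A.t * (r₂ - const A.a₃ + const A.η))) q₂ r₂
    ?_ ?_ ?_ ?_ fun L m m1 m2 m3 => ⟨mem_of_eq (sub_mem m1 (mul_mem (m A.a₃) (sub_mem
      (mul_mem (m A.a₂) (m A.t)) (mul_mem (m A.t) (add_mem (sub_mem m3 (m A.a₃)) (m A.η))))))
      (add_sub_cancel_right _ _), m2, m3⟩
  all_goals simp only [Divisor.coords, Backlund.onCoord, Backlund.onParam, Matrix.cons_val, e]
  · exact c0
  · refine (c1.add (a.mul ((c4.mul k).sub ((t.mul s).mul k)))).of ?_ (by ring)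
    simp only [const_mul, const_add]
    generalize r₂ - const A.a₃ + const A.η = u at e' ⊢
    linear_combination -const A.a₃ * const A.t * r₁ * e'
  · exact (c2.add ((a.mul c2).mul d)).of (by ring) (by ring)
  · exact c3

lemma s₃_e₉ : Backlund.s₃.Sends A .e₉ .e₉ := by
  obtain ⟨c0, c1, c2, c3, c4⟩ := cong_e₉ A
  have a := Cong.const c0.isCoord A.a₃
  have s := (c3.sub a).add (Cong.const c0.isCoord A.η)
  have d := c0.inv_add r₂_ne_zero s
  have k := c0.self_div_add r₂_ne_zero s
  have e : r₁ + r₂ - const A.a₃ + const A.η = r₂ + (r₁ - const A.a₃ + const A.η) := by ring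
  refine Backlund.sends ((q₂ - 1) * r₂ + const A.a₃) q₁ r₁ ?_ ?_ ?_ ?_
    fun L m m1 m2 m3 => ⟨(add_const_mem_iff _).1 m1, m2, m3⟩
  all_goals simp only [Divisor.coords, Backlund.onCoord, Matrix.cons_val, e]
  exacts [c0, (c1.add ((a.mul c4).mul k)).of (by ring) (by ring),
    (c2.add ((a.mul c2).mul d)).of (by ring) (by ring), c3]

lemma s₃_e₁₀ : Backlund.s₃.Sends A .e₁₀ .e₁₀ := by
  obtain ⟨c0, c1, c2, c3, c4, c5⟩ := cong_e₁₀ A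
  have a := Cong.const c0.isCoord A.a₃
  have s := (c3.sub a).add (Cong.const c0.isCoord A.η)
  have d := c0.inv_add r₂_ne_zero s
  have k := c0.self_div_add r₂_ne_zero s
  have e : r₁ + r₂ - const A.a₃ + const A.η = r₂ + (r₁ - const A.a₃ + const A.η) := by ring
  have nd := d_ne_zero A
  rw [e] at nd
  have e' := mul_inv_cancel₀ nd
  refine Backlund.sends (((q₂ - 1) * r₂ - const A.a₄) * r₂ +
    const A.a₃ * (const A.a₄ - (r₁ - const A.a₃ + const A.η))) q₁ r₁ ?_ ?_ ?_ ?_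
    fun L m m1 m2 m3 => ⟨mem_of_eq (sub_mem m1 (mul_mem (m A.a₃) (sub_mem
      (m A.a₄) (add_mem (sub_mem m3 (m A.a₃)) (m A.η))))) (add_sub_cancel_right _ _), m2, m3⟩
  all_goals simp only [Divisor.coords, Backlund.onCoord, Backlund.onParam, Matrix.cons_val, e]
  · exact c0
  · refine (c1.add (a.mul ((c4.mul k).sub (s.mul k)))).of ?_ (by ring)
    simp only [const_add]
    generalize r₁ - const A.a₃ + const A.η = u at e' ⊢
    linear_combination -const A.a₃ * r₂ * e'
  · exact (c2.add ((a.mul c2).mul d)).of (by ring) (by ring)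
  · exact c3

lemma s₃_e₁₁ : Backlund.s₃.Sends A .e₁₁ .e₁₁ := by
  obtain ⟨c0, c1, c2, c3, c4⟩ := cong_e₁₁ A
  have a := Cong.const c0.isCoord A.a₃
  have n3 := r₁_ne_zero
  have n4 := r₂_ne_zero
  have nd := d_ne_zero A
  have np := div_ne_zero n3 n4
  have n34 : r₁ + r₂ ≠ 0 := by simpa using r₁_add_r₂_add_const_ne_zero 0
  have ns : 1 + (r₁ / r₂)⁻¹ + (const A.η - const A.a₃) * 0 ≠ 0 := by
    rw [mul_zero, add_zero, inv_div, _root_.one_add_div n3]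
    exact div_ne_zero n34 n3
  have s := ((Cong.one c0.isCoord).add (c1.inv np)).add
    (((Cong.const c0.isCoord A.η).sub a).mul c0)
  have d : Cong (Divisor.e₁₁.coord A) (r₁ + r₂ - const A.a₃ + const A.η)⁻¹ 0 := by
    refine (c0.mul (s.inv ns)).of ?_ (zero_mul _)
    rw [← mul_inv, inv_inj]
    field_simp
    ring
  refine Backlund.sends (r₁ / r₂) ((q₁ - q₂) * r₁) q₂ ?_ ?_ ?_ ?_ fun L m m1 m2 m3 => ⟨m1, m2, m3⟩
  all_goals simp only [Divisor.coords, Backlund.onCoord, Matrix.cons_val]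
  exacts [c0, c1, (c2.add ((a.mul c2).mul d)).of (by ring) (by ring),
    (c3.add ((a.mul c3).mul d)).of (by ring) (by ring)]

-- Although `r₁` and `r₂` have poles, their sum is finite on `e₁₂`, since `r₁ / r₂` has residue
-- `-1`. The common factor of `q₁` and `q₂` is therefore a non-constant residue in the first
-- coordinate.
open MvPolynomial in
lemma s₃_e₁₂ : Backlund.s₃.Sends A .e₁₂ .e₁₂ := by
  obtain ⟨c0, c1, c2, c3, c4, c5, c6⟩ := cong_e₁₂ A
  have a := Cong.const c0.isCoord A.a₃
  have n3 := r₁_ne_zero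
  have n4 := r₂_ne_zero
  have h : ∀ c : ℂ, (r₁ / r₂ + 1) * r₁ / (-1) + const c ≠ 0 := fun c => by
    have : -((r₁ + r₂) * r₁) + const c * r₂ ≠ 0 :=
      ne_zero_of_eval (-((X 2 + X 3) * X 2) + C c * X 3) ![0, 0, 1, 0] (by simp)
        (by simp [r₁, r₂, const])
    have e : (r₁ / r₂ + 1) * r₁ / (-1) + const c = (-((r₁ + r₂) * r₁) + const c * r₂) / r₂ := by
      field_simp
    rw [e]
    exact div_ne_zero this n4
  have nd : (r₁ / r₂ + 1) * r₁ / (-1) - const A.a₃ + const A.η ≠ 0 := by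
    convert h (A.η - A.a₃) using 1
    rw [const_sub]
    ring
  have nd' : (r₁ / r₂ + 1) * r₁ / (-1) - const A.a₃ + const A.η + const A.a₃ ≠ 0 := by
    convert h A.η using 1
    ring
  have n := one_add_div_ne_zero nd nd'
  have s : Cong (Divisor.e₁₂.coord A) (r₁ + r₂) ((r₁ / r₂ + 1) * r₁ / (-1)) :=
    (c1.div c4 (by simp)).of (by field_simp) rfl
  have th := ((s.sub a).add (Cong.const c0.isCoord A.η)).one_add_div A.a₃ nd
  refine Backlund.sends ((r₁ / r₂ + 1) * r₁) (((q₁ - q₂) * r₁ - const A.a₀ * q₂) * r₁ *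
    (1 + const A.a₃ / ((r₁ / r₂ + 1) * r₁ / (-1) - const A.a₃ + const A.η)))
    (q₂ * (1 + const A.a₃ / ((r₁ / r₂ + 1) * r₁ / (-1) - const A.a₃ + const A.η))) ?_ ?_ ?_ ?_
    fun L m m1 m2 m3 => ?_
  rotate_right
  · have m4 := one_add_div_mem (add_mem (sub_mem (div_mem m1 (neg_mem L.one_mem)) (m A.a₃))
      (m A.η)) (m A.a₃)
    exact ⟨m1, mem_of_eq (div_mem m2 m4) (mul_div_cancel_right₀ _ n),
      mem_of_eq (div_mem m3 m4) (mul_div_cancel_right₀ _ n)⟩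
  all_goals simp only [Divisor.coords, Backlund.onCoord, Backlund.onParam, Matrix.cons_val]
  exacts [c0, c1, (c2.mul th).of (by ring) rfl, (c3.mul th).of (by ring) rfl]

lemma s₃_q₁inf : Backlund.s₃.Sends A .q₁inf .q₁inf := by
  obtain ⟨c0, c1, c2, c3⟩ := cong_q₁inf A
  have nd := d_ne_zero A
  have n := one_add_div_ne_zero nd (d_add_ne_zero A)
  have th := (((c2.add c3).sub (Cong.const c0.isCoord A.a₃)).add
    (Cong.const c0.isCoord A.η)).one_add_div A.a₃ nd
  refine Backlund.sends (q₂ * (1 + const A.a₃ / (r₁ + r₂ - const A.a₃ + const A.η))) r₁ r₂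
    ?_ ?_ ?_ ?_ fun L m m1 m2 m3 => ⟨mem_of_eq (div_mem m1 (one_add_div_mem (add_mem (sub_mem
      (add_mem m2 m3) (m A.a₃)) (m A.η)) (m A.a₃))) (mul_div_cancel_right₀ _ n), m2, m3⟩
  all_goals simp only [Divisor.coords, Backlund.onCoord, Matrix.cons_val]
  exacts [(c0.mul (th.inv n)).of (by rw [← mul_inv]; congr 1; ring) (zero_mul _),
    (c1.mul th).of (by ring) rfl, c2, c3]

lemma s₃_q₂inf : Backlund.s₃.Sends A .q₂inf .q₂inf := by
  obtain ⟨c0, c1, c2, c3⟩ := cong_q₂inf A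
  have nd := d_ne_zero A
  have n := one_add_div_ne_zero nd (d_add_ne_zero A)
  have th := (((c2.add c3).sub (Cong.const c0.isCoord A.a₃)).add
    (Cong.const c0.isCoord A.η)).one_add_div A.a₃ nd
  refine Backlund.sends (q₁ * (1 + const A.a₃ / (r₁ + r₂ - const A.a₃ + const A.η))) r₁ r₂
    ?_ ?_ ?_ ?_ fun L m m1 m2 m3 => ⟨mem_of_eq (div_mem m1 (one_add_div_mem (add_mem (sub_mem
      (add_mem m2 m3) (m A.a₃)) (m A.η)) (m A.a₃))) (mul_div_cancel_right₀ _ n), m2, m3⟩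
  all_goals simp only [Divisor.coords, Backlund.onCoord, Matrix.cons_val]
  exacts [(c0.mul (th.inv n)).of (by rw [← mul_inv]; congr 1; ring) (zero_mul _),
    (c1.mul th).of (by ring) rfl, c2, c3]

lemma s₃_r₁inf : Backlund.s₃.Sends A .r₁inf .r₁inf := by
  obtain ⟨c0, c1, c2, c3⟩ := cong_r₁inf A
  have a := Cong.const c0.isCoord A.a₃
  have d := c0.inv_add r₁_ne_zero ((c3.sub a).add (Cong.const c0.isCoord A.η))
  have e : r₁ + r₂ - const A.a₃ + const A.η = r₁ + (r₂ - const A.a₃ + const A.η) := by ring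
  refine Backlund.sends q₁ q₂ r₂ ?_ ?_ ?_ ?_ fun L m m1 m2 m3 => ⟨m1, m2, m3⟩
  all_goals simp only [Divisor.coords, Backlund.onCoord, Matrix.cons_val, e]
  exacts [c0, (c1.add ((a.mul c1).mul d)).of (by ring) (by ring),
    (c2.add ((a.mul c2).mul d)).of (by ring) (by ring), c3]

lemma s₃_r₂inf : Backlund.s₃.Sends A .r₂inf .r₂inf := by
  obtain ⟨c0, c1, c2, c3⟩ := cong_r₂inf A
  have a := Cong.const c0.isCoord A.a₃
  have d := c0.inv_add r₂_ne_zero ((c3.sub a).add (Cong.const c0.isCoord A.η))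
  have e : r₁ + r₂ - const A.a₃ + const A.η = r₂ + (r₁ - const A.a₃ + const A.η) := by ring
  refine Backlund.sends q₁ q₂ r₁ ?_ ?_ ?_ ?_ fun L m m1 m2 m3 => ⟨m1, m2, m3⟩
  all_goals simp only [Divisor.coords, Backlund.onCoord, Matrix.cons_val, e]
  exacts [c0, (c1.add ((a.mul c1).mul d)).of (by ring) (by ring),
    (c2.add ((a.mul c2).mul d)).of (by ring) (by ring), c3]

end s₃


/-! ### The transformation `ρ` -/

section ρ

variable (A : Param)

lemma ρ_e₁ (ht : A.t ≠ 0) : Backlund.ρ.Sends A .e₁ .e₃ := by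
  obtain ⟨c0, c1, c2, c3⟩ := cong_e₁ A
  have t := Cong.const c0.isCoord A.t
  have nt := const_ne_zero ht
  exact Backlund.sends (r₁ / q₁ * const A.t) (q₂ / const A.t) r₂
    ((c0.div t nt).of rfl (zero_div _)) ((c1.mul t).of (by rw [div_mul_eq_mul_div, ← div_div_eq_mul_div]; rfl) rfl)
    (c2.div t nt) c3 fun L m m1 m2 m3 => ⟨mem_of_eq (div_mem m1 (m A.t))
      (mul_div_cancel_right₀ _ nt), (div_mem_field (m _) nt).1 m2, m3⟩

lemma ρ_e₂ (ht : A.t ≠ 0) : Backlund.ρ.Sends A .e₂ .e₄ := by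
  obtain ⟨c0, c1, c2, c3⟩ := cong_e₂ A
  have t := Cong.const c0.isCoord A.t
  have nt := const_ne_zero ht
  exact Backlund.sends ((r₁ + const A.a₁) * q₁ / const A.t) (q₂ / const A.t) r₂
    ((c0.mul t).of (by rw [inv_mul_eq_div, ← inv_div]; rfl) (zero_mul _))
    ((c1.div t nt).of (mul_div_assoc _ _ _) rfl)
    (c2.div t nt) c3 fun L m m1 m2 m3 => ⟨(div_mem_field (m _) nt).1 m1,
      (div_mem_field (m _) nt).1 m2, m3⟩

lemma ρ_e₃ (ht : A.t ≠ 0) : Backlund.ρ.Sends A .e₃ .e₁ := by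
  obtain ⟨c0, c1, c2, c3⟩ := cong_e₃ A
  have t := Cong.const c0.isCoord A.t
  have nt := const_ne_zero ht
  exact Backlund.sends (r₂ / q₂ * const A.t) (q₁ / const A.t) r₁
    ((c0.div t nt).of rfl (zero_div _)) ((c1.mul t).of (by rw [div_mul_eq_mul_div, ← div_div_eq_mul_div]; rfl) rfl)
    (c2.div t nt) c3 fun L m m1 m2 m3 => ⟨mem_of_eq (div_mem m1 (m A.t))
      (mul_div_cancel_right₀ _ nt), (div_mem_field (m _) nt).1 m2, m3⟩

lemma ρ_e₄ (ht : A.t ≠ 0) : Backlund.ρ.Sends A .e₄ .e₂ := by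
  obtain ⟨c0, c1, c2, c3⟩ := cong_e₄ A
  have t := Cong.const c0.isCoord A.t
  have nt := const_ne_zero ht
  exact Backlund.sends ((r₂ + const A.a₅) * q₂ / const A.t) (q₁ / const A.t) r₁
    ((c0.mul t).of (by rw [inv_mul_eq_div, ← inv_div]; rfl) (zero_mul _))
    ((c1.div t nt).of (mul_div_assoc _ _ _) rfl)
    (c2.div t nt) c3 fun L m m1 m2 m3 => ⟨(div_mem_field (m _) nt).1 m1,
      (div_mem_field (m _) nt).1 m2, m3⟩

/-- Exchanging the indices inverts `q₂ / q₁`, and the equation of the centre expresses the residue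
of `r₂` through that of `r₁`. -/
lemma ρ_e₅ (ht : A.t ≠ 0) : Backlund.ρ.Sends A .e₅ .e₅ := by
  obtain ⟨c0, c1, c2, c3⟩ := cong_e₅ A
  have t := Cong.const c0.isCoord A.t
  have nt := const_ne_zero ht
  have n1 := q₁_ne_zero
  have n2 := q₂_ne_zero
  have ny := div_ne_zero n2 n1
  refine Backlund.sends (q₂ / q₁)⁻¹
    ((r₁ + r₂ - const A.a₃ + const A.η) / q₁ * const A.t / (q₂ / q₁))
    (const A.a₃ - const A.η - r₁) ?_ ?_ ?_ ?_ fun L m m1 m2 m3 => ?_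
  rotate_right
  · have m4 := inv_mem_field.1 m1
    refine ⟨m4, mem_of_eq (div_mem ((div_mem_field m4 ny).1 m2) (m A.t))
      (mul_div_cancel_right₀ _ nt), ?_⟩
    change r₁ ∈ L
    exact mem_of_eq (sub_mem (sub_mem (m A.a₃) (m A.η)) m3) (by ring)
  all_goals simp only [Divisor.coords, Backlund.onCoord, Backlund.onParam, Matrix.cons_val]
  exacts [((c1.mul c0).div t nt).of (by field_simp) (by simp), (c1.inv ny).of (by field_simp) rfl,
    ((c2.mul t).div c1 ny).of (by field_simp; ring) rfl,
    ((((c2.mul c0).add (Cong.const c0.isCoord A.a₃)).sub (Cong.const c0.isCoord A.η)).sub c3).of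
      (by field_simp; ring) (by ring)]

lemma ρ_e₆ (ht : A.t ≠ 0) : Backlund.ρ.Sends A .e₆ .e₆ := by
  obtain ⟨c0, c1, c2, c3⟩ := cong_e₆ A
  have t := Cong.const c0.isCoord A.t
  have nt := const_ne_zero ht
  have n1 := q₁_ne_zero
  have n2 := q₂_ne_zero
  have ny := div_ne_zero n1 n2
  refine Backlund.sends (q₁ / q₂)⁻¹
    ((r₁ + r₂ + const A.η) * q₁ / const A.t / (q₁ / q₂))
    (-const A.η - r₁) ?_ ?_ ?_ ?_ fun L m m1 m2 m3 => ?_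
  rotate_right
  · have m4 := inv_mem_field.1 m1
    refine ⟨m4, (div_mem_field (m _) nt).1 ((div_mem_field m4 ny).1 m2), ?_⟩
    change r₁ ∈ L
    exact mem_of_eq (sub_mem (neg_mem (m A.η)) m3) (by ring)
  all_goals simp only [Divisor.coords, Backlund.onCoord, Backlund.onParam, Matrix.cons_val]
  exacts [((c1.mul c0).mul t).of (by field_simp) (by simp), (c1.inv ny).of (by field_simp) rfl,
    ((c2.div t nt).div c1 ny).of (by field_simp; ring) rfl,
    (((c2.mul c0).sub (Cong.const c0.isCoord A.η)).sub c3).of (by field_simp; ring) (by ring)]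

lemma ρ_e₇ (ht : A.t ≠ 0) : Backlund.ρ.Sends A .e₇ .e₉ := by
  obtain ⟨c0, c1, c2, c3, -⟩ := cong_e₇ A
  have t := Cong.const c0.isCoord A.t
  have nt := const_ne_zero ht
  refine Backlund.sends ((q₁ - const A.t) * r₁ / const A.t) (q₂ / const A.t) r₂ c0 ?_
    (c2.div t nt) c3 fun L m m1 m2 m3 => ⟨(div_mem_field (m _) nt).1 m1,
      (div_mem_field (m _) nt).1 m2, m3⟩
  simp only [Divisor.coords, Backlund.onCoord, Matrix.cons_val]
  exact (c1.div t nt).of (by field_simp) rfl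

lemma ρ_e₈ (ht : A.t ≠ 0) : Backlund.ρ.Sends A .e₈ .e₁₀ := by
  obtain ⟨c0, c1, c2, c3, -⟩ := cong_e₈ A
  have t := Cong.const c0.isCoord A.t
  have nt := const_ne_zero ht
  refine Backlund.sends (((q₁ - const A.t) * r₁ - const (A.a₂ * A.t)) * r₁ / const A.t)
    (q₂ / const A.t) r₂ c0 ?_
    (c2.div t nt) c3 fun L m m1 m2 m3 => ⟨(div_mem_field (m _) nt).1 m1,
      (div_mem_field (m _) nt).1 m2, m3⟩
  simp only [Divisor.coords, Backlund.onCoord, Backlund.onParam, Matrix.cons_val]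
  exact (c1.div t nt).of (by rw [const_mul]; field_simp) rfl

lemma ρ_e₉ (ht : A.t ≠ 0) : Backlund.ρ.Sends A .e₉ .e₇ := by
  obtain ⟨c0, c1, c2, c3, -⟩ := cong_e₉ A
  have t := Cong.const c0.isCoord A.t
  have nt := const_ne_zero ht
  refine Backlund.sends ((q₂ - 1) * r₂ / const A.t) (q₁ / const A.t) r₁ c0 ?_
    (c2.div t nt) c3 fun L m m1 m2 m3 => ⟨(div_mem_field (m _) nt).1 m1,
      (div_mem_field (m _) nt).1 m2, m3⟩
  simp only [Divisor.coords, Backlund.onCoord, Backlund.onParam, Matrix.cons_val, const_inv]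
  exact (c1.div t nt).of (by field_simp) rfl

lemma ρ_e₁₀ (ht : A.t ≠ 0) : Backlund.ρ.Sends A .e₁₀ .e₈ := by
  obtain ⟨c0, c1, c2, c3, -⟩ := cong_e₁₀ A
  have t := Cong.const c0.isCoord A.t
  have nt := const_ne_zero ht
  refine Backlund.sends (((q₂ - 1) * r₂ - const A.a₄) * r₂ / const A.t)
    (q₁ / const A.t) r₁ c0 ?_
    (c2.div t nt) c3 fun L m m1 m2 m3 => ⟨(div_mem_field (m _) nt).1 m1,
      (div_mem_field (m _) nt).1 m2, m3⟩
  simp only [Divisor.coords, Backlund.onCoord, Backlund.onParam, Matrix.cons_val, const_mul,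
    const_inv]
  exact (c1.div t nt).of (by field_simp) rfl

lemma ρ_e₁₁ (ht : A.t ≠ 0) : Backlund.ρ.Sends A .e₁₁ .e₁₁ := by
  obtain ⟨c0, c1, c2, c3, c4⟩ := cong_e₁₁ A
  have t := Cong.const c0.isCoord A.t
  have nt := const_ne_zero ht
  have n3 := r₁_ne_zero
  have n4 := r₂_ne_zero
  have np := div_ne_zero n3 n4
  refine Backlund.sends (r₁ / r₂)⁻¹ (-((q₁ - q₂) * r₁) / (r₁ / r₂) / const A.t) (q₂ / const A.t)
    ?_ ?_ ?_ ?_ fun L m m1 m2 m3 => ?_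
  rotate_right
  · have m4 := inv_mem_field.1 m1
    have := neg_mem ((div_mem_field m4 np).1 ((div_mem_field (m _) nt).1 m2))
    rw [neg_neg] at this
    exact ⟨m4, this, (div_mem_field (m _) nt).1 m3⟩
  all_goals simp only [Divisor.coords, Backlund.onCoord, Matrix.cons_val]
  · exact (c1.mul c0).of (by field_simp) (by simp)
  · exact (c1.inv np).of (by field_simp) rfl
  -- Negation of a congruence, obtained by subtracting from a difference that is zero.
  · have := ((((Cong.zero c0.isCoord).sub (Cong.zero c0.isCoord)).sub c2).div c1 np).div t nt
    exact this.of (by field_simp; ring) (by simp)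
  · exact c4.div t nt

/-- Exchanging `r₁` with `r₂` divides the coordinates by the square of `r₁ / r₂`, whose residue is
one; the remaining terms correct for using `q₁` instead of `q₂` in the equation. -/
lemma ρ_e₁₂ (ht : A.t ≠ 0) : Backlund.ρ.Sends A .e₁₂ .e₁₂ := by
  obtain ⟨c0, c1, c2, c3, c4, c5, c6⟩ := cong_e₁₂ A
  have a := Cong.const c0.isCoord A.a₀
  have t := Cong.const c0.isCoord A.t
  have nt := const_ne_zero ht
  have nt' := neg_ne_zero.2 nt
  have n3 := r₁_ne_zero
  have n4 := r₂_ne_zero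
  have np := div_ne_zero n3 n4
  have pp := c4.mul c4
  have npp : (-1 : K) * -1 ≠ 0 := by simp
  have t' := (a.sub a).sub t
  rw [sub_self, zero_sub] at t'
  refine Backlund.sends ((r₁ / r₂ + 1) * r₁) ((((q₁ - q₂) * r₁ - const A.a₀ * q₂) * r₁ -
    const A.a₀ * (const A.a₀ * q₂) + const A.a₀ * q₂ * ((r₁ / r₂ + 1) * r₁)) / -const A.t)
    (q₂ / const A.t) ?_ ?_ ?_ ?_ fun L m m1 m2 m3 => ?_
  rotate_right
  · have m4 := (div_mem_field (m _) nt).1 m3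
    have m5 := mul_mem (m A.a₀) m4
    exact ⟨m1, mem_of_eq (add_mem (sub_mem ((div_mem_field (neg_mem (m _)) nt').1 m2)
      (mul_mem m5 m1)) (mul_mem (m A.a₀) m5)) (by rw [add_sub_cancel_right, sub_add_cancel]; rfl),
      m4⟩
  all_goals simp only [Divisor.coords, Backlund.onCoord, Backlund.onParam, Matrix.cons_val]
  · exact (c4.mul c0).of (by field_simp) (by simp)
  · exact (c1.div pp npp).of (by field_simp; ring) (by simp)
  · refine ((((c2.sub (a.mul c5)).add ((a.mul c6).mul c1)).div t' nt').div pp npp).of ?_ (by simp)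
    field_simp
    ring
  · exact c6.div t nt

lemma ρ_q₁inf (ht : A.t ≠ 0) : Backlund.ρ.Sends A .q₁inf .q₂inf := by
  obtain ⟨c0, c1, c2, c3⟩ := cong_q₁inf A
  have t := Cong.const c0.isCoord A.t
  have nt := const_ne_zero ht
  exact Backlund.sends (q₂ / const A.t) r₂ r₁
    ((c0.mul t).of (by rw [inv_mul_eq_div, ← inv_div]; rfl) (zero_mul _)) (c1.div t nt) c3 c2
    fun L m m1 m2 m3 => ⟨(div_mem_field (m _) nt).1 m1, m3, m2⟩

lemma ρ_q₂inf (ht : A.t ≠ 0) : Backlund.ρ.Sends A .q₂inf .q₁inf := by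
  obtain ⟨c0, c1, c2, c3⟩ := cong_q₂inf A
  have t := Cong.const c0.isCoord A.t
  have nt := const_ne_zero ht
  exact Backlund.sends (q₁ / const A.t) r₂ r₁
    ((c0.mul t).of (by rw [inv_mul_eq_div, ← inv_div]; rfl) (zero_mul _)) (c1.div t nt) c3 c2
    fun L m m1 m2 m3 => ⟨(div_mem_field (m _) nt).1 m1, m3, m2⟩

lemma ρ_r₁inf (ht : A.t ≠ 0) : Backlund.ρ.Sends A .r₁inf .r₂inf := by
  obtain ⟨c0, c1, c2, c3⟩ := cong_r₁inf A
  have t := Cong.const c0.isCoord A.t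
  have nt := const_ne_zero ht
  exact Backlund.sends (q₂ / const A.t) (q₁ / const A.t) r₂ c0 (c2.div t nt) (c1.div t nt) c3
    fun L m m1 m2 m3 => ⟨(div_mem_field (m _) nt).1 m2, (div_mem_field (m _) nt).1 m1, m3⟩

lemma ρ_r₂inf (ht : A.t ≠ 0) : Backlund.ρ.Sends A .r₂inf .r₁inf := by
  obtain ⟨c0, c1, c2, c3⟩ := cong_r₂inf A
  have t := Cong.const c0.isCoord A.t
  have nt := const_ne_zero ht
  exact Backlund.sends (q₂ / const A.t) (q₁ / const A.t) r₁ c0 (c2.div t nt) (c1.div t nt) c3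
    fun L m m1 m2 m3 => ⟨(div_mem_field (m _) nt).1 m2, (div_mem_field (m _) nt).1 m1, m3⟩

end ρ


/-! ### The transformations match the prime divisors -/

section matching

variable {A B : Param} {R : LocalSubring K} {φ : K ≃ₐ[ℂ] K} {g : Backlund} {C : Subring K}

/-- If the old coordinates can be recovered from the new ones with denominators that are units at
`R`, the transformation is a local isomorphism at `R`. -/
lemma IsLocOf.of_coord_mem {y : Fin 4 → K} (hR : IsLocOf (gen (Set.range coord)) R)
    (hy : ∀ i, y i ∈ R.toSubring)
    (h : ∀ C : Subring K, (∀ c, const c ∈ C) → (∀ i, y i ∈ C) →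
      (∀ x ∈ C, ∀ s ∈ C, s ∉ maxIdeal R → x / s ∈ C) → ∀ i, coord i ∈ C) :
    IsLocOf (gen (Set.range y)) R := by
  have hc : ∀ c, const c ∈ R.toSubring := fun c => hR.1 (const_mem_gen _ c)
  have hle : gen (Set.range y) ≤ R.toSubring := gen_le hc (by rintro _ ⟨i, rfl⟩; exact hy i)
  refine hR.of_le_fractions hle (gen_le (fun c => le_fractions hle (const_mem_gen _ c)) ?_)
  rintro _ ⟨i, rfl⟩
  exact h (fractions _ R hle) (fun c => le_fractions hle (const_mem_gen _ c))
    (fun i => le_fractions hle (subset_gen _ ⟨i, rfl⟩)) (fun x hx s hs hs' =>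
      div_mem_fractions hle hx hs hs') i

lemma isCoord_of_coord_mem {y : Fin 4 → K}
    (h : ∀ C : Subring K, (∀ c, const c ∈ C) → (∀ i, y i ∈ C) →
      (∀ x ∈ C, ∀ s ∈ C, s ≠ 0 → x / s ∈ C) → ∀ i, coord i ∈ C) : IsCoord y :=
  isCoord_of_adjoin <| h (IntermediateField.adjoin ℂ (Set.range y)).toSubalgebra.toSubring
    (fun c => IntermediateField.algebraMap_mem _ c)
    (fun i => IntermediateField.subset_adjoin _ _ ⟨i, rfl⟩) fun x hx s hs _ => by
      have h1 : x ∈ IntermediateField.adjoin ℂ (Set.range y) := hx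
      have h2 := div_mem h1 hs
      exact h2

lemma mem_of_coe_eq {x y : K} (h : x ∈ C) (e : x = y) : y ∈ C := e ▸ h

lemma div_mem_of_notMem {x s : K} (hx : x ∈ R.toSubring) (hs : s ∈ R.toSubring)
    (hs' : s ∉ maxIdeal R) : x / s ∈ R.toSubring := by
  rw [div_eq_mul_inv]
  exact mul_mem hx (inv_mem_of_notMem_maxIdeal hs hs')

/-- The transformation is birational, and matches the local rings of height at most one of `X_A`
and `X_Ā`. -/
def Backlund.Matches (g : Backlund) (A : Param) : Prop :=
  ∃ φ : K ≃ₐ[ℂ] K, (∀ i, φ (coord i) = g.onCoord A i) ∧ MatchesBig φ A (g.onParam A)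

lemma Backlund.Matches.of_eq (h : ∀ i, g.onCoord A i = coord i) (h' : g.onParam A = A) :
    g.Matches A := by
  refine ⟨AlgEquiv.refl, fun i => (h i).symm, ?_⟩
  rw [h']
  have e : ∀ R, transport (AlgEquiv.refl : K ≃ₐ[ℂ] K) R = R := fun R => by
    apply LocalSubring_ext
    ext x
    simp
  exact ⟨fun R hR _ => by rwa [AlgEquiv.refl_symm, e], fun R hR _ => by rwa [e]⟩

/-- The inverse automorphism is the same transformation with parameters `Ā`, so the backward
direction is the forward one applied there. -/
lemma Backlund.Matches.of_involutive (hA : A.t ≠ 0) (hB : (g.onParam A).t ≠ 0)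
    (hg : g.onParam (g.onParam A) = A) (hy : IsCoord (g.onCoord A))
    (h : ∀ φ : K ≃ₐ[ℂ] K, (∀ i, φ (coord i) = g.onCoord A i) →
      ∀ i, φ (g.onCoord (g.onParam A) i) = coord i)
    (hf : ∀ B : Param, (B = A ∨ B = g.onParam A) → B.t ≠ 0 → ∀ φ : K ≃ₐ[ℂ] K,
      (∀ i, φ (coord i) = g.onCoord B i) →
      ∀ R ∈ variety B, Big R → transport φ.symm R ∈ variety (g.onParam B)) : g.Matches A := by
  obtain ⟨φ, hφ⟩ := hy.exists_algEquiv
  refine ⟨φ, hφ, hf A (.inl rfl) hA φ hφ, fun R hR hbig => ?_⟩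
  have := hf _ (.inr rfl) hB φ.symm (fun i => by rw [← h φ hφ i, φ.symm_apply_apply]) R hR hbig
  rwa [hg] at this

lemma coord_mem_iff : (∀ i, coord i ∈ C) ↔ q₁ ∈ C ∧ q₂ ∈ C ∧ r₁ ∈ C ∧ r₂ ∈ C :=
  ⟨fun h => ⟨h 0, h 1, h 2, h 3⟩, fun ⟨h1, h2, h3, h4⟩ i => by
    fin_cases i
    exacts [h1, h2, h3, h4]⟩

lemma onCoord_mem_iff : (∀ i, g.onCoord A i ∈ C) ↔ g.onCoord A 0 ∈ C ∧ g.onCoord A 1 ∈ C ∧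
    g.onCoord A 2 ∈ C ∧ g.onCoord A 3 ∈ C :=
  ⟨fun h => ⟨h 0, h 1, h 2, h 3⟩, fun ⟨h1, h2, h3, h4⟩ i => by
    fin_cases i
    exacts [h1, h2, h3, h4]⟩

lemma coord_mem_of_isLocOf (hR : IsLocOf (gen (Set.range coord)) R) (i : Fin 4) :
    coord i ∈ R.toSubring := hR.1 (subset_gen _ ⟨i, rfl⟩)

lemma const_mem_of_isLocOf (hR : IsLocOf (gen (Set.range coord)) R) (c : ℂ) :
    const c ∈ R.toSubring := hR.1 (const_mem_gen _ c)

/-- Stated for an arbitrary subring in which one denominator may be divided out. It serves both for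
birationality, in a field, and for local isomorphism, in the fractions at a point off the diagonal.
-/
lemma s₀_coord_mem (hc : ∀ c, const c ∈ C) (hy : ∀ i, Backlund.s₀.onCoord A i ∈ C)
    (hd : ∀ x ∈ C, q₁ - q₂ ∈ C → x / (q₁ - q₂) ∈ C) : ∀ i, coord i ∈ C := by
  obtain ⟨h1, h2, h3, h4⟩ := onCoord_mem_iff.1 hy
  replace h1 : q₁ ∈ C := h1
  replace h2 : q₂ ∈ C := h2
  have h := sub_mem h1 h2
  refine coord_mem_iff.2 ⟨h1, h2, ?_, ?_⟩
  · have := add_mem h3 (hd _ (mul_mem (hc A.a₀) h1) h)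
    simpa [Backlund.onCoord] using this
  · have := sub_mem h4 (hd _ (mul_mem (hc A.a₀) h2) h)
    simpa [Backlund.onCoord] using this

lemma s₀_forward (hA : A.t ≠ 0) (ha : A.a₀ ≠ 0) (hφ : ∀ i, φ (coord i) = Backlund.s₀.onCoord A i) :
    ∀ R ∈ variety A, Big R → transport φ.symm R ∈ variety (Backlund.s₀.onParam A) := by
  refine forall_mem_variety hA hA (fun d hd => ?_) fun R hR hbig => ?_
  · cases d
    exacts [⟨_, s₀_e₁ A φ hφ⟩, ⟨_, s₀_e₂ A φ hφ⟩, ⟨_, s₀_e₃ A φ hφ⟩, ⟨_, s₀_e₄ A φ hφ⟩,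
      ⟨_, s₀_e₅ A φ hφ⟩, ⟨_, s₀_e₆ A φ hφ⟩, ⟨_, s₀_e₇ A φ hφ⟩, ⟨_, s₀_e₈ A φ hφ⟩,
      ⟨_, s₀_e₉ A φ hφ⟩, ⟨_, s₀_e₁₀ A φ hφ⟩, ⟨_, s₀_e₁₁ A φ hφ⟩, ⟨_, s₀_e₁₂ A ha φ hφ⟩,
      ⟨_, s₀_q₁inf A φ hφ⟩, ⟨_, s₀_q₂inf A φ hφ⟩, ⟨_, s₀_r₁inf A φ hφ⟩, ⟨_, s₀_r₂inf A φ hφ⟩,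
      (hd trivial).elim, (hd trivial).elim, (hd trivial).elim, (hd trivial).elim,
      (hd trivial).elim, (hd trivial).elim]
  · by_cases hm : q₁ - q₂ ∈ maxIdeal R
    · right
      rw [Divisor.eq_loc (A := A) (d := .diag) trivial hR hbig hm]
      exact ⟨_, s₀_diag A ha φ hφ⟩
    · left
      rw [funext hφ]
      have h := coord_mem_of_isLocOf hR
      have hc := const_mem_of_isLocOf hR
      have h' := sub_mem (h 0) (h 1)
      exact hR.of_coord_mem (onCoord_mem_iff.2 ⟨h 0, h 1,
        sub_mem (h 2) (div_mem_of_notMem (mul_mem (hc _) (h 0)) h' hm),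
        add_mem (h 3) (div_mem_of_notMem (mul_mem (hc _) (h 1)) h' hm)⟩)
        fun C hc hy hd => s₀_coord_mem hc hy fun x hx hs => hd x hx _ hs hm

lemma s₀_matches (hA : A.t ≠ 0) : Backlund.s₀.Matches A := by
  by_cases ha : A.a₀ = 0
  · refine .of_eq (fun i => ?_) ?_
    · fin_cases i <;> simp [Backlund.onCoord, ha, q₁, q₂, r₁, r₂]
    · simp [Backlund.onParam, ha]
      simp [← ha]
  refine .of_involutive hA hA (by simp [Backlund.onParam]) (isCoord_of_coord_mem fun C hc hy hd =>
    s₀_coord_mem hc hy fun x hx hs => hd x hx _ hs q₁_sub_q₂_ne_zero) (fun φ hφ => ?_) ?_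
  · have e1 : φ q₁ = q₁ := hφ 0
    have e2 : φ q₂ = q₂ := hφ 1
    have e3 : φ r₁ = r₁ - const A.a₀ * q₁ / (q₁ - q₂) := hφ 2
    have e4 : φ r₂ = r₂ + const A.a₀ * q₂ / (q₁ - q₂) := hφ 3
    intro i
    fin_cases i
    · exact e1
    · exact e2
    · simp [Backlund.onCoord, Backlund.onParam, e1, e2, e3, map_const, const_neg, neg_div]
      rfl
    · simp [Backlund.onCoord, Backlund.onParam, e1, e2, e4, map_const, const_neg, neg_div]
      rfl
  · rintro B (rfl | rfl) hB φ hφ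
    · exact s₀_forward hB ha hφ
    · exact s₀_forward hB (neg_ne_zero.2 ha) hφ

/-! #### `s₁` -/

lemma s₁_coord_mem (hc : ∀ c, const c ∈ C) (hy : ∀ i, Backlund.s₁.onCoord A i ∈ C)
    (hd : ∀ x ∈ C, r₁ + const A.a₁ ∈ C → x / (r₁ + const A.a₁) ∈ C) : ∀ i, coord i ∈ C := by
  obtain ⟨h1, h2, h3, h4⟩ := onCoord_mem_iff.1 hy
  replace h3 : r₁ + const A.a₁ ∈ C := h3
  have h5 : r₁ ∈ C := by simpa using sub_mem h3 (hc A.a₁)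
  refine coord_mem_iff.2 ⟨?_, h2, h5, h4⟩
  have := hd _ (mul_mem h1 h5) h3
  have n := r₁_add_const_ne_zero A.a₁
  have n' := r₁_ne_zero
  have e : q₁ * (1 + const A.a₁ / r₁) * r₁ / (r₁ + const A.a₁) = q₁ := by field_simp
  exact e ▸ this

lemma s₁_forward (hA : A.t ≠ 0) (ha : A.a₁ ≠ 0) (hφ : ∀ i, φ (coord i) = Backlund.s₁.onCoord A i) :
    ∀ R ∈ variety A, Big R → transport φ.symm R ∈ variety (Backlund.s₁.onParam A) := by
  refine forall_mem_variety hA hA (fun d hd => ?_) fun R hR hbig => ?_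
  · cases d
    exacts [⟨_, s₁_e₁ A ha φ hφ⟩, ⟨_, s₁_e₂ A ha φ hφ⟩, ⟨_, s₁_e₃ A φ hφ⟩, ⟨_, s₁_e₄ A φ hφ⟩,
      ⟨_, s₁_e₅ A φ hφ⟩, ⟨_, s₁_e₆ A φ hφ⟩, ⟨_, s₁_e₇ A φ hφ⟩, ⟨_, s₁_e₈ A φ hφ⟩,
      ⟨_, s₁_e₉ A φ hφ⟩, ⟨_, s₁_e₁₀ A φ hφ⟩, ⟨_, s₁_e₁₁ A φ hφ⟩, ⟨_, s₁_e₁₂ A φ hφ⟩,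
      ⟨_, s₁_q₁inf A φ hφ⟩, ⟨_, s₁_q₂inf A φ hφ⟩, ⟨_, s₁_r₁inf A φ hφ⟩, ⟨_, s₁_r₂inf A φ hφ⟩,
      (hd trivial).elim, (hd trivial).elim, (hd trivial).elim, (hd trivial).elim,
      (hd trivial).elim, (hd trivial).elim]
  · by_cases hm : r₁ ∈ maxIdeal R
    · right
      rw [Divisor.eq_loc (A := A) (d := .r₁zero) trivial hR hbig hm]
      exact ⟨_, s₁_r₁zero A ha φ hφ⟩
    -- Being defined at `R` needs only `r₁` to be a unit; recovering the old `q₁` needs `r₁ + a₁` to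
    -- be one as well.
    by_cases hm' : r₁ + const A.a₁ ∈ maxIdeal R
    · right
      rw [Divisor.eq_loc (A := A) (d := .r₁neg) trivial hR hbig hm']
      exact ⟨_, s₁_r₁neg A ha φ hφ⟩
    · left
      rw [funext hφ]
      have h := coord_mem_of_isLocOf hR
      have hc := const_mem_of_isLocOf hR
      exact hR.of_coord_mem (onCoord_mem_iff.2 ⟨mul_mem (h 0) (add_mem (one_mem _)
        (div_mem_of_notMem (hc _) (h 2) hm)), h 1, add_mem (h 2) (hc _), h 3⟩)
        fun C hc hy hd => s₁_coord_mem hc hy fun x hx hs => hd x hx _ hs hm'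

lemma s₁_matches (hA : A.t ≠ 0) : Backlund.s₁.Matches A := by
  by_cases ha : A.a₁ = 0
  · refine .of_eq (fun i => ?_) ?_
    · fin_cases i <;> simp [Backlund.onCoord, ha, q₁, q₂, r₁, r₂]
    · simp [Backlund.onParam, ha]
      simp [← ha]
  refine .of_involutive hA hA (by simp [Backlund.onParam]) (isCoord_of_coord_mem fun C hc hy hd =>
    s₁_coord_mem hc hy fun x hx hs => hd x hx _ hs (r₁_add_const_ne_zero _)) (fun φ hφ => ?_) ?_
  · have e1 : φ q₁ = q₁ * (1 + const A.a₁ / r₁) := hφ 0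
    have e2 : φ q₂ = q₂ := hφ 1
    have e3 : φ r₁ = r₁ + const A.a₁ := hφ 2
    have e4 : φ r₂ = r₂ := hφ 3
    have n := r₁_add_const_ne_zero A.a₁
    have n' := r₁_ne_zero
    intro i
    fin_cases i
    · simp only [Backlund.onCoord, Backlund.onParam, Fin.zero_eta, Matrix.cons_val, map_mul, map_add,
        map_div₀, map_one, e1, e3, map_neg, map_const, const_neg]
      change _ = q₁
      field_simp
      ring
    · exact e2
    · simp [Backlund.onCoord, Backlund.onParam, e3, map_const, const_neg]
      rfl
    · exact e4
  · rintro B (rfl | rfl) hB φ hφ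
    · exact s₁_forward hB ha hφ
    · exact s₁_forward hB (neg_ne_zero.2 ha) hφ

/-! #### `s₂` -/

lemma s₂_coord_mem (hc : ∀ c, const c ∈ C) (hy : ∀ i, Backlund.s₂.onCoord A i ∈ C)
    (hd : ∀ x ∈ C, q₁ - const A.t ∈ C → x / (q₁ - const A.t) ∈ C) : ∀ i, coord i ∈ C := by
  obtain ⟨h1, h2, h3, h4⟩ := onCoord_mem_iff.1 hy
  replace h1 : q₁ ∈ C := h1
  refine coord_mem_iff.2 ⟨h1, h2, ?_, h4⟩
  have := add_mem h3 (hd _ (mul_mem (hc A.a₂) h1) (sub_mem h1 (hc _)))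
  simpa [Backlund.onCoord] using this

lemma s₂_forward (hA : A.t ≠ 0) (ha : A.a₂ ≠ 0) (hφ : ∀ i, φ (coord i) = Backlund.s₂.onCoord A i) :
    ∀ R ∈ variety A, Big R → transport φ.symm R ∈ variety (Backlund.s₂.onParam A) := by
  refine forall_mem_variety hA hA (fun d hd => ?_) fun R hR hbig => ?_
  · cases d
    exacts [⟨_, s₂_e₁ A hA φ hφ⟩, ⟨_, s₂_e₂ A φ hφ⟩, ⟨_, s₂_e₃ A φ hφ⟩, ⟨_, s₂_e₄ A φ hφ⟩,
      ⟨_, s₂_e₅ A hA φ hφ⟩, ⟨_, s₂_e₆ A φ hφ⟩, ⟨_, s₂_e₇ A φ hφ⟩, ⟨_, s₂_e₈ A hA ha φ hφ⟩,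
      ⟨_, s₂_e₉ A φ hφ⟩, ⟨_, s₂_e₁₀ A φ hφ⟩, ⟨_, s₂_e₁₁ A φ hφ⟩, ⟨_, s₂_e₁₂ A φ hφ⟩,
      ⟨_, s₂_q₁inf A φ hφ⟩, ⟨_, s₂_q₂inf A φ hφ⟩, ⟨_, s₂_r₁inf A φ hφ⟩, ⟨_, s₂_r₂inf A φ hφ⟩,
      (hd trivial).elim, (hd trivial).elim, (hd trivial).elim, (hd trivial).elim,
      (hd trivial).elim, (hd trivial).elim]
  · by_cases hm : q₁ - const A.t ∈ maxIdeal R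
    · right
      rw [Divisor.eq_loc (A := A) (d := .q₁t) trivial hR hbig hm]
      exact ⟨_, s₂_q₁t A hA ha φ hφ⟩
    · left
      rw [funext hφ]
      have h := coord_mem_of_isLocOf hR
      have hc := const_mem_of_isLocOf hR
      exact hR.of_coord_mem (onCoord_mem_iff.2 ⟨h 0, h 1, sub_mem (h 2) (div_mem_of_notMem
        (mul_mem (hc _) (h 0)) (sub_mem (h 0) (hc _)) hm), h 3⟩)
        fun C hc hy hd => s₂_coord_mem hc hy fun x hx hs => hd x hx _ hs hm

lemma s₂_matches (hA : A.t ≠ 0) : Backlund.s₂.Matches A := by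
  by_cases ha : A.a₂ = 0
  · refine .of_eq (fun i => ?_) ?_
    · fin_cases i <;> simp [Backlund.onCoord, ha, q₁, q₂, r₁, r₂]
    · simp [Backlund.onParam, ha]
      simp [← ha]
  refine .of_involutive hA hA (by simp [Backlund.onParam]) (isCoord_of_coord_mem fun C hc hy hd =>
    s₂_coord_mem hc hy fun x hx hs => hd x hx _ hs (q₁_sub_const_ne_zero _)) (fun φ hφ => ?_) ?_
  · have e1 : φ q₁ = q₁ := hφ 0
    have e3 : φ r₁ = r₁ - const A.a₂ * q₁ / (q₁ - const A.t) := hφ 2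
    intro i
    fin_cases i
    · exact e1
    · exact hφ 1
    · simp [Backlund.onCoord, Backlund.onParam, e1, e3, map_const, const_neg, neg_div]
      rfl
    · exact hφ 3
  · rintro B (rfl | rfl) hB φ hφ
    · exact s₂_forward hB ha hφ
    · exact s₂_forward hB (neg_ne_zero.2 ha) hφ

/-! #### `s₃` -/

lemma s₃_coord_mem (hc : ∀ c, const c ∈ C) (hy : ∀ i, Backlund.s₃.onCoord A i ∈ C)
    (hd : ∀ x ∈ C, r₁ + r₂ + const A.η ∈ C → x / (r₁ + r₂ + const A.η) ∈ C) :
    ∀ i, coord i ∈ C := by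
  obtain ⟨h1, h2, h3, h4⟩ := onCoord_mem_iff.1 hy
  replace h3 : r₁ ∈ C := h3
  replace h4 : r₂ ∈ C := h4
  have n := d_ne_zero A
  have n' := r₁_add_r₂_add_const_ne_zero A.η
  have e : ∀ q : K, (q + const A.a₃ * q / (r₁ + r₂ - const A.a₃ + const A.η)) *
      (r₁ + r₂ - const A.a₃ + const A.η) / (r₁ + r₂ + const A.η) = q := fun q => by
    field_simp
    ring
  have h5 := add_mem (add_mem h3 h4) (hc A.η)
  have h6 := add_mem (sub_mem (add_mem h3 h4) (hc A.a₃)) (hc A.η)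
  exact coord_mem_iff.2 ⟨mem_of_coe_eq (hd _ (mul_mem h1 h6) h5) (e q₁),
    mem_of_coe_eq (hd _ (mul_mem h2 h6) h5) (e q₂), h3, h4⟩

lemma s₃_forward (hA : A.t ≠ 0) (ha : A.a₃ ≠ 0) (hφ : ∀ i, φ (coord i) = Backlund.s₃.onCoord A i) :
    ∀ R ∈ variety A, Big R → transport φ.symm R ∈ variety (Backlund.s₃.onParam A) := by
  refine forall_mem_variety hA hA (fun d hd => ?_) fun R hR hbig => ?_
  · cases d
    exacts [⟨_, s₃_e₁ A φ hφ⟩, ⟨_, s₃_e₂ A φ hφ⟩, ⟨_, s₃_e₃ A φ hφ⟩, ⟨_, s₃_e₄ A φ hφ⟩,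
      ⟨_, s₃_e₅ A ha φ hφ⟩, ⟨_, s₃_e₆ A ha φ hφ⟩, ⟨_, s₃_e₇ A φ hφ⟩, ⟨_, s₃_e₈ A φ hφ⟩,
      ⟨_, s₃_e₉ A φ hφ⟩, ⟨_, s₃_e₁₀ A φ hφ⟩, ⟨_, s₃_e₁₁ A φ hφ⟩, ⟨_, s₃_e₁₂ A φ hφ⟩,
      ⟨_, s₃_q₁inf A φ hφ⟩, ⟨_, s₃_q₂inf A φ hφ⟩, ⟨_, s₃_r₁inf A φ hφ⟩, ⟨_, s₃_r₂inf A φ hφ⟩,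
      (hd trivial).elim, (hd trivial).elim, (hd trivial).elim, (hd trivial).elim,
      (hd trivial).elim, (hd trivial).elim]
  · by_cases hm : r₁ + r₂ - const A.a₃ + const A.η ∈ maxIdeal R
    · right
      rw [Divisor.eq_loc (A := A) (d := .dzero) trivial hR hbig hm]
      exact ⟨_, s₃_dzero A ha φ hφ⟩
    by_cases hm' : r₁ + r₂ + const A.η ∈ maxIdeal R
    · right
      rw [Divisor.eq_loc (A := A) (d := .dneg) trivial hR hbig hm']
      exact ⟨_, s₃_dneg A ha φ hφ⟩
    · left
      rw [funext hφ]
      have h := coord_mem_of_isLocOf hR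
      have hc := const_mem_of_isLocOf hR
      have h' := add_mem (sub_mem (add_mem (h 2) (h 3)) (hc A.a₃)) (hc A.η)
      exact hR.of_coord_mem (onCoord_mem_iff.2
        ⟨add_mem (h 0) (div_mem_of_notMem (mul_mem (hc _) (h 0)) h' hm),
        add_mem (h 1) (div_mem_of_notMem (mul_mem (hc _) (h 1)) h' hm), h 2, h 3⟩)
        fun C hc hy hd => s₃_coord_mem hc hy fun x hx hs => hd x hx _ hs hm'

lemma s₃_matches (hA : A.t ≠ 0) : Backlund.s₃.Matches A := by
  by_cases ha : A.a₃ = 0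
  · refine .of_eq (fun i => ?_) ?_
    · fin_cases i <;> simp [Backlund.onCoord, ha, q₁, q₂, r₁, r₂]
    · simp [Backlund.onParam, ha]
      simp [← ha]
  refine .of_involutive hA hA (by simp [Backlund.onParam]) (isCoord_of_coord_mem fun C hc hy hd =>
    s₃_coord_mem hc hy fun x hx hs => hd x hx _ hs (r₁_add_r₂_add_const_ne_zero _))
    (fun φ hφ => ?_) ?_
  · have e1 : φ q₁ = q₁ + const A.a₃ * q₁ / (r₁ + r₂ - const A.a₃ + const A.η) := hφ 0
    have e2 : φ q₂ = q₂ + const A.a₃ * q₂ / (r₁ + r₂ - const A.a₃ + const A.η) := hφ 1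
    have e3 : φ r₁ = r₁ := hφ 2
    have e4 : φ r₂ = r₂ := hφ 3
    have n := d_ne_zero A
    have n' := r₁_add_r₂_add_const_ne_zero A.η
    have e : ∀ q : K, q + const A.a₃ * q / (r₁ + r₂ - const A.a₃ + const A.η) +
        -const A.a₃ * (q + const A.a₃ * q / (r₁ + r₂ - const A.a₃ + const A.η)) /
          (r₁ + r₂ - -const A.a₃ + (const A.η - const A.a₃)) = q := fun q => by
      have e5 : r₁ + r₂ - -const A.a₃ + (const A.η - const A.a₃) = r₁ + r₂ + const A.η := by ring
      rw [e5]
      field_simp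
      ring
    intro i
    fin_cases i
    · simp only [Backlund.onCoord, Backlund.onParam, Fin.zero_eta, Matrix.cons_val, map_mul, map_add,
        map_sub, map_neg, map_div₀, e1, e3, e4, map_const, const_neg, const_sub]
      exact e q₁
    · simp only [Backlund.onCoord, Backlund.onParam, Fin.mk_one, Matrix.cons_val, map_mul, map_add,
        map_sub, map_neg, map_div₀, e2, e3, e4, map_const, const_neg, const_sub]
      exact e q₂
    · exact e3
    · exact e4
  · rintro B (rfl | rfl) hB φ hφ
    · exact s₃_forward hB ha hφ
    · exact s₃_forward hB (neg_ne_zero.2 ha) hφ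

/-! #### `ρ` -/

lemma ρ_coord_mem (hA : A.t ≠ 0) (hc : ∀ c, const c ∈ C) (hy : ∀ i, Backlund.ρ.onCoord A i ∈ C) :
    ∀ i, coord i ∈ C := by
  obtain ⟨h1, h2, h3, h4⟩ := onCoord_mem_iff.1 hy
  have nt := const_ne_zero hA
  exact coord_mem_iff.2 ⟨mem_of_coe_eq (mul_mem h2 (hc A.t)) (div_mul_cancel₀ _ nt),
    mem_of_coe_eq (mul_mem h1 (hc A.t)) (div_mul_cancel₀ _ nt), h4, h3⟩

lemma ρ_forward (hA : A.t ≠ 0) (hφ : ∀ i, φ (coord i) = Backlund.ρ.onCoord A i) :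
    ∀ R ∈ variety A, Big R → transport φ.symm R ∈ variety (Backlund.ρ.onParam A) := by
  refine forall_mem_variety hA (inv_ne_zero hA) (fun d hd => ?_) fun R hR hbig => ?_
  · cases d
    exacts [⟨_, ρ_e₁ A hA φ hφ⟩, ⟨_, ρ_e₂ A hA φ hφ⟩, ⟨_, ρ_e₃ A hA φ hφ⟩, ⟨_, ρ_e₄ A hA φ hφ⟩,
      ⟨_, ρ_e₅ A hA φ hφ⟩, ⟨_, ρ_e₆ A hA φ hφ⟩, ⟨_, ρ_e₇ A hA φ hφ⟩, ⟨_, ρ_e₈ A hA φ hφ⟩,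
      ⟨_, ρ_e₉ A hA φ hφ⟩, ⟨_, ρ_e₁₀ A hA φ hφ⟩, ⟨_, ρ_e₁₁ A hA φ hφ⟩, ⟨_, ρ_e₁₂ A hA φ hφ⟩,
      ⟨_, ρ_q₁inf A hA φ hφ⟩, ⟨_, ρ_q₂inf A hA φ hφ⟩, ⟨_, ρ_r₁inf A hA φ hφ⟩,
      ⟨_, ρ_r₂inf A hA φ hφ⟩,
      (hd trivial).elim, (hd trivial).elim, (hd trivial).elim, (hd trivial).elim,
      (hd trivial).elim, (hd trivial).elim]
  · left
    rw [funext hφ]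
    have h := coord_mem_of_isLocOf hR
    have ht : (const A.t)⁻¹ ∈ R.toSubring := const_inv A.t ▸ const_mem_of_isLocOf hR A.t⁻¹
    refine hR.of_coord_mem (onCoord_mem_iff.2 ⟨?_, ?_, h 3, h 2⟩)
      fun C hc hy _ => ρ_coord_mem hA hc hy
    · exact mem_of_coe_eq (mul_mem (h 1) ht) (div_eq_mul_inv _ _).symm
    · exact mem_of_coe_eq (mul_mem (h 0) ht) (div_eq_mul_inv _ _).symm

lemma ρ_matches (hA : A.t ≠ 0) : Backlund.ρ.Matches A := by
  refine .of_involutive hA (inv_ne_zero hA) (by simp [Backlund.onParam])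
    (isCoord_of_coord_mem fun C hc hy _ => ρ_coord_mem hA hc hy) (fun φ hφ => ?_) ?_
  · have e1 : φ q₁ = q₂ / const A.t := hφ 0
    have e2 : φ q₂ = q₁ / const A.t := hφ 1
    have nt := const_ne_zero hA
    intro i
    fin_cases i
    · simp only [Backlund.onCoord, Backlund.onParam, Fin.zero_eta, Matrix.cons_val, map_div₀, e2,
        map_inv₀, map_const, const_inv]
      rw [div_inv_eq_mul, div_mul_cancel₀ _ nt]
      rfl
    · simp only [Backlund.onCoord, Backlund.onParam, Fin.mk_one, Matrix.cons_val, map_div₀, e1,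
        map_inv₀, map_const, const_inv]
      rw [div_inv_eq_mul, div_mul_cancel₀ _ nt]
      rfl
    · exact hφ 3
    · exact hφ 2
  · rintro B (rfl | rfl) hB φ hφ <;> exact ρ_forward hB hφ

/-! #### `s₄` and `s₅` -/

/-- `s₄` is `s₂` conjugated by `ρ`: the exchange of indices with the scaling by `t` turns the
condition `q₁ = t` into `q₂ = 1`. -/
lemma s₄_matches (hA : A.t ≠ 0) : Backlund.s₄.Matches A := by
  obtain ⟨φ, hφ, h1⟩ := ρ_matches hA
  obtain ⟨ψ, hψ, h2⟩ := s₂_matches (A := Backlund.ρ.onParam A) (inv_ne_zero hA)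
  obtain ⟨χ, hχ, h3⟩ := ρ_matches (A := Backlund.s₂.onParam (Backlund.ρ.onParam A))
    (inv_ne_zero hA)
  have hp : Backlund.ρ.onParam (Backlund.s₂.onParam (Backlund.ρ.onParam A)) =
      Backlund.s₄.onParam A := by
    simp [Backlund.onParam, add_comm]
  refine ⟨χ.trans (ψ.trans φ), fun i => ?_, hp ▸ (h1.trans h2).trans h3⟩
  have nt := const_ne_zero hA
  have f1 : φ q₁ = q₂ / const A.t := hφ 0
  have f2 : φ q₂ = q₁ / const A.t := hφ 1
  have f3 : φ r₁ = r₂ := hφ 2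
  have f4 : φ r₂ = r₁ := hφ 3
  have g1 : ψ q₁ = q₁ := hψ 0
  have g2 : ψ q₂ = q₂ := hψ 1
  have g3 : ψ r₁ = r₁ - const A.a₄ * q₁ / (q₁ - const A.t⁻¹) := hψ 2
  have g4 : ψ r₂ = r₂ := hψ 3
  change φ (ψ (χ (coord i))) = _
  rw [hχ]
  have n := q₂_sub_one_ne_zero
  fin_cases i
  · change φ (ψ (q₂ / const A.t⁻¹)) = q₁
    simp only [map_div₀, map_inv₀, map_const, g2, f2, const_inv]
    field_simp
  · change φ (ψ (q₁ / const A.t⁻¹)) = q₂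
    simp only [map_div₀, map_inv₀, map_const, g1, f1, const_inv]
    field_simp
  · change φ (ψ r₂) = r₁
    rw [g4, f4]
  · change φ (ψ r₁) = r₂ - const A.a₄ * q₂ / (q₂ - 1)
    simp only [map_div₀, map_mul, map_sub, map_inv₀, map_const, g3, f3, f1, const_inv]
    field_simp

/-- `s₅` is `s₁` conjugated by `ρ`, which exchanges the two factors together with `a₁` and `a₅`. -/
lemma s₅_matches (hA : A.t ≠ 0) : Backlund.s₅.Matches A := by
  obtain ⟨φ, hφ, h1⟩ := ρ_matches hA
  obtain ⟨ψ, hψ, h2⟩ := s₁_matches (A := Backlund.ρ.onParam A) (inv_ne_zero hA)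
  obtain ⟨χ, hχ, h3⟩ := ρ_matches (A := Backlund.s₁.onParam (Backlund.ρ.onParam A))
    (inv_ne_zero hA)
  have hp : Backlund.ρ.onParam (Backlund.s₁.onParam (Backlund.ρ.onParam A)) =
      Backlund.s₅.onParam A := by
    simp [Backlund.onParam, add_comm]
  refine ⟨χ.trans (ψ.trans φ), fun i => ?_, hp ▸ (h1.trans h2).trans h3⟩
  have nt := const_ne_zero hA
  have f1 : φ q₁ = q₂ / const A.t := hφ 0
  have f2 : φ q₂ = q₁ / const A.t := hφ 1
  have f3 : φ r₁ = r₂ := hφ 2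
  have f4 : φ r₂ = r₁ := hφ 3
  have g1 : ψ q₁ = q₁ * (1 + const A.a₅ / r₁) := hψ 0
  have g2 : ψ q₂ = q₂ := hψ 1
  have g3 : ψ r₁ = r₁ + const A.a₅ := hψ 2
  have g4 : ψ r₂ = r₂ := hψ 3
  change φ (ψ (χ (coord i))) = _
  rw [hχ]
  fin_cases i
  · change φ (ψ (q₂ / const A.t⁻¹)) = q₁
    simp only [map_div₀, map_inv₀, map_const, g2, f2, const_inv]
    field_simp
  · change φ (ψ (q₁ / const A.t⁻¹)) = q₂ * (1 + const A.a₅ / r₂)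
    simp only [map_div₀, map_mul, map_add, map_one, map_inv₀, map_const, g1, f1, f3, const_inv]
    field_simp
  · change φ (ψ r₂) = r₁
    rw [g4, f4]
  · change φ (ψ r₁) = r₂ + const A.a₅
    rw [g3, map_add, f3, map_const]

lemma Backlund.matches (hA : A.t ≠ 0) : g.Matches A := by
  cases g
  exacts [s₀_matches hA, s₁_matches hA, s₂_matches hA, s₃_matches hA, s₄_matches hA,
    s₅_matches hA, ρ_matches hA]

lemma Backlund.onParam_t_ne_zero (hA : A.t ≠ 0) : (g.onParam A).t ≠ 0 := by
  cases g
  exacts [hA, hA, hA, hA, hA, hA, inv_ne_zero hA]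

end matching

end FujiSuzukiTsuda
end

open FujiSuzukiTsuda in
/-- The centres `C₁, …, C₁₂` are irreducible, eight of dimension two and four of dimension one, and
for each of `s₀, …, s₅, ρ` the substitution of `(q̄₁, q̄₂, r̄₁, r̄₂)` for `(q₁, q₂, r₁, r₂)` is the
pull-back of functions by a birational map that is a pseudo-isomorphism from `X_A` to `X_Ā`. -/
theorem mainTheorem1 (A : Param) (ht : A.t ≠ 0) :
    (∀ k : Fin 12, IsIrreducibleOfDim ((center A k).locus (stage A k)) (centerDim k)) ∧
    ∀ g : Backlund, ∃ φ : K ≃ₐ[ℂ] K,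
      (∀ i, φ (coord i) = g.onCoord A i) ∧
      IsPseudoIsomorphism φ (variety A) (variety (g.onParam A)) := by
  refine ⟨isIrreducibleOfDim_center A ht, fun g => ?_⟩
  obtain ⟨φ, hφ, h⟩ := Backlund.matches (g := g) ht
  exact ⟨φ, hφ, h.isPseudoIsomorphism ht (Backlund.onParam_t_ne_zero ht)⟩
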